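/- Let $\Bbbk$ be a field of characteristic $0$ and $n\ge 0$ an integer. Let $\widehat Q$ be the quiver with vertices $1,\dots,n$, with arrows $x,y:i\to j$ and $x^*,y^*:j\to i$ for all $i<j$, and with a loop $z$ at every vertex. Let $\widehat A$ be the quotient of the path algebra of $\widehat Q$ over $\Bbbk$ (paths composed from left to right, $e_i$ the length $0$ path at $i$) by the ideal generated by all paths of length two with distinct end points and by the elements $e_ia^*b\,e_i-\delta_{a,b}\,e_ize_i$, $a,b\in\{x,y,x^*,y^*\}$ (where $x^{**}=x$, $y^{**}=y$); for $n=1$ put $\widehat A=\Bbbk[z]/z^2$. Grade $\widehat A$ by $\deg e_i=0$, $\deg x=\deg y^*=\deg z=1$, $\deg x^*=\deg y=0$. Modules are graded left $\widehat A$-modules, maps have degree $0$, and $M\langle l\rangle_d=M_{d+l}$. Let $P_i=\widehat Ae_i$ with $e_i$ in degree $0$, and let $\mathcal D$ be the homotopy category of bounded complexes of finitely generated projective graded $\widehat A$-modules, with homological shift $[s]$. Let $g_i:\widehat A\to(\widehat Ae_i\otimes_{\Bbbk}e_i\widehat A)\langle1\rangle$ and $f_i:\widehat Ae_i\otimes_{\Bbbk}e_i\widehat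 A\to\widehat A$ be the bimodule maps with $g_i(1)=z\otimes e_i+e_i\otimes z+\sum_a a\otimes a^*$, where $z$ is the loop at $i$ and the sum is over all non-loop arrows $a$ ending at $i$, and $f_i(e_i\otimes e_i)=e_i$. Let $\Sigma_i$ and $\Sigma_i^{-1}$ be the operations on $\mathcal D$ given by tensoring over $\widehat A$ with the two-term complexes of bimodules $g_i$ and $f_i$ respectively, with $\widehat A$ in homological degree $0$. Every finitely generated projective graded module is a direct sum of modules $P_i\langle l\rangle$, and there are no non-zero maps $P_i\langle l\rangle\to P_j\langle l'\rangle$ with $l>l'$. For $Y\in\mathcal D$ the slice $Y(l)\in\mathcal D$ is the subquotient complex of $Y$ formed by the summands $P_i\langle l\rangle$ with the induced differential. For $Y\not\cong0$ let $\phi_+(Y)$ and $\phi_-(Y)$ be the largest and the smallest $l$ with $Y(l)\not\cong0$ in $\mathcal D$. Let $X_i^+$ be the set of indecomposable (in particular non-zero) $Y\in\mathcal D$ such that $Y(\phi_+(Y))$ is isomorphic to a direct sum of shifts $P_i\langle l\rangle[s]$ and such that, for every $j$, $$\operatorname{Hom}_{\mathcal D}(Y,P_j\langle\phi_-(Y)\rangle[s])=0\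 \text{ for all } s\in\mathbb Z\iff j=i.$$ Let $X_i^-$ be the set of indecomposable $Y\in\mathcal D$ such that $Y(\phi_-(Y))$ is isomorphic to a direct sum of shifts $P_i\langle l\rangle[s]$ and such that, for every $j$, $$\operatorname{Hom}_{\mathcal D}(P_j\langle\phi_+(Y)\rangle[s],Y)=0\ \text{ for all } s\in\mathbb Z\iff j=i.$$ Then, for $i,j\in\{1,\dots,n\}$: 1. if $j\ne i$, then $\Sigma_i(P_j)\in X_i^+$ and $\Sigma_i^{-1}(P_j)\in X_i^-$; 2. the $2n$ sets $X_1^-,\dots,X_n^-,X_1^+,\dots,X_n^+$ are pairwise disjoint; 3. if $i\ne j$ and $Y\in X_j^-$, then $\Sigma_i(Y)\in X_i^+$; 4. if $i\ne j$ and $Y\in X_j^+$, then $\Sigma_i^{-1}(Y)\in X_i^-$; 5. if $Y\in X_j^+$, then $\Sigma_i(Y)\in X_i^+$ (for all $i,j$); 6. if $Y\in X_j^-$, then $\Sigma_i^{-1}(Y)\in X_i^-$ (for all $i,j$). -/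

import Mathlib

noncomputable section

open CategoryTheory CategoryTheory.Limits TensorProduct

namespace Zigzag

universe u

/-! ### Gradings of vector spaces -/

section Grading

variable {k : Type u} [Field k] {V W : Type u} [AddCommGroup V] [Module k V]
  [AddCommGroup W] [Module k W]

theorem isInternal_of_proj {D : ℤ → Submodule k V} (π : ℤ → V →ₗ[k] V)
    (h1 : ∀ d, ∀ v ∈ D d, π d v = v) (h2 : ∀ d e, d ≠ e → ∀ v ∈ D e, π d v = 0)
    (h3 : ∀ v, v ∈ ⨆ d, D d) : DirectSum.IsInternal D := by
  refine DirectSum.isInternal_submodule_of_iSupIndep_of_iSup_eq_top (fun d => ?_)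
    (eq_top_iff.mpr fun v _ => h3 v)
  rw [Submodule.disjoint_def]
  intro v hv hv'
  have hle : (⨆ j, ⨆ (_ : j ≠ d), D j) ≤ LinearMap.ker (π d) :=
    iSup_le fun j => iSup_le fun hj w hw => h2 d j hj.symm w hw
  rw [← h1 d v hv]
  exact hle hv'

/-- The projection of a graded vector space onto its part of degree `d`. -/
def proj {D : ℤ → Submodule k V} (h : DirectSum.IsInternal D) (d : ℤ) :
    V →ₗ[k] V :=
  (D d).subtype ∘ₗ DirectSum.component k ℤ (fun e => D e) d ∘ₗ
    (LinearEquiv.ofBijective (DirectSum.coeLinearMap D) h).symm.toLinearMap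

theorem proj_mem {D : ℤ → Submodule k V} (h : DirectSum.IsInternal D) (d : ℤ) (v : V) :
    proj h d v ∈ D d := by
  simp [proj]

theorem ofBijective_symm_of_mem {D : ℤ → Submodule k V} (h : DirectSum.IsInternal D) {d : ℤ}
    {v : V} (hv : v ∈ D d) :
    (LinearEquiv.ofBijective (DirectSum.coeLinearMap D) h).symm v =
      DirectSum.lof k ℤ (fun e => D e) d ⟨v, hv⟩ := by
  rw [LinearEquiv.symm_apply_eq]
  exact (DirectSum.coeLinearMap_lof D d ⟨v, hv⟩).symm

theorem proj_of_mem {D : ℤ → Submodule k V} (h : DirectSum.IsInternal D) {d : ℤ} {v : V}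
    (hv : v ∈ D d) : proj h d v = v := by
  simp [proj, ofBijective_symm_of_mem h hv, DirectSum.component.lof_self]

theorem proj_of_mem_ne {D : ℤ → Submodule k V} (h : DirectSum.IsInternal D) {d e : ℤ}
    (hde : d ≠ e) {v : V} (hv : v ∈ D e) : proj h d v = 0 := by
  simp [proj, ofBijective_symm_of_mem h hv, DirectSum.component.of, hde.symm]

theorem mem_iSup {D : ℤ → Submodule k V} (h : DirectSum.IsInternal D) (v : V) :
    v ∈ ⨆ d, D d := by
  rw [h.submodule_iSup_eq_top]; trivial

theorem grading_induction {D : ℤ → Submodule k V} (h : ∀ v, v ∈ ⨆ d, D d) {p : V → Prop}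
    (h0 : p 0) (hadd : ∀ v w, p v → p w → p (v + w)) (hmem : ∀ d, ∀ v ∈ D d, p v) (v : V) :
    p v :=
  Submodule.iSup_induction D (motive := p) (h v) hmem h0 hadd

theorem exists_sum_proj {D : ℤ → Submodule k V} (h : DirectSum.IsInternal D) (v : V) :
    ∃ s : Finset ℤ, ∑ d ∈ s, proj h d v = v := by
  classical
  let f := (LinearEquiv.ofBijective (DirectSum.coeLinearMap D) h).symm v
  refine ⟨DFinsupp.support f, ?_⟩
  have hv : DirectSum.coeLinearMap D f = v :=
    (LinearEquiv.ofBijective (DirectSum.coeLinearMap D) h).apply_symm_apply v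
  conv_rhs => rw [← hv, ← DirectSum.sum_support_of f, map_sum]
  refine Finset.sum_congr rfl fun d _ => ?_
  simp [proj, f]
  rfl

/-- A subspace stable under the projections is graded. -/
theorem isInternal_comap {D : ℤ → Submodule k V} (h : DirectSum.IsInternal D)
    (ι : W →ₗ[k] V) (hι : Function.Injective ι) (hS : ∀ d w, ∃ w', ι w' = proj h d (ι w)) :
    DirectSum.IsInternal fun d => (D d).comap ι := by
  choose π hπ using hS
  let ϖ : ℤ → W →ₗ[k] W := fun d =>
    { toFun := π d
      map_add' := fun a b => hι (by simp only [map_add, hπ])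
      map_smul' := fun c a => hι (by simp only [map_smul, hπ, RingHom.id_apply]) }
  refine isInternal_of_proj ϖ ?_ ?_ ?_
  · exact fun d w hw => hι ((hπ d w).trans (proj_of_mem h hw))
  · exact fun d e hde w hw => hι ((hπ d w).trans ((proj_of_mem_ne h hde hw).trans (map_zero ι).symm))
  · intro w
    obtain ⟨s, hs⟩ := exists_sum_proj h (ι w)
    have : w = ∑ d ∈ s, π d w := hι (by simp only [map_sum, hπ, hs])
    rw [this]
    refine Submodule.sum_mem _ fun d _ => Submodule.mem_iSup_of_mem d ?_
    rw [Submodule.mem_comap, hπ]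
    exact proj_mem h d _

/-- The image of a grading under a surjection whose kernel is stable under the projections. -/
theorem isInternal_map {D : ℤ → Submodule k V} (h : DirectSum.IsInternal D)
    (q : V →ₗ[k] W) (hq : Function.Surjective q)
    (hker : ∀ d v, q v = 0 → q (proj h d v) = 0) :
    DirectSum.IsInternal fun d => (D d).map q := by
  have hex : ∀ d w, ∃ w', ∀ v, q v = w → q (proj h d v) = w' := by
    intro d w
    obtain ⟨v, rfl⟩ := hq w
    refine ⟨q (proj h d v), fun v' hv' => ?_⟩
    have := hker d (v' - v) (by simp [hv'])
    rwa [map_sub, map_sub, sub_eq_zero] at this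
  choose π hπ using hex
  have hπ' : ∀ d v, π d (q v) = q (proj h d v) := fun d v => (hπ d (q v) v rfl).symm
  let ϖ : ℤ → W →ₗ[k] W := fun d =>
    { toFun := π d
      map_add' := by
        intro a b
        obtain ⟨a, rfl⟩ := hq a
        obtain ⟨b, rfl⟩ := hq b
        rw [← map_add, hπ', hπ', hπ', map_add, map_add]
      map_smul' := by
        intro c a
        obtain ⟨a, rfl⟩ := hq a
        rw [← map_smul, hπ', hπ', map_smul, map_smul, RingHom.id_apply] }
  refine isInternal_of_proj ϖ ?_ ?_ ?_
  · rintro d _ ⟨v, hv, rfl⟩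
    exact (hπ' d v).trans (by rw [proj_of_mem h hv])
  · rintro d e hde _ ⟨v, hv, rfl⟩
    exact (hπ' d v).trans (by rw [proj_of_mem_ne h hde hv, map_zero])
  · intro w
    obtain ⟨v, rfl⟩ := hq w
    rw [← Submodule.map_iSup]
    exact Submodule.mem_map_of_mem (mem_iSup h v)

theorem isInternal_prod {D : ℤ → Submodule k V} {E : ℤ → Submodule k W}
    (hD : DirectSum.IsInternal D) (hE : DirectSum.IsInternal E) :
    DirectSum.IsInternal fun d => (D d).prod (E d) := by
  refine isInternal_of_proj (fun d => (proj hD d).prodMap (proj hE d)) ?_ ?_ ?_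
  · rintro d ⟨v, w⟩ ⟨hv, hw⟩
    exact Prod.ext (proj_of_mem hD hv) (proj_of_mem hE hw)
  · rintro d e hde ⟨v, w⟩ ⟨hv, hw⟩
    exact Prod.ext (proj_of_mem_ne hD hde hv) (proj_of_mem_ne hE hde hw)
  · rintro ⟨v, w⟩
    have h1 : (v, (0 : W)) ∈ ⨆ d, (D d).prod (E d) :=
      grading_induction (mem_iSup hD) (p := fun v => (v, (0 : W)) ∈ ⨆ d, (D d).prod (E d))
        (Submodule.zero_mem _) (fun a b ha hb => by simpa using Submodule.add_mem _ ha hb)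
        (fun d a ha => Submodule.mem_iSup_of_mem d ⟨ha, Submodule.zero_mem _⟩) v
    have h2 : ((0 : V), w) ∈ ⨆ d, (D d).prod (E d) :=
      grading_induction (mem_iSup hE) (p := fun w => ((0 : V), w) ∈ ⨆ d, (D d).prod (E d))
        (Submodule.zero_mem _) (fun a b ha hb => by simpa using Submodule.add_mem _ ha hb)
        (fun d a ha => Submodule.mem_iSup_of_mem d ⟨Submodule.zero_mem _, ha⟩) w
    simpa using Submodule.add_mem _ h1 h2

/-- The degree `d` part of a tensor product is spanned by the `v ⊗ w` with
`deg v + deg w = d`. -/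
def tensorDeg (D : ℤ → Submodule k V) (E : ℤ → Submodule k W) (d : ℤ) :
    Submodule k (V ⊗[k] W) :=
  Submodule.span k {t | ∃ a b : ℤ, a + b = d ∧ ∃ v ∈ D a, ∃ w ∈ E b, v ⊗ₜ[k] w = t}

theorem isInternal_tensor {D : ℤ → Submodule k V} {E : ℤ → Submodule k W}
    (hD : DirectSum.IsInternal D) (hE : DirectSum.IsInternal E) :
    DirectSum.IsInternal (tensorDeg D E) := by
  let π : ℤ → V ⊗[k] W →ₗ[k] V ⊗[k] W := fun d =>
    DirectSum.toModule k (ℤ × ℤ) (V ⊗[k] W)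
      (fun s => if s.1 + s.2 = d then TensorProduct.map (D s.1).subtype (E s.2).subtype else 0) ∘ₗ
    (TensorProduct.directSum k k (fun a => D a) (fun b => E b)).toLinearMap ∘ₗ
    TensorProduct.map (LinearEquiv.ofBijective (DirectSum.coeLinearMap D) hD).symm.toLinearMap
      (LinearEquiv.ofBijective (DirectSum.coeLinearMap E) hE).symm.toLinearMap
  have hπ : ∀ d a b : ℤ, ∀ v ∈ D a, ∀ w ∈ E b,
      π d (v ⊗ₜ w) = if a + b = d then v ⊗ₜ w else 0 := by
    intro d a b v hv w hw
    simp only [π, LinearMap.comp_apply, TensorProduct.map_tmul, LinearEquiv.coe_coe,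
      ofBijective_symm_of_mem hD hv, ofBijective_symm_of_mem hE hw,
      TensorProduct.directSum_lof_tmul_lof, DirectSum.toModule_lof]
    split_ifs <;> simp
  refine isInternal_of_proj π ?_ ?_ ?_
  · intro d t ht
    refine (Submodule.span_le (p := LinearMap.eqLocus (π d) LinearMap.id)).mpr ?_ ht
    rintro _ ⟨a, b, hab, v, hv, w, hw, rfl⟩
    simp [hπ d a b v hv w hw, hab]
  · intro d e hde t ht
    refine (Submodule.span_le (p := LinearMap.ker (π d))).mpr ?_ ht
    rintro _ ⟨a, b, hab, v, hv, w, hw, rfl⟩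
    simp [hπ d a b v hv w hw, hab, hde.symm]
  · intro t
    induction t using TensorProduct.induction_on with
    | zero => exact Submodule.zero_mem _
    | add a b ha hb => exact Submodule.add_mem _ ha hb
    | tmul v w =>
      refine grading_induction (mem_iSup hD) (p := fun v => v ⊗ₜ[k] w ∈ ⨆ d, tensorDeg D E d)
        (by simp) (fun a b ha hb => by
          rw [TensorProduct.add_tmul]; exact Submodule.add_mem _ ha hb) (fun a v hv => ?_) v
      refine grading_induction (mem_iSup hE) (p := fun w => v ⊗ₜ[k] w ∈ ⨆ d, tensorDeg D E d)
        (by simp) (fun a b ha hb => by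
          rw [TensorProduct.tmul_add]; exact Submodule.add_mem _ ha hb) (fun b w hw => ?_) w
      exact Submodule.mem_iSup_of_mem (a + b)
        (Submodule.subset_span ⟨a, b, rfl, v, hv, w, hw, rfl⟩)

end Grading

/-! ### The quiver and the zigzag algebra -/

/-- The two edges of the doubled complete graph between a pair of distinct vertices. -/
inductive Letter
  | x
  | y
  deriving DecidableEq

instance : Fintype Letter := ⟨{Letter.x, Letter.y}, by rintro (_ | _) <;> simp⟩

/-- The arrows of the Ginzburg double of the doubled complete graph on `n` vertices.
For `i < j`, `edge x i j` and `edge y i j` are the arrows `x, y : i → j`, while `edge x j i` and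
`edge y j i` are the arrows `x^*, y^* : j → i`; so `(edge c i j)^* = edge c j i` always.
`loop i` is the loop `z` at `i`. -/
inductive Arrow (n : ℕ)
  | edge (c : Letter) (i j : Fin n) (h : i ≠ j)
  | loop (i : Fin n)

/-- The starting vertex of an arrow. -/
def Arrow.source {n : ℕ} : Arrow n → Fin n
  | edge _ i _ _ => i
  | loop i => i

/-- The end vertex of an arrow. -/
def Arrow.target {n : ℕ} : Arrow n → Fin n
  | edge _ _ j _ => j
  | loop i => i

/-- The degree of an arrow for the symmetric orientation: `x` and `y^*` have degree `1`,
`x^*` and `y` have degree `0`, and `z` has degree `1`. -/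
def Arrow.deg {n : ℕ} : Arrow n → ℤ
  | edge Letter.x i j _ => if i < j then 1 else 0
  | edge Letter.y i j _ => if i < j then 0 else 1
  | loop _ => 1

/-- The degree of a generator of the path algebra; the length zero paths have degree `0`. -/
def genDeg {n : ℕ} : Fin n ⊕ Arrow n → ℤ
  | Sum.inl _ => 0
  | Sum.inr a => a.deg

section Algebra

variable (k : Type u) [Field k] (n : ℕ)

/-- The length zero path at `i`, in the free algebra on all vertices and arrows. -/
def freeVertex (i : Fin n) : FreeAlgebra k (Fin n ⊕ Arrow n) := FreeAlgebra.ι k (Sum.inl i)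

/-- An arrow, in the free algebra on all vertices and arrows. -/
def freeArrow (a : Arrow n) : FreeAlgebra k (Fin n ⊕ Arrow n) := FreeAlgebra.ι k (Sum.inr a)

/-- The relations of the zigzag algebra. The first five present the path algebra (paths are
composed from left to right), the following three are the zigzag relations.
The last one follows from the others if `n ≥ 2`; for `n = 1` it makes the algebra `k[z]/z²`. -/
inductive Rel : FreeAlgebra k (Fin n ⊕ Arrow n) → FreeAlgebra k (Fin n ⊕ Arrow n) → Prop
  | vertex_mul_self (i : Fin n) : Rel (freeVertex k n i * freeVertex k n i) (freeVertex k n i)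
  | vertex_mul_vertex (i j : Fin n) (h : i ≠ j) : Rel (freeVertex k n i * freeVertex k n j) 0
  | sum_vertex : Rel (∑ i, freeVertex k n i) 1
  | source_mul (a : Arrow n) : Rel (freeVertex k n a.source * freeArrow k n a) (freeArrow k n a)
  | mul_target (a : Arrow n) : Rel (freeArrow k n a * freeVertex k n a.target) (freeArrow k n a)
  | distinct_ends (a b : Arrow n) (h : a.target = b.source) (h' : a.source ≠ b.target) :
      Rel (freeArrow k n a * freeArrow k n b) 0
  | edge_mul_dual (c : Letter) (i j : Fin n) (h : i ≠ j) :
      Rel (freeArrow k n (.edge c i j h) * freeArrow k n (.edge c j i h.symm))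
        (freeArrow k n (.loop i))
  | edge_mul_other (c c' : Letter) (hc : c ≠ c') (i j : Fin n) (h : i ≠ j) :
      Rel (freeArrow k n (.edge c i j h) * freeArrow k n (.edge c' j i h.symm)) 0
  | loop_mul_loop (i : Fin n) : Rel (freeArrow k n (.loop i) * freeArrow k n (.loop i)) 0

/-- The zigzag algebra of the doubled complete graph on `n` vertices. -/
def Alg : Type u := RingQuot (Rel k n)

instance : Ring (Alg k n) := inferInstanceAs (Ring (RingQuot (Rel k n)))

instance : Algebra k (Alg k n) := inferInstanceAs (Algebra k (RingQuot (Rel k n)))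

/-- The quotient map from the free algebra. -/
def algMk : FreeAlgebra k (Fin n ⊕ Arrow n) →ₐ[k] Alg k n :=
  RingQuot.mkAlgHom k (Rel k n)

theorem algMk_rel {s t : FreeAlgebra k (Fin n ⊕ Arrow n)} (h : Rel k n s t) :
    algMk k n s = algMk k n t := RingQuot.mkAlgHom_rel k h

theorem algMk_surjective : Function.Surjective (algMk k n) :=
  RingQuot.mkAlgHom_surjective k (Rel k n)

/-- Algebra maps that respect the relations factor through the zigzag algebra. -/
theorem exists_lift {B : Type u} [Ring B] [Algebra k B]
    (f : FreeAlgebra k (Fin n ⊕ Arrow n) →ₐ[k] B) (hf : ∀ s t, Rel k n s t → f s = f t) :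
    ∃ F : Alg k n →ₐ[k] B, ∀ s, F (algMk k n s) = f s :=
  ⟨RingQuot.liftAlgHom k ⟨f, fun s t h => hf s t h⟩,
    fun s => RingQuot.liftAlgHom_mkAlgHom_apply k f (fun _ _ h => hf _ _ h) s⟩

/-- The image in the zigzag algebra of a length zero path or an arrow. -/
def gen (g : Fin n ⊕ Arrow n) : Alg k n := algMk k n (FreeAlgebra.ι k g)

/-- The idempotent `e_i`. -/
def idem (i : Fin n) : Alg k n := gen k n (Sum.inl i)

/-- An arrow as an element of the zigzag algebra. -/
def arr (a : Arrow n) : Alg k n := gen k n (Sum.inr a)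

/-- The grading of the zigzag algebra for the symmetric orientation: the part of degree `d` is
spanned by the products of generators whose degrees add up to `d`. -/
def algDeg (d : ℤ) : Submodule k (Alg k n) :=
  Submodule.span k {a | ∃ w : List (Fin n ⊕ Arrow n),
    (w.map genDeg).sum = d ∧ (w.map (gen k n)).prod = a}

variable {k n}

theorem algMk_freeVertex (i : Fin n) :
    algMk k n (freeVertex k n i) = idem k n i := rfl

theorem algMk_freeArrow (a : Arrow n) :
    algMk k n (freeArrow k n a) = arr k n a := rfl

theorem idem_mul_self (i : Fin n) : idem k n i * idem k n i = idem k n i := by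
  simpa [algMk_freeVertex] using algMk_rel k n (Rel.vertex_mul_self (k := k) i)

theorem idem_mul_idem {i j : Fin n} (h : i ≠ j) : idem k n i * idem k n j = 0 := by
  simpa [algMk_freeVertex] using algMk_rel k n (Rel.vertex_mul_vertex (k := k) i j h)

theorem sum_idem : ∑ i, idem k n i = 1 := by
  simpa [algMk_freeVertex] using algMk_rel k n (Rel.sum_vertex (k := k) (n := n))

theorem source_mul (a : Arrow n) : idem k n a.source * arr k n a = arr k n a := by
  simpa [algMk_freeVertex, algMk_freeArrow] using
    algMk_rel k n (Rel.source_mul (k := k) a)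

theorem mul_target (a : Arrow n) : arr k n a * idem k n a.target = arr k n a := by
  simpa [algMk_freeVertex, algMk_freeArrow] using
    algMk_rel k n (Rel.mul_target (k := k) a)

theorem idem_mul_arr (i : Fin n) (a : Arrow n) (h : i ≠ a.source) :
    idem k n i * arr k n a = 0 := by
  rw [← source_mul, ← mul_assoc, idem_mul_idem h, zero_mul]

theorem arr_mul_idem (i : Fin n) (a : Arrow n) (h : a.target ≠ i) :
    arr k n a * idem k n i = 0 := by
  rw [← mul_target, mul_assoc, idem_mul_idem h, mul_zero]

theorem arr_mul_arr (a b : Arrow n) (h : a.target = b.source → a.source ≠ b.target) :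
    arr k n a * arr k n b = 0 := by
  by_cases hab : a.target = b.source
  · simpa [algMk_freeArrow] using
      algMk_rel k n (Rel.distinct_ends (k := k) a b hab (h hab))
  · rw [← source_mul b, ← mul_assoc, arr_mul_idem _ _ hab, zero_mul]

theorem edge_mul_dual (c : Letter) {i j : Fin n} (h : i ≠ j) :
    arr k n (.edge c i j h) * arr k n (.edge c j i h.symm) = arr k n (.loop i) := by
  simpa [algMk_freeArrow] using algMk_rel k n (Rel.edge_mul_dual (k := k) c i j h)

theorem edge_mul_other {c c' : Letter} (hc : c ≠ c') {i j : Fin n} (h : i ≠ j) :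
    arr k n (.edge c i j h) * arr k n (.edge c' j i h.symm) = 0 := by
  simpa [algMk_freeArrow] using
    algMk_rel k n (Rel.edge_mul_other (k := k) c c' hc i j h)

theorem loop_mul_loop (i : Fin n) : arr k n (.loop i) * arr k n (.loop i) = 0 := by
  simpa [algMk_freeArrow] using algMk_rel k n (Rel.loop_mul_loop (k := k) i)

/-- The element `z ⊗ e_i + e_i ⊗ z + ∑ a ⊗ a^*`, the sum over the edges `a` that end at `i`, commutes
with the generators of the zigzag algebra; `T a b` stands for `a ⊗ b`. -/
theorem casimir_comm {X : Type u} [AddCommMonoid X] (T : Alg k n → Alg k n → X)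
    (hl : ∀ b, T 0 b = 0) (hr : ∀ a, T a 0 = 0) (i : Fin n) (g : Fin n ⊕ Arrow n) :
    T (arr k n (.loop i)) (idem k n i * gen k n g) +
        T (idem k n i) (arr k n (.loop i) * gen k n g) +
        ∑ s : Letter × {j : Fin n // j ≠ i}, T (arr k n (.edge s.1 s.2.1 i s.2.2))
          (arr k n (.edge s.1 i s.2.1 s.2.2.symm) * gen k n g) =
      T (gen k n g * arr k n (.loop i)) (idem k n i) +
        T (gen k n g * idem k n i) (arr k n (.loop i)) +
        ∑ s : Letter × {j : Fin n // j ≠ i}, T (gen k n g * arr k n (.edge s.1 s.2.1 i s.2.2))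
          (arr k n (.edge s.1 i s.2.1 s.2.2.symm)) := by
  have et : ∀ c p q h, (Arrow.edge c p q h : Arrow n).target = q := fun _ _ _ _ => rfl
  have es : ∀ c p q h, (Arrow.edge c p q h : Arrow n).source = p := fun _ _ _ _ => rfl
  have lt : ∀ p, (Arrow.loop p : Arrow n).target = p := fun _ => rfl
  have ls : ∀ p, (Arrow.loop p : Arrow n).source = p := fun _ => rfl
  have le : arr k n (.loop i) * idem k n i = arr k n (.loop i) := mul_target (.loop i)
  have el : idem k n i * arr k n (.loop i) = arr k n (.loop i) := source_mul (.loop i)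
  rcases g with j | (⟨c, p, q, hpq⟩ | j)
  · change T _ (_ * idem k n j) + T _ (_ * idem k n j) +
      ∑ s : Letter × {j : Fin n // j ≠ i}, T _ (_ * idem k n j) =
      T (idem k n j * _) _ + T (idem k n j * _) _ +
      ∑ s : Letter × {j : Fin n // j ≠ i}, T (idem k n j * _) _
    congr 1
    · by_cases h : i = j
      · subst h
        rw [idem_mul_self, le, el]
      · rw [idem_mul_idem h, idem_mul_idem (Ne.symm h), arr_mul_idem _ _ (by rwa [lt]),
          idem_mul_arr _ _ (by rw [ls]; exact Ne.symm h)]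
        simp only [hl, hr]
    · refine Finset.sum_congr rfl fun ⟨c, l, hl'⟩ _ => ?_
      by_cases h : l = j
      · subst h
        have h1 : arr k n (.edge c i l hl'.symm) * idem k n l = arr k n (.edge c i l hl'.symm) :=
          mul_target (.edge c i l hl'.symm)
        have h2 : idem k n l * arr k n (.edge c l i hl') = arr k n (.edge c l i hl') :=
          source_mul (.edge c l i hl')
        simp only [h1, h2]
      · rw [arr_mul_idem _ _ (by rwa [et]), idem_mul_arr _ _ (by rw [es]; exact Ne.symm h), hl, hr]
  · change T _ (_ * arr k n (.edge c p q hpq)) + T _ (_ * arr k n (.edge c p q hpq)) +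
      ∑ s : Letter × {j : Fin n // j ≠ i}, T _ (_ * arr k n (.edge c p q hpq)) =
      T (arr k n (.edge c p q hpq) * _) _ + T (arr k n (.edge c p q hpq) * _) _ +
      ∑ s : Letter × {j : Fin n // j ≠ i}, T (arr k n (.edge c p q hpq) * _) _
    have hs : idem k n p * arr k n (.edge c p q hpq) = arr k n (.edge c p q hpq) :=
      source_mul (.edge c p q hpq)
    have ht : arr k n (.edge c p q hpq) * idem k n q = arr k n (.edge c p q hpq) :=
      mul_target (.edge c p q hpq)
    rw [arr_mul_arr (.loop i) (.edge c p q hpq) fun h h' => hpq (h.symm.trans h'),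
      arr_mul_arr (.edge c p q hpq) (.loop i) fun h h' => hpq (h'.trans h.symm),
      hl, hr, add_zero, zero_add]
    have hright : p ≠ i → ∑ s : Letter × {j : Fin n // j ≠ i},
        T (arr k n (.edge c p q hpq) * arr k n (.edge s.1 s.2.1 i s.2.2))
          (arr k n (.edge s.1 i s.2.1 s.2.2.symm)) = 0 := fun hp =>
      Finset.sum_eq_zero fun s _ => by rw [arr_mul_arr _ _ fun _ => by rwa [es, et], hl]
    have hleft : q ≠ i → ∑ s : Letter × {j : Fin n // j ≠ i},
        T (arr k n (.edge s.1 s.2.1 i s.2.2))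
          (arr k n (.edge s.1 i s.2.1 s.2.2.symm) * arr k n (.edge c p q hpq)) = 0 := fun hq =>
      Finset.sum_eq_zero fun s _ => by
        rw [arr_mul_arr _ _ fun _ => by rw [es, et]; exact Ne.symm hq, hr]
    by_cases hp : p = i
    · subst hp
      rw [hleft (Ne.symm hpq), hs, arr_mul_idem _ _ (by rw [et]; exact Ne.symm hpq), hl, add_zero,
        zero_add, Finset.sum_eq_single ((c, ⟨q, Ne.symm hpq⟩) : Letter × {j : Fin n // j ≠ p})]
      · rw [edge_mul_dual]
      · rintro ⟨c', j, hj⟩ - hne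
        by_cases hjq : q = j
        · subst hjq
          rw [edge_mul_other (fun h => hne (by subst h; rfl)), hl]
        · rw [arr_mul_arr _ _ fun h => absurd h (by rwa [es, et]), hl]
      · exact fun h => absurd (Finset.mem_univ _) h
    · rw [hright hp, idem_mul_arr _ _ (by rw [es]; exact Ne.symm hp), hr, add_zero, zero_add]
      by_cases hq : q = i
      · subst hq
        rw [ht, Finset.sum_eq_single ((c, ⟨p, hp⟩) : Letter × {j : Fin n // j ≠ q})]
        · rw [edge_mul_dual]
        · rintro ⟨c', j, hj⟩ - hne
          by_cases hjp : j = p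
          · subst hjp
            rw [edge_mul_other (fun h => hne (by subst h; rfl)), hr]
          · rw [arr_mul_arr _ _ fun h => absurd h (by rwa [es, et]), hr]
        · exact fun h => absurd (Finset.mem_univ _) h
      · rw [hleft hq, arr_mul_idem _ _ (by rwa [et]), hl]
  · change T _ (_ * arr k n (.loop j)) + T _ (_ * arr k n (.loop j)) +
      ∑ s : Letter × {j : Fin n // j ≠ i}, T _ (_ * arr k n (.loop j)) =
      T (arr k n (.loop j) * _) _ + T (arr k n (.loop j) * _) _ +
      ∑ s : Letter × {j : Fin n // j ≠ i}, T (arr k n (.loop j) * _) _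
    congr 1
    · by_cases h : i = j
      · subst h
        rw [loop_mul_loop, le, el, hl, hr, add_zero, zero_add]
      · rw [arr_mul_arr (.loop i) (.loop j) fun _ => h,
          arr_mul_arr (.loop j) (.loop i) fun _ => Ne.symm h,
          idem_mul_arr i (.loop j) h, arr_mul_idem i (.loop j) (Ne.symm h)]
        simp only [hl, hr]
    · refine Finset.sum_congr rfl fun ⟨c, l, hl'⟩ _ => ?_
      rw [arr_mul_arr (.edge c i l hl'.symm) (.loop j) fun h h' => hl' (h.trans h'.symm),
        arr_mul_arr (.loop j) (.edge c l i hl') fun h h' => hl' (h.symm.trans h'), hl, hr]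

theorem deg_add_deg_dual (c : Letter) {i j : Fin n} (h : i ≠ j) :
    (Arrow.edge c i j h).deg + (Arrow.edge c j i h.symm).deg = 1 := by
  rcases lt_or_gt_of_ne h with h' | h' <;> cases c <;> simp [Arrow.deg, h', h'.le]

theorem gen_mem (g : Fin n ⊕ Arrow n) : gen k n g ∈ algDeg k n (genDeg g) :=
  Submodule.subset_span ⟨[g], by simp⟩

theorem idem_mem (i : Fin n) : idem k n i ∈ algDeg k n 0 := gen_mem (Sum.inl i)

theorem arr_mem (a : Arrow n) : arr k n a ∈ algDeg k n a.deg := gen_mem (Sum.inr a)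

theorem algDeg_mul {d e : ℤ} {a b : Alg k n} (ha : a ∈ algDeg k n d) (hb : b ∈ algDeg k n e) :
    a * b ∈ algDeg k n (d + e) := by
  have h := Submodule.mul_mem_mul ha hb
  rw [algDeg, algDeg, Submodule.span_mul_span] at h
  refine Submodule.span_mono ?_ h
  rintro _ ⟨_, ⟨w, hw, rfl⟩, _, ⟨w', hw', rfl⟩, rfl⟩
  exact ⟨w ++ w', by simp [hw, hw'], by simp⟩

/-- An additive predicate, stable under multiplication, that holds for scalars and generators,
holds on the whole algebra. -/
theorem alg_induction {p : Alg k n → Prop} (hk : ∀ c : k, p (algebraMap k _ c))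
    (hadd : ∀ a b, p a → p b → p (a + b)) (hmul : ∀ a b, p a → p b → p (a * b))
    (hg : ∀ g, p (gen k n g)) (a : Alg k n) : p a := by
  obtain ⟨a, rfl⟩ := algMk_surjective k n a
  induction a using FreeAlgebra.induction with
  | grade0 c => simpa using hk c
  | grade1 g => exact hg g
  | mul a b ha hb => rw [map_mul]; exact hmul _ _ ha hb
  | add a b ha hb => rw [map_add]; exact hadd _ _ ha hb

/-- There is an algebra map that sends every generator `g` to `g t^(deg g)`. -/
theorem exists_coaction : ∃ F : Alg k n →ₐ[k] AddMonoidAlgebra (Alg k n) ℤ,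
    ∀ g, F (gen k n g) = AddMonoidAlgebra.single (genDeg g) (gen k n g) := by
  suffices h : ∀ s t, Rel k n s t →
      FreeAlgebra.lift k (fun g => AddMonoidAlgebra.single (genDeg g) (gen k n g)) s =
      FreeAlgebra.lift k (fun g => AddMonoidAlgebra.single (genDeg g) (gen k n g)) t by
    obtain ⟨F, hF⟩ := exists_lift k n _ h
    exact ⟨F, fun g => (hF _).trans (FreeAlgebra.lift_ι_apply _ _)⟩
  have hv : ∀ i, FreeAlgebra.lift k
      (fun g => AddMonoidAlgebra.single (genDeg g) (gen k n g)) (freeVertex k n i) =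
      AddMonoidAlgebra.single 0 (idem k n i) := fun i => by
    simp [freeVertex, idem, genDeg]
  have ha : ∀ a, FreeAlgebra.lift k
      (fun g => AddMonoidAlgebra.single (genDeg g) (gen k n g)) (freeArrow k n a) =
      AddMonoidAlgebra.single a.deg (arr k n a) := fun a => by
    simp [freeArrow, arr, genDeg]
  have hs := fun (d e : ℤ) (a b : Alg k n) =>
    AddMonoidAlgebra.single_mul_single (R := Alg k n) d e a b
  have hz := fun d : ℤ => AddMonoidAlgebra.single_zero (R := Alg k n) d
  intro s t hst
  cases hst with
  | vertex_mul_self i => simp only [map_mul, hv, hs, idem_mul_self, zero_add]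
  | vertex_mul_vertex i j h => simp only [map_mul, map_zero, hv, hs, idem_mul_idem h, hz]
  | sum_vertex =>
    rw [map_sum, map_one, AddMonoidAlgebra.one_def, ← sum_idem]
    simp only [hv]
    exact (map_sum (AddMonoidAlgebra.singleAddHom (0 : ℤ)) _ _).symm
  | source_mul a => simp only [map_mul, hv, ha, hs, source_mul, zero_add]
  | mul_target a => simp only [map_mul, hv, ha, hs, mul_target, add_zero]
  | distinct_ends a b h h' =>
    simp only [map_mul, map_zero, ha, hs, arr_mul_arr a b fun _ => h', hz]
  | edge_mul_dual c i j h => simp only [map_mul, ha, hs, edge_mul_dual, deg_add_deg_dual]; rfl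
  | edge_mul_other c c' hc i j h =>
    simp only [map_mul, map_zero, ha, hs, edge_mul_other hc h, hz]
  | loop_mul_loop i => simp only [map_mul, map_zero, ha, hs, loop_mul_loop, hz]

theorem algDeg_isInternal : DirectSum.IsInternal (algDeg k n) := by
  obtain ⟨F, hF⟩ := exists_coaction (k := k) (n := n)
  have hFw : ∀ w : List (Fin n ⊕ Arrow n), F (w.map (gen k n)).prod =
      AddMonoidAlgebra.single (w.map genDeg).sum (w.map (gen k n)).prod := by
    intro w
    induction w with
    | nil =>
      simp only [List.map_nil, List.prod_nil, List.sum_nil, map_one, AddMonoidAlgebra.one_def]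
    | cons g w ih =>
      simp only [List.map_cons, List.prod_cons, List.sum_cons, map_mul, hF, ih,
        AddMonoidAlgebra.single_mul_single]
  let π : ℤ → Alg k n →ₗ[k] Alg k n := fun d =>
    { toFun := fun a => (F a).coeff d
      map_add' := fun a b => by simp
      map_smul' := fun c a => by simp }
  have hword : ∀ d (w : List (Fin n ⊕ Arrow n)), π d (w.map (gen k n)).prod =
      if (w.map genDeg).sum = d then (w.map (gen k n)).prod else 0 := by
    intro d w
    change (F _).coeff d = _
    rw [hFw, AddMonoidAlgebra.coeff_single, Finsupp.single_apply]
  have hπ : ∀ d e, ∀ a ∈ algDeg k n e, π d a = if e = d then a else 0 := by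
    intro d e a ha
    by_cases h : e = d
    · rw [if_pos h]
      refine (Submodule.span_le (p := LinearMap.eqLocus (π d) LinearMap.id)).mpr ?_ ha
      rintro _ ⟨w, hw, rfl⟩
      simpa [hw, h] using hword d w
    · rw [if_neg h]
      refine (Submodule.span_le (p := LinearMap.ker (π d))).mpr ?_ ha
      rintro _ ⟨w, hw, rfl⟩
      simpa [hw, h] using hword d w
  refine isInternal_of_proj π (fun d a ha => by simp [hπ d d a ha])
    (fun d e hde a ha => by simp [hπ d e a ha, hde.symm]) fun a => ?_
  have h1 : (1 : Alg k n) ∈ algDeg k n 0 := Submodule.subset_span ⟨[], by simp⟩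
  refine alg_induction (p := fun a => a ∈ ⨆ d, algDeg k n d) (fun c => ?_)
    (fun a b ha hb => Submodule.add_mem _ ha hb) (fun a b ha hb => ?_)
    (fun g => Submodule.mem_iSup_of_mem _ (gen_mem g)) a
  · rw [Algebra.algebraMap_eq_smul_one]
    exact Submodule.mem_iSup_of_mem 0 (Submodule.smul_mem _ c h1)
  · refine Submodule.iSup_induction (algDeg k n) (motive := fun a => a * b ∈ ⨆ d, algDeg k n d) ha
      (fun d a ha => ?_) (by simp) (fun a a' h h' => by
        rw [add_mul]; exact Submodule.add_mem _ h h')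
    refine Submodule.iSup_induction (algDeg k n) (motive := fun b => a * b ∈ ⨆ d, algDeg k n d) hb
      (fun e b hb => ?_) (by simp) (fun a a' h h' => by
        rw [mul_add]; exact Submodule.add_mem _ h h')
    exact Submodule.mem_iSup_of_mem (d + e) (algDeg_mul ha hb)

end Algebra

/-! ### Graded modules -/

section GrMod

variable (k : Type u) [Field k] (n : ℕ)

/-- A graded left module over the zigzag algebra, with its grading for the symmetric
orientation. -/
structure GrMod where
  carrier : Type u
  [addCommGroup : AddCommGroup carrier]
  [moduleBase : Module k carrier]
  [moduleAlg : Module (Alg k n) carrier]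
  [tower : IsScalarTower k (Alg k n) carrier]
  deg : ℤ → Submodule k carrier
  isInternal : DirectSum.IsInternal deg
  smul_mem : ∀ {d e : ℤ} {a : Alg k n} {m : carrier},
    a ∈ algDeg k n d → m ∈ deg e → a • m ∈ deg (d + e)

attribute [instance] GrMod.addCommGroup GrMod.moduleBase GrMod.moduleAlg GrMod.tower

variable {k n}

namespace GrMod

instance : CoeSort (GrMod k n) (Type u) := ⟨GrMod.carrier⟩

/-- The module maps that preserve degrees. -/
def homs (M N : GrMod k n) : AddSubgroup (M →ₗ[Alg k n] N) where
  carrier := {f | ∀ d, ∀ m ∈ M.deg d, f m ∈ N.deg d}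
  zero_mem' := fun _ _ _ => Submodule.zero_mem _
  add_mem' := fun hf hg d m hm => Submodule.add_mem _ (hf d m hm) (hg d m hm)
  neg_mem' := fun hf d m hm => Submodule.neg_mem _ (hf d m hm)

instance : Category (GrMod k n) where
  Hom M N := homs M N
  id M := ⟨LinearMap.id, fun _ _ hm => hm⟩
  comp f g := ⟨g.1 ∘ₗ f.1, fun d m hm => g.2 d _ (f.2 d m hm)⟩

/-- The module map underlying a morphism of graded modules. -/
def Hom.lin {M N : GrMod k n} (f : M ⟶ N) : M →ₗ[Alg k n] N := Subtype.val (p := (· ∈ homs M N)) f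

/-- A degree preserving module map as a morphism of graded modules. -/
def ofLin {M N : GrMod k n} (f : M →ₗ[Alg k n] N) (hf : ∀ d, ∀ m ∈ M.deg d, f m ∈ N.deg d) :
    M ⟶ N := Subtype.mk (p := (· ∈ homs M N)) f hf

theorem Hom.lin_mem {M N : GrMod k n} (f : M ⟶ N) {d : ℤ} {m : M} (hm : m ∈ M.deg d) :
    Hom.lin f m ∈ N.deg d :=
  Subtype.prop (p := (· ∈ homs M N)) f d m hm

theorem hom_ext {M N : GrMod k n} {f g : M ⟶ N} (h : ∀ m, Hom.lin f m = Hom.lin g m) : f = g :=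
  Subtype.ext (p := (· ∈ homs M N)) (LinearMap.ext h)

@[simp] theorem lin_ofLin {M N : GrMod k n} (f : M →ₗ[Alg k n] N) (hf) :
    Hom.lin (ofLin (M := M) (N := N) f hf) = f := rfl

@[simp] theorem lin_id (M : GrMod k n) : Hom.lin (𝟙 M) = LinearMap.id := rfl

@[simp] theorem lin_comp {M N L : GrMod k n} (f : M ⟶ N) (g : N ⟶ L) :
    Hom.lin (f ≫ g) = Hom.lin g ∘ₗ Hom.lin f := rfl

instance (M N : GrMod k n) : AddCommGroup (M ⟶ N) :=
  inferInstanceAs (AddCommGroup (homs M N))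

@[simp] theorem lin_add {M N : GrMod k n} (f g : M ⟶ N) :
    Hom.lin (f + g) = Hom.lin f + Hom.lin g := rfl

@[simp] theorem lin_zero (M N : GrMod k n) : Hom.lin (0 : M ⟶ N) = 0 := rfl

instance : Preadditive (GrMod k n) where
  add_comp _ _ _ f g h := hom_ext fun m => map_add (Hom.lin h) _ _
  comp_add _ _ _ f g h := hom_ext fun m => rfl

/-- The zero module. -/
def zeroObj : GrMod k n where
  carrier := PUnit
  deg _ := ⊤
  isInternal := isInternal_of_proj (fun _ => LinearMap.id) (fun _ _ _ => rfl)
    (fun _ _ _ _ _ => rfl) fun _ => Submodule.mem_iSup_of_mem 0 trivial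
  smul_mem _ _ := trivial

instance : HasZeroObject (GrMod k n) :=
  ⟨zeroObj, (IsZero.iff_id_eq_zero _).mpr (hom_ext fun _ => rfl)⟩

/-- The direct sum of two graded modules. -/
def prod (M N : GrMod k n) : GrMod k n where
  carrier := M × N
  deg d := (M.deg d).prod (N.deg d)
  isInternal := isInternal_prod M.isInternal N.isInternal
  smul_mem ha hm := ⟨M.smul_mem ha hm.1, N.smul_mem ha hm.2⟩

/-- The direct sum of two graded modules is their biproduct. -/
def prodBicone (M N : GrMod k n) : BinaryBicone M N where
  pt := prod M N
  fst := ofLin (LinearMap.fst _ M N) fun _ _ hm => hm.1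
  snd := ofLin (LinearMap.snd _ M N) fun _ _ hm => hm.2
  inl := ofLin (LinearMap.inl _ M N) fun _ _ hm => ⟨hm, Submodule.zero_mem _⟩
  inr := ofLin (LinearMap.inr _ M N) fun _ _ hm => ⟨Submodule.zero_mem _, hm⟩
  inl_fst := hom_ext fun _ => rfl
  inl_snd := hom_ext fun _ => rfl
  inr_fst := hom_ext fun _ => rfl
  inr_snd := hom_ext fun _ => rfl

instance : HasBinaryBiproducts (GrMod k n) where
  has_binary_biproduct M N := hasBinaryBiproduct_of_total (prodBicone M N)
    (hom_ext fun m => Prod.ext (add_zero m.1) (zero_add m.2))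

/-- The shift `M⟨s⟩` of the internal grading, `(M⟨s⟩)_d = M_{d+s}`; so the map `P_j → P_i⟨1⟩`
given by an element of degree `1` preserves degrees. -/
def shiftObj (s : ℤ) (M : GrMod k n) : GrMod k n where
  carrier := M
  deg := fun d => M.deg (d + s)
  isInternal := isInternal_of_proj (fun d => proj M.isInternal (d + s))
    (fun _ _ hm => proj_of_mem _ hm) (fun _ _ h _ hm => proj_of_mem_ne _ (by omega) hm)
    fun m => grading_induction (mem_iSup M.isInternal)
      (p := fun m => m ∈ ⨆ d, M.deg (d + s)) (Submodule.zero_mem _)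
      (fun _ _ => Submodule.add_mem _) (fun d m hm => Submodule.mem_iSup_of_mem (d - s) (by
        rwa [sub_add_cancel])) m
  smul_mem := fun {d e a m} ha hm => by
    rw [add_assoc]; exact M.smul_mem ha hm

/-- The functor `M ↦ M⟨s⟩`. -/
def shift (s : ℤ) : GrMod k n ⥤ GrMod k n where
  obj M := shiftObj s M
  map {M N} f := ofLin (M := shiftObj s M) (N := shiftObj s N)
    (Hom.lin (M := M) (N := N) f) fun _ _ hm => Hom.lin_mem (M := M) (N := N) f hm

instance (s : ℤ) : (shift (k := k) (n := n) s).Additive where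
  map_add := rfl

/-! ### Homogeneous submodules and quotients -/

theorem map_proj {M N : GrMod k n} (f : M.carrier →ₗ[k] N.carrier)
    (hf : ∀ d, ∀ m ∈ M.deg d, f m ∈ N.deg d) (d : ℤ) (m : M) :
    f (proj M.isInternal d m) = proj N.isInternal d (f m) := by
  refine grading_induction (mem_iSup M.isInternal)
    (p := fun m => f (proj M.isInternal d m) = proj N.isInternal d (f m)) (by simp)
    (fun a b ha hb => by simp only [map_add, ha, hb]) (fun e m hm => ?_) m
  by_cases h : d = e
  · subst h
    rw [proj_of_mem _ hm, proj_of_mem _ (hf _ m hm)]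
  · rw [proj_of_mem_ne _ h hm, proj_of_mem_ne _ h (hf _ m hm), map_zero]

theorem proj_smul (M : GrMod k n) {e : ℤ} {a : Alg k n} (ha : a ∈ algDeg k n e) (d : ℤ) (m : M) :
    proj M.isInternal d (a • m) = a • proj M.isInternal (d - e) m := by
  refine grading_induction (mem_iSup M.isInternal)
    (p := fun m => proj M.isInternal d (a • m) = a • proj M.isInternal (d - e) m) (by simp)
    (fun a b ha hb => by simp only [map_add, smul_add, ha, hb]) (fun e' m hm => ?_) m
  by_cases h : d = e + e'
  · subst h
    rw [proj_of_mem _ (M.smul_mem ha hm), add_sub_cancel_left, proj_of_mem _ hm]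
  · rw [proj_of_mem_ne _ h (M.smul_mem ha hm), proj_of_mem_ne _ (by omega) hm, smul_zero]

/-- A submodule is homogeneous if it contains the homogeneous parts of its elements. -/
def IsHomog (M : GrMod k n) (S : Submodule (Alg k n) M) : Prop :=
  ∀ d, ∀ m ∈ S, proj M.isInternal d m ∈ S

theorem isHomog_span (M : GrMod k n) (s : Set M) (hs : ∀ m ∈ s, ∃ d, m ∈ M.deg d) :
    IsHomog M (Submodule.span (Alg k n) s) := by
  suffices h : ∀ m ∈ Submodule.span (Alg k n) s, ∀ d,
      proj M.isInternal d m ∈ Submodule.span (Alg k n) s from fun d m hm => h m hm d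
  intro m hm
  induction hm using Submodule.span_induction with
  | mem m hm =>
    intro d
    obtain ⟨e, he⟩ := hs m hm
    by_cases h : d = e
    · subst h
      rw [proj_of_mem _ he]
      exact Submodule.subset_span hm
    · rw [proj_of_mem_ne _ h he]
      exact Submodule.zero_mem _
  | zero => intro d; simp
  | add a b _ _ ha hb => intro d; rw [map_add]; exact Submodule.add_mem _ (ha d) (hb d)
  | smul a m _ hm =>
    intro d
    refine grading_induction (mem_iSup (algDeg_isInternal (k := k) (n := n)))
      (p := fun a => proj M.isInternal d (a • m) ∈ Submodule.span (Alg k n) s) (by simp)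
      (fun a b ha hb => by rw [add_smul, map_add]; exact Submodule.add_mem _ ha hb)
      (fun e a ha => ?_) a
    rw [proj_smul M ha]
    exact Submodule.smul_mem _ _ (hm _)

/-- A homogeneous submodule as a graded module. -/
def sub (M : GrMod k n) (S : Submodule (Alg k n) M) (hS : IsHomog M S) : GrMod k n where
  carrier := S
  deg d := (M.deg d).comap (S.subtype.restrictScalars k)
  isInternal := isInternal_comap M.isInternal (S.subtype.restrictScalars k)
    Subtype.val_injective fun d m => ⟨⟨_, hS d m.1 m.2⟩, rfl⟩
  smul_mem {_ _ _ m} ha hm := M.smul_mem (m := (m : S).1) ha hm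

/-- The quotient by a homogeneous submodule as a graded module. -/
def quot (M : GrMod k n) (S : Submodule (Alg k n) M) (hS : IsHomog M S) : GrMod k n where
  carrier := M ⧸ S
  deg d := (M.deg d).map (S.mkQ.restrictScalars k)
  isInternal := isInternal_map M.isInternal (S.mkQ.restrictScalars k) S.mkQ_surjective
    fun d m hm => by
      simp only [LinearMap.restrictScalars_apply, Submodule.mkQ_apply,
        Submodule.Quotient.mk_eq_zero] at hm ⊢
      exact hS d m hm
  smul_mem := by
    rintro d e a _ ha ⟨m, hm, rfl⟩
    exact ⟨a • m, M.smul_mem ha hm, rfl⟩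

/-! ### Baric slices -/

/-- The submodule generated by the homogeneous elements of degree at most `-s`. Since `P_i⟨l⟩` is
generated by an element of degree `-l`, in a direct sum of modules `P_i⟨l⟩` this is the sum of the
summands with `l ≥ s`. -/
def filt (M : GrMod k n) (s : ℤ) : Submodule (Alg k n) M :=
  Submodule.span (Alg k n) {m | ∃ d ≤ -s, m ∈ M.deg d}

theorem filt_isHomog (M : GrMod k n) (s : ℤ) : IsHomog M (M.filt s) :=
  isHomog_span M _ fun _ ⟨d, _, hm⟩ => ⟨d, hm⟩

theorem filt_map {M N : GrMod k n} (f : M ⟶ N) (s : ℤ) {m : M} (hm : m ∈ M.filt s) :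
    Hom.lin f m ∈ N.filt s := by
  have : M.filt s ≤ (N.filt s).comap (Hom.lin f) := by
    rw [filt, Submodule.span_le]
    rintro m ⟨d, hd, hm⟩
    exact Submodule.subset_span ⟨d, hd, Hom.lin_mem f hm⟩
  exact this hm

/-- The graded module `filt M s`. -/
def filtObj (M : GrMod k n) (s : ℤ) : GrMod k n := M.sub (M.filt s) (M.filt_isHomog s)

/-- The map `filtObj M s ⟶ filtObj N s` induced by `f : M ⟶ N`. -/
def filtMap {M N : GrMod k n} (f : M ⟶ N) (s : ℤ) : M.filtObj s ⟶ N.filtObj s :=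
  ofLin (M := M.filtObj s) (N := N.filtObj s)
    ((Hom.lin f).restrict fun _ hm => filt_map f s hm) fun _ _ hm => Hom.lin_mem f hm

/-- `filt M (s + 1)` as a submodule of `filtObj M s`. -/
def filtNext (M : GrMod k n) (s : ℤ) : Submodule (Alg k n) (M.filtObj s) :=
  (M.filt (s + 1)).comap (M.filt s).subtype

theorem filtNext_isHomog (M : GrMod k n) (s : ℤ) : IsHomog (M.filtObj s) (M.filtNext s) := by
  intro d m hm
  have := map_proj (M := M.filtObj s) (N := M) ((M.filt s).subtype.restrictScalars k)
    (fun _ _ hm => hm) d m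
  exact Eq.subst (motive := (· ∈ M.filt (s + 1))) this.symm (M.filt_isHomog (s + 1) d _ hm)

/-- The graded module `filt M s / filt M (s + 1)`. -/
def sliceObj (s : ℤ) (M : GrMod k n) : GrMod k n :=
  (M.filtObj s).quot (M.filtNext s) (M.filtNext_isHomog s)

/-- The map `sliceObj s M ⟶ sliceObj s N` induced by `f : M ⟶ N`. -/
def sliceMap (s : ℤ) {M N : GrMod k n} (f : M ⟶ N) : sliceObj s M ⟶ sliceObj s N :=
  ofLin (M := sliceObj s M) (N := sliceObj s N)
    ((M.filtNext s).mapQ (N.filtNext s) (Hom.lin (filtMap f s))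
      fun m hm => filt_map f (s + 1) (m := (M.filt s).subtype m) hm)
    (by
      rintro d _ ⟨m, hm, rfl⟩
      exact ⟨Hom.lin (filtMap f s) m, Hom.lin_mem _ hm, rfl⟩)

/-- The slice functor, `M ↦ filt M s / filt M (s + 1)`. On a direct sum of modules `P_i⟨l⟩` it
picks the summands with `l = s`, and it takes a matrix of maps between such sums to the block of
its entries between the summands with `l = s`. -/
def slice (s : ℤ) : GrMod k n ⥤ GrMod k n where
  obj M := sliceObj s M
  map f := sliceMap s f
  map_id M := hom_ext fun m => by
    obtain ⟨m, rfl⟩ := (M.filtNext s).mkQ_surjective m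
    rfl
  map_comp {M _ _} f g := hom_ext fun m => by
    obtain ⟨m, rfl⟩ := (M.filtNext s).mkQ_surjective m
    rfl

instance (s : ℤ) : (slice (k := k) (n := n) s).Additive where
  map_add {M _ _ _} := hom_ext fun m => by
    obtain ⟨m, rfl⟩ := (M.filtNext s).mkQ_surjective m
    rfl

/-! ### The indecomposable projectives and the functors of the bimodules -/

/-- The zigzag algebra as a graded left module over itself. -/
def regular : GrMod k n where
  carrier := Alg k n
  deg := algDeg k n
  isInternal := algDeg_isInternal
  smul_mem := algDeg_mul

variable (k) in
/-- The graded module `P_i = A e_i`, with `e_i` in degree `0`. -/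
def P (i : Fin n) : GrMod k n :=
  regular.sub (Submodule.span (Alg k n) {idem k n i})
    (isHomog_span regular _ (by rintro _ rfl; exact ⟨0, idem_mem i⟩))

/-- The subspace `e_i M` of `M`. -/
def corner (i : Fin n) (M : GrMod k n) : Submodule k M :=
  LinearMap.range (Algebra.lsmul k k M.carrier (idem k n i))

/-- The grading of `e_i M`. -/
def cornerDeg (i : Fin n) (M : GrMod k n) (d : ℤ) : Submodule k (corner i M) :=
  (M.deg d).comap (corner i M).subtype

theorem idem_smul_mem (i : Fin n) (M : GrMod k n) {d : ℤ} {m : M} (hm : m ∈ M.deg d) :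
    idem k n i • m ∈ M.deg d := by
  simpa using M.smul_mem (idem_mem i) hm

theorem cornerDeg_isInternal (i : Fin n) (M : GrMod k n) :
    DirectSum.IsInternal (cornerDeg i M) := by
  refine isInternal_comap M.isInternal (corner i M).subtype Subtype.val_injective ?_
  rintro d ⟨_, m, rfl⟩
  exact ⟨⟨_, _, rfl⟩, map_proj (M := M) (N := M) (Algebra.lsmul k k M.carrier (idem k n i))
    (fun _ _ hm => idem_smul_mem i M hm) d m⟩

/-- The map `e_i M → e_i N` induced by `f : M ⟶ N`. -/
def cornerMap (i : Fin n) {M N : GrMod k n} (f : M ⟶ N) :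
    corner i M →ₗ[k] corner i N :=
  ((Hom.lin f).restrictScalars k).restrict (by
    rintro _ ⟨m, rfl⟩
    exact ⟨Hom.lin f m, by simp⟩)

/-- The graded module `A e_i ⊗_k e_i M`. -/
def tensorObj (i : Fin n) (M : GrMod k n) : GrMod k n where
  carrier := (P k i).carrier ⊗[k] corner i M
  deg := tensorDeg (P k i).deg (cornerDeg i M)
  isInternal := isInternal_tensor (P k i).isInternal (cornerDeg_isInternal i M)
  smul_mem := by
    intro d e a m ha hm
    refine (Submodule.span_le (p := (tensorDeg (P k i).deg (cornerDeg i M) (d + e)).comap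
      (Algebra.lsmul k k ((P k i).carrier ⊗[k] corner i M) a))).mpr ?_ hm
    rintro _ ⟨b, c, hbc, v, hv, w, hw, rfl⟩
    exact Submodule.subset_span
      ⟨d + b, c, by omega, a • v, (P k i).smul_mem ha hv, w, hw, rfl⟩

/-- The map `A e_i ⊗_k e_i M ⟶ A e_i ⊗_k e_i N` induced by `f : M ⟶ N`. -/
def tensorMap (i : Fin n) {M N : GrMod k n} (f : M ⟶ N) :
    tensorObj i M ⟶ tensorObj i N :=
  ofLin (M := tensorObj i M) (N := tensorObj i N)
    (TensorProduct.AlgebraTensorModule.map LinearMap.id (cornerMap i f)) (by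
      intro d t ht
      refine (Submodule.span_le (p := (tensorDeg (P k i).deg (cornerDeg i N) d).comap
        (TensorProduct.map LinearMap.id (cornerMap i f)))).mpr ?_ ht
      rintro _ ⟨b, c, hbc, v, hv, w, hw, rfl⟩
      exact Submodule.subset_span ⟨b, c, hbc, v, hv, cornerMap i f w, Hom.lin_mem f hw, rfl⟩)

theorem tensor_hom_ext {i : Fin n} {M N : GrMod k n} {f g : tensorObj i M ⟶ N}
    (h : ∀ (v : P k i) (w : corner i M), Hom.lin f (v ⊗ₜ[k] w) = Hom.lin g (v ⊗ₜ[k] w)) :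
    f = g :=
  hom_ext fun t => by
    induction t using TensorProduct.induction_on with
    | zero => exact (map_zero (Hom.lin f)).trans (map_zero (Hom.lin g)).symm
    | add a b ha hb =>
      exact (map_add (Hom.lin f) a b).trans
        ((congrArg₂ (· + ·) ha hb).trans (map_add (Hom.lin g) a b).symm)
    | tmul v w => exact h v w

/-- The functor `M ↦ (A e_i ⊗_k e_i A) ⊗_A M = A e_i ⊗_k e_i M`. -/
def tensor (i : Fin n) : GrMod k n ⥤ GrMod k n where
  obj M := tensorObj i M
  map f := tensorMap i f
  map_id _ := tensor_hom_ext fun _ _ => rfl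
  map_comp _ _ := tensor_hom_ext fun _ _ => rfl

instance (i : Fin n) : (tensor (k := k) i).Additive where
  map_add := tensor_hom_ext fun v w => TensorProduct.tmul_add (R := k) v (cornerMap i _ w) (cornerMap i _ w)

/-- The map `A e_i ⊗_k e_i M → M` given by the action; it is induced by the bimodule map
`f_i : A e_i ⊗_k e_i A → A`, `e_i ⊗ e_i ↦ e_i`. -/
def counitLin (i : Fin n) (M : GrMod k n) : tensorObj i M →ₗ[Alg k n] M :=
  TensorProduct.AlgebraTensorModule.lift
    { toFun := fun v =>
        Algebra.lsmul k k M.carrier ((Submodule.span (Alg k n) {idem k n i}).subtype v) ∘ₗ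
          (corner i M).subtype
      map_add' := fun v w => LinearMap.ext fun m => by
        exact add_smul (Subtype.val (p := (· ∈ Submodule.span (Alg k n) {idem k n i})) v)
          (Subtype.val (p := (· ∈ Submodule.span (Alg k n) {idem k n i})) w) (m : M.carrier)
      map_smul' := fun a v => LinearMap.ext fun m => by
        exact mul_smul a (Subtype.val (p := (· ∈ Submodule.span (Alg k n) {idem k n i})) v)
          (m : M.carrier) }

theorem counitLin_tmul (i : Fin n) (M : GrMod k n)
    (v : Submodule.span (Alg k n) {idem k n i}) (w : corner i M) :
    counitLin i M (v ⊗ₜ[k] w : (P k i).carrier ⊗[k] corner i M) = v.1 • w.1 := rfl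

/-- The natural transformation given by the bimodule map `f_i`. -/
def counit (i : Fin n) : tensor (k := k) i ⟶ 𝟭 (GrMod k n) where
  app M := ofLin (M := tensorObj i M) (N := M) (counitLin i M) (by
    intro d t ht
    refine (Submodule.span_le (p := (M.deg d).comap ((counitLin i M).restrictScalars k))).mpr
      ?_ ht
    rintro _ ⟨b, c, rfl, v, hv, w, hw, rfl⟩
    exact M.smul_mem (a := Subtype.val (p := (· ∈ Submodule.span (Alg k n) {idem k n i})) v) hv hw)
  naturality M N f := tensor_hom_ext fun v w => (map_smul (Hom.lin f) _ _).symm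

/-- The element `a e_i` of `P_i`. -/
def toP (i : Fin n) : Alg k n →ₗ[Alg k n] (P k i).carrier :=
  (LinearMap.toSpanSingleton (Alg k n) (Alg k n) (idem k n i)).codRestrict
    (Submodule.span (Alg k n) {idem k n i})
    fun a => Submodule.smul_mem _ a (Submodule.subset_span rfl)

/-- The element `e_i m` of `e_i M`. -/
def toCorner (i : Fin n) (M : GrMod k n) : M.carrier →ₗ[k] corner i M :=
  (Algebra.lsmul k k M.carrier (idem k n i)).rangeRestrict

/-- The map `M → A e_i ⊗_k e_i M`, `m ↦ a e_i ⊗ e_i b m`. -/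
def unitTerm (i : Fin n) (M : GrMod k n) (a b : Alg k n) : M.carrier →ₗ[k] (tensorObj i M).carrier :=
  TensorProduct.mk k (P k i).carrier (corner i M) (toP i a) ∘ₗ toCorner i M ∘ₗ
    Algebra.lsmul k k M.carrier b

theorem unitTerm_smul (i : Fin n) (M : GrMod k n) (a b c : Alg k n) (m : M) :
    unitTerm i M a b (c • m) = unitTerm i M a (b * c) m := by
  change toP i a ⊗ₜ[k] toCorner i M (b • c • m) = toP i a ⊗ₜ[k] toCorner i M ((b * c) • m)
  rw [mul_smul]

theorem smul_unitTerm (i : Fin n) (M : GrMod k n) (a b c : Alg k n) (m : M) :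
    c • unitTerm i M a b m = unitTerm i M (c * a) b m := by
  change (c • toP i a) ⊗ₜ[k] _ = toP i (c * a) ⊗ₜ[k] _
  rw [← map_smul, smul_eq_mul]

theorem unitTerm_zero_left (i : Fin n) (M : GrMod k n) (b : Alg k n) (m : M) :
    unitTerm i M 0 b m = 0 := by
  change toP i 0 ⊗ₜ[k] _ = 0
  rw [map_zero, TensorProduct.zero_tmul]

theorem unitTerm_zero_right (i : Fin n) (M : GrMod k n) (a : Alg k n) (m : M) :
    unitTerm i M a 0 m = 0 := by
  change toP i a ⊗ₜ[k] toCorner i M ((0 : Alg k n) • m) = 0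
  rw [zero_smul, map_zero, TensorProduct.tmul_zero]

theorem unitTerm_mem (i : Fin n) (M : GrMod k n) {a b : Alg k n} {d d' e : ℤ} {m : M}
    (ha : a ∈ algDeg k n d) (hb : b ∈ algDeg k n d') (hm : m ∈ M.deg e) :
    unitTerm i M a b m ∈ (tensorObj i M).deg (e + (d + d')) := by
  change toP i a ⊗ₜ[k] toCorner i M (b • m) ∈ tensorDeg (P k i).deg (cornerDeg i M) (e + (d + d'))
  refine Submodule.subset_span ⟨d, d' + e, by omega, toP i a, ?_, toCorner i M (b • m), ?_, rfl⟩
  · have := algDeg_mul ha (idem_mem i)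
    rwa [add_zero] at this
  · exact idem_smul_mem i M (M.smul_mem hb hm)

/-- The map `m ↦ z ⊗ m + e_i ⊗ z m + ∑ a ⊗ a^* m`, where the sum is over the edges `a` that end at
`i`; it is induced by the bimodule map `g_i : A → A e_i ⊗_k e_i A`. -/
def unitBase (i : Fin n) (M : GrMod k n) : M.carrier →ₗ[k] (tensorObj i M).carrier :=
  unitTerm i M (arr k n (.loop i)) (idem k n i) + unitTerm i M (idem k n i) (arr k n (.loop i)) +
    ∑ s : Letter × {j : Fin n // j ≠ i},
      unitTerm i M (arr k n (.edge s.1 s.2.1 i s.2.2)) (arr k n (.edge s.1 i s.2.1 s.2.2.symm))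

theorem unitBase_apply (i : Fin n) (M : GrMod k n) (m : M) : unitBase i M m =
    unitTerm i M (arr k n (.loop i)) (idem k n i) m +
      unitTerm i M (idem k n i) (arr k n (.loop i)) m +
      ∑ s : Letter × {j : Fin n // j ≠ i}, unitTerm i M (arr k n (.edge s.1 s.2.1 i s.2.2))
        (arr k n (.edge s.1 i s.2.1 s.2.2.symm)) m := by
  simp only [unitBase, LinearMap.add_apply, LinearMap.sum_apply]

theorem unitBase_gen (i : Fin n) (M : GrMod k n) (g : Fin n ⊕ Arrow n) (m : M) :
    unitBase i M (gen k n g • m) = gen k n g • unitBase i M m := by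
  simp only [unitBase_apply, smul_add, Finset.smul_sum, unitTerm_smul, smul_unitTerm]
  exact casimir_comm (fun a b => unitTerm i M a b m) (fun b => unitTerm_zero_left i M b m)
    (fun a => unitTerm_zero_right i M a m) i g

theorem unitBase_smul (i : Fin n) (M : GrMod k n) (a : Alg k n) :
    ∀ m : M, unitBase i M (a • m) = a • unitBase i M m := by
  refine alg_induction (p := fun a => ∀ m : M, unitBase i M (a • m) = a • unitBase i M m)
    (fun c m => ?_) (fun a b ha hb m => ?_) (fun a b ha hb m => ?_)
    (fun g m => unitBase_gen i M g m) a
  · simp only [algebraMap_smul, map_smul]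
  · simp only [add_smul, map_add, ha, hb]
  · rw [mul_smul, ha, hb, mul_smul]

theorem unitBase_mem (i : Fin n) (M : GrMod k n) {d : ℤ} {m : M} (hm : m ∈ M.deg d) :
    unitBase i M m ∈ (tensorObj i M).deg (d + 1) := by
  rw [unitBase_apply]
  refine Submodule.add_mem _ (Submodule.add_mem _ ?_ ?_) (Submodule.sum_mem _ fun s _ => ?_)
  · exact unitTerm_mem i M (d := 1) (d' := 0) (arr_mem (.loop i)) (idem_mem i) hm
  · exact unitTerm_mem i M (d := 0) (d' := 1) (idem_mem i) (arr_mem (.loop i)) hm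
  · rw [← deg_add_deg_dual s.1 s.2.2]
    exact unitTerm_mem i M (arr_mem _) (arr_mem _) hm

/-- The natural transformation given by the bimodule map `g_i`, which has degree `1`. -/
def unit (i : Fin n) : 𝟭 (GrMod k n) ⟶ tensor i ⋙ shift 1 where
  app M := ofLin (M := M) (N := shiftObj 1 (tensorObj i M))
    { toFun := unitBase i M
      map_add' := map_add _
      map_smul' := unitBase_smul i M }
    fun _ _ hm => unitBase_mem i M hm
  naturality M N f := hom_ext fun m => by
    have h : ∀ (a b : Alg k n), unitTerm i N a b (Hom.lin f m) =
        Hom.lin (tensorMap i f) (unitTerm i M a b m) := by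
      intro a b
      change toP i a ⊗ₜ[k] toCorner i N (b • Hom.lin f m) =
        toP i a ⊗ₜ[k] cornerMap i f (toCorner i M (b • m))
      congr 1
      refine Subtype.ext ?_
      change idem k n i • b • Hom.lin f m = Hom.lin f (idem k n i • b • m)
      rw [map_smul, map_smul]
    change unitBase i N (Hom.lin f m) = Hom.lin (tensorMap i f) (unitBase i M m)
    rw [unitBase_apply, unitBase_apply, map_add, map_add, map_sum, h, h]
    simp only [h]

end GrMod

end GrMod

/-! ### Complexes, the homotopy category and the sets `X_i^±` -/

section Complexes

variable {k : Type u} [Field k] {n : ℕ}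

variable (k n) in
/-- Complexes of graded modules. -/
abbrev Cpx : Type (u + 1) := CochainComplex (GrMod k n) ℤ

variable (k n) in
/-- The functor from complexes of graded modules to their homotopy category. -/
abbrev toHo : Cpx k n ⥤ HomotopyCategory (GrMod k n) (ComplexShape.up ℤ) :=
  HomotopyCategory.quotient (GrMod k n) (ComplexShape.up ℤ)

/-- The objects of `𝒟`: bounded complexes of finitely generated projective graded modules.
The category `𝒟` is the full subcategory of the homotopy category on these objects. -/
def InD (Y : Cpx k n) : Prop :=
  (∃ a b : ℤ, ∀ m, m < a ∨ b < m → IsZero (Y.X m)) ∧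
    ∀ m, Module.Finite (Alg k n) (Y.X m) ∧ Module.Projective (Alg k n) (Y.X m)

/-- `Y` is an indecomposable object of `𝒟`. -/
def IsIndec (Y : Cpx k n) : Prop :=
  InD Y ∧ ¬ IsZero ((toHo k n).obj Y) ∧
    ∀ Y₁ Y₂ : Cpx k n, InD Y₁ → InD Y₂ →
      Nonempty ((toHo k n).obj Y ≅ (toHo k n).obj Y₁ ⊞ (toHo k n).obj Y₂) →
      IsZero ((toHo k n).obj Y₁) ∨ IsZero ((toHo k n).obj Y₂)

variable (k) in
/-- The complex `P_i⟨l⟩[s]`. -/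
def PShift (i : Fin n) (l s : ℤ) : Cpx k n :=
  ((HomologicalComplex.single (GrMod k n) (ComplexShape.up ℤ) 0).obj
    ((GrMod.shift l).obj (GrMod.P k i)))⟦s⟧

variable (k) in
/-- The module `P_i` as a complex concentrated in degree `0`. -/
def PCpx (i : Fin n) : Cpx k n :=
  (HomologicalComplex.single (GrMod k n) (ComplexShape.up ℤ) 0).obj (GrMod.P k i)

/-- The baric slice `Y(s)`, obtained by applying the slice functor termwise. As this functor is
additive, homotopy equivalent complexes have homotopy equivalent slices; in particular `Y(s)` is
the slice of the minimal complex of `Y`. -/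
def baricSlice (s : ℤ) (Y : Cpx k n) : Cpx k n :=
  ((GrMod.slice s).mapHomologicalComplex (ComplexShape.up ℤ)).obj Y

/-- `φ_+(Y)`, the level of the top slice; for `Y ≠ 0` in `𝒟` the set is nonempty and finite. -/
def phiPlus (Y : Cpx k n) : ℤ := sSup {s | ¬ IsZero ((toHo k n).obj (baricSlice s Y))}

/-- `φ_-(Y)`, the level of the bottom slice; for `Y ≠ 0` in `𝒟` the set is nonempty and finite. -/
def phiMinus (Y : Cpx k n) : ℤ := sInf {s | ¬ IsZero ((toHo k n).obj (baricSlice s Y))}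

/-- `Y` is isomorphic in the homotopy category to a finite direct sum of shifts of `P_i`. -/
def IsSumOfShifts (i : Fin n) (Y : Cpx k n) : Prop :=
  ∃ (r : ℕ) (l s : Fin r → ℤ),
    Nonempty ((toHo k n).obj Y ≅ ⨁ fun a : Fin r => (toHo k n).obj (PShift k i (l a) (s a)))

/-- The set `X_i^+`. The condition `Hom(Y, 𝔓_j⟨l⟩) = 0` says that every morphism of `𝒟` from `Y` to
some `P_j⟨l⟩[s]` is zero. -/
def XPlus (i : Fin n) : Set (Cpx k n) :=
  {Y | IsIndec Y ∧ IsSumOfShifts i (baricSlice (phiPlus Y) Y) ∧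
    ∀ j : Fin n, (∀ (s : ℤ)
      (f : (toHo k n).obj Y ⟶ (toHo k n).obj (PShift k j (phiMinus Y) s)), f = 0) ↔ j = i}

/-- The set `X_i^-`. The condition `Hom(𝔓_j⟨l⟩, Y) = 0` says that every morphism of `𝒟` from some
`P_j⟨l⟩[s]` to `Y` is zero. -/
def XMinus (i : Fin n) : Set (Cpx k n) :=
  {Y | IsIndec Y ∧ IsSumOfShifts i (baricSlice (phiMinus Y) Y) ∧
    ∀ j : Fin n, (∀ (s : ℤ)
      (f : (toHo k n).obj (PShift k j (phiPlus Y) s) ⟶ (toHo k n).obj Y), f = 0) ↔ j = i}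

/-- The map of complexes `Y → A e_i ⊗_k e_i Y ⟨1⟩` given by `g_i`. -/
def unitMap (i : Fin n) (Y : Cpx k n) :
    Y ⟶ ((GrMod.tensor i ⋙ GrMod.shift 1).mapHomologicalComplex (ComplexShape.up ℤ)).obj Y where
  f m := (GrMod.unit i).app (Y.X m)
  comm' a b _ := ((GrMod.unit i).naturality (Y.d a b)).symm

/-- The map of complexes `A e_i ⊗_k e_i Y → Y` given by `f_i`. -/
def counitMap (i : Fin n) (Y : Cpx k n) :
    ((GrMod.tensor i).mapHomologicalComplex (ComplexShape.up ℤ)).obj Y ⟶ Y where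
  f m := (GrMod.counit i).app (Y.X m)
  comm' a b _ := ((GrMod.counit i).naturality (Y.d a b)).symm

/-- `Σ_i(Y) = Σ_i ⊗_A Y`, where `Σ_i` is the complex `A → (A e_i ⊗_k e_i A)⟨1⟩` of bimodules with
differential `g_i` and with `A` in degree `0`. -/
def sigma (i : Fin n) (Y : Cpx k n) : Cpx k n := CochainComplex.mappingCocone (unitMap i Y)

/-- `Σ_i^{-1}(Y) = Σ_i^{-1} ⊗_A Y`, where `Σ_i^{-1}` is the complex `A e_i ⊗_k e_i A → A` of
bimodules with differential `f_i` and with `A` in degree `0`. -/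
def sigmaInv (i : Fin n) (Y : Cpx k n) : Cpx k n := CochainComplex.mappingCone (counitMap i Y)

end Complexes

end Zigzag

end

noncomputable section

open CategoryTheory CategoryTheory.Limits TensorProduct

namespace Zigzag

universe u

/-! ### A basis of the zigzag algebra -/

section Basis

variable {k : Type u} [Field k] {n : ℕ}

/-! Everything is read off from the homology of the complexes of vector spaces `e_j Y` in each
internal degree; `Ac Y j d` says that it vanishes at the vertex `j` in degree `d`. Maps out of
`P_j⟨l⟩` are elements of degree `-l` of `e_j Y`, so all `Hom(P_j⟨l⟩[s], Y)` vanish iff `Ac Y j (-l)`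
(`pShift_hom_iff`). The algebra carries a symmetric form of degree one, the coefficient of the loop
in a product. It makes maps `M → P_j⟨l⟩` the same as functionals on `e_j M` in degree `1 - l`, so
all `Hom(Y, P_j⟨l⟩[s])` vanish iff `Ac Y j (1 - l)` (`hom_pShift_iff`).

Each `e_j A e_i` is spanned by one path of degree 0 and one of degree 1. Hence `P_i⟨l⟩` lives in the
degrees `-l` and `1 - l`, and the degree `-l` of `Y` only sees the slices `Y(l)` and `Y(l+1)`. A
slice is contractible as soon as its homology vanishes, at all vertices, in one of its two degrees
(`isZero_slice_iff_bot`, `isZero_slice_iff_top`). So `φ_+` is the largest `l` with homology in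
degree `-l`, and `φ_-` is the smallest `l` with homology in degree `1 - l` (`phiPlus_eq`,
`phiMinus_eq`); in these degrees the homology of `Y` is that of the extreme slice.

Up to a shift, `Σ_i(Y)` is the cone of the unit `Y → A e_i ⊗ e_i Y⟨1⟩`. At a vertex `j` the target
consists of two copies of `e_i Y`, taken in degrees `d + 1` and `d`, and the unit is `y ↦ (p₁ y, p₀
y)`, where `p₀`, `p₁` are the paths of degree 0 and 1 from `i` to `j`. If `e_i Y` has homology in
degree `-φ_+`, the target pushes `φ_+` up by one. The new top slice is a slice of `A e_i ⊗ e_i Y`,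
which is a sum of shifts of `P_i` because a complex of vector spaces splits (`sumK_TC`,
`isSumOfShifts_sigma`). In degree `1 - φ_-` the copy in degree `d + 1` is acyclic, and what remains
at `j` is the cone of `p₀ : e_j Y → e_i Y`. It is acyclic for `j = i`. For `j ≠ i` it is not acyclic
if `p₀` is not surjective on homology, or if only its target is acyclic. This is `sigma_mem_XPlus`;
`sigmaInv_mem_XMinus` is the dual statement, with injectivity.

Failure of surjectivity has two sources. If the bottom slice is a sum of copies of `P_j` with `j ≠
i`, it is a computation with paths (`nonSurj_SP`). If the homology in degree `1 - φ_-` vanishes at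
`j` but not at `i`, it follows from a chase with the multiplicity complexes of the bottom slice
(`nonSurj_of_ac`). The duals are `nonInj_SP` and `nonInj_of_ac`.

`Σ_i` and `Σ_i^{-1}` preserve indecomposability because they are inverse to each other on objects of
the homotopy category, up to a shift for the cones used here (`sigmaInvConeIso`, `coneSigmaInvIso`):
after tensoring with `A e_i`, the unit becomes a split monomorphism and the counit a split
epimorphism.

For disjointness, the top slice of an object of `X_j^+` is made of copies of `P_j`, which has
elements of degree `-φ_+` at every vertex, while an object of `X_i^-` has no homology at `i` in that
degree. Within one of the two families the vanishing condition determines `i`. -/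

theorem edge_deg_cases (c : Letter) {i j : Fin n} (h : i ≠ j) :
    (Arrow.edge c i j h).deg = 0 ∨ (Arrow.edge c i j h).deg = 1 := by
  cases c <;> simp only [Arrow.deg] <;> split_ifs <;> simp

theorem edge_deg_dual (c : Letter) {i j : Fin n} (h : i ≠ j) :
    (Arrow.edge c j i h.symm).deg = 1 - (Arrow.edge c i j h).deg := by
  have := deg_add_deg_dual c h
  omega

/-- Reversing an edge and changing its letter each exchange the degrees 0 and 1. So the zero
products `edge_mul_other` are exactly those of two returning edges of equal degree. -/
theorem edge_deg_other {c c' : Letter} (hc : c ≠ c') {i j : Fin n} (h : i ≠ j) :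
    (Arrow.edge c' j i h.symm).deg = (Arrow.edge c i j h).deg := by
  rcases lt_or_gt_of_ne h with h' | h' <;> cases c <;> cases c' <;>
    simp_all [Arrow.deg, not_lt_of_gt]

variable (k) in
/-- The action of the generators on the space with basis the paths that end at `i`: the first
component of a vector holds the coefficients of the paths of degree `0`, one for every starting
vertex, and the second component those of the paths of degree `1`. -/
def pathAct (i : Fin n) : Fin n ⊕ Arrow n →
    Module.End k ((Fin n → k) × (Fin n → k))
  | Sum.inl m =>
    { toFun := fun v => (fun r => if r = m then v.1 r else 0, fun r => if r = m then v.2 r else 0)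
      map_add' := fun v w => by ext r <;> simp <;> split_ifs <;> simp
      map_smul' := fun c v => by ext r <;> simp }
  | Sum.inr (.loop m) =>
    { toFun := fun v => (0, fun r => if r = m ∧ m = i then v.1 i else 0)
      map_add' := fun v w => by ext r <;> simp; split_ifs <;> simp
      map_smul' := fun c v => by ext r <;> simp }
  | Sum.inr (.edge c m j h) =>
    -- An arrow `m → j` followed by a path `j → i` survives only if that path is `e_i`, or if the
    -- composite returns to `i` and the two degrees are complementary.
    { toFun := fun v => (fun r => if r = m ∧ j = i ∧ (Arrow.edge c m j h).deg = 0 then v.1 i else 0,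
        fun r => if r = m then (if j = i ∧ (Arrow.edge c m j h).deg = 1 then v.1 i else 0) +
          ((if m = i ∧ (Arrow.edge c m j h).deg = 1 then v.1 j else 0) +
          (if m = i ∧ (Arrow.edge c m j h).deg = 0 then v.2 j else 0)) else 0)
      map_add' := fun v w => by
        ext r
        · simp; split_ifs <;> simp
        · simp; split_ifs <;> simp [add_add_add_comm, add_assoc, add_left_comm]
      map_smul' := fun c v => by ext r <;> simp [mul_add] }

/-- `pathAct` imitates left multiplication on `A e_i`. That it satisfies the relations shows that
the paths ending at `i` are linearly independent in the algebra, which the presentation leaves open.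
-/
theorem pathAct_rel (i : Fin n) (s t : FreeAlgebra k (Fin n ⊕ Arrow n)) (h : Rel k n s t) :
    FreeAlgebra.lift k (pathAct k i) s = FreeAlgebra.lift k (pathAct k i) t := by
  cases h with
  | vertex_mul_self m =>
    simp only [freeVertex, map_mul, FreeAlgebra.lift_ι_apply]
    refine LinearMap.ext fun v => Prod.ext (funext fun r => ?_) (funext fun r => ?_) <;>
      simp only [pathAct, Module.End.mul_apply, LinearMap.coe_mk, AddHom.coe_mk] <;> grind
  | vertex_mul_vertex m j h =>
    simp only [freeVertex, map_mul, FreeAlgebra.lift_ι_apply, map_zero]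
    refine LinearMap.ext fun v => Prod.ext (funext fun r => ?_) (funext fun r => ?_) <;>
    · simp [pathAct]
      intro h1 h2
      exact absurd (h1.symm.trans h2) h
  | sum_vertex =>
    simp only [freeVertex, map_sum, FreeAlgebra.lift_ι_apply, map_one]
    refine LinearMap.ext fun v => Prod.ext (funext fun r => ?_) (funext fun r => ?_) <;>
      simp [pathAct, LinearMap.sum_apply, Prod.fst_sum, Prod.snd_sum, Finset.sum_apply]
  | source_mul a =>
    simp only [freeVertex, freeArrow, map_mul, FreeAlgebra.lift_ι_apply]
    refine LinearMap.ext fun v => Prod.ext (funext fun r => ?_) (funext fun r => ?_) <;>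
    cases a <;> simp [pathAct, Arrow.source] <;> split_ifs <;> simp_all
  | mul_target a =>
    simp only [freeVertex, freeArrow, map_mul, FreeAlgebra.lift_ι_apply]
    refine LinearMap.ext fun v => Prod.ext (funext fun r => ?_) (funext fun r => ?_) <;>
    cases a <;> simp [pathAct, Arrow.target] <;> split_ifs <;> simp_all
  | distinct_ends a b h h' =>
    simp only [freeArrow, map_mul, FreeAlgebra.lift_ι_apply, map_zero]
    refine LinearMap.ext fun v => Prod.ext (funext fun r => ?_) (funext fun r => ?_) <;>
    rcases a with ⟨c, p, q, hpq⟩ | p <;> rcases b with ⟨c', p', q', hpq'⟩ | p' <;>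
      simp only [Arrow.target, Arrow.source] at h h' <;>
      subst h <;> simp [pathAct] <;> grind
  | edge_mul_dual c p q h =>
    simp only [freeArrow, map_mul, FreeAlgebra.lift_ι_apply]
    have hd := edge_deg_dual c h
    have hc := edge_deg_cases c h
    refine LinearMap.ext fun v => Prod.ext (funext fun r => ?_) (funext fun r => ?_) <;>
      simp only [pathAct, hd, Module.End.mul_apply, LinearMap.coe_mk, AddHom.coe_mk,
        Pi.zero_apply] <;> grind
  | edge_mul_other c c' hcc p q h =>
    simp only [freeArrow, map_mul, FreeAlgebra.lift_ι_apply, map_zero]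
    have hd := edge_deg_other hcc h
    have hc := edge_deg_cases c h
    refine LinearMap.ext fun v => Prod.ext (funext fun r => ?_) (funext fun r => ?_) <;>
      simp only [pathAct, hd, Module.End.mul_apply, LinearMap.coe_mk, AddHom.coe_mk,
        LinearMap.zero_apply, Prod.fst_zero, Prod.snd_zero, Pi.zero_apply] <;> grind
  | loop_mul_loop m =>
    simp only [freeArrow, map_mul, FreeAlgebra.lift_ι_apply, map_zero]
    refine LinearMap.ext fun v => Prod.ext (funext fun r => ?_) (funext fun r => ?_) <;>
      simp [pathAct]

theorem exists_pathRep (i : Fin n) : ∃ F : Alg k n →ₐ[k]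
    Module.End k ((Fin n → k) × (Fin n → k)), ∀ g, F (gen k n g) = pathAct k i g := by
  obtain ⟨F, hF⟩ := exists_lift k n _ (pathAct_rel (k := k) i)
  exact ⟨F, fun g => (hF _).trans (FreeAlgebra.lift_ι_apply _ _)⟩

variable (k) in
/-- The representation on the space with basis the paths that end at `i`. -/
def pathRep (i : Fin n) : Alg k n →ₐ[k] Module.End k ((Fin n → k) × (Fin n → k)) :=
  (exists_pathRep i).choose

theorem pathRep_gen (i : Fin n) (g : Fin n ⊕ Arrow n) :
    pathRep k i (gen k n g) = pathAct k i g :=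
  (exists_pathRep i).choose_spec g

/-! ### Paths of degree 0 and 1 and their products -/

/-- The letter of the edge of degree `0` from `i` to `j`. -/
def letterZero (i j : Fin n) : Letter := if i < j then .y else .x

/-- The letter of the edge of degree `1` from `i` to `j`. -/
def letterOne (i j : Fin n) : Letter := if i < j then .x else .y

variable (k) in
/-- The path of degree `0` from `i` to `j`. -/
def pathZero (i j : Fin n) : Alg k n :=
  if h : i = j then idem k n i else arr k n (.edge (letterZero i j) i j h)

variable (k) in
/-- The path of degree `1` from `i` to `j`. -/
def pathOne (i j : Fin n) : Alg k n :=
  if h : i = j then arr k n (.loop i) else arr k n (.edge (letterOne i j) i j h)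

theorem pathZero_self (i : Fin n) : pathZero k i i = idem k n i := by simp [pathZero]

theorem pathOne_self (i : Fin n) : pathOne k i i = arr k n (.loop i) := by simp [pathOne]

theorem letterZero_deg {i j : Fin n} (h : i ≠ j) :
    (Arrow.edge (letterZero i j) i j h).deg = 0 := by
  unfold letterZero; split_ifs <;> simp [Arrow.deg, *]

theorem letterOne_deg {i j : Fin n} (h : i ≠ j) :
    (Arrow.edge (letterOne i j) i j h).deg = 1 := by
  unfold letterOne; split_ifs <;> simp [Arrow.deg, *]

theorem letterOne_eq {i j : Fin n} (h : i ≠ j) : letterOne i j = letterZero j i := by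
  unfold letterOne letterZero
  rcases lt_or_gt_of_ne h with h' | h' <;> simp [h', not_lt_of_gt h']

theorem letterZero_ne {i j : Fin n} : letterZero i j ≠ letterOne i j := by
  unfold letterOne letterZero
  split_ifs <;> simp

theorem pathZero_mem (i j : Fin n) : pathZero k i j ∈ algDeg k n 0 := by
  unfold pathZero
  split_ifs with h
  · exact idem_mem i
  · simpa [letterZero_deg h] using arr_mem (k := k) (.edge (letterZero i j) i j h)

theorem pathOne_mem (i j : Fin n) : pathOne k i j ∈ algDeg k n 1 := by
  unfold pathOne
  split_ifs with h
  · exact arr_mem (.loop i)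
  · simpa [letterOne_deg h] using arr_mem (k := k) (.edge (letterOne i j) i j h)

theorem idem_mul_pathZero (p i j : Fin n) :
    idem k n p * pathZero k i j = if p = i then pathZero k i j else 0 := by
  unfold pathZero
  split_ifs with h h' h'
  · subst h'; exact idem_mul_self _
  · exact idem_mul_idem h'
  · subst h'; exact source_mul (.edge _ _ _ _)
  · exact idem_mul_arr _ _ h'

theorem idem_mul_pathOne (p i j : Fin n) :
    idem k n p * pathOne k i j = if p = i then pathOne k i j else 0 := by
  unfold pathOne
  split_ifs with h h' h'
  · subst h'; exact source_mul (.loop _)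
  · exact idem_mul_arr _ (.loop _) h'
  · subst h'; exact source_mul (.edge _ _ _ _)
  · exact idem_mul_arr _ _ h'

theorem pathZero_mul_idem (p i j : Fin n) :
    pathZero k i j * idem k n p = if p = j then pathZero k i j else 0 := by
  unfold pathZero
  split_ifs with h h' h'
  · subst h'; rw [h]; exact idem_mul_self _
  · exact idem_mul_idem fun h'' => h' (h''.symm.trans h)
  · subst h'; exact mul_target (.edge _ _ _ _)
  · exact arr_mul_idem _ _ (Ne.symm h')

theorem pathOne_mul_idem (p i j : Fin n) :
    pathOne k i j * idem k n p = if p = j then pathOne k i j else 0 := by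
  unfold pathOne
  split_ifs with h h' h'
  · subst h'; subst h; exact mul_target (.loop _)
  · exact arr_mul_idem _ (.loop _) fun h'' => h' (h''.symm.trans h)
  · subst h'; exact mul_target (.edge _ _ _ _)
  · exact arr_mul_idem _ _ (Ne.symm h')

/-- An arrow is a path of degree `0` or `1`. -/
theorem arr_eq (a : Arrow n) : arr k n a = pathZero k a.source a.target ∨
    arr k n a = pathOne k a.source a.target := by
  rcases a with ⟨c, i, j, h⟩ | i
  · have : c = letterZero i j ∨ c = letterOne i j := by
      unfold letterZero letterOne
      cases c <;> split_ifs <;> simp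
    rcases this with rfl | rfl
    · left; simp [pathZero, Arrow.source, Arrow.target, h]
    · right; simp [pathOne, Arrow.source, Arrow.target, h]
  · right; exact (pathOne_self i).symm

theorem pathZero_mul_pathOne_self (i j : Fin n) :
    pathZero k i j * pathOne k j i = pathOne k i i := by
  rw [pathOne_self]
  unfold pathZero pathOne
  by_cases h : i = j
  · subst h
    rw [dif_pos rfl, dif_pos rfl]
    exact source_mul (.loop i)
  · rw [dif_neg h, dif_neg (Ne.symm h), letterOne_eq (Ne.symm h)]
    exact edge_mul_dual _ h

theorem pathOne_mul_pathZero_self (i j : Fin n) :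
    pathOne k i j * pathZero k j i = pathOne k i i := by
  rw [pathOne_self]
  unfold pathZero pathOne
  by_cases h : i = j
  · subst h
    rw [dif_pos rfl, dif_pos rfl]
    exact mul_target (.loop i)
  · rw [dif_neg h, dif_neg (Ne.symm h), letterOne_eq h]
    exact edge_mul_dual _ h

/-- The dual of an edge of degree 0 has degree 1, so two edges of degree 0 that return to their
start carry different letters. Composites that do not return vanish anyway. -/
theorem pathZero_mul_pathZero {p i j : Fin n} (hp : p ≠ i) (hj : i ≠ j) :
    pathZero k p i * pathZero k i j = 0 := by
  unfold pathZero
  rw [dif_neg hp, dif_neg hj]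
  by_cases h : p = j
  · subst h
    refine edge_mul_other ?_ _
    rw [← letterOne_eq hp]
    exact letterZero_ne
  · exact arr_mul_arr _ _ fun _ => h

theorem pathOne_mul_pathOne (p i j : Fin n) : pathOne k p i * pathOne k i j = 0 := by
  unfold pathOne
  by_cases hp : p = i
  · subst hp
    by_cases hj : p = j
    · subst hj; simpa using loop_mul_loop p
    · rw [dif_pos rfl, dif_neg hj]
      exact arr_mul_arr _ _ fun _ => hj
  · rw [dif_neg hp]
    by_cases hj : i = j
    · rw [dif_pos hj]
      exact arr_mul_arr _ _ fun _ => hp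
    · rw [dif_neg hj]
      by_cases h : p = j
      · subst h
        refine edge_mul_other ?_ _
        rw [letterOne_eq hj]
        exact letterZero_ne.symm
      · exact arr_mul_arr _ _ fun _ => h

theorem pathZero_mul_pathOne {p i j : Fin n} (hp : p ≠ i) (hj : p ≠ j) :
    pathZero k p i * pathOne k i j = 0 := by
  unfold pathZero pathOne
  rw [dif_neg hp]
  split_ifs
  · exact arr_mul_arr _ _ fun _ => hp
  · exact arr_mul_arr _ _ fun _ => hj

theorem pathOne_mul_pathZero {p i j : Fin n} (hi : i ≠ j) (hj : p ≠ j) :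
    pathOne k p i * pathZero k i j = 0 := by
  unfold pathZero pathOne
  rw [dif_neg hi]
  split_ifs <;> exact arr_mul_arr _ _ fun _ => hj

theorem mul_eq_zero_of_ne {x y : Alg k n} (i j : Fin n) (hij : i ≠ j) (hx : x * idem k n i = x)
    (hy : idem k n j * y = y) : x * y = 0 := by
  rw [← hx, ← hy, mul_assoc, ← mul_assoc (idem k n i), idem_mul_idem hij, zero_mul, mul_zero]

/-- The zigzag algebra is spanned by the paths `pathZero` and `pathOne`. -/
theorem span_path : Submodule.span k
    (Set.range (fun s : Fin n × Fin n => pathZero k s.1 s.2) ∪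
      Set.range (fun s : Fin n × Fin n => pathOne k s.1 s.2)) = ⊤ := by
  set S := Submodule.span k
    (Set.range (fun s : Fin n × Fin n => pathZero k s.1 s.2) ∪
      Set.range (fun s : Fin n × Fin n => pathOne k s.1 s.2)) with hS
  have h0 : ∀ i j, pathZero k i j ∈ S := fun i j => Submodule.subset_span (Or.inl ⟨(i, j), rfl⟩)
  have h1 : ∀ i j, pathOne k i j ∈ S := fun i j => Submodule.subset_span (Or.inr ⟨(i, j), rfl⟩)
  have h00 : ∀ p q i j, pathZero k p q * pathZero k i j ∈ S := by
    intro p q i j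
    by_cases hq : q = i
    · subst hq
      by_cases hp : p = q
      · subst hp; rw [pathZero_self, idem_mul_pathZero, if_pos rfl]; exact h0 _ _
      · by_cases hj : q = j
        · subst hj; rw [pathZero_self, pathZero_mul_idem, if_pos rfl]; exact h0 _ _
        · rw [pathZero_mul_pathZero hp hj]; exact S.zero_mem
    · rw [mul_eq_zero_of_ne q i hq (by simp [pathZero_mul_idem]) (by simp [idem_mul_pathZero])]
      exact S.zero_mem
  have h01 : ∀ p q i j, pathZero k p q * pathOne k i j ∈ S := by
    intro p q i j
    by_cases hq : q = i
    · subst hq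
      by_cases hp : p = q
      · subst hp; rw [pathZero_self, idem_mul_pathOne, if_pos rfl]; exact h1 _ _
      · by_cases hj : p = j
        · subst hj; rw [pathZero_mul_pathOne_self]; exact h1 _ _
        · rw [pathZero_mul_pathOne hp hj]; exact S.zero_mem
    · rw [mul_eq_zero_of_ne q i hq (by simp [pathZero_mul_idem]) (by simp [idem_mul_pathOne])]
      exact S.zero_mem
  have h10 : ∀ p q i j, pathOne k p q * pathZero k i j ∈ S := by
    intro p q i j
    by_cases hq : q = i
    · subst hq
      by_cases hj : q = j
      · subst hj; rw [pathZero_self, pathOne_mul_idem, if_pos rfl]; exact h1 _ _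
      · by_cases hp : p = j
        · subst hp; rw [pathOne_mul_pathZero_self]; exact h1 _ _
        · rw [pathOne_mul_pathZero hj hp]; exact S.zero_mem
    · rw [mul_eq_zero_of_ne q i hq (by simp [pathOne_mul_idem]) (by simp [idem_mul_pathZero])]
      exact S.zero_mem
  have h11 : ∀ p q i j, pathOne k p q * pathOne k i j ∈ S := by
    intro p q i j
    by_cases hq : q = i
    · subst hq; rw [pathOne_mul_pathOne]; exact S.zero_mem
    · rw [mul_eq_zero_of_ne q i hq (by simp [pathOne_mul_idem]) (by simp [idem_mul_pathOne])]
      exact S.zero_mem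
  rw [eq_top_iff]
  rintro a -
  refine alg_induction (p := (· ∈ S)) (fun c => ?_) (fun _ _ => S.add_mem) (fun a b ha hb => ?_)
    (fun g => ?_) a
  · rw [Algebra.algebraMap_eq_smul_one, ← sum_idem]
    exact S.smul_mem _ (S.sum_mem fun i _ => pathZero_self (k := k) i ▸ h0 i i)
  · have := Submodule.mul_mem_mul ha hb
    rw [hS, Submodule.span_mul_span] at this
    refine (Submodule.span_le (p := S)).mpr ?_ this
    rintro _ ⟨_, ⟨⟨p, q⟩, rfl⟩ | ⟨⟨p, q⟩, rfl⟩, _, ⟨⟨i, j⟩, rfl⟩ | ⟨⟨i, j⟩, rfl⟩, rfl⟩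
    exacts [h00 p q i j, h01 p q i j, h10 p q i j, h11 p q i j]
  · rcases g with i | a
    · have := h0 i i
      rwa [pathZero_self] at this
    · change arr k n a ∈ S
      rcases arr_eq (k := k) a with h | h <;> rw [h]
      exacts [h0 _ _, h1 _ _]

instance : Module.Finite k (Alg k n) :=
  ⟨⟨((Set.finite_range _).union (Set.finite_range _)).toFinset, by
    rw [Set.Finite.coe_toFinset]; exact span_path⟩⟩

/-- A linear property that holds for all paths holds on the whole algebra. -/
theorem path_induction {p : Alg k n → Prop} (hadd : ∀ a b, p a → p b → p (a + b))
    (hsmul : ∀ (c : k) a, p a → p (c • a)) (hz : p 0) (h0 : ∀ i j, p (pathZero k i j))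
    (h1 : ∀ i j, p (pathOne k i j)) (a : Alg k n) : p a := by
  have : a ∈ (⊤ : Submodule k (Alg k n)) := trivial
  rw [← span_path] at this
  induction this using Submodule.span_induction with
  | mem a ha => rcases ha with ⟨s, rfl⟩ | ⟨s, rfl⟩; exacts [h0 _ _, h1 _ _]
  | zero => exact hz
  | add a b _ _ ha hb => exact hadd a b ha hb
  | smul c a _ ha => exact hsmul c a ha

/-! ### Coefficients with respect to the paths -/

/-- The coefficient in `a e_i` of the path of degree `0` from `j` to `i`. -/
def coeffZero (i j : Fin n) : Alg k n →ₗ[k] k where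
  toFun a := (pathRep k i a (Pi.single i 1, 0)).1 j
  map_add' a b := by simp
  map_smul' c a := by simp

/-- The coefficient in `a e_i` of the path of degree `1` from `j` to `i`. -/
def coeffOne (i j : Fin n) : Alg k n →ₗ[k] k where
  toFun a := (pathRep k i a (Pi.single i 1, 0)).2 j
  map_add' a b := by simp
  map_smul' c a := by simp

theorem pathRep_pathZero (i p q : Fin n) :
    pathRep k i (pathZero k p q) (Pi.single i 1, 0) =
      if q = i then (Pi.single p 1, 0) else 0 := by
  unfold pathZero
  split_ifs with h h' h'
  · subst h; subst h'
    rw [idem, pathRep_gen]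
    refine Prod.ext (funext fun r => ?_) (funext fun r => ?_) <;> simp [pathAct]
    by_cases hr : r = p <;> simp [hr]
  · subst h
    rw [idem, pathRep_gen]
    refine Prod.ext (funext fun r => ?_) (funext fun r => ?_) <;> simp [pathAct]
    rintro rfl; simp [Pi.single_apply, h']
  · subst h'
    rw [arr, pathRep_gen]
    have := letterZero_deg h
    refine Prod.ext (funext fun r => ?_) (funext fun r => ?_) <;>
      simp [pathAct, this, Pi.single_apply, h]
  · rw [arr, pathRep_gen]
    have := letterZero_deg h
    refine Prod.ext (funext fun r => ?_) (funext fun r => ?_) <;>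
      simp [pathAct, this, Pi.single_apply, h']

theorem pathRep_pathOne (i p q : Fin n) :
    pathRep k i (pathOne k p q) (Pi.single i 1, 0) =
      if q = i then (0, Pi.single p 1) else 0 := by
  unfold pathOne
  split_ifs with h h' h'
  · subst h; subst h'
    rw [arr, pathRep_gen]
    refine Prod.ext (funext fun r => ?_) (funext fun r => ?_) <;> simp [pathAct, Pi.single_apply]
  · subst h
    rw [arr, pathRep_gen]
    refine Prod.ext (funext fun r => ?_) (funext fun r => ?_) <;> simp [pathAct, h']
  · subst h'
    rw [arr, pathRep_gen]
    have := letterOne_deg h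
    refine Prod.ext (funext fun r => ?_) (funext fun r => ?_) <;>
      simp [pathAct, this, Pi.single_apply, h]
  · rw [arr, pathRep_gen]
    have := letterOne_deg h
    refine Prod.ext (funext fun r => ?_) (funext fun r => ?_) <;>
      simp [pathAct, this, Pi.single_apply, h']

theorem coeffZero_pathZero (i j p q : Fin n) :
    coeffZero i j (pathZero k p q) = if q = i ∧ p = j then 1 else 0 := by
  change (pathRep k i _ _).1 j = _
  rw [pathRep_pathZero]
  by_cases h : q = i <;> simp [h, Pi.single_apply, eq_comm]

theorem coeffZero_pathOne (i j p q : Fin n) : coeffZero i j (pathOne k p q) = 0 := by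
  change (pathRep k i _ _).1 j = _
  rw [pathRep_pathOne]
  by_cases h : q = i <;> simp [h]

theorem coeffOne_pathZero (i j p q : Fin n) : coeffOne i j (pathZero k p q) = 0 := by
  change (pathRep k i _ _).2 j = _
  rw [pathRep_pathZero]
  by_cases h : q = i <;> simp [h]

theorem coeffOne_pathOne (i j p q : Fin n) :
    coeffOne i j (pathOne k p q) = if q = i ∧ p = j then 1 else 0 := by
  change (pathRep k i _ _).2 j = _
  rw [pathRep_pathOne]
  by_cases h : q = i <;> simp [h, Pi.single_apply, eq_comm]

theorem mul_idem_eq (i : Fin n) (a : Alg k n) : a * idem k n i =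
    ∑ j, (coeffZero i j a • pathZero k j i + coeffOne i j a • pathOne k j i) := by
  refine path_induction (p := fun a => a * idem k n i =
    ∑ j, (coeffZero i j a • pathZero k j i + coeffOne i j a • pathOne k j i))
    (fun a b ha hb => ?_) (fun c a ha => ?_) (by simp) (fun p q => ?_) (fun p q => ?_) a
  · simp only [add_mul, ha, hb, map_add, add_smul, Finset.sum_add_distrib]; abel
  · simp only [smul_mul_assoc, ha, map_smul, Finset.smul_sum, smul_add, smul_smul, smul_eq_mul]
  · simp only [coeffZero_pathZero, coeffOne_pathZero, pathZero_mul_idem]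
    by_cases h : q = i
    · subst h; simp
    · simp [h, Ne.symm h]
  · simp only [coeffZero_pathOne, coeffOne_pathOne, pathOne_mul_idem]
    by_cases h : q = i
    · subst h; simp
    · simp [h, Ne.symm h]

/-- With the linear independence from `pathRep` this makes every `e_j A e_i` two-dimensional, with
one dimension in degree 0 and one in degree 1, also for `i = j`. -/
theorem idem_mul_mul_idem (j i : Fin n) (a : Alg k n) : idem k n j * (a * idem k n i) =
    coeffZero i j a • pathZero k j i + coeffOne i j a • pathOne k j i := by
  rw [mul_idem_eq, Finset.mul_sum, Finset.sum_eq_single j]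
  · simp [mul_add, idem_mul_pathZero, idem_mul_pathOne]
  · intro p _ hp
    simp [mul_add, idem_mul_pathZero, idem_mul_pathOne, Ne.symm hp]
  · simp

/-- The zigzag algebra lives in degrees `0` and `1`. -/
theorem coeff_of_mem {d : ℤ} {a : Alg k n} (ha : a ∈ algDeg k n d) (i j : Fin n) :
    (d ≠ 0 → coeffZero i j a = 0) ∧ (d ≠ 1 → coeffOne i j a = 0) := by
  have hI := algDeg_isInternal (k := k) (n := n)
  suffices h : ∀ a : Alg k n, (d ≠ 0 → coeffZero i j (proj hI d a) = 0) ∧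
      (d ≠ 1 → coeffOne i j (proj hI d a) = 0) by
    have := h a
    rwa [proj_of_mem hI ha] at this
  refine path_induction (fun a b ha hb => ?_) (fun c a ha => ?_) (by simp) (fun p q => ?_)
    (fun p q => ?_)
  · exact ⟨fun h => by simp [ha.1 h, hb.1 h], fun h => by simp [ha.2 h, hb.2 h]⟩
  · exact ⟨fun h => by simp [ha.1 h], fun h => by simp [ha.2 h]⟩
  · refine ⟨fun h => ?_, fun h => ?_⟩
    · rw [proj_of_mem_ne hI h (pathZero_mem p q), map_zero]
    · by_cases h0 : d = 0
      · subst h0; rw [proj_of_mem hI (pathZero_mem p q), coeffOne_pathZero]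
      · rw [proj_of_mem_ne hI h0 (pathZero_mem p q), map_zero]
  · refine ⟨fun h => ?_, fun h => ?_⟩
    · by_cases h0 : d = 1
      · subst h0; rw [proj_of_mem hI (pathOne_mem p q), coeffZero_pathOne]
      · rw [proj_of_mem_ne hI h0 (pathOne_mem p q), map_zero]
    · rw [proj_of_mem_ne hI h (pathOne_mem p q), map_zero]

end Basis

end Zigzag

end

noncomputable section

open CategoryTheory CategoryTheory.Limits TensorProduct

namespace Zigzag

universe u

namespace GrMod

variable {k : Type u} [Field k] {n : ℕ}

/-! ### Homogeneous elements of graded modules -/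

/-- The elements of degree `d` of `e_j M`. -/
def part (j : Fin n) (d : ℤ) (M : GrMod k n) : Submodule k M where
  carrier := {m | m ∈ M.deg d ∧ idem k n j • m = m}
  zero_mem' := ⟨Submodule.zero_mem _, smul_zero _⟩
  add_mem' := fun ha hb => ⟨Submodule.add_mem _ ha.1 hb.1, by rw [smul_add, ha.2, hb.2]⟩
  smul_mem' := fun c m hm => ⟨Submodule.smul_mem _ c hm.1, by rw [smul_algebra_smul_comm, hm.2]⟩

theorem idem_smul_mem_part (j : Fin n) {d : ℤ} {M : GrMod k n} {m : M} (hm : m ∈ M.deg d) :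
    idem k n j • m ∈ part j d M :=
  ⟨idem_smul_mem j M hm, by rw [smul_smul, idem_mul_self]⟩

theorem sum_idem_smul {M : GrMod k n} (m : M) : ∑ j, idem k n j • m = m := by
  rw [← Finset.sum_smul, sum_idem, one_smul]

theorem pathZero_smul_mem (i : Fin n) {j : Fin n} {d : ℤ} {M : GrMod k n} {m : M}
    (hm : m ∈ part j d M) : pathZero k i j • m ∈ part i d M :=
  ⟨by simpa using M.smul_mem (pathZero_mem i j) hm.1, by
    rw [smul_smul, idem_mul_pathZero, if_pos rfl]⟩

theorem pathOne_smul_mem (i : Fin n) {j : Fin n} {d : ℤ} {M : GrMod k n} {m : M}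
    (hm : m ∈ part j d M) : pathOne k i j • m ∈ part i (d + 1) M :=
  ⟨by simpa [add_comm] using M.smul_mem (pathOne_mem i j) hm.1, by
    rw [smul_smul, idem_mul_pathOne, if_pos rfl]⟩

theorem lin_mem_part {j : Fin n} {d : ℤ} {M N : GrMod k n} (f : M ⟶ N) {m : M}
    (hm : m ∈ part j d M) : Hom.lin f m ∈ part j d N :=
  ⟨Hom.lin_mem f hm.1, by rw [← map_smul, hm.2]⟩

@[simp] theorem lin_sub {M N : GrMod k n} (f g : M ⟶ N) :
    Hom.lin (f - g) = Hom.lin f - Hom.lin g := rfl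

/-- The module map underlying a morphism, as a group homomorphism in the morphism. -/
def linHom (M N : GrMod k n) : (M ⟶ N) →+ (M →ₗ[Alg k n] N) where
  toFun f := Hom.lin f
  map_zero' := rfl
  map_add' _ _ := rfl

theorem lin_sum {M N : GrMod k n} {J : Type*} (s : Finset J) (f : J → (M ⟶ N)) :
    Hom.lin (∑ a ∈ s, f a) = ∑ a ∈ s, Hom.lin (f a) :=
  map_sum (linHom M N) f s

/-- A module map between graded modules has a part of degree `0`. -/
theorem exists_degZero {M N : GrMod k n} (f : M.carrier →ₗ[Alg k n] N.carrier) :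
    ∃ g : M ⟶ N, ∀ d, ∀ m ∈ M.deg d, Hom.lin g m = proj N.isInternal d (f m) := by
  let G : M.carrier →ₗ[k] N.carrier :=
    DirectSum.toModule k ℤ N.carrier
      (fun d => proj N.isInternal d ∘ₗ f.restrictScalars k ∘ₗ (M.deg d).subtype) ∘ₗ
      (LinearEquiv.ofBijective (DirectSum.coeLinearMap M.deg) M.isInternal).symm.toLinearMap
  have hG : ∀ d, ∀ m ∈ M.deg d, G m = proj N.isInternal d (f m) := by
    intro d m hm
    simp [G, ofBijective_symm_of_mem M.isInternal hm, DirectSum.toModule_lof]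
  have hsmul : ∀ (a : Alg k n) (m : M), G (a • m) = a • G m := by
    intro a m
    refine grading_induction (mem_iSup M.isInternal) (p := fun m => G (a • m) = a • G m)
      (by simp) (fun m m' h h' => by simp only [smul_add, map_add, h, h']) (fun d m hm => ?_) m
    refine grading_induction (mem_iSup (algDeg_isInternal (k := k) (n := n)))
      (p := fun a => G (a • m) = a • G m)
      (by simp) (fun m m' h h' => by simp only [add_smul, map_add, h, h']) (fun e a ha => ?_) a
    rw [hG _ _ (M.smul_mem ha hm), hG _ _ hm, map_smul, proj_smul N ha, add_sub_cancel_left]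
  refine ⟨ofLin (M := M) (N := N) { toFun := G, map_add' := map_add G, map_smul' := hsmul }
    fun d m hm => ?_, hG⟩
  change G m ∈ _
  rw [hG d m hm]
  exact proj_mem _ _ _

/-! ### Maps out of `P_i⟨l⟩` -/

variable (k) in
/-- The graded module `P_i⟨l⟩`. -/
abbrev PS (i : Fin n) (l : ℤ) : GrMod k n := (shift l).obj (P k i)

/-- The inclusion of `P_i⟨l⟩` in the zigzag algebra. -/
def pval (i : Fin n) (l : ℤ) : (PS k i l).carrier →ₗ[Alg k n] Alg k n :=
  (Submodule.span (Alg k n) {idem k n i}).subtype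

theorem pval_injective (i : Fin n) (l : ℤ) : Function.Injective (pval (k := k) i l) :=
  Subtype.val_injective

theorem pval_mul_idem (i : Fin n) (l : ℤ) (u : PS k i l) :
    pval i l u * idem k n i = pval i l u := by
  obtain ⟨a, ha⟩ := Submodule.mem_span_singleton.mp
    (Subtype.prop (p := (· ∈ Submodule.span (Alg k n) {idem k n i})) u)
  have : pval i l u = a * idem k n i := ha.symm
  rw [this, mul_assoc, idem_mul_self]

theorem mem_deg_PS {i : Fin n} {l d : ℤ} {u : PS k i l} :
    u ∈ (PS k i l).deg d ↔ pval i l u ∈ algDeg k n (d + l) := Iff.rfl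

variable (k) in
/-- The generator `e_i` of `P_i⟨l⟩`. -/
def topElt (i : Fin n) (l : ℤ) : PS k i l := toP i 1

@[simp] theorem pval_topElt (i : Fin n) (l : ℤ) : pval i l (topElt k i l) = idem k n i :=
  one_mul _

theorem pval_smul_topElt (i : Fin n) (l : ℤ) (u : PS k i l) : pval i l u • topElt k i l = u :=
  pval_injective i l (by rw [map_smul, pval_topElt, smul_eq_mul, pval_mul_idem])

theorem topElt_mem (i : Fin n) (l : ℤ) : topElt k i l ∈ part i (-l) (PS k i l) := by
  refine ⟨?_, pval_injective i l ?_⟩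
  · rw [mem_deg_PS, pval_topElt, neg_add_cancel]
    exact idem_mem i
  · rw [map_smul, pval_topElt, smul_eq_mul, idem_mul_self]

/-- The map `P_i⟨l⟩ ⟶ M` that sends the generator to a given element. -/
def fromP {i : Fin n} {l : ℤ} {M : GrMod k n} (x : M) (hx : x ∈ part i (-l) M) : PS k i l ⟶ M :=
  ofLin (M := PS k i l) (N := M) (LinearMap.toSpanSingleton (Alg k n) M x ∘ₗ pval i l)
    fun d u hu => by
      have := M.smul_mem (mem_deg_PS.mp hu) hx.1
      rwa [add_neg_cancel_right] at this

@[simp] theorem fromP_apply {i : Fin n} {l : ℤ} {M : GrMod k n} (x : M) (hx : x ∈ part i (-l) M)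
    (u : PS k i l) : Hom.lin (fromP x hx) u = pval i l u • x := rfl

theorem fromP_topElt {i : Fin n} {l : ℤ} {M : GrMod k n} (x : M) (hx : x ∈ part i (-l) M) :
    Hom.lin (fromP x hx) (topElt k i l) = x := by
  rw [fromP_apply, pval_topElt, hx.2]

theorem PS_hom_ext {i : Fin n} {l : ℤ} {M : GrMod k n} {f g : PS k i l ⟶ M}
    (h : Hom.lin f (topElt k i l) = Hom.lin g (topElt k i l)) : f = g :=
  hom_ext fun u => by rw [← pval_smul_topElt i l u, map_smul, map_smul, h]

theorem pval_eq {i j : Fin n} {l d : ℤ} {u : PS k i l} (hu : u ∈ part j d (PS k i l)) :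
    pval i l u = coeffZero i j (pval i l u) • pathZero k j i +
      coeffOne i j (pval i l u) • pathOne k j i := by
  rw [← idem_mul_mul_idem, pval_mul_idem, ← smul_eq_mul, ← map_smul, hu.2]

theorem pval_eq_zero {i j : Fin n} {l d : ℤ} {u : PS k i l} (hu : u ∈ part j d (PS k i l))
    (hd : d + l = 0) : pval i l u = coeffZero i j (pval i l u) • pathZero k j i := by
  conv_lhs => rw [pval_eq hu]
  rw [(coeff_of_mem (mem_deg_PS.mp hu.1) i j).2 (by omega), zero_smul, add_zero]

theorem pval_eq_one {i j : Fin n} {l d : ℤ} {u : PS k i l} (hu : u ∈ part j d (PS k i l))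
    (hd : d + l = 1) : pval i l u = coeffOne i j (pval i l u) • pathOne k j i := by
  conv_lhs => rw [pval_eq hu]
  rw [(coeff_of_mem (mem_deg_PS.mp hu.1) i j).1 (by omega), zero_smul, zero_add]

theorem part_PS_eq_zero {i j : Fin n} {l d : ℤ} {u : PS k i l} (hu : u ∈ part j d (PS k i l))
    (hd : d + l ≠ 0) (hd' : d + l ≠ 1) : u = 0 := by
  refine pval_injective i l ?_
  have := coeff_of_mem (mem_deg_PS.mp hu.1) i j
  rw [pval_eq hu, this.1 hd, this.2 hd', zero_smul, zero_smul, add_zero, map_zero]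

/-! ### Finitely generated projective graded modules -/

/-- Any finite set of generators can be cut into homogeneous parts, and these into their components
at the vertices. -/
theorem exists_homog_generators (M : GrMod k n) [Module.Finite (Alg k n) M] :
    ∃ (J : Type u) (_ : Fintype J) (i : J → Fin n) (d : J → ℤ) (x : J → M),
      (∀ a, x a ∈ part (i a) (d a) M) ∧ Submodule.span (Alg k n) (Set.range x) = ⊤ := by
  obtain ⟨S, hS⟩ := Module.Finite.fg_top (R := Alg k n) (M := M)
  choose s hs using fun x => exists_sum_proj M.isInternal x
  refine ⟨Σ x : S, (s x.1) × Fin n, inferInstance, fun a => a.2.2, fun a => a.2.1.1,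
    fun a => idem k n a.2.2 • proj M.isInternal a.2.1.1 a.1.1,
    fun a => idem_smul_mem_part _ (proj_mem _ _ _), ?_⟩
  rw [eq_top_iff, ← hS, Submodule.span_le]
  intro x hx
  rw [SetLike.mem_coe, ← hs x]
  refine Submodule.sum_mem _ fun d hd => ?_
  rw [← sum_idem_smul (proj M.isInternal d x)]
  exact Submodule.sum_mem _ fun j _ => Submodule.subset_span ⟨⟨⟨x, hx⟩, ⟨d, hd⟩, j⟩, rfl⟩

/-- A finitely generated projective graded module is a direct summand of a finite direct sum of
modules `P_i⟨l⟩`. -/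
theorem exists_dual_basis (M : GrMod k n) [Module.Finite (Alg k n) M]
    [Module.Projective (Alg k n) M] :
    ∃ (J : Type u) (_ : Fintype J) (i : J → Fin n) (l : J → ℤ) (π : ∀ a, M ⟶ PS k (i a) (l a))
      (ι : ∀ a, PS k (i a) (l a) ⟶ M), ∑ a, π a ≫ ι a = 𝟙 M := by
  obtain ⟨J, _, i, d, x, hx, hspan⟩ := exists_homog_generators M
  let φ : (J → Alg k n) →ₗ[Alg k n] M.carrier := Fintype.linearCombination (Alg k n) x
  have hφ : Function.Surjective φ := by
    rw [← LinearMap.range_eq_top, ← hspan]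
    exact Fintype.range_linearCombination (Alg k n) x
  obtain ⟨σ, hσ⟩ := Module.projective_lifting_property φ LinearMap.id hφ
  -- The section `σ` need not preserve degrees. Its coordinates may be replaced by their parts of
  -- degree 0, since `x a` is homogeneous and only these parts contribute to the degree of `m`.
  choose π hπ using fun a => exists_degZero (M := M) (N := PS k (i a) (-d a))
    (toP (i a) ∘ₗ LinearMap.proj a ∘ₗ σ)
  have hx' : ∀ a, x a ∈ part (i a) (-(-d a)) M := fun a => by rw [neg_neg]; exact hx a
  refine ⟨J, inferInstance, i, fun a => -d a, π, fun a => fromP (x a) (hx' a), hom_ext fun m => ?_⟩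
  refine grading_induction (mem_iSup M.isInternal) (p := fun m =>
    Hom.lin (∑ a, π a ≫ fromP (x a) (hx' a)) m = Hom.lin (𝟙 M) m)
    (by simp) (fun a b ha hb => by rw [map_add, map_add, ha, hb]) (fun e m hm => ?_) m
  rw [lin_sum, LinearMap.sum_apply]
  have h1 : ∀ a, Hom.lin (π a ≫ fromP (x a) (hx' a)) m = proj M.isInternal e (σ m a • x a) := by
    intro a
    rw [lin_comp, LinearMap.comp_apply, hπ a e m hm]
    refine (map_proj (M := PS k (i a) (-d a)) (N := M)
      ((Hom.lin (fromP (x a) (hx' a))).restrictScalars k) (fun _ _ h => Hom.lin_mem _ h) e _).trans ?_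
    congr 1
    change (σ m a * idem k n (i a)) • x a = _
    rw [mul_smul, (hx a).2]
  rw [Finset.sum_congr rfl fun a _ => h1 a, ← map_sum]
  have h2 : ∑ a, σ m a • x a = m := LinearMap.congr_fun hσ m
  rw [h2, proj_of_mem _ hm]
  rfl

/-- Maps out of `M` lift along surjections of graded modules. -/
def IsGrProj (M : GrMod k n) : Prop :=
  ∀ ⦃N N' : GrMod k n⦄ (f : N ⟶ N') (g : M ⟶ N'),
    (∀ m, ∃ x, Hom.lin f x = Hom.lin g m) → ∃ h : M ⟶ N, h ≫ f = g

/-- A preimage of the image of the generator need not be homogeneous or lie in `e_i N`; its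
component in degree `-l` at the vertex `i` is a preimage too. -/
theorem isGrProj_PS (i : Fin n) (l : ℤ) : IsGrProj (PS k i l) := by
  intro N N' f g hfg
  obtain ⟨x, hx⟩ := hfg (topElt k i l)
  have ht := lin_mem_part g (topElt_mem (k := k) i l)
  have hx' : Hom.lin f (idem k n i • proj N.isInternal (-l) x) = Hom.lin g (topElt k i l) := by
    have h1 : Hom.lin f (proj N.isInternal (-l) x) = proj N'.isInternal (-l) (Hom.lin f x) :=
      map_proj (M := N) (N := N') ((Hom.lin f).restrictScalars k)
        (fun _ _ h => Hom.lin_mem f h) (-l) x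
    rw [map_smul, h1, hx, proj_of_mem _ ht.1, ht.2]
  refine ⟨fromP _ (idem_smul_mem_part i (proj_mem N.isInternal (-l) x)), PS_hom_ext ?_⟩
  rw [lin_comp, LinearMap.comp_apply, fromP_topElt, hx']

theorem isGrProj_of_isZero {M : GrMod k n} (h : IsZero M) : IsGrProj M :=
  fun _ _ _ _ _ => ⟨0, h.eq_of_src _ _⟩

theorem isGrProj_of_sum {M : GrMod k n} {J : Type*} [Fintype J] {N : J → GrMod k n}
    (π : ∀ a, M ⟶ N a) (ι : ∀ a, N a ⟶ M) (h : ∑ a, π a ≫ ι a = 𝟙 M)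
    (hN : ∀ a, IsGrProj (N a)) : IsGrProj M := by
  intro X X' f g hfg
  choose t ht using fun a => hN a f (ι a ≫ g) fun m => hfg (Hom.lin (ι a) m)
  refine ⟨∑ a, π a ≫ t a, ?_⟩
  rw [Preadditive.sum_comp]
  simp only [Category.assoc, ht]
  simp only [← Category.assoc, ← Preadditive.sum_comp, h, Category.id_comp]

theorem isGrProj_of_projective (M : GrMod k n) [Module.Finite (Alg k n) M]
    [Module.Projective (Alg k n) M] : IsGrProj M := by
  obtain ⟨J, _, i, l, π, ι, h⟩ := exists_dual_basis M
  exact isGrProj_of_sum π ι h fun a => isGrProj_PS _ _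

theorem isZero_of_forall {M : GrMod k n} (h : ∀ m : M, m = 0) : IsZero M :=
  (IsZero.iff_id_eq_zero _).mpr (hom_ext fun m => h m)

theorem eq_zero_of_isZero {M : GrMod k n} (h : IsZero M) (m : M) : m = 0 :=
  LinearMap.congr_fun (congrArg Hom.lin ((IsZero.iff_id_eq_zero M).mp h)) m

/-! ### Slices of graded modules -/

theorem mem_filt {M : GrMod k n} {d s : ℤ} (h : d ≤ -s) {m : M} (hm : m ∈ M.deg d) :
    m ∈ M.filt s := Submodule.subset_span ⟨d, h, hm⟩

/-- The submodule `filt M s` vanishes in degrees above `1 - s`. -/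
theorem proj_filt {M : GrMod k n} {s : ℤ} {m : M} (hm : m ∈ M.filt s) {d : ℤ} (hd : 1 - s < d) :
    proj M.isInternal d m = 0 := by
  refine Submodule.closure_induction (p := fun m _ => proj M.isInternal d m = 0) (by simp)
    (fun a b _ _ ha hb => by rw [map_add, ha, hb, add_zero]) (fun a m hm => ?_) hm
  obtain ⟨e, he, hm⟩ := hm
  refine path_induction (p := fun a => proj M.isInternal d (a • m) = 0)
    (fun a b ha hb => by rw [add_smul, map_add, ha, hb, add_zero])
    (fun c a ha => by rw [smul_assoc, map_smul, ha, smul_zero]) (by simp) (fun i j => ?_)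
    (fun i j => ?_) a
  · exact proj_of_mem_ne _ (by omega) (M.smul_mem (pathZero_mem i j) hm)
  · exact proj_of_mem_ne _ (by omega) (M.smul_mem (pathOne_mem i j) hm)

theorem eq_zero_of_mem_filt {M : GrMod k n} {s d : ℤ} (hd : 1 - s < d) {m : M}
    (hm : m ∈ M.filt s) (hm' : m ∈ M.deg d) : m = 0 := by
  rw [← proj_of_mem M.isInternal hm', proj_filt hm hd]

/-- The quotient map from `filt M s` to the slice. -/
def sliceMk (s : ℤ) (M : GrMod k n) : M.filt s →ₗ[Alg k n] ((slice s).obj M).carrier :=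
  (M.filtNext s).mkQ

theorem sliceMk_eq_zero {s : ℤ} {M : GrMod k n} {m : M} {hm : m ∈ M.filt s} :
    sliceMk s M ⟨m, hm⟩ = 0 ↔ m ∈ M.filt (s + 1) :=
  Submodule.Quotient.mk_eq_zero _

theorem sliceMk_mem {s : ℤ} {M : GrMod k n} {j : Fin n} {d : ℤ} {m : M} (hm : m ∈ M.filt s)
    (hm' : m ∈ part j d M) : sliceMk s M ⟨m, hm⟩ ∈ part j d ((slice s).obj M) := by
  refine ⟨⟨⟨m, hm⟩, hm'.1, rfl⟩, ?_⟩
  rw [← map_smul]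
  exact congrArg _ (Subtype.ext hm'.2)

theorem exists_sliceMk {s : ℤ} {M : GrMod k n} {j : Fin n} {d : ℤ} {x : (slice s).obj M}
    (hx : x ∈ part j d ((slice s).obj M)) :
    ∃ (m : M) (hm : m ∈ M.filt s), m ∈ part j d M ∧ sliceMk s M ⟨m, hm⟩ = x := by
  obtain ⟨⟨⟨m, hm⟩, hmd, rfl⟩, hx'⟩ := hx
  refine ⟨idem k n j • m, (M.filt s).smul_mem _ hm, idem_smul_mem_part j hmd, Eq.trans ?_ hx'⟩
  exact map_smul (sliceMk s M) (idem k n j) ⟨m, hm⟩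

theorem filt_PS_of_le {i : Fin n} {l t : ℤ} (h : t ≤ l) : (PS k i l).filt t = ⊤ := by
  rw [eq_top_iff]
  rintro u -
  rw [← pval_smul_topElt i l u]
  exact Submodule.smul_mem _ _ (mem_filt (by omega) (topElt_mem i l).1)

/-- `P_i⟨l⟩` begins in degree `-l`, so it has nothing in degrees at most `-t`. -/
theorem filt_PS_of_lt {i : Fin n} {l t : ℤ} (h : l < t) : (PS k i l).filt t = ⊥ := by
  rw [eq_bot_iff, filt, Submodule.span_le]
  rintro u ⟨d, hd, hu⟩
  rw [SetLike.mem_coe, Submodule.mem_bot, ← sum_idem_smul u]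
  exact Finset.sum_eq_zero fun j _ =>
    part_PS_eq_zero (idem_smul_mem_part j hu) (by omega) (by omega)

theorem isZero_slice_PS {i : Fin n} {l s : ℤ} (h : s ≠ l) : IsZero ((slice s).obj (PS k i l)) := by
  refine isZero_of_forall fun x => ?_
  obtain ⟨⟨m, hm⟩, rfl⟩ := ((PS k i l).filtNext s).mkQ_surjective x
  refine sliceMk_eq_zero.mpr ?_
  rcases lt_or_gt_of_ne h with h | h
  · rw [filt_PS_of_le (by omega)]; trivial
  · rw [filt_PS_of_lt h] at hm
    rw [(Submodule.mem_bot _).mp hm]; exact Submodule.zero_mem _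

/-- The slice of `P_i⟨l⟩` at level `l` is `P_i⟨l⟩`. -/
def slicePSIso (i : Fin n) (l : ℤ) : (slice l).obj (PS k i l) ≅ PS k i l where
  hom := ofLin (M := (slice l).obj (PS k i l)) (N := PS k i l)
    (((PS k i l).filtNext l).liftQ ((PS k i l).filt l).subtype (by
      rintro ⟨m, hm⟩ hm'
      change m ∈ (PS k i l).filt (l + 1) at hm'
      rw [filt_PS_of_lt (by omega)] at hm'
      exact (Submodule.mem_bot _).mp hm')) (by
      rintro d _ ⟨m, hm, rfl⟩
      exact hm)
  inv := ofLin (M := PS k i l) (N := (slice l).obj (PS k i l))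
    (sliceMk l (PS k i l) ∘ₗ LinearMap.codRestrict _ LinearMap.id fun u => by
      rw [filt_PS_of_le le_rfl]; trivial) (fun d u hu => ⟨⟨u, _⟩, hu, rfl⟩)
  hom_inv_id := hom_ext fun x => by
    obtain ⟨⟨m, hm⟩, rfl⟩ := ((PS k i l).filtNext l).mkQ_surjective x
    rfl
  inv_hom_id := hom_ext fun x => rfl

/-- The properties of the direct summands of direct sums of modules `P_i⟨s⟩` that matter for the
homology of complexes of such modules. -/
structure IsLevel (s : ℤ) (N : GrMod k n) : Prop where
  isGrProj : IsGrProj N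
  eq_zero : ∀ {j : Fin n} {d : ℤ}, d ≠ -s → d ≠ 1 - s → ∀ y ∈ part j d N, y = 0
  socle : ∀ {j : Fin n} {y : N}, y ∈ part j (1 - s) N →
    (∀ p, p ≠ j → pathZero k p j • y = 0) → ∃ w ∈ part j (-s) N, pathOne k j j • w = y
  top : ∀ {j : Fin n} {y : N}, y ∈ part j (-s) N → pathOne k j j • y = 0 →
    ∃ w : Fin n → N, (∀ p, w p ∈ part p (-s) N) ∧
      y = ∑ p : {p // p ≠ j}, pathZero k j p.1 • w p.1

theorem isLevel_of_isZero {s : ℤ} {N : GrMod k n} (h : IsZero N) : IsLevel s N where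
  isGrProj := isGrProj_of_isZero h
  eq_zero _ _ y _ := eq_zero_of_isZero h y
  socle _ _ := ⟨0, Submodule.zero_mem _, by rw [eq_zero_of_isZero h (_ • _)]; exact (eq_zero_of_isZero h _).symm⟩
  top _ _ := ⟨0, fun _ => Submodule.zero_mem _, (eq_zero_of_isZero h _).trans
    (eq_zero_of_isZero h _).symm⟩

/-- At a vertex `j ≠ i` the path of degree 1 is detected by the path of degree 0 from `i` to `j`,
their product being the loop, and the path of degree 0 is a multiple of the generator. At `i` itself
the loop is `z` times the generator, and the generator is not killed by `z`. -/
theorem isLevel_PS (i : Fin n) (s : ℤ) : IsLevel s (PS k i s) where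
  isGrProj := isGrProj_PS i s
  eq_zero h h' y hy := part_PS_eq_zero hy (by omega) (by omega)
  socle {j y} hy h := by
    have h1 := pval_eq_one hy (by omega)
    by_cases hij : j = i
    · subst hij
      refine ⟨coeffOne j j (pval j s y) • topElt k j s, Submodule.smul_mem _ _ (topElt_mem j s),
        pval_injective j s ?_⟩
      conv_rhs => rw [h1]
      rw [smul_algebra_smul_comm, LinearMap.map_smul_of_tower, map_smul, pval_topElt, smul_eq_mul, pathOne_mul_idem,
        if_pos rfl]
    · have h2 := congrArg (pval i s) (h i (Ne.symm hij))
      rw [map_smul, h1, map_zero, smul_eq_mul, mul_smul_comm, pathZero_mul_pathOne_self] at h2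
      have h3 := congrArg (coeffOne i i) h2
      rw [map_smul, coeffOne_pathOne, if_pos ⟨rfl, rfl⟩, map_zero, smul_eq_mul, mul_one] at h3
      refine ⟨0, Submodule.zero_mem _, pval_injective i s ?_⟩
      rw [h1, h3, smul_zero, map_zero, zero_smul]
  top {j y} hy h := by
    have h1 := pval_eq_zero hy (by omega)
    by_cases hij : j = i
    · subst hij
      have h2 := congrArg (pval j s) h
      rw [map_smul, h1, map_zero, smul_eq_mul, mul_smul_comm, pathOne_mul_pathZero_self] at h2
      have h3 := congrArg (coeffOne j j) h2
      rw [map_smul, coeffOne_pathOne, if_pos ⟨rfl, rfl⟩, map_zero, smul_eq_mul, mul_one] at h3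
      refine ⟨0, fun _ => Submodule.zero_mem _, pval_injective j s ?_⟩
      rw [h1, h3, zero_smul]
      simp
    · refine ⟨Pi.single i (coeffZero i j (pval i s y) • topElt k i s), fun p => ?_, ?_⟩
      · by_cases hp : p = i
        · subst hp
          rw [Pi.single_eq_same]
          exact Submodule.smul_mem _ _ (topElt_mem p s)
        · rw [Pi.single_eq_of_ne hp]
          exact Submodule.zero_mem _
      · rw [Finset.sum_eq_single ⟨i, Ne.symm hij⟩]
        · refine pval_injective i s ?_
          conv_lhs => rw [h1]
          rw [Pi.single_eq_same, smul_algebra_smul_comm, LinearMap.map_smul_of_tower, map_smul, pval_topElt,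
            smul_eq_mul, pathZero_mul_idem, if_pos rfl]
        · rintro ⟨p, hp⟩ _ hne
          rw [Pi.single_eq_of_ne (fun h => hne (Subtype.ext h)), smul_zero]
        · simp

theorem sum_apply_eq {M : GrMod k n} {J : Type*} [Fintype J] {N : J → GrMod k n}
    {π : ∀ a, M ⟶ N a} {ι : ∀ a, N a ⟶ M} (h : ∑ a, π a ≫ ι a = 𝟙 M) (y : M) :
    ∑ a, Hom.lin (ι a) (Hom.lin (π a) y) = y := by
  have := LinearMap.congr_fun (congrArg Hom.lin h) y
  rwa [lin_sum, LinearMap.sum_apply] at this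

theorem isLevel_of_sum {s : ℤ} {M : GrMod k n} {J : Type*} [Fintype J] {N : J → GrMod k n}
    (π : ∀ a, M ⟶ N a) (ι : ∀ a, N a ⟶ M) (h : ∑ a, π a ≫ ι a = 𝟙 M)
    (hN : ∀ a, IsLevel s (N a)) : IsLevel s M where
  isGrProj := isGrProj_of_sum π ι h fun a => (hN a).isGrProj
  eq_zero hd hd' y hy := by
    rw [← sum_apply_eq h y]
    exact Finset.sum_eq_zero fun a _ => by
      rw [(hN a).eq_zero hd hd' _ (lin_mem_part (π a) hy), map_zero]
  socle {j y} hy hp := by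
    choose w hw hw' using fun a => (hN a).socle (lin_mem_part (π a) hy) fun p hpj => by
      rw [← map_smul, hp p hpj, map_zero]
    refine ⟨∑ a, Hom.lin (ι a) (w a), Submodule.sum_mem _ fun a _ => lin_mem_part (ι a) (hw a), ?_⟩
    rw [Finset.smul_sum, ← sum_apply_eq h y]
    exact Finset.sum_congr rfl fun a _ => by rw [← map_smul, hw']
  top {j y} hy hp := by
    choose w hw hw' using fun a => (hN a).top (lin_mem_part (π a) hy) (by
      rw [← map_smul, hp, map_zero])
    refine ⟨fun p => ∑ a, Hom.lin (ι a) (w a p), fun p =>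
      Submodule.sum_mem _ fun a _ => lin_mem_part (ι a) (hw a p), ?_⟩
    conv_lhs => rw [← sum_apply_eq h y]
    simp only [Finset.smul_sum]
    rw [Finset.sum_comm]
    exact Finset.sum_congr rfl fun a _ => by rw [hw' a, map_sum]; simp only [map_smul]

theorem isLevel_of_iso {s : ℤ} {M N : GrMod k n} (e : M ≅ N) (hN : IsLevel s N) : IsLevel s M :=
  isLevel_of_sum (J := Unit) (N := fun _ => N) (fun _ => e.hom) (fun _ => e.inv) (by simp)
    fun _ => hN

theorem slice_sum {s : ℤ} {M : GrMod k n} {J : Type*} [Fintype J] {N : J → GrMod k n}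
    {π : ∀ a, M ⟶ N a} {ι : ∀ a, N a ⟶ M} (h : ∑ a, π a ≫ ι a = 𝟙 M) :
    ∑ a, (slice s).map (π a) ≫ (slice s).map (ι a) = 𝟙 ((slice s).obj M) := by
  rw [← (slice s).map_id, ← h, Functor.map_sum]
  simp only [Functor.map_comp]

theorem isLevel_slice (s : ℤ) (M : GrMod k n) [Module.Finite (Alg k n) M]
    [Module.Projective (Alg k n) M] : IsLevel s ((slice s).obj M) := by
  obtain ⟨J, _, i, l, π, ι, h⟩ := exists_dual_basis M
  refine isLevel_of_sum _ _ (slice_sum h) fun a => ?_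
  by_cases hl : s = l a
  · subst hl
    exact isLevel_of_iso (slicePSIso _ _) (isLevel_PS _ _)
  · exact isLevel_of_isZero (isZero_slice_PS hl)

theorem exists_bound_slice (M : GrMod k n) [Module.Finite (Alg k n) M]
    [Module.Projective (Alg k n) M] :
    ∃ B : ℤ, ∀ s, B < |s| → IsZero ((slice s).obj M) := by
  obtain ⟨J, _, i, l, π, ι, h⟩ := exists_dual_basis M
  -- The sum dominates every `|l a|`, so beyond it no summand has a slice.
  refine ⟨∑ a, |l a|, fun s hs => (IsZero.iff_id_eq_zero _).mpr ?_⟩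
  rw [← slice_sum (s := s) h]
  refine Finset.sum_eq_zero fun a _ => ?_
  rw [(isZero_slice_PS (k := k) (i := i a) (l := l a) (s := s) fun hsl => ?_).eq_of_tgt
    ((slice s).map (π a)) 0, zero_comp]
  rw [hsl] at hs
  exact absurd hs (not_lt.mpr (Finset.single_le_sum (f := fun a => |l a|)
    (fun _ _ => abs_nonneg _) (Finset.mem_univ a)))

end GrMod

end Zigzag

end

noncomputable section

open CategoryTheory CategoryTheory.Limits TensorProduct

namespace Zigzag

universe u

/-! ### Exactness of complexes of abelian groups -/

/-- A complex of abelian groups, given by its differentials `V m → V (m + 1)`. -/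
structure DC where
  V : ℤ → Type u
  [grp : ∀ m, AddCommGroup (V m)]
  d : ∀ m, V m →+ V (m + 1)
  d_d : ∀ m x, d (m + 1) (d m x) = 0

namespace DC

attribute [instance] DC.grp

/-- Exactness at `m + 1`. -/
def Ex (C : DC.{u}) (m : ℤ) : Prop := ∀ y : C.V (m + 1), C.d (m + 1) y = 0 → ∃ x, C.d m x = y

/-- Maps of complexes. -/
structure Map (C D : DC.{u}) where
  f : ∀ m, C.V m →+ D.V m
  comm : ∀ m x, f (m + 1) (C.d m x) = D.d m (f m x)

/-- Short exact sequences of complexes. -/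
structure IsSES {A B C : DC.{u}} (f : Map A B) (g : Map B C) : Prop where
  inj : ∀ m x, f.f m x = 0 → x = 0
  zero : ∀ m x, g.f m (f.f m x) = 0
  exact : ∀ m y, g.f m y = 0 → ∃ x, f.f m x = y
  surj : ∀ m z, ∃ y, g.f m y = z

variable {A B C : DC.{u}} {f : Map A B} {g : Map B C}

/-- This and the following lemmas are fragments of the long exact homology sequence, by diagram
chase. `Ex m` is the vanishing of the homology at `m + 1`; a jump from `m` to `m + 1` comes from the
connecting map. -/
theorem IsSES.ex_mid (h : IsSES f g) {m : ℤ} (hA : A.Ex m) (hC : C.Ex m) : B.Ex m := by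
  intro y hy
  obtain ⟨z, hz⟩ := hC (g.f _ y) (by rw [← g.comm, hy, map_zero])
  obtain ⟨w, rfl⟩ := h.surj m z
  obtain ⟨v, hv⟩ := h.exact _ (y - B.d m w) (by rw [map_sub, g.comm, hz, sub_self])
  obtain ⟨v', hv'⟩ := hA v (h.inj _ _ (by rw [f.comm, hv, map_sub, hy, B.d_d, sub_zero]))
  exact ⟨w + f.f m v', by rw [map_add, ← f.comm, hv', hv, add_sub_cancel]⟩

/-- Cycles lift along `g`. -/
theorem IsSES.lift_cycle (h : IsSES f g) {m : ℤ} (hA : A.Ex (m + 1)) (z : C.V (m + 1))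
    (hz : C.d (m + 1) z = 0) : ∃ y, B.d (m + 1) y = 0 ∧ g.f (m + 1) y = z := by
  obtain ⟨w, rfl⟩ := h.surj _ z
  obtain ⟨v, hv⟩ := h.exact _ (B.d (m + 1) w) (by rw [g.comm, hz])
  obtain ⟨v', hv'⟩ := hA v (h.inj _ _ (by rw [f.comm, hv, B.d_d]))
  exact ⟨w - f.f _ v', by rw [map_sub, ← f.comm, hv', hv, sub_self], by
    rw [map_sub, h.zero, sub_zero]⟩

theorem IsSES.ex_right (h : IsSES f g) {m : ℤ} (hB : B.Ex m) (hA : A.Ex (m + 1)) : C.Ex m := by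
  intro z hz
  obtain ⟨y, hy, rfl⟩ := h.lift_cycle hA z hz
  obtain ⟨x, rfl⟩ := hB y hy
  exact ⟨g.f m x, (g.comm m x).symm⟩

/-- A cycle of `A` that bounds in `B` bounds in `A`. -/
theorem IsSES.descend (h : IsSES f g) {m : ℤ} (hC : C.Ex m) (v : A.V (m + 1 + 1))
    (w : B.V (m + 1)) (hw : B.d (m + 1) w = f.f _ v) : ∃ v', A.d (m + 1) v' = v := by
  obtain ⟨z, hz⟩ := hC (g.f _ w) (by rw [← g.comm, hw, h.zero])
  obtain ⟨w', rfl⟩ := h.surj _ z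
  obtain ⟨v', hv'⟩ := h.exact _ (w - B.d m w') (by rw [map_sub, g.comm, hz, sub_self])
  refine ⟨v', sub_eq_zero.mp (h.inj _ _ ?_)⟩
  rw [map_sub, f.comm, hv', map_sub, B.d_d, sub_zero, hw, sub_self]

theorem IsSES.ex_left (h : IsSES f g) {m : ℤ} (hB : B.Ex (m + 1)) (hC : C.Ex m) :
    A.Ex (m + 1) := fun v hv => by
  obtain ⟨w, hw⟩ := hB (f.f _ v) (by rw [← f.comm, hv, map_zero])
  exact h.descend hC v w hw

/-- A cycle of `B` whose image in `C` bounds is a boundary. -/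
theorem IsSES.bound_of_image (h : IsSES f g) {m : ℤ} (hA : A.Ex m) (y : B.V (m + 1))
    (hy : B.d (m + 1) y = 0) (z : C.V m) (hz : C.d m z = g.f _ y) : ∃ x, B.d m x = y := by
  obtain ⟨w, rfl⟩ := h.surj m z
  obtain ⟨v, hv⟩ := h.exact _ (y - B.d m w) (by rw [map_sub, g.comm, hz, sub_self])
  obtain ⟨v', hv'⟩ := hA v (h.inj _ _ (by rw [f.comm, hv, map_sub, hy, B.d_d, sub_zero]))
  exact ⟨w + f.f m v', by rw [map_add, ← f.comm, hv', hv, add_sub_cancel]⟩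

/-- A cycle of `B` is homologous to a cycle of `A`. -/
theorem IsSES.exists_homologous (h : IsSES f g) {m : ℤ} (hC : C.Ex m) (y : B.V (m + 1))
    (hy : B.d (m + 1) y = 0) : ∃ v w, A.d (m + 1) v = 0 ∧ y = f.f (m + 1) v + B.d m w := by
  obtain ⟨z, hz⟩ := hC (g.f _ y) (by rw [← g.comm, hy, map_zero])
  obtain ⟨w, rfl⟩ := h.surj m z
  obtain ⟨v, hv⟩ := h.exact _ (y - B.d m w) (by rw [map_sub, g.comm, hz, sub_self])
  exact ⟨v, w, h.inj _ _ (by rw [f.comm, hv, map_sub, hy, B.d_d, sub_zero]), by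
    rw [hv, sub_add_cancel]⟩

/-- Exactness is invariant under isomorphisms. -/
theorem ex_iff_of_bijective (f : Map A B) (hi : ∀ m x, f.f m x = 0 → x = 0)
    (hs : ∀ m y, ∃ x, f.f m x = y) (m : ℤ) : A.Ex m ↔ B.Ex m := by
  constructor
  · intro h y hy
    obtain ⟨x, rfl⟩ := hs _ y
    obtain ⟨w, rfl⟩ := h x (hi _ _ (by rw [f.comm, hy]))
    exact ⟨f.f m w, (f.comm m w).symm⟩
  · intro h x hx
    obtain ⟨y, hy⟩ := h (f.f _ x) (by rw [← f.comm, hx, map_zero])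
    obtain ⟨w, rfl⟩ := hs _ y
    exact ⟨w, sub_eq_zero.mp (hi _ _ (by rw [map_sub, f.comm, hy, sub_self]))⟩

/-- The product of a family of complexes. -/
def pi {J : Type} (C : J → DC.{u}) : DC.{u} where
  V m := ∀ a, (C a).V m
  d m := AddMonoidHom.mk' (fun x a => (C a).d m (x a)) fun x y => funext fun a => map_add _ _ _
  d_d m x := funext fun a => (C a).d_d m (x a)

theorem pi_ex {J : Type} {C : J → DC.{u}} {m : ℤ} : (pi C).Ex m ↔ ∀ a, (C a).Ex m := by
  classical
  constructor
  · intro h a y hy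
    obtain ⟨x, hx⟩ := h (Pi.single (M := fun b => (C b).V (m + 1)) a y) (funext fun b => by
      change (C b).d (m + 1) (Pi.single (M := fun b => (C b).V (m + 1)) a y b) = 0
      by_cases hb : b = a
      · subst hb; rwa [Pi.single_eq_same]
      · rw [Pi.single_eq_of_ne hb, map_zero])
    exact ⟨x a, (congrFun hx a).trans (Pi.single_eq_same (M := fun b => (C b).V (m + 1)) a y)⟩
  · intro h y hy
    choose x hx using fun a => h a (y a) (congrFun hy a)
    exact ⟨x, funext hx⟩

end DC

/-- Induction downwards over all integers; the start is provided by a bound above which the complex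
is zero. -/
theorem int_descend {p : ℤ → Prop} (b : ℤ) (hb : ∀ m, b < m → p m) (h : ∀ m, p (m + 1) → p m)
    (m : ℤ) : p m := by
  have : ∀ t : ℕ, p (b + 1 - t) := by
    intro t
    induction t with
    | zero => exact hb _ (by simp)
    | succ t ih => exact h _ (by convert ih using 1; push_cast; ring)
  by_cases hm : b < m
  · exact hb m hm
  · convert this (b + 1 - m).toNat using 1
    omega

theorem int_ascend {p : ℤ → Prop} (a : ℤ) (ha : ∀ m, m < a → p m) (h : ∀ m, p m → p (m + 1))
    (m : ℤ) : p m := by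
  have := int_descend (p := fun m => p (-m)) (-a) (fun m hm => ha _ (by omega))
    (fun m hm => by have := h _ hm; convert this using 1; ring) (-m)
  rwa [neg_neg] at this

/-! ### Exactness of the homogeneous parts of complexes of graded modules -/

namespace Cpx

open GrMod

variable {k : Type u} [Field k] {n : ℕ}

/-- The differential of a complex of graded modules, as a module map. -/
def dl (Y : Cpx k n) (m : ℤ) : (Y.X m).carrier →ₗ[Alg k n] (Y.X (m + 1)).carrier :=
  Hom.lin (Y.d m (m + 1))

theorem dl_dl (Y : Cpx k n) (m : ℤ) (y : Y.X m) : dl Y (m + 1) (dl Y m y) = 0 :=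
  LinearMap.congr_fun (congrArg Hom.lin (Y.d_comp_d m (m + 1) (m + 1 + 1))) y

theorem dl_mem {Y : Cpx k n} {m : ℤ} {j : Fin n} {d : ℤ} {y : Y.X m} (hy : y ∈ part j d (Y.X m)) :
    dl Y m y ∈ part j d (Y.X (m + 1)) :=
  lin_mem_part _ hy

/-- A subcomplex of a complex of graded modules. -/
def subDC (Y : Cpx k n) (S : ∀ m, Submodule k (Y.X m).carrier)
    (hS : ∀ m y, y ∈ S m → dl Y m y ∈ S (m + 1)) : DC.{u} where
  V m := S m
  d m := AddMonoidHom.mk' (fun y => ⟨dl Y m y.1, hS m y.1 y.2⟩) fun x y =>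
    Subtype.ext (map_add (dl Y m) x.1 y.1)
  d_d m x := Subtype.ext (dl_dl Y m x.1)

/-- The complex formed by the elements of degree `d` of `e_j Y`. -/
def partDC (Y : Cpx k n) (j : Fin n) (d : ℤ) : DC.{u} :=
  subDC Y (fun m => part j d (Y.X m)) fun _ _ => dl_mem

/-- The homology of `e_j Y` vanishes in the internal degree `d`. -/
def Ac (Y : Cpx k n) (j : Fin n) (d : ℤ) : Prop :=
  ∀ m, ∀ y ∈ part j d (Y.X (m + 1)), dl Y (m + 1) y = 0 → ∃ x ∈ part j d (Y.X m), dl Y m x = y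

theorem partDC_ex {Y : Cpx k n} {j : Fin n} {d m : ℤ} : (partDC Y j d).Ex m ↔
    ∀ y ∈ part j d (Y.X (m + 1)), dl Y (m + 1) y = 0 → ∃ x ∈ part j d (Y.X m), dl Y m x = y := by
  constructor
  · intro h y hy hy'
    obtain ⟨x, hx⟩ := h ⟨y, hy⟩ (Subtype.ext hy')
    exact ⟨x.1, x.2, congrArg Subtype.val hx⟩
  · rintro h ⟨y, hy⟩ hy'
    obtain ⟨x, hx, hx'⟩ := h y hy (congrArg Subtype.val hy')
    exact ⟨⟨x, hx⟩, Subtype.ext hx'⟩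

theorem ac_iff {Y : Cpx k n} {j : Fin n} {d : ℤ} : Ac Y j d ↔ ∀ m, (partDC Y j d).Ex m :=
  forall_congr' fun _ => partDC_ex.symm

/-- The path of degree `0` from `i` to `l` does not act surjectively on the homology of degree
`d`. -/
def NonSurj (Y : Cpx k n) (i l : Fin n) (d : ℤ) : Prop :=
  ∃ m, ∃ w ∈ part i d (Y.X (m + 1)), dl Y (m + 1) w = 0 ∧
    ∀ y ∈ part l d (Y.X (m + 1)), dl Y (m + 1) y = 0 →
      ∀ x ∈ part i d (Y.X m), w ≠ pathZero k i l • y + dl Y m x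

/-- The path of degree `0` from `l` to `i` does not act injectively on the homology of degree
`d`. -/
def NonInj (Y : Cpx k n) (i l : Fin n) (d : ℤ) : Prop :=
  ∃ m, ∃ y ∈ part i d (Y.X (m + 1)), dl Y (m + 1) y = 0 ∧
    (¬ ∃ x ∈ part i d (Y.X m), dl Y m x = y) ∧
    ∃ x ∈ part l d (Y.X m), dl Y m x = pathZero k l i • y

/-- Complexes that vanish in almost all degrees. -/
def IsBdd (Y : Cpx k n) : Prop := ∃ a b : ℤ, ∀ m, m < a ∨ b < m → IsZero (Y.X m)

/-! ### Complexes with a single level: multiplicity complexes and homology at the vertices -/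

section Level

variable {s : ℤ} {L : Cpx k n}

theorem dl_smul (Y : Cpx k n) {m : ℤ} (a : Alg k n) (y : Y.X m) : dl Y m (a • y) = a • dl Y m y :=
  map_smul _ _ _

/-- The elements `z y` with `y` of degree `-s` in `e_j L`. -/
def socDC (s : ℤ) (L : Cpx k n) (j : Fin n) : DC.{u} :=
  subDC L (fun m => (part j (-s) (L.X m)).map (Algebra.lsmul k k (L.X m).carrier (pathOne k j j)))
    (by
      rintro m _ ⟨w, hw, rfl⟩
      exact ⟨dl L m w, dl_mem hw, (dl_smul L _ _).symm⟩)

/-- The elements of degree `-s` of `e_j L` that are killed by `z`. -/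
def radDC (s : ℤ) (L : Cpx k n) (j : Fin n) : DC.{u} :=
  subDC L (fun m => part j (-s) (L.X m) ⊓
      LinearMap.ker (Algebra.lsmul k k (L.X m).carrier (pathOne k j j)))
    (by
      rintro m y ⟨hy, hy'⟩
      refine ⟨dl_mem hy, ?_⟩
      change pathOne k j j • dl L m y = 0
      rw [← dl_smul]
      exact (congrArg (dl L m) hy').trans (map_zero _))

theorem pathOne_smul_mem' (i : Fin n) {j : Fin n} {M : GrMod k n} {m : M}
    (hm : m ∈ part j (-s) M) : pathOne k i j • m ∈ part i (1 - s) M := by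
  have := pathOne_smul_mem i hm
  rwa [show -s + 1 = 1 - s by ring] at this

/-- The inclusion of the socle. -/
def socIncl (s : ℤ) (L : Cpx k n) (j : Fin n) : DC.Map (socDC s L j) (partDC L j (1 - s)) where
  f m := AddMonoidHom.mk' (fun y => ⟨y.1, by
    obtain ⟨_, w, hw, rfl⟩ := y
    exact pathOne_smul_mem' j hw⟩) fun _ _ => rfl
  comm _ _ := rfl

/-- Two non-trivial paths of degree 0 compose to zero, so the result is killed by all of them and
lies in the socle. -/
theorem pathZero_smul_socle (hL : ∀ m, IsLevel s (L.X m)) {m : ℤ} {p j : Fin n} (hp : p ≠ j)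
    {y : L.X m} (hy : y ∈ part j (1 - s) (L.X m)) :
    pathZero k p j • y ∈ (part p (-s) (L.X m)).map
      (Algebra.lsmul k k (L.X m).carrier (pathOne k p p)) := by
  obtain ⟨w, hw, hw'⟩ := (hL m).socle (pathZero_smul_mem p hy) fun q hq => by
    rw [smul_smul, pathZero_mul_pathZero hq hp, zero_smul]
  exact ⟨w, hw, hw'⟩

/-- The map from the top degree of `e_j L` given by the paths of degree `0`. -/
def socProj (hL : ∀ m, IsLevel s (L.X m)) (j : Fin n) :
    DC.Map (partDC L j (1 - s)) (DC.pi fun p : {p // p ≠ j} => socDC s L p.1) where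
  f m := AddMonoidHom.mk' (fun y p => ⟨pathZero k p.1 j • y.1, pathZero_smul_socle hL p.2 y.2⟩)
    fun x y => funext fun p => Subtype.ext (smul_add _ _ _)
  comm m x := funext fun p => Subtype.ext (dl_smul L _ _).symm

/-- For a sum of copies of the `P_p⟨s⟩`, the loop at `j` only survives on the copies of `P_j`, so
`socDC s L j` is the multiplicity complex of `P_j`. The top degree at `j` contains in addition the
paths of degree 1 from `j` to `p ≠ j`, one multiplicity complex for each `p`, which the path of
degree 0 from `p` to `j` reads off. -/
theorem soc_isSES (hL : ∀ m, IsLevel s (L.X m)) (j : Fin n) :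
    DC.IsSES (socIncl s L j) (socProj hL j) where
  inj m x hx := Subtype.ext (congrArg Subtype.val hx :)
  zero m x := by
    obtain ⟨_, w, hw, rfl⟩ := x
    refine funext fun p => Subtype.ext ?_
    change pathZero k p.1 j • pathOne k j j • w = 0
    rw [smul_smul, pathZero_mul_pathOne p.2 p.2, zero_smul]
  exact m y hy := by
    obtain ⟨w, hw, hw'⟩ := (hL m).socle y.2 fun p hp => congrArg Subtype.val (congrFun hy ⟨p, hp⟩)
    exact ⟨⟨y.1, w, hw, hw'⟩, rfl⟩
  surj m z := by
    choose w hw hw' using fun p => (z p).2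
    refine ⟨⟨∑ p : {p // p ≠ j}, pathOne k j p.1 • w p, Submodule.sum_mem _ fun p _ =>
      pathOne_smul_mem' j (hw p)⟩, funext fun q => Subtype.ext ?_⟩
    change pathZero k q.1 j • ∑ p : {p // p ≠ j}, pathOne k j p.1 • w p = (z q).1
    rw [Finset.smul_sum, Finset.sum_eq_single q, smul_smul, pathZero_mul_pathOne_self]
    · exact hw' q
    · intro p _ hpq
      rw [smul_smul, pathZero_mul_pathOne q.2 fun h => hpq (Subtype.ext h.symm), zero_smul]
    · simp

/-- The inclusion of the radical. -/
def radIncl (s : ℤ) (L : Cpx k n) (j : Fin n) : DC.Map (radDC s L j) (partDC L j (-s)) where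
  f m := AddMonoidHom.mk' (fun y => ⟨y.1, y.2.1⟩) fun _ _ => rfl
  comm _ _ := rfl

/-- The multiplication by `z`. -/
def radProj (s : ℤ) (L : Cpx k n) (j : Fin n) : DC.Map (partDC L j (-s)) (socDC s L j) where
  f m := AddMonoidHom.mk' (fun y => ⟨pathOne k j j • y.1, y.1, y.2, rfl⟩)
    fun x y => Subtype.ext (smul_add _ _ _)
  comm m x := Subtype.ext (dl_smul L _ _).symm

/-- The dual picture in the bottom degree: multiplication by `z` keeps the generators of the copies
of `P_j` and kills the paths of degree 0 from `j` to the other vertices. -/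
theorem rad_isSES (s : ℤ) (L : Cpx k n) (j : Fin n) :
    DC.IsSES (radIncl s L j) (radProj s L j) where
  inj m x hx := Subtype.ext (congrArg Subtype.val hx :)
  zero m x := Subtype.ext x.2.2
  exact m y hy := ⟨⟨y.1, y.2, congrArg Subtype.val hy⟩, rfl⟩
  surj m z := by
    obtain ⟨_, w, hw, rfl⟩ := z
    exact ⟨⟨w, hw⟩, rfl⟩

theorem rad_eq (hL : ∀ m, IsLevel s (L.X m)) {m : ℤ} {j : Fin n} (y : (radDC s L j).V m) :
    ∃ w : Fin n → (L.X m).carrier, (∀ p, w p ∈ part p (-s) (L.X m)) ∧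
      y.1 = ∑ p : {p // p ≠ j}, pathZero k j p.1 • w p.1 :=
  (hL m).top y.2.1 y.2.2

theorem pathOne_smul_sum {m : ℤ} {j : Fin n} (q : {p // p ≠ j}) (w : Fin n → (L.X m).carrier) :
    pathOne k q.1 j • ∑ p : {p // p ≠ j}, pathZero k j p.1 • w p.1 = pathOne k q.1 q.1 • w q.1 := by
  rw [Finset.smul_sum, Finset.sum_eq_single q, smul_smul, pathOne_mul_pathZero_self]
  · intro p _ hpq
    rw [smul_smul, pathOne_mul_pathZero p.2.symm fun h => hpq (Subtype.ext h.symm), zero_smul]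
  · simp

/-- The radical in terms of the socle. -/
def radSoc (hL : ∀ m, IsLevel s (L.X m)) (j : Fin n) :
    DC.Map (radDC s L j) (DC.pi fun p : {p // p ≠ j} => socDC s L p.1) where
  f m := AddMonoidHom.mk' (fun y p => ⟨pathOne k p.1 j • y.1, by
      obtain ⟨w, hw, h⟩ := rad_eq hL y
      rw [h, pathOne_smul_sum]
      exact ⟨w p.1, hw p.1, rfl⟩⟩)
    fun x y => funext fun p => Subtype.ext (smul_add _ _ _)
  comm m x := funext fun p => Subtype.ext (dl_smul L _ _).symm

/-- The contribution of `w p` to the radical at `j` depends only on `z w p`. This makes `radSoc`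
injective. -/
theorem pathZero_smul_eq_zero (hL : ∀ m, IsLevel s (L.X m)) {m : ℤ} {j p : Fin n} (hp : p ≠ j)
    {w : L.X m} (hw : w ∈ part p (-s) (L.X m)) (h : pathOne k p p • w = 0) :
    pathZero k j p • w = 0 := by
  obtain ⟨v, hv, rfl⟩ := (hL m).top hw h
  rw [Finset.smul_sum]
  exact Finset.sum_eq_zero fun q _ => by
    rw [smul_smul, pathZero_mul_pathZero hp.symm q.2.symm, zero_smul]

/-- `radSoc` is bijective: the path of degree 1 from `p` to `j` recovers `z w p` from the sum `y` in
`rad_eq`. So the radical at `j` is the product of the multiplicity complexes at the other vertices.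
-/
theorem rad_ex_iff (hL : ∀ m, IsLevel s (L.X m)) (j : Fin n) (m : ℤ) :
    (radDC s L j).Ex m ↔ ∀ p, p ≠ j → (socDC s L p).Ex m := by
  rw [DC.ex_iff_of_bijective (radSoc hL j), DC.pi_ex, Subtype.forall]
  · intro m y hy
    obtain ⟨w, hw, h⟩ := rad_eq hL y
    refine Subtype.ext ?_
    change y.1 = 0
    rw [h]
    refine Finset.sum_eq_zero fun p _ => pathZero_smul_eq_zero hL p.2 (hw p.1) ?_
    rw [← pathOne_smul_sum p w, ← h]
    exact congrArg Subtype.val (congrFun hy p)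
  · intro m z
    choose w hw hw' using fun p => (z p).2
    -- The sums run over `p ≠ j` but take families indexed by all vertices; the value 0 at `j` plays
    -- no role.
    let v : Fin n → (L.X m).carrier := fun p => if h : p ≠ j then w ⟨p, h⟩ else 0
    have hv : ∀ p : {p // p ≠ j}, v p.1 = w p := fun p => dif_pos p.2
    have hmem : ∀ p : {p // p ≠ j}, v p.1 ∈ part p.1 (-s) (L.X m) := fun p => by
      rw [hv]; exact hw p
    refine ⟨⟨∑ p : {p // p ≠ j}, pathZero k j p.1 • v p.1, Submodule.sum_mem _ fun p _ =>
      pathZero_smul_mem j (hmem p), ?_⟩, funext fun q => Subtype.ext ?_⟩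
    · change pathOne k j j • ∑ p : {p // p ≠ j}, pathZero k j p.1 • v p.1 = 0
      rw [Finset.smul_sum]
      exact Finset.sum_eq_zero fun p _ => by
        rw [smul_smul, pathOne_mul_pathZero p.2.symm p.2.symm, zero_smul]
    · change pathOne k q.1 j • ∑ p : {p // p ≠ j}, pathZero k j p.1 • v p.1 = (z q).1
      rw [pathOne_smul_sum, hv]
      exact hw' q

theorem subDC_ex_of_isZero {Y : Cpx k n} {S : ∀ m, Submodule k (Y.X m).carrier}
    {hS : ∀ m y, y ∈ S m → dl Y m y ∈ S (m + 1)} {m : ℤ} (h : IsZero (Y.X (m + 1))) :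
    (subDC Y S hS).Ex m := fun y _ =>
  ⟨0, Subtype.ext ((map_zero (dl Y m)).trans (eq_zero_of_isZero h y.1).symm)⟩

/-- Descending induction for all vertices at once: exact multiplicity complexes at `m + 1` make the
radicals exact there, and then acyclicity of the bottom degree passes to the quotients of
`rad_isSES` at `m`. -/
theorem soc_ex_of_bot (hL : ∀ m, IsLevel s (L.X m)) (hb : IsBdd L) (h : ∀ j, Ac L j (-s)) (m : ℤ) :
    ∀ j, (socDC s L j).Ex m := by
  obtain ⟨a, b, hab⟩ := hb
  refine int_descend (p := fun m => ∀ j, (socDC s L j).Ex m) b (fun m hm j => subDC_ex_of_isZero (hab _ (Or.inr (by omega))))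
    (fun m hm j => ?_) m
  exact (rad_isSES s L j).ex_right (ac_iff.mp (h j) m) ((rad_ex_iff hL j _).mpr fun p _ => hm p)

/-- Ascending induction, with `soc_isSES` in place of `rad_isSES`: exact quotients at `m` and an
acyclic top degree make the subcomplexes exact at `m + 1`. -/
theorem soc_ex_of_top (hL : ∀ m, IsLevel s (L.X m)) (hb : IsBdd L) (h : ∀ j, Ac L j (1 - s))
    (m : ℤ) : ∀ j, (socDC s L j).Ex m := by
  obtain ⟨a, b, hab⟩ := hb
  -- The bound is `a - 1` since `Ex m` concerns the term of index `m + 1`.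
  refine int_ascend (p := fun m => ∀ j, (socDC s L j).Ex m) (a - 1) (fun m hm j => subDC_ex_of_isZero (hab _ (Or.inl (by omega))))
    (fun m hm j => ?_) m
  exact (soc_isSES hL j).ex_left (ac_iff.mp (h j) _) (DC.pi_ex.mpr fun p => hm p)

theorem ac_of_soc (hL : ∀ m, IsLevel s (L.X m)) (h : ∀ m j, (socDC s L j).Ex m) (j : Fin n)
    (d : ℤ) : Ac L j d := by
  by_cases h1 : d = -s
  · subst h1
    exact ac_iff.mpr fun m => (rad_isSES s L j).ex_mid
      ((rad_ex_iff hL j m).mpr fun p _ => h m p) (h m j)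
  · by_cases h2 : d = 1 - s
    · subst h2
      exact ac_iff.mpr fun m => (soc_isSES hL j).ex_mid (h m j) (DC.pi_ex.mpr fun p => h m p)
    · exact fun m y hy _ => ⟨0, Submodule.zero_mem _, by
        rw [map_zero, (hL _).eq_zero h1 h2 y hy]⟩

/-- The path from `i` to `l` maps into the socle at `i`. If it were surjective on homology, every
class of the top degree at `i` would come from the socle, so the connecting map would inject the
homology of every multiplicity complex at `p ≠ i` into that at `i`, one degree higher. Acyclicity at
`j` does the same from `i` to `j`. Going round, the homology at `i` embeds in itself two degrees
higher and vanishes by boundedness; then so do all classes at `i`. -/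
theorem nonSurj_of_ac (hL : ∀ m, IsLevel s (L.X m)) (hb : IsBdd L) {i j l : Fin n} (hij : i ≠ j)
    (hl : l ≠ i) (hj : Ac L j (1 - s)) (hi : ¬ Ac L i (1 - s)) : NonSurj L i l (1 - s) := by
  by_contra hns
  have hsurj : ∀ m, ∀ w ∈ part i (1 - s) (L.X (m + 1)), dl L (m + 1) w = 0 →
      ∃ y ∈ part l (1 - s) (L.X (m + 1)), dl L (m + 1) y = 0 ∧
        ∃ x ∈ part i (1 - s) (L.X m), w = pathZero k i l • y + dl L m x := by
    intro m w hw hw'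
    by_contra hcon
    exact hns ⟨m, w, hw, hw', fun y hy hy' x hx h => hcon ⟨y, hy, hy', x, hx, h⟩⟩
  obtain ⟨a, b, hab⟩ := hb
  have h1 : ∀ m, (socDC s L i).Ex (m + 1) → ∀ p, p ≠ i → (socDC s L p).Ex m := by
    intro m hm
    have : (DC.pi fun p : {p // p ≠ i} => socDC s L p.1).Ex m := by
      intro c hc
      obtain ⟨w, hw, rfl⟩ := (soc_isSES hL i).lift_cycle hm c hc
      obtain ⟨y, hy, _, x, hx, hxy⟩ := hsurj m w.1 w.2 (congrArg Subtype.val hw)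
      refine ⟨(socProj hL i).f m ⟨x, hx⟩, funext fun p => Subtype.ext ?_⟩
      change dl L m (pathZero k p.1 i • x) = pathZero k p.1 i • w.1
      rw [hxy, smul_add, smul_smul, pathZero_mul_pathZero p.2 hl.symm, zero_smul, zero_add, dl_smul]
    exact fun p hp => DC.pi_ex.mp this ⟨p, hp⟩
  have h2 : ∀ m, (socDC s L j).Ex (m + 1) → (socDC s L i).Ex m := fun m hm =>
    DC.pi_ex.mp ((soc_isSES hL j).ex_right (ac_iff.mp hj m) hm) ⟨i, hij⟩
  -- Each round from `i` to `j` and back moves the index by two, so two consecutive indices are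
  -- carried along.
  have h3 : ∀ m, (socDC s L i).Ex m ∧ (socDC s L i).Ex (m + 1) := by
    refine int_descend b (fun m hm => ⟨subDC_ex_of_isZero (hab _ (Or.inr (by omega))),
      subDC_ex_of_isZero (hab _ (Or.inr (by omega)))⟩) fun m hm => ⟨?_, hm.1⟩
    exact h2 m (h1 _ hm.2 j hij.symm)
  refine hi fun m w hw hw' => ?_
  obtain ⟨y, hy, hy', x, hx, hxy⟩ := hsurj m w hw hw'
  have hmem := pathZero_smul_socle hL hl.symm hy
  obtain ⟨v, hv⟩ := (h3 m).1 ⟨pathZero k i l • y, hmem⟩ (Subtype.ext (by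
    change dl L (m + 1) (pathZero k i l • y) = 0
    rw [dl_smul, hy', smul_zero]))
  refine ⟨v.1 + x, Submodule.add_mem _ ((socIncl s L i).f m v).2 hx, ?_⟩
  rw [map_add, hxy, show dl L m v.1 = _ from congrArg Subtype.val hv]

/-- Dual to `nonSurj_of_ac`. The radical at `i` is killed by the path from `l` to `i`, so
injectivity would make all its cycles bound in the bottom degree at `i`. Together with acyclicity at
`j` this carries exactness of the multiplicity complex at `i` two steps upwards, starting below the
lower bound of the complex. -/
theorem nonInj_of_ac (hL : ∀ m, IsLevel s (L.X m)) (hb : IsBdd L) {i j l : Fin n} (hij : i ≠ j)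
    (hl : l ≠ i) (hj : Ac L j (-s)) (hi : ¬ Ac L i (-s)) : NonInj L i l (-s) := by
  by_contra hni
  have hinj : ∀ m, ∀ y ∈ part i (-s) (L.X (m + 1)), dl L (m + 1) y = 0 →
      (∃ x ∈ part l (-s) (L.X m), dl L m x = pathZero k l i • y) →
      ∃ x ∈ part i (-s) (L.X m), dl L m x = y := by
    intro m y hy hy' hx
    by_contra hcon
    exact hni ⟨m, y, hy, hy', hcon, hx⟩
  obtain ⟨a, b, hab⟩ := hb
  have h1 : ∀ m, (socDC s L i).Ex m → (radDC s L i).Ex (m + 1) := by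
    intro m hm v hv
    obtain ⟨x, hx, hx'⟩ := hinj _ v.1 v.2.1 (congrArg Subtype.val hv)
      ⟨0, Submodule.zero_mem _, by
        obtain ⟨w, hw, h⟩ := rad_eq hL v
        rw [map_zero, h, Finset.smul_sum]
        exact (Finset.sum_eq_zero fun p _ => by
          rw [smul_smul, pathZero_mul_pathZero hl p.2.symm, zero_smul]).symm⟩
    exact (rad_isSES s L i).descend hm v ⟨x, hx⟩ (Subtype.ext hx')
  have h2 : ∀ m, (socDC s L j).Ex m → (socDC s L i).Ex (m + 1) := fun m hm =>
    (rad_ex_iff hL j _).mp ((rad_isSES s L j).ex_left (ac_iff.mp hj _) hm) i hij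
  have h3 : ∀ m, (socDC s L i).Ex m ∧ (socDC s L i).Ex (m + 1) := by
    refine int_ascend (a - 2) (fun m hm => ⟨subDC_ex_of_isZero (hab _ (Or.inl (by omega))),
      subDC_ex_of_isZero (hab _ (Or.inl (by omega)))⟩) fun m hm => ⟨hm.2, ?_⟩
    exact h2 _ ((rad_ex_iff hL i _).mp (h1 m hm.1) j hij.symm)
  refine hi (ac_iff.mpr fun m => (rad_isSES s L i).ex_mid ?_ (h3 m).1)
  have := h1 (m - 1) (h3 _).1
  rwa [sub_add_cancel] at this

end Level

/-! ### Comparison of the homology of a complex and of its slices -/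

section Slices

variable (Y : Cpx k n)

/-- The elements of degree `-l` of `e_j Y` in the submodule of the filtration of level `l + 1`. -/
def filtDC (j : Fin n) (l : ℤ) : DC.{u} :=
  subDC Y (fun m => part j (-l) (Y.X m) ⊓ ((Y.X m).filt (l + 1)).restrictScalars k)
    fun _ _ hy => ⟨dl_mem hy.1, filt_map _ _ hy.2⟩

/-- The inclusion of a step of the filtration. -/
def filtIncl (j : Fin n) (l : ℤ) : DC.Map (filtDC Y j l) (partDC Y j (-l)) where
  f m := AddMonoidHom.mk' (fun y => ⟨y.1, y.2.1⟩) fun _ _ => rfl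
  comm _ _ := rfl

/-- The projection to the slice. -/
def filtProj (j : Fin n) (l : ℤ) :
    DC.Map (partDC Y j (-l)) (partDC (baricSlice l Y) j (-l)) where
  f m := AddMonoidHom.mk' (fun y => ⟨sliceMk l (Y.X m) ⟨y.1, mem_filt le_rfl y.2.1⟩,
    sliceMk_mem _ y.2⟩) fun _ _ => rfl
  comm _ _ := rfl

/-- All elements of degree `-l` lie in the filtration step `l`, so the quotient by the step `l + 1`
is the bottom degree of the slice at level `l`. -/
theorem filt_isSES (j : Fin n) (l : ℤ) : DC.IsSES (filtIncl Y j l) (filtProj Y j l) where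
  inj m x hx := Subtype.ext (congrArg Subtype.val hx :)
  zero m x := Subtype.ext (sliceMk_eq_zero.mpr x.2.2)
  exact m y hy := ⟨⟨y.1, y.2, sliceMk_eq_zero.mp (congrArg Subtype.val hy)⟩, rfl⟩
  surj m z := by
    obtain ⟨y, hy, hy', h⟩ := exists_sliceMk z.2
    exact ⟨⟨y, hy'⟩, Subtype.ext h⟩

/-- A step of the filtration in its top degree is the top degree of a slice. -/
def filtSlice (j : Fin n) (l : ℤ) :
    DC.Map (filtDC Y j l) (partDC (baricSlice (l + 1) Y) j (-l)) where
  f m := AddMonoidHom.mk' (fun y => ⟨sliceMk (l + 1) (Y.X m) ⟨y.1, y.2.2⟩, sliceMk_mem _ y.2.1⟩)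
    fun _ _ => rfl
  comm _ _ := rfl

/-- The filtration step `l + 2` vanishes in degrees above `-l - 1`, so passing to the slice at level
`l + 1` loses nothing in degree `-l`. -/
theorem filtSlice_injective (j : Fin n) (l m : ℤ) (y : (filtDC Y j l).V m)
    (hy : (filtSlice Y j l).f m y = 0) : y = 0 :=
  Subtype.ext (eq_zero_of_mem_filt (s := l + 1 + 1) (by omega)
    (sliceMk_eq_zero.mp (congrArg Subtype.val hy)) y.2.1.1)

theorem filtSlice_surjective (j : Fin n) (l m : ℤ)
    (z : (partDC (baricSlice (l + 1) Y) j (-l)).V m) : ∃ y, (filtSlice Y j l).f m y = z := by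
  obtain ⟨y, hy, hy', h⟩ := exists_sliceMk z.2
  exact ⟨⟨y, hy', hy⟩, Subtype.ext h⟩

variable {Y}

theorem filtDC_ex {j : Fin n} {l m : ℤ} :
    (filtDC Y j l).Ex m ↔ (partDC (baricSlice (l + 1) Y) j (-l)).Ex m :=
  DC.ex_iff_of_bijective (filtSlice Y j l) (filtSlice_injective Y j l) (filtSlice_surjective Y j l) m

/-- Degree `-l` is the bottom degree of level `l` and the top degree of level `l + 1`, and no other
level reaches it. -/
theorem ac_of_slices {j : Fin n} {l : ℤ} (h : Ac (baricSlice (l + 1) Y) j (-l))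
    (h' : Ac (baricSlice l Y) j (-l)) : Ac Y j (-l) :=
  ac_iff.mpr fun m => (filt_isSES Y j l).ex_mid (filtDC_ex.mpr (ac_iff.mp h m)) (ac_iff.mp h' m)

theorem ac_iff_slice_bot {j : Fin n} {l : ℤ} (h : Ac (baricSlice (l + 1) Y) j (-l)) :
    Ac Y j (-l) ↔ Ac (baricSlice l Y) j (-l) :=
  ⟨fun h' => ac_iff.mpr fun m => (filt_isSES Y j l).ex_right (ac_iff.mp h' m)
    (filtDC_ex.mpr (ac_iff.mp h _)), ac_of_slices h⟩

theorem ac_iff_slice_top {j : Fin n} {l : ℤ} (h : Ac (baricSlice l Y) j (-l)) :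
    Ac Y j (-l) ↔ Ac (baricSlice (l + 1) Y) j (-l) := by
  refine ⟨fun h' => ac_iff.mpr fun m => ?_, fun h' => ac_of_slices h' h⟩
  have := (filt_isSES Y j l).ex_left (m := m - 1) (ac_iff.mp h' _) (ac_iff.mp h _)
  rw [sub_add_cancel] at this
  exact filtDC_ex.mp this

/-- As the next slice is acyclic in this degree at both vertices, the projection to the slice is
bijective on homology there, and it commutes with the action of paths. -/
theorem nonInj_of_slice {i p : Fin n} {l : ℤ} (hi : Ac (baricSlice (l + 1) Y) i (-l))
    (hp : Ac (baricSlice (l + 1) Y) p (-l)) (h : NonInj (baricSlice l Y) i p (-l)) :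
    NonInj Y i p (-l) := by
  obtain ⟨m, y, hy, hy', hb, x, hx, hx'⟩ := h
  obtain ⟨w, hw, hwy⟩ := (filt_isSES Y i l).lift_cycle (filtDC_ex.mpr (ac_iff.mp hi _)) ⟨y, hy⟩
    (Subtype.ext hy')
  refine ⟨m, w.1, w.2, congrArg Subtype.val hw, ?_, ?_⟩
  · rintro ⟨v, hv, hv'⟩
    refine hb ⟨_, ((filtProj Y i l).f m ⟨v, hv⟩).2, ?_⟩
    have h1 := (filtProj Y i l).comm m ⟨v, hv⟩
    rw [show (partDC Y i (-l)).d m ⟨v, hv⟩ = w from Subtype.ext hv', hwy] at h1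
    exact (congrArg Subtype.val h1).symm
  · obtain ⟨v, hv⟩ := (filt_isSES Y p l).bound_of_image (filtDC_ex.mpr (ac_iff.mp hp _))
      ⟨pathZero k p i • w.1, pathZero_smul_mem p w.2⟩ (Subtype.ext (by
        change dl Y (m + 1) (pathZero k p i • w.1) = 0
        rw [dl_smul, show dl Y (m + 1) w.1 = 0 from congrArg Subtype.val hw, smul_zero]))
      ⟨x, hx⟩ (Subtype.ext (by
        refine hx'.trans ?_
        have h1 : y = _ := (congrArg Subtype.val hwy).symm
        rw [h1]
        exact (map_smul (sliceMk l (Y.X (m + 1))) _ _).symm))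
    exact ⟨v.1, v.2, congrArg Subtype.val hv⟩

/-- As the lower slice is acyclic in this degree at both vertices, the inclusion of the filtration
step is bijective on homology there, and it commutes with the action of paths. -/
theorem nonSurj_of_slice {i p : Fin n} {l : ℤ} (hi : Ac (baricSlice l Y) i (-l))
    (hp : Ac (baricSlice l Y) p (-l)) (h : NonSurj (baricSlice (l + 1) Y) i p (-l)) :
    NonSurj Y i p (-l) := by
  obtain ⟨m, w, hw, hw', hns⟩ := h
  -- `descend` also uses exactness of the slice one step lower, so the index has to be a successor.
  obtain ⟨m, rfl⟩ : ∃ m', m = m' + 1 := ⟨m - 1, by omega⟩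
  obtain ⟨v, hv⟩ := filtSlice_surjective Y i l (m + 1 + 1) ⟨w, hw⟩
  have hcyc : ∀ {j : Fin n} (v : (filtDC Y j l).V (m + 1 + 1)),
      dl (baricSlice (l + 1) Y) (m + 1 + 1) ((filtSlice Y j l).f _ v).1 = 0 ↔
        dl Y (m + 1 + 1) v.1 = 0 := by
    intro j v
    constructor
    · intro h
      exact congrArg Subtype.val (filtSlice_injective Y j l (m + 1 + 1 + 1)
        ((filtDC Y j l).d (m + 1 + 1) v) (by rw [(filtSlice Y j l).comm]; exact Subtype.ext h))
    · intro h
      have h1 := (filtSlice Y j l).comm _ v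
      rw [show (filtDC Y j l).d (m + 1 + 1) v = 0 from Subtype.ext h, map_zero] at h1
      exact (congrArg Subtype.val h1).symm
  refine ⟨m + 1, v.1, v.2.1, (hcyc v).mp (by rw [hv]; exact hw'), fun y hy hy' x hx hxy => ?_⟩
  obtain ⟨y', x', hy'c, hyx⟩ := (filt_isSES Y p l).exists_homologous (ac_iff.mp hp _) ⟨y, hy⟩
    (Subtype.ext hy')
  have hyx' : y = y'.1 + dl Y (m + 1) x'.1 := congrArg Subtype.val hyx
  let t : (filtDC Y i l).V (m + 1 + 1) := ⟨pathZero k i p • y'.1, pathZero_smul_mem i y'.2.1,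
    Submodule.smul_mem ((Y.X (m + 1 + 1)).filt (l + 1)) _ y'.2.2⟩
  obtain ⟨r, hr⟩ := (filt_isSES Y i l).descend (ac_iff.mp hi m) (v - t)
    ⟨pathZero k i p • x'.1 + x, Submodule.add_mem _ (pathZero_smul_mem i x'.2) hx⟩ (Subtype.ext (by
      change dl Y (m + 1) (pathZero k i p • x'.1 + x) = v.1 - pathZero k i p • y'.1
      rw [hxy, hyx', map_add, dl_smul, smul_add]
      abel))
  refine hns _ ((filtSlice Y p l).f _ y').2 ((hcyc y').mpr (congrArg Subtype.val hy'c)) _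
    ((filtSlice Y i l).f _ r).2 ?_
  have h1 := (filtSlice Y i l).comm _ r
  rw [hr, map_sub, hv] at h1
  have h2 : w - pathZero k i p • ((filtSlice Y p l).f _ y').1 = _ := congrArg Subtype.val h1
  rw [sub_eq_iff_eq_add'] at h2
  exact h2

end Slices

end Cpx

end Zigzag

end

noncomputable section

open CategoryTheory CategoryTheory.Limits TensorProduct

namespace Zigzag

universe u

/-! ### Null-homotopic maps -/

namespace Cpx

open GrMod

variable {k : Type u} [Field k] {n : ℕ}

/-- Indexing a homotopy by `m` alone avoids the two-index family with zeros and the transports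
between equal indices. -/
theorem toHo_map_eq_zero_iff {Y Z : Cpx k n} (f : Y ⟶ Z) : (toHo k n).map f = 0 ↔
    ∃ h : ∀ m, Y.X (m + 1) ⟶ Z.X m, ∀ m,
      f.f (m + 1) = h m ≫ Z.d m (m + 1) + Y.d (m + 1) (m + 1 + 1) ≫ h (m + 1) := by
  rw [HomotopyCategory.quotient_map_eq_zero_iff]
  constructor
  · rintro ⟨H⟩
    refine ⟨fun m => H.hom (m + 1) m, fun m => ?_⟩
    have h1 := H.comm (m + 1)
    rw [dNext_eq H.hom (show (ComplexShape.up ℤ).Rel (m + 1) (m + 1 + 1) from rfl),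
      prevD_eq H.hom (show (ComplexShape.up ℤ).Rel m (m + 1) from rfl),
      HomologicalComplex.zero_f, add_zero] at h1
    exact h1.trans (add_comm _ _)
  · rintro ⟨h, hh⟩
    refine ⟨{ hom := fun i j => if hij : j + 1 = i then (Y.XIsoOfEq hij.symm).hom ≫ h j else 0
              zero := fun i j hij => dif_neg hij
              comm := fun i => ?_ }⟩
    obtain ⟨m, rfl⟩ : ∃ m, i = m + 1 := ⟨i - 1, by omega⟩
    rw [dNext_eq _ (show (ComplexShape.up ℤ).Rel (m + 1) (m + 1 + 1) from rfl),
      prevD_eq _ (show (ComplexShape.up ℤ).Rel m (m + 1) from rfl),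
      HomologicalComplex.zero_f, add_zero, dif_pos rfl, dif_pos rfl, hh m]
    refine (add_comm _ _).trans ?_
    simp

theorem comp_dl {Y Z : Cpx k n} (f : Y ⟶ Z) (m : ℤ) (y : Y.X m) :
    Hom.lin (f.f (m + 1)) (dl Y m y) = dl Z m (Hom.lin (f.f m) y) :=
  LinearMap.congr_fun (congrArg Hom.lin (f.comm m (m + 1)).symm) y

/-! ### Contractibility of acyclic complexes -/

theorem exists_of_cycle {Y : Cpx k n} (h : ∀ j d, Ac Y j d) {m : ℤ} {y : Y.X (m + 1)}
    (hy : dl Y (m + 1) y = 0) : ∃ x, dl Y m x = y := by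
  obtain ⟨s, hs⟩ := exists_sum_proj (Y.X (m + 1)).isInternal y
  have h1 : ∀ d, ∃ x, dl Y m x = proj (Y.X (m + 1)).isInternal d y := by
    intro d
    have h2 : dl Y (m + 1) (proj (Y.X (m + 1)).isInternal d y) = 0 := by
      refine (map_proj ((dl Y (m + 1)).restrictScalars k)
        (fun _ _ => Hom.lin_mem (Y.d (m + 1) (m + 1 + 1))) d y).trans ?_
      rw [LinearMap.restrictScalars_apply, hy, map_zero]
    choose x _ hx using fun j => h j d m (idem k n j • proj (Y.X (m + 1)).isInternal d y)
      (idem_smul_mem_part j (proj_mem _ _ _)) (by rw [dl_smul, h2, smul_zero])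
    exact ⟨∑ j, x j, by rw [map_sum, Finset.sum_congr rfl fun j _ => hx j, sum_idem_smul]⟩
  choose x hx using h1
  exact ⟨∑ d ∈ s, x d, by rw [map_sum, Finset.sum_congr rfl fun d _ => hx d, hs]⟩

/-- A contraction is built downwards from the upper bound, as for bounded above acyclic complexes of
projectives; acyclicity in every degree at every vertex makes all cycles boundaries. -/
theorem isZero_of_ac {Y : Cpx k n} (hb : IsBdd Y) (hp : ∀ m, IsGrProj (Y.X m))
    (h : ∀ j d, Ac Y j d) : IsZero ((toHo k n).obj Y) := by
  obtain ⟨a, b, hab⟩ := hb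
  have key : ∀ t : ℤ, ∃ h : ∀ m, Y.X (m + 1) ⟶ Y.X m, ∀ m, t ≤ m →
      𝟙 (Y.X (m + 1)) = h m ≫ Y.d m (m + 1) + Y.d (m + 1) (m + 1 + 1) ≫ h (m + 1) := by
    refine int_descend b (fun t ht => ⟨fun _ => 0, fun m hm => ?_⟩) fun t ht => ?_
    · exact (hab (m + 1) (Or.inr (by omega))).eq_of_src _ _
    · obtain ⟨r, hr⟩ := ht
      -- By the homotopy already constructed, `𝟙 - d ≫ r` takes values in cycles, hence in
      -- boundaries, so projectivity lifts it through the differential.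
      obtain ⟨g, hg⟩ := hp (t + 1) (Y.d t (t + 1))
        (𝟙 _ - Y.d (t + 1) (t + 1 + 1) ≫ r (t + 1)) fun y => by
          refine exists_of_cycle h ?_
          have h1 := LinearMap.congr_fun (congrArg Hom.lin (hr (t + 1) le_rfl)) (dl Y (t + 1) y)
          simp only [lin_id, lin_add, lin_comp, LinearMap.add_apply, LinearMap.comp_apply,
            LinearMap.id_apply] at h1
          have h2 : Hom.lin (Y.d (t + 1 + 1) (t + 1 + 1 + 1)) (dl Y (t + 1) y) = 0 :=
            dl_dl Y (t + 1) y
          rw [h2, map_zero, add_zero] at h1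
          rw [lin_sub, LinearMap.sub_apply, map_sub, sub_eq_zero]
          exact h1
      refine ⟨Function.update r t g, fun m hm => ?_⟩
      rcases hm.eq_or_lt with rfl | hm
      · rw [Function.update_self, Function.update_of_ne (by omega), hg, sub_add_cancel]
      · rw [Function.update_of_ne (by omega), Function.update_of_ne (by omega), hr m (by omega)]
  -- For `m < a - 1` the equation concerns maps out of a zero object.
  obtain ⟨r, hr⟩ := key (a - 1)
  rw [IsZero.iff_id_eq_zero, ← (toHo k n).map_id, toHo_map_eq_zero_iff]
  refine ⟨r, fun m => ?_⟩
  by_cases hm : a - 1 ≤ m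
  · exact hr m hm
  · exact (hab (m + 1) (Or.inl (by omega))).eq_of_src _ _

/-! ### Maps from and to the complexes `P_j⟨l⟩` -/

variable (k) in
/-- The module `P_j⟨l⟩` as a complex concentrated in degree `m`. -/
abbrev SP (j : Fin n) (l m : ℤ) : Cpx k n :=
  (HomologicalComplex.single (GrMod k n) (ComplexShape.up ℤ) m).obj (PS k j l)

/-- The isomorphism between `P_j⟨l⟩[s]` and `P_j⟨l⟩` placed in degree `-s`. -/
def pShiftIso (j : Fin n) (l s : ℤ) : PShift k j l s ≅ SP k j l (-s) :=
  ((CochainComplex.singleFunctors (GrMod k n)).shiftIso s (-s) 0 (by omega)).app (PS k j l)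

/-- The image of the generator identifies chain maps with cycles of degree `-l` at the vertex `j`,
and null-homotopies with ways of bounding them. -/
theorem hom_from_single_iff (Y : Cpx k n) (j : Fin n) (l m : ℤ) :
    (∀ f : (toHo k n).obj (SP k j l (m + 1)) ⟶ (toHo k n).obj Y, f = 0) ↔
      (partDC Y j (-l)).Ex m := by
  rw [partDC_ex]
  let e := HomologicalComplex.singleObjXSelf (ComplexShape.up ℤ) (m + 1) (PS k j l)
  constructor
  · intro h y hy hy'
    have hf := h ((toHo k n).map (HomologicalComplex.mkHomFromSingle (fromP y hy) (by
      rintro _ rfl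
      exact PS_hom_ext (by
        rw [lin_comp, LinearMap.comp_apply, fromP_topElt, lin_zero, LinearMap.zero_apply]
        exact hy'))))
    obtain ⟨r, hr⟩ := (toHo_map_eq_zero_iff _).mp hf
    have h1 := hr m
    rw [HomologicalComplex.single_obj_d, zero_comp, add_zero,
      HomologicalComplex.mkHomFromSingle_f, ← Iso.eq_inv_comp] at h1
    have h2 := LinearMap.congr_fun (congrArg Hom.lin h1) (topElt k j l)
    rw [fromP_topElt] at h2
    exact ⟨Hom.lin (e.inv ≫ r m) (topElt k j l), lin_mem_part _ (topElt_mem j l), h2.symm⟩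
  · intro h f
    obtain ⟨f, rfl⟩ := (toHo k n).map_surjective f
    obtain ⟨x, hx, hx'⟩ := h (Hom.lin (e.inv ≫ f.f (m + 1)) (topElt k j l))
      (lin_mem_part _ (topElt_mem j l)) (by
        rw [lin_comp, LinearMap.comp_apply, ← comp_dl]
        refine (congrArg _ ?_).trans (map_zero _)
        rfl)
    rw [toHo_map_eq_zero_iff]
    refine ⟨fun t => if ht : t = m then
      (HomologicalComplex.singleObjXIsoOfEq _ _ _ _ (by rw [ht])).hom ≫ fromP x hx ≫
        (Y.XIsoOfEq ht).inv else 0, fun t => ?_⟩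
    rw [HomologicalComplex.single_obj_d, zero_comp, add_zero]
    by_cases ht : t = m
    · subst ht
      beta_reduce
      rw [dif_pos rfl, HomologicalComplex.XIsoOfEq_rfl, Iso.refl_inv, Category.comp_id]
      change f.f (t + 1) = (e.hom ≫ fromP x hx) ≫ Y.d t (t + 1)
      rw [Category.assoc, ← Iso.inv_comp_eq]
      refine PS_hom_ext (hx'.symm.trans ?_)
      rw [lin_comp (fromP x hx), LinearMap.comp_apply, fromP_topElt]
      rfl
    · exact (HomologicalComplex.isZero_single_obj_X _ _ _ _ (by omega)).eq_of_src _ _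

theorem ac_neg_iff_hom {Y : Cpx k n} {j : Fin n} {l : ℤ} : Ac Y j (-l) ↔
    ∀ (m : ℤ) (f : (toHo k n).obj (SP k j l m) ⟶ (toHo k n).obj Y), f = 0 := by
  rw [ac_iff]
  constructor
  · intro h m
    have := (hom_from_single_iff Y j l (m - 1)).mpr (h _)
    rwa [sub_add_cancel] at this
  · intro h m
    exact (hom_from_single_iff Y j l m).mp (h _)

theorem ac_iff_hom {Y : Cpx k n} {j : Fin n} {d : ℤ} : Ac Y j d ↔
    ∀ (m : ℤ) (f : (toHo k n).obj (SP k j (-d) m) ⟶ (toHo k n).obj Y), f = 0 := by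
  rw [← ac_neg_iff_hom, neg_neg]

theorem pShift_hom_iff {Y : Cpx k n} {j : Fin n} {l : ℤ} :
    (∀ (s : ℤ) (f : (toHo k n).obj (PShift k j l s) ⟶ (toHo k n).obj Y), f = 0) ↔ Ac Y j (-l) := by
  rw [ac_neg_iff_hom]
  constructor
  · intro h m f
    have h1 := h (-m) (((toHo k n).mapIso (pShiftIso j l (-m))).hom ≫
      eqToHom (by rw [neg_neg]) ≫ f)
    rwa [Preadditive.IsIso.comp_left_eq_zero, Preadditive.IsIso.comp_left_eq_zero] at h1
  · intro h s f
    have h1 := h (-s) (((toHo k n).mapIso (pShiftIso j l s)).inv ≫ f)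
    rwa [Preadditive.IsIso.comp_left_eq_zero] at h1

/-- Homological vanishing passes to direct summands in the homotopy category. -/
theorem Ac.of_retract {Y Z : Cpx k n} {j : Fin n} {d : ℤ} (h : Ac Y j d)
    (i : (toHo k n).obj Z ⟶ (toHo k n).obj Y) (r : (toHo k n).obj Y ⟶ (toHo k n).obj Z)
    (hir : i ≫ r = 𝟙 _) : Ac Z j d := by
  rw [ac_iff_hom] at h ⊢
  intro m f
  rw [← Category.comp_id f, ← hir, ← Category.assoc, h m (f ≫ i), zero_comp]

theorem ac_iff_of_iso {Y Z : Cpx k n} (e : (toHo k n).obj Y ≅ (toHo k n).obj Z) {j : Fin n}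
    {d : ℤ} : Ac Y j d ↔ Ac Z j d :=
  ⟨fun h => h.of_retract e.inv e.hom e.inv_hom_id, fun h => h.of_retract e.hom e.inv e.hom_inv_id⟩

theorem ac_of_isZero {Y : Cpx k n} (h : IsZero ((toHo k n).obj Y)) (j : Fin n) (d : ℤ) :
    Ac Y j d :=
  ac_iff_hom.mpr fun _ _ => h.eq_of_tgt _ _

/-! ### The symmetric form -/

/-- The coefficient of the loop `z` in an element of `P_j⟨l⟩`. -/
def tau (j : Fin n) (l : ℤ) : (PS k j l).carrier →ₗ[k] k :=
  coeffOne j j ∘ₗ (pval j l).restrictScalars k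

/-- The form `(a, b) ↦` coefficient of the loop in `a b` is non-degenerate: a value of `f` in either
degree becomes a multiple of the loop at `j` under the path of complementary degree starting at `j`,
and `tau` sees this multiple. -/
theorem frob_eq_zero {M : GrMod k n} {j : Fin n} {l : ℤ} (f : M ⟶ PS k j l)
    (h : ∀ y ∈ part j (1 - l) M, tau j l (Hom.lin f y) = 0) : f = 0 := by
  have key : ∀ p d, ∀ m ∈ part p d M, Hom.lin f m = 0 := by
    intro p d m hm
    have hu := lin_mem_part f hm
    by_cases h0 : d + l = 0
    · have h1 := pval_eq_zero hu h0
      have h2 := h (pathOne k j p • m) (by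
        have := pathOne_smul_mem j hm
        rwa [show d + 1 = 1 - l by omega] at this)
      rw [map_smul] at h2
      change coeffOne j j (pval j l (pathOne k j p • _)) = 0 at h2
      rw [map_smul, h1, smul_eq_mul, mul_smul_comm, pathOne_mul_pathZero_self, map_smul,
        coeffOne_pathOne, if_pos ⟨rfl, rfl⟩, smul_eq_mul, mul_one] at h2
      exact pval_injective j l (by rw [h1, h2, zero_smul, map_zero])
    · by_cases h1 : d + l = 1
      · have h1' := pval_eq_one hu h1
        have h2 := h (pathZero k j p • m) (by
          have := pathZero_smul_mem j hm
          rwa [show d = 1 - l by omega] at this)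
        rw [map_smul] at h2
        change coeffOne j j (pval j l (pathZero k j p • _)) = 0 at h2
        rw [map_smul, h1', smul_eq_mul, mul_smul_comm, pathZero_mul_pathOne_self, map_smul,
          coeffOne_pathOne, if_pos ⟨rfl, rfl⟩, smul_eq_mul, mul_one] at h2
        exact pval_injective j l (by rw [h1', h2, zero_smul, map_zero])
      · exact part_PS_eq_zero hu h0 h1
  refine hom_ext fun m => ?_
  refine grading_induction (mem_iSup M.isInternal) (p := fun m => Hom.lin f m = 0) (map_zero _)
    (fun a b ha hb => by rw [map_add, ha, hb, add_zero]) (fun d m hm => ?_) m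
  rw [← sum_idem_smul m, map_sum]
  exact Finset.sum_eq_zero fun j _ => key j d _ (idem_smul_mem_part j hm)

/-- The projection onto the elements of degree `d` of `e_j M`. -/
def toPart (j : Fin n) (d : ℤ) (M : GrMod k n) : M.carrier →ₗ[k] part j d M :=
  (Algebra.lsmul k k M.carrier (idem k n j) ∘ₗ proj M.isInternal d).codRestrict (part j d M)
    fun m => idem_smul_mem_part j (proj_mem _ _ _)

theorem toPart_of_mem {j : Fin n} {d : ℤ} {M : GrMod k n} {m : M} (hm : m ∈ part j d M) :
    toPart j d M m = ⟨m, hm⟩ :=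
  Subtype.ext (by
    change idem k n j • proj M.isInternal d m = m
    rw [proj_of_mem _ hm.1, hm.2])

theorem toPart_of_ne {j : Fin n} {d e : ℤ} {M : GrMod k n} {m : M} (hm : m ∈ M.deg e)
    (hde : d ≠ e) : toPart j d M m = 0 :=
  Subtype.ext (by
    change idem k n j • proj M.isInternal d m = 0
    rw [proj_of_mem_ne _ hde hm, smul_zero])

/-- The element of the algebra whose products with all elements have coefficients prescribed by a
functional. -/
def frobVal {M : GrMod k n} (j : Fin n) (μ : M.carrier →ₗ[k] k) : M.carrier →ₗ[k] Alg k n :=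
  ∑ p, ((μ ∘ₗ Algebra.lsmul k k M.carrier (pathOne k j p)).smulRight (pathZero k p j) +
    (μ ∘ₗ Algebra.lsmul k k M.carrier (pathZero k j p)).smulRight (pathOne k p j))

theorem frobVal_apply {M : GrMod k n} (j : Fin n) (μ : M.carrier →ₗ[k] k) (m : M) :
    frobVal j μ m = ∑ p, (μ (pathOne k j p • m) • pathZero k p j +
      μ (pathZero k j p • m) • pathOne k p j) := by
  simp [frobVal, LinearMap.sum_apply]

/-- The paths from `p` to `j` and the complementary paths from `j` to `p` are dual bases for the
form, so `frobVal j μ m` represents the functional `c ↦ μ (e_j c m)`. -/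
theorem coeffOne_mul_frobVal {M : GrMod k n} (j : Fin n) (μ : M.carrier →ₗ[k] k) (c : Alg k n)
    (m : M) : coeffOne j j (c * frobVal j μ m) = μ (idem k n j • c • m) := by
  refine path_induction (p := fun c => coeffOne j j (c * frobVal j μ m) = μ (idem k n j • c • m))
    (fun a b ha hb => by rw [add_mul, map_add, ha, hb, add_smul, smul_add, map_add])
    (fun t a ha => by
      rw [smul_mul_assoc, map_smul (coeffOne j j), ha, smul_assoc, smul_algebra_smul_comm,
        map_smul μ t])
    (by simp) (fun q r => ?_) (fun q r => ?_) c
  · rw [frobVal_apply, Finset.mul_sum, map_sum, smul_smul, idem_mul_pathZero]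
    have h0 : ∀ p, coeffOne j j (pathZero k q r * pathZero k p j) = 0 := by
      intro p
      exact (coeff_of_mem (algDeg_mul (pathZero_mem q r) (pathZero_mem p j)) j j).2 (by norm_num)
    rw [Finset.sum_eq_single r]
    · rw [mul_add, mul_smul_comm, mul_smul_comm, map_add, map_smul (coeffOne j j),
        map_smul (coeffOne j j), h0, smul_zero,
        zero_add]
      by_cases hq : j = q
      · subst hq
        rw [pathZero_mul_pathOne_self, coeffOne_pathOne, if_pos ⟨rfl, rfl⟩, if_pos rfl,
          smul_eq_mul, mul_one]
      · rw [if_neg hq, zero_smul, map_zero]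
        by_cases hqr : q = r
        · subst hqr
          rw [pathZero_self, idem_mul_pathOne, if_pos rfl, coeffOne_pathOne,
            if_neg fun h => hq h.2.symm, smul_zero]
        · rw [pathZero_mul_pathOne hqr (Ne.symm hq), map_zero, smul_zero]
    · intro p _ hp
      rw [mul_add, mul_smul_comm, mul_smul_comm, map_add, map_smul (coeffOne j j),
        map_smul (coeffOne j j), h0, smul_zero,
        zero_add, mul_eq_zero_of_ne r p (Ne.symm hp) (by simp [pathZero_mul_idem])
          (by simp [idem_mul_pathOne]), map_zero, smul_zero]
    · simp
  · rw [frobVal_apply, Finset.mul_sum, map_sum, smul_smul, idem_mul_pathOne]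
    have h0 : ∀ p, coeffOne j j (pathOne k q r * pathOne k p j) = 0 := by
      intro p
      exact (coeff_of_mem (algDeg_mul (pathOne_mem q r) (pathOne_mem p j)) j j).2 (by norm_num)
    rw [Finset.sum_eq_single r]
    · rw [mul_add, mul_smul_comm, mul_smul_comm, map_add, map_smul (coeffOne j j),
        map_smul (coeffOne j j), h0, smul_zero,
        add_zero]
      by_cases hq : j = q
      · subst hq
        rw [pathOne_mul_pathZero_self, coeffOne_pathOne, if_pos ⟨rfl, rfl⟩, if_pos rfl,
          smul_eq_mul, mul_one]
      · rw [if_neg hq, zero_smul, map_zero]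
        by_cases hqr : r = j
        · subst hqr
          rw [pathZero_self, pathOne_mul_idem, if_pos rfl, coeffOne_pathOne,
            if_neg fun h => hq h.2.symm, smul_zero]
        · rw [pathOne_mul_pathZero hqr (Ne.symm hq), map_zero, smul_zero]
    · intro p _ hp
      rw [mul_add, mul_smul_comm, mul_smul_comm, map_add, map_smul (coeffOne j j),
        map_smul (coeffOne j j), h0, smul_zero,
        add_zero, mul_eq_zero_of_ne r p (Ne.symm hp) (by simp [pathOne_mul_idem])
          (by simp [idem_mul_pathZero]), map_zero, smul_zero]
    · simp

theorem frobVal_mul_idem {M : GrMod k n} (j : Fin n) (μ : M.carrier →ₗ[k] k) (m : M) :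
    frobVal j μ m * idem k n j = frobVal j μ m := by
  rw [frobVal_apply, Finset.sum_mul]
  refine Finset.sum_congr rfl fun p _ => ?_
  rw [add_mul, smul_mul_assoc, smul_mul_assoc, pathZero_mul_idem, pathOne_mul_idem, if_pos rfl,
    if_pos rfl]

theorem eq_zero_of_coeffOne {j : Fin n} {u : Alg k n} (hu : u * idem k n j = u)
    (h : ∀ c, coeffOne j j (c * u) = 0) : u = 0 := by
  have h0 : ∀ p, coeffZero j p u = 0 := fun p => by
    rw [← h (pathOne k j p)]
    conv_rhs => rw [← hu, mul_idem_eq, Finset.mul_sum, map_sum]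
    rw [Finset.sum_eq_single p]
    · rw [mul_add, mul_smul_comm, mul_smul_comm, pathOne_mul_pathZero_self, pathOne_mul_pathOne,
        smul_zero, add_zero, map_smul, coeffOne_pathOne, if_pos ⟨rfl, rfl⟩, smul_eq_mul, mul_one]
    · intro q _ hq
      rw [mul_add, mul_smul_comm, mul_smul_comm,
        mul_eq_zero_of_ne p q (Ne.symm hq) (by simp [pathOne_mul_idem])
          (by simp [idem_mul_pathZero]),
        mul_eq_zero_of_ne p q (Ne.symm hq) (by simp [pathOne_mul_idem])
          (by simp [idem_mul_pathOne]), smul_zero, smul_zero, add_zero, map_zero]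
    · simp
  have h1 : ∀ p, coeffOne j p u = 0 := fun p => by
    rw [← h (pathZero k j p)]
    conv_rhs => rw [← hu, mul_idem_eq, Finset.mul_sum, map_sum]
    rw [Finset.sum_eq_single p]
    · rw [h0, zero_smul, zero_add, mul_smul_comm, pathZero_mul_pathOne_self,
        map_smul, coeffOne_pathOne, if_pos ⟨rfl, rfl⟩, smul_eq_mul, mul_one]
    · intro q _ hq
      rw [h0, zero_smul, zero_add, mul_smul_comm,
        mul_eq_zero_of_ne p q (Ne.symm hq) (by simp [pathZero_mul_idem])
          (by simp [idem_mul_pathOne]), smul_zero, map_zero]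
    · simp
  rw [← hu, mul_idem_eq]
  exact Finset.sum_eq_zero fun p _ => by rw [h0, h1, zero_smul, zero_smul, add_zero]

/-- Functionals on the part of degree `1 - l` of `e_j M` come from maps `M ⟶ P_j⟨l⟩`. -/
theorem exists_frob {M : GrMod k n} {j : Fin n} {l : ℤ} (μ : part j (1 - l) M →ₗ[k] k) :
    ∃ f : M ⟶ PS k j l, ∀ y (hy : y ∈ part j (1 - l) M), tau j l (Hom.lin f y) = μ ⟨y, hy⟩ := by
  let ν : M.carrier →ₗ[k] k := μ ∘ₗ toPart j (1 - l) M
  -- Linearity over the algebra follows from non-degeneracy: both sides have the same loop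
  -- coefficients after multiplication by any `c`.
  have hsmul : ∀ (a : Alg k n) (m : M), frobVal j ν (a • m) = a * frobVal j ν m := by
    intro a m
    refine sub_eq_zero.mp (eq_zero_of_coeffOne (j := j) ?_ fun c => ?_)
    · rw [sub_mul, mul_assoc, frobVal_mul_idem, frobVal_mul_idem]
    · rw [mul_sub, map_sub, coeffOne_mul_frobVal, ← mul_assoc, coeffOne_mul_frobVal, mul_smul,
        sub_self]
  let F : M.carrier →ₗ[Alg k n] (PS k j l).carrier :=
    { toFun := fun m => toP j (frobVal j ν m)
      map_add' := fun a b => by rw [map_add, map_add]; rfl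
      map_smul' := fun a m => by rw [hsmul, ← smul_eq_mul, map_smul]; rfl }
  have hF : ∀ m, pval j l (F m) = frobVal j ν m := fun m => frobVal_mul_idem j ν m
  refine ⟨ofLin F fun d m hm => ?_, fun y hy => ?_⟩
  · rw [mem_deg_PS, hF, frobVal_apply]
    refine Submodule.sum_mem _ fun p _ => Submodule.add_mem _ ?_ ?_
    · by_cases h : 1 - l = 1 + d
      · rw [show d + l = 0 by omega]
        exact Submodule.smul_mem _ _ (pathZero_mem p j)
      · have : ν (pathOne k j p • m) = 0 := by
          change μ _ = 0
          rw [toPart_of_ne (M.smul_mem (pathOne_mem j p) hm) h, map_zero]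
        rw [this, zero_smul]
        exact Submodule.zero_mem _
    · by_cases h : 1 - l = 0 + d
      · rw [show d + l = 1 by omega]
        exact Submodule.smul_mem _ _ (pathOne_mem p j)
      · have : ν (pathZero k j p • m) = 0 := by
          change μ _ = 0
          rw [toPart_of_ne (M.smul_mem (pathZero_mem j p) hm) h, map_zero]
        rw [this, zero_smul]
        exact Submodule.zero_mem _
  · change coeffOne j j (pval j l (F y)) = _
    rw [hF, ← one_mul (frobVal j ν y), coeffOne_mul_frobVal, one_smul, hy.2]
    exact congrArg μ (toPart_of_mem hy)

/-- The differential on the elements of degree `d` of `e_j Y`. -/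
def partD (Y : Cpx k n) (j : Fin n) (d m : ℤ) : part j d (Y.X m) →ₗ[k] part j d (Y.X (m + 1)) :=
  ((dl Y m).restrictScalars k).restrict fun _ hy => dl_mem hy

/-- By the form, maps `M ⟶ P_j⟨l⟩` are the functionals on degree `1 - l` of `e_j M`. So chain maps
to `P_j⟨l⟩` modulo homotopy form the homology of the dual complex, which over a field vanishes
exactly where the homology of the complex does. -/
theorem hom_to_single_iff (Y : Cpx k n) (j : Fin n) (l m : ℤ) :
    (∀ f : (toHo k n).obj Y ⟶ (toHo k n).obj (SP k j l (m + 1)), f = 0) ↔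
      (partDC Y j (1 - l)).Ex m := by
  rw [partDC_ex]
  let e := HomologicalComplex.singleObjXSelf (ComplexShape.up ℤ) (m + 1) (PS k j l)
  constructor
  · intro h y hy hy'
    by_contra hcon
    -- A functional that kills the boundaries but not the cycle `y` gives a chain map; any
    -- null-homotopic chain map would kill `y`.
    obtain ⟨μ, hμ, hμ'⟩ := Submodule.exists_le_ker_of_notMem
      (p := LinearMap.range (partD Y j (1 - l) m)) (v := ⟨y, hy⟩) (by
        rintro ⟨x, hx⟩
        exact hcon ⟨x.1, x.2, congrArg Subtype.val hx⟩)
    obtain ⟨f, hf⟩ := exists_frob μ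
    have hd : Y.d m (m + 1) ≫ f = 0 := frob_eq_zero _ fun x hx => by
      exact (hf _ (dl_mem hx)).trans (hμ' ⟨⟨x, hx⟩, rfl⟩)
    have h0 := h ((toHo k n).map (HomologicalComplex.mkHomToSingle f (by
      intro i hi
      obtain rfl : i = m := by
        have : i + 1 = m + 1 := hi
        omega
      exact hd)))
    obtain ⟨r, hr⟩ := (toHo_map_eq_zero_iff _).mp h0
    have h1 := hr m
    rw [HomologicalComplex.single_obj_d, comp_zero, zero_add,
      HomologicalComplex.mkHomToSingle_f, Iso.comp_inv_eq] at h1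
    refine hμ ?_
    rw [← hf y hy, h1]
    change tau j l (Hom.lin (r (m + 1) ≫ e.hom) (dl Y (m + 1) y)) = 0
    rw [hy', map_zero, map_zero]
  · intro h f
    obtain ⟨f, rfl⟩ := (toHo k n).map_surjective f
    let g : Y.X (m + 1) ⟶ PS k j l := f.f (m + 1) ≫ e.hom
    have hg : ∀ x, Hom.lin g (dl Y m x) = 0 := fun x => by
      rw [lin_comp, LinearMap.comp_apply, comp_dl]
      exact map_zero (Hom.lin e.hom)
    let μ : part j (1 - l) (Y.X (m + 1)) →ₗ[k] k :=
      tau j l ∘ₗ ((Hom.lin g).restrictScalars k) ∘ₗ (part j (1 - l) (Y.X (m + 1))).subtype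
    -- Cycles are boundaries by assumption and `f` kills boundaries, so `μ` kills the cycles and
    -- factors through the next differential; the factor `ν` becomes the homotopy.
    have hμ : μ ∈ (LinearMap.ker (partD Y j (1 - l) (m + 1))).dualAnnihilator := by
      rw [Submodule.mem_dualAnnihilator]
      rintro ⟨y, hy⟩ hy'
      obtain ⟨x, hx, rfl⟩ := h y hy (congrArg Subtype.val hy')
      change tau j l (Hom.lin g (dl Y m x)) = 0
      rw [hg, map_zero]
    rw [← LinearMap.range_dualMap_eq_dualAnnihilator_ker] at hμ
    obtain ⟨ν, hν⟩ := hμ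
    obtain ⟨r, hr⟩ := exists_frob ν
    have key : g = Y.d (m + 1) (m + 1 + 1) ≫ r := sub_eq_zero.mp (frob_eq_zero _ fun y hy => by
      rw [lin_sub, LinearMap.sub_apply, map_sub, sub_eq_zero]
      exact (LinearMap.congr_fun hν ⟨y, hy⟩).symm.trans (hr _ (dl_mem hy)).symm)
    rw [toHo_map_eq_zero_iff]
    refine ⟨fun t => if ht : t = m + 1 then (Y.XIsoOfEq (by rw [ht])).hom ≫ r ≫
      (HomologicalComplex.singleObjXIsoOfEq _ _ _ _ ht).inv else 0, fun t => ?_⟩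
    rw [HomologicalComplex.single_obj_d, comp_zero, zero_add]
    by_cases ht : t = m
    · subst ht
      beta_reduce
      rw [dif_pos rfl, HomologicalComplex.XIsoOfEq_rfl, Iso.refl_hom, Category.id_comp,
        ← Category.assoc, ← key]
      change _ = (f.f (t + 1) ≫ e.hom) ≫ e.inv
      rw [Category.assoc, e.hom_inv_id, Category.comp_id]
    · exact (HomologicalComplex.isZero_single_obj_X _ _ _ _ (by omega)).eq_of_tgt _ _

theorem hom_pShift_iff {Y : Cpx k n} {j : Fin n} {l : ℤ} :
    (∀ (s : ℤ) (f : (toHo k n).obj Y ⟶ (toHo k n).obj (PShift k j l s)), f = 0) ↔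
      Ac Y j (1 - l) := by
  rw [ac_iff]
  constructor
  · intro h m
    refine (hom_to_single_iff Y j l m).mp fun f => ?_
    have h1 := h (-(m + 1)) (f ≫ eqToHom (by rw [neg_neg]) ≫
      ((toHo k n).mapIso (pShiftIso j l (-(m + 1)))).inv)
    rwa [← Category.assoc, Preadditive.IsIso.comp_right_eq_zero,
      Preadditive.IsIso.comp_right_eq_zero] at h1
  · intro h s f
    obtain ⟨m, hm⟩ : ∃ m, -s = m + 1 := ⟨-s - 1, by omega⟩
    have h1 := (hom_to_single_iff Y j l m).mpr (h m)
    rw [← hm] at h1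
    have h2 := h1 (f ≫ ((toHo k n).mapIso (pShiftIso j l s)).hom)
    rwa [Preadditive.IsIso.comp_right_eq_zero] at h2

end Cpx

end Zigzag

end

noncomputable section

open CategoryTheory CategoryTheory.Limits TensorProduct

namespace Zigzag

universe u

/-! ### The levels of the top and the bottom slice -/

namespace Cpx

open GrMod

variable {k : Type u} [Field k] {n : ℕ} {Y : Cpx k n}

theorem _root_.Zigzag.InD.isBdd (hY : InD Y) : IsBdd Y := hY.1

theorem isBdd_slice (hY : IsBdd Y) (s : ℤ) : IsBdd (baricSlice s Y) := by
  obtain ⟨a, b, h⟩ := hY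
  exact ⟨a, b, fun m hm => (slice s).map_isZero (h m hm)⟩

theorem _root_.Zigzag.InD.isLevel (hY : InD Y) (s m : ℤ) : IsLevel s ((baricSlice s Y).X m) := by
  have := (hY.2 m).1
  have := (hY.2 m).2
  exact isLevel_slice s (Y.X m)

theorem _root_.Zigzag.InD.isGrProj (hY : InD Y) (m : ℤ) : IsGrProj (Y.X m) := by
  have := (hY.2 m).1
  have := (hY.2 m).2
  exact isGrProj_of_projective (Y.X m)

theorem isZero_slice_of_soc (hY : InD Y) {s : ℤ}
    (h : ∀ m j, (socDC s (baricSlice s Y) j).Ex m) : IsZero ((toHo k n).obj (baricSlice s Y)) :=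
  isZero_of_ac (isBdd_slice hY.isBdd s) (fun m => (hY.isLevel s m).isGrProj)
    (ac_of_soc (hY.isLevel s) h)

/-- Vanishing homology in one of the two degrees already makes all multiplicity complexes exact,
hence the other degree acyclic too. -/
theorem isZero_slice_iff_bot (hY : InD Y) {s : ℤ} :
    IsZero ((toHo k n).obj (baricSlice s Y)) ↔ ∀ j, Ac (baricSlice s Y) j (-s) :=
  ⟨fun h j => ac_of_isZero h j _, fun h => isZero_slice_of_soc hY
    (soc_ex_of_bot (hY.isLevel s) (isBdd_slice hY.isBdd s) h)⟩

theorem isZero_slice_iff_top (hY : InD Y) {s : ℤ} :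
    IsZero ((toHo k n).obj (baricSlice s Y)) ↔ ∀ j, Ac (baricSlice s Y) j (1 - s) :=
  ⟨fun h j => ac_of_isZero h j _, fun h => isZero_slice_of_soc hY
    (soc_ex_of_top (hY.isLevel s) (isBdd_slice hY.isBdd s) h)⟩

theorem isZero_toHo_of_isZero {Z : Cpx k n} (h : ∀ m, IsZero (Z.X m)) :
    IsZero ((toHo k n).obj Z) := by
  rw [IsZero.iff_id_eq_zero, ← (toHo k n).map_id,
    show 𝟙 Z = 0 from HomologicalComplex.hom_ext _ _ fun m => (h m).eq_of_src _ _,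
    Functor.map_zero]

theorem exists_bound_baricSlice (hY : InD Y) :
    ∃ B : ℤ, ∀ s, B < |s| → IsZero ((toHo k n).obj (baricSlice s Y)) := by
  have h : ∀ m, ∃ B : ℤ, ∀ s, B < |s| → IsZero ((slice s).obj (Y.X m)) := fun m => by
    have := (hY.2 m).1
    have := (hY.2 m).2
    exact exists_bound_slice (Y.X m)
  choose B hB using h
  obtain ⟨a, b, hab⟩ := hY.1
  refine ⟨∑ m ∈ Finset.Icc a b, |B m|, fun s hs => isZero_toHo_of_isZero fun m => ?_⟩
  by_cases hm : m ∈ Finset.Icc a b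
  · refine hB m s ((le_abs_self _).trans_lt (lt_of_le_of_lt ?_ hs))
    exact Finset.single_le_sum (f := fun m => |B m|) (fun _ _ => abs_nonneg _) hm
  · exact (slice s).map_isZero (hab m (by rw [Finset.mem_Icc] at hm; omega))

/-- Descending from a level above all slices: once the slice at `l + 1` is zero, degree `-l` of `Y`
has the homology of the bottom degree of the slice at `l`. -/
theorem isZero_slice_above (hY : InD Y) {L : ℤ} (h : ∀ l, L < l → ∀ j, Ac Y j (-l)) (l : ℤ)
    (hl : L < l) : IsZero ((toHo k n).obj (baricSlice l Y)) := by
  obtain ⟨B, hB⟩ := exists_bound_baricSlice hY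
  refine int_descend (p := fun l => L < l → IsZero ((toHo k n).obj (baricSlice l Y))) |B|
    (fun l hl _ => hB l ((le_abs_self B).trans_lt (hl.trans_le (le_abs_self l))))
    (fun l ih hl => ?_) l hl
  exact (isZero_slice_iff_bot hY).mpr fun j =>
    (ac_iff_slice_bot (ac_of_isZero (ih (by omega)) j _)).mp (h l hl j)

theorem isZero_slice_below (hY : InD Y) {L : ℤ} (h : ∀ l, l < L → ∀ j, Ac Y j (1 - l)) (l : ℤ)
    (hl : l < L) : IsZero ((toHo k n).obj (baricSlice l Y)) := by
  obtain ⟨B, hB⟩ := exists_bound_baricSlice hY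
  refine int_ascend (p := fun l => l < L → IsZero ((toHo k n).obj (baricSlice l Y))) (-|B|)
    (fun l hl _ => hB l ((le_abs_self B).trans_lt ((lt_neg.mp hl).trans_le (neg_le_abs l))))
    (fun l ih hl => ?_) l hl
  refine (isZero_slice_iff_top hY).mpr fun j => ?_
  have h1 := h (l + 1) hl j
  rw [show 1 - (l + 1) = -l by omega] at h1 ⊢
  exact (ac_iff_slice_top (ac_of_isZero (ih (by omega)) j _)).mp h1

theorem isGreatest_of_ac (hY : InD Y) {L : ℤ} (h : ∀ l, L < l → ∀ j, Ac Y j (-l))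
    (h' : ∃ j, ¬ Ac Y j (-L)) :
    IsGreatest {s | ¬ IsZero ((toHo k n).obj (baricSlice s Y))} L := by
  refine ⟨fun h0 => ?_, fun l hl => not_lt.mp fun hlt => hl (isZero_slice_above hY h l hlt)⟩
  obtain ⟨j, hj⟩ := h'
  exact hj (ac_of_slices (ac_of_isZero (isZero_slice_above hY h _ (by omega)) j _)
    (ac_of_isZero h0 j _))

/-- This and `phiMinus_eq` compute the extreme levels of `Σ_i` and `Σ_i^{-1}` from homology alone,
without a minimal complex. -/
theorem phiPlus_eq (hY : InD Y) {L : ℤ} (h : ∀ l, L < l → ∀ j, Ac Y j (-l))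
    (h' : ∃ j, ¬ Ac Y j (-L)) : phiPlus Y = L :=
  (isGreatest_of_ac hY h h').csSup_eq

theorem isLeast_of_ac (hY : InD Y) {L : ℤ} (h : ∀ l, l < L → ∀ j, Ac Y j (1 - l))
    (h' : ∃ j, ¬ Ac Y j (1 - L)) :
    IsLeast {s | ¬ IsZero ((toHo k n).obj (baricSlice s Y))} L := by
  refine ⟨fun h0 => ?_, fun l hl => not_lt.mp fun hlt => hl (isZero_slice_below hY h l hlt)⟩
  obtain ⟨j, hj⟩ := h'
  have h1 := ac_of_slices (Y := Y) (j := j) (l := L - 1)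
    (by rw [sub_add_cancel]; exact ac_of_isZero h0 j _)
    (ac_of_isZero (isZero_slice_below hY h _ (by omega)) j _)
  rw [neg_sub] at h1
  exact hj h1

theorem phiMinus_eq (hY : InD Y) {L : ℤ} (h : ∀ l, l < L → ∀ j, Ac Y j (1 - l))
    (h' : ∃ j, ¬ Ac Y j (1 - L)) : phiMinus Y = L :=
  (isLeast_of_ac hY h h').csInf_eq

theorem exists_slice_ne_zero (hY : InD Y) (h0 : ¬ IsZero ((toHo k n).obj Y)) :
    ∃ s, ¬ IsZero ((toHo k n).obj (baricSlice s Y)) := by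
  by_contra! hcon
  refine h0 (isZero_of_ac hY.isBdd hY.isGrProj fun j d => ?_)
  have := ac_of_slices (ac_of_isZero (hcon (-d + 1)) j (- -d)) (ac_of_isZero (hcon (-d)) j (- -d))
  rwa [neg_neg] at this

theorem isGreatest_phiPlus (hY : InD Y) (h0 : ¬ IsZero ((toHo k n).obj Y)) :
    IsGreatest {s | ¬ IsZero ((toHo k n).obj (baricSlice s Y))} (phiPlus Y) := by
  obtain ⟨B, hB⟩ := exists_bound_baricSlice hY
  have hbdd : BddAbove {s | ¬ IsZero ((toHo k n).obj (baricSlice s Y))} :=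
    ⟨B, fun s hs => not_lt.mp fun h => hs (hB s (h.trans_le (le_abs_self s)))⟩
  exact ⟨Int.csSup_mem (exists_slice_ne_zero hY h0) hbdd, fun s hs => le_csSup hbdd hs⟩

theorem isLeast_phiMinus (hY : InD Y) (h0 : ¬ IsZero ((toHo k n).obj Y)) :
    IsLeast {s | ¬ IsZero ((toHo k n).obj (baricSlice s Y))} (phiMinus Y) := by
  obtain ⟨B, hB⟩ := exists_bound_baricSlice hY
  have hbdd : BddBelow {s | ¬ IsZero ((toHo k n).obj (baricSlice s Y))} :=
    ⟨-B, fun s hs => not_lt.mp fun h => hs (hB s ((by omega : B < -s).trans_le (neg_le_abs s)))⟩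
  exact ⟨Int.csInf_mem (exists_slice_ne_zero hY h0) hbdd, fun s hs => csInf_le hbdd hs⟩

theorem isZero_slice_of_phiPlus_lt (hY : InD Y) (h0 : ¬ IsZero ((toHo k n).obj Y)) {l : ℤ}
    (hl : phiPlus Y < l) : IsZero ((toHo k n).obj (baricSlice l Y)) :=
  not_not.mp fun h => absurd ((isGreatest_phiPlus hY h0).2 h) (not_le.mpr hl)

theorem isZero_slice_of_lt_phiMinus (hY : InD Y) (h0 : ¬ IsZero ((toHo k n).obj Y)) {l : ℤ}
    (hl : l < phiMinus Y) : IsZero ((toHo k n).obj (baricSlice l Y)) :=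
  not_not.mp fun h => absurd ((isLeast_phiMinus hY h0).2 h) (not_le.mpr hl)

theorem ac_of_phiPlus_lt (hY : InD Y) (h0 : ¬ IsZero ((toHo k n).obj Y)) {l : ℤ}
    (hl : phiPlus Y < l) (j : Fin n) : Ac Y j (-l) :=
  ac_of_slices (ac_of_isZero (isZero_slice_of_phiPlus_lt hY h0 (by omega)) j _)
    (ac_of_isZero (isZero_slice_of_phiPlus_lt hY h0 hl) j _)

theorem ac_of_lt_phiMinus (hY : InD Y) (h0 : ¬ IsZero ((toHo k n).obj Y)) {l : ℤ}
    (hl : l < phiMinus Y) (j : Fin n) : Ac Y j (1 - l) := by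
  have := ac_of_slices (Y := Y) (l := l - 1)
    (ac_of_isZero (isZero_slice_of_lt_phiMinus hY h0 (by omega)) j _)
    (ac_of_isZero (isZero_slice_of_lt_phiMinus hY h0 (by omega)) j _)
  rwa [neg_sub] at this

/-- In degree `-φ_+` no slice above the top one interferes, so the vanishing condition on `Y` is a
condition on its top slice. -/
theorem ac_phiPlus_iff (hY : InD Y) (h0 : ¬ IsZero ((toHo k n).obj Y)) (j : Fin n) :
    Ac Y j (-phiPlus Y) ↔ Ac (baricSlice (phiPlus Y) Y) j (-phiPlus Y) :=
  ac_iff_slice_bot (ac_of_isZero (isZero_slice_of_phiPlus_lt hY h0 (by omega)) j _)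

theorem ac_phiMinus_iff (hY : InD Y) (h0 : ¬ IsZero ((toHo k n).obj Y)) (j : Fin n) :
    Ac Y j (1 - phiMinus Y) ↔ Ac (baricSlice (phiMinus Y) Y) j (1 - phiMinus Y) := by
  have := ac_iff_slice_top (Y := Y) (l := phiMinus Y - 1)
    (ac_of_isZero (isZero_slice_of_lt_phiMinus hY h0 (by omega)) j _)
  rwa [neg_sub, sub_add_cancel] at this

theorem exists_not_ac_phiPlus (hY : InD Y) (h0 : ¬ IsZero ((toHo k n).obj Y)) :
    ∃ j, ¬ Ac Y j (-phiPlus Y) := by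
  by_contra! h
  exact (isGreatest_phiPlus hY h0).1 ((isZero_slice_iff_bot hY).mpr fun j =>
    (ac_phiPlus_iff hY h0 j).mp (h j))

theorem exists_not_ac_phiMinus (hY : InD Y) (h0 : ¬ IsZero ((toHo k n).obj Y)) :
    ∃ j, ¬ Ac Y j (1 - phiMinus Y) := by
  by_contra! h
  exact (isLeast_phiMinus hY h0).1 ((isZero_slice_iff_top hY).mpr fun j =>
    (ac_phiMinus_iff hY h0 j).mp (h j))

theorem nonInj_phiPlus (hY : InD Y) (h0 : ¬ IsZero ((toHo k n).obj Y)) {i p : Fin n}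
    (h : NonInj (baricSlice (phiPlus Y) Y) i p (-phiPlus Y)) : NonInj Y i p (-phiPlus Y) :=
  nonInj_of_slice (ac_of_isZero (isZero_slice_of_phiPlus_lt hY h0 (by omega)) i _)
    (ac_of_isZero (isZero_slice_of_phiPlus_lt hY h0 (by omega)) p _) h

theorem nonSurj_phiMinus (hY : InD Y) (h0 : ¬ IsZero ((toHo k n).obj Y)) {i p : Fin n}
    (h : NonSurj (baricSlice (phiMinus Y) Y) i p (1 - phiMinus Y)) :
    NonSurj Y i p (1 - phiMinus Y) := by
  have := nonSurj_of_slice (Y := Y) (i := i) (p := p) (l := phiMinus Y - 1)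
    (ac_of_isZero (isZero_slice_of_lt_phiMinus hY h0 (by omega)) i _)
    (ac_of_isZero (isZero_slice_of_lt_phiMinus hY h0 (by omega)) p _)
  rw [neg_sub, sub_add_cancel] at this
  exact this h

end Cpx

end Zigzag

end

noncomputable section

open CategoryTheory CategoryTheory.Limits TensorProduct

namespace Zigzag

universe u

/-! ### Coordinates on `A e_i ⊗ e_i M` -/

namespace GrMod

variable {k : Type u} [Field k] {n : ℕ}

/-- The inclusion of `P_i` in the algebra. -/
def incl (i : Fin n) : (P k i).carrier →ₗ[Alg k n] Alg k n :=
  (Submodule.span (Alg k n) {idem k n i}).subtype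

/-- The map `A e_i ⊗ e_i M → M` given by a functional on the first factor. -/
def contr (i : Fin n) (M : GrMod k n) (θ : Alg k n →ₗ[k] k) :
    (tensorObj i M).carrier →ₗ[k] M.carrier :=
  TensorProduct.lift (((LinearMap.lsmul k M.carrier).compl₂ (corner i M).subtype) ∘ₗ
    (θ ∘ₗ (incl i).restrictScalars k))

/-- The map `M → A e_i ⊗ e_i M`, `x ↦ a e_i ⊗ e_i x`. -/
def tin (i : Fin n) (M : GrMod k n) (a : Alg k n) : M.carrier →ₗ[k] (tensorObj i M).carrier :=
  TensorProduct.mk k (P k i).carrier (corner i M) (toP i a) ∘ₗ toCorner i M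

theorem tin_add (i : Fin n) (M : GrMod k n) (a b : Alg k n) (x : M) :
    tin i M (a + b) x = tin i M a x + tin i M b x := by
  change toP i (a + b) ⊗ₜ[k] _ = toP i a ⊗ₜ[k] _ + toP i b ⊗ₜ[k] _
  rw [map_add, TensorProduct.add_tmul]
  rfl

theorem tin_smul (i : Fin n) (M : GrMod k n) (c : k) (a : Alg k n) (x : M) :
    tin i M (c • a) x = tin i M a (c • x) := by
  change toP i (c • a) ⊗ₜ[k] toCorner i M x = toP i a ⊗ₜ[k] toCorner i M (c • x)
  rw [LinearMap.map_smul_of_tower, map_smul, TensorProduct.smul_tmul]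

theorem smul_tin (i : Fin n) (M : GrMod k n) (a b : Alg k n) (x : M) :
    b • tin i M a x = tin i M (b * a) x := by
  change (b • toP i a) ⊗ₜ[k] _ = toP i (b * a) ⊗ₜ[k] _
  rw [← map_smul, smul_eq_mul]

theorem tmul_eq_tin (i : Fin n) (M : GrMod k n) (v : (P k i).carrier) (w : corner i M) :
    (v ⊗ₜ[k] w : (P k i).carrier ⊗[k] corner i M) = tin i M (incl i v) w.1 := by
  have h1 : toP i (incl i v) = v := Subtype.ext (pval_mul_idem i 0 v)
  have h2 : toCorner i M w.1 = w := by
    obtain ⟨_, m, rfl⟩ := w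
    refine Subtype.ext ?_
    change idem k n i • idem k n i • m = idem k n i • m
    rw [smul_smul, idem_mul_self]
  change _ = toP i (incl i v) ⊗ₜ[k] toCorner i M w.1
  rw [h1, h2]

theorem contr_tin (i : Fin n) (M : GrMod k n) (θ : Alg k n →ₗ[k] k) (a : Alg k n) (x : M) :
    contr i M θ (tin i M a x) = θ (a * idem k n i) • idem k n i • x := rfl

theorem tensor_induction {i : Fin n} {M : GrMod k n} {p : (tensorObj i M).carrier → Prop}
    (h0 : p 0) (hadd : ∀ s t, p s → p t → p (s + t))
    (ht : ∀ a x, a * idem k n i = a → idem k n i • x = x → p (tin i M a x))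
    (t : (tensorObj i M).carrier) : p t := by
  induction t using TensorProduct.induction_on with
  | zero => exact h0
  | add a b ha hb => exact hadd a b ha hb
  | tmul v w =>
    rw [tmul_eq_tin]
    refine ht _ _ (pval_mul_idem i 0 v) ?_
    obtain ⟨_, m, rfl⟩ := w
    change idem k n i • idem k n i • m = idem k n i • m
    rw [smul_smul, idem_mul_self]

theorem tensorMap_tin {i : Fin n} {M N : GrMod k n} (f : M ⟶ N) (a : Alg k n) (x : M) :
    Hom.lin (tensorMap i f) (tin i M a x) = tin i N a (Hom.lin f x) := by
  change toP i a ⊗ₜ[k] cornerMap i f (toCorner i M x) = toP i a ⊗ₜ[k] toCorner i N (Hom.lin f x)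
  congr 1
  exact Subtype.ext (map_smul (Hom.lin f) _ _)

theorem contr_tensorMap {i : Fin n} {M N : GrMod k n} (f : M ⟶ N) (θ : Alg k n →ₗ[k] k)
    (t : (tensorObj i M).carrier) :
    contr i N θ (Hom.lin (tensorMap i f) t) = Hom.lin f (contr i M θ t) := by
  refine tensor_induction (p := fun t => contr i N θ (Hom.lin (tensorMap i f) t) =
    Hom.lin f (contr i M θ t)) (by simp only [map_zero])
    (fun s t hs ht => by simp only [map_add, hs, ht]) (fun a x _ _ => ?_) t
  rw [tensorMap_tin, contr_tin, contr_tin, LinearMap.map_smul_of_tower, map_smul]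

theorem idem_smul_contr (i : Fin n) (M : GrMod k n) (θ : Alg k n →ₗ[k] k)
    (t : (tensorObj i M).carrier) : idem k n i • contr i M θ t = contr i M θ t := by
  refine tensor_induction (p := fun t => idem k n i • contr i M θ t = contr i M θ t)
    (by simp only [map_zero, smul_zero])
    (fun s t hs ht => by rw [map_add, smul_add, hs, ht]) (fun a x _ _ => ?_) t
  rw [contr_tin, smul_algebra_smul_comm, smul_smul, idem_mul_self]

/-- Expanding the first tensor factor in the two paths from `j` to `i` exhibits the part at `j` as
two copies of `e_i M`. -/
theorem idem_smul_eq (i j : Fin n) (M : GrMod k n) (t : (tensorObj i M).carrier) :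
    idem k n j • t = tin i M (pathZero k j i) (contr i M (coeffZero i j) t) +
      tin i M (pathOne k j i) (contr i M (coeffOne i j) t) := by
  refine tensor_induction (p := fun t => idem k n j • t =
    tin i M (pathZero k j i) (contr i M (coeffZero i j) t) +
      tin i M (pathOne k j i) (contr i M (coeffOne i j) t)) (by simp only [map_zero, smul_zero,
        add_zero])
    (fun s t hs ht => by rw [smul_add, hs, ht]; simp only [map_add]; abel) (fun a x ha hx => ?_) t
  rw [smul_tin, contr_tin, contr_tin, ha, hx, ← tin_smul, ← tin_smul, ← tin_add,
    ← idem_mul_mul_idem, ha]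

theorem contr_mem {i : Fin n} {M : GrMod k n} {θ : Alg k n →ₗ[k] k} {e : ℤ}
    (hθ : ∀ d, d ≠ e → ∀ a ∈ algDeg k n d, θ a = 0) {d : ℤ} {t : (tensorObj i M).carrier}
    (ht : t ∈ (tensorObj i M).deg d) : contr i M θ t ∈ part i (d - e) M := by
  refine ⟨?_, idem_smul_contr i M θ t⟩
  refine (Submodule.span_le (p := (M.deg (d - e)).comap (contr i M θ))).mpr ?_ ht
  rintro _ ⟨b, c, rfl, v, hv, w, hw, rfl⟩
  change θ (incl i v) • w.1 ∈ M.deg (b + c - e)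
  by_cases hb : b = e
  · subst hb
    rw [add_sub_cancel_left]
    exact Submodule.smul_mem _ _ hw
  · have : θ (incl i v) = 0 := hθ b hb _ hv
    rw [this, zero_smul]
    exact Submodule.zero_mem _

theorem contr_zero_mem {i j : Fin n} {M : GrMod k n} {d : ℤ} {t : (tensorObj i M).carrier}
    (ht : t ∈ (tensorObj i M).deg d) : contr i M (coeffZero i j) t ∈ part i d M := by
  have := contr_mem (θ := coeffZero i j) (e := 0) (fun d hd a ha => (coeff_of_mem ha i j).1 hd) ht
  rwa [sub_zero] at this

theorem contr_one_mem {i j : Fin n} {M : GrMod k n} {d : ℤ} {t : (tensorObj i M).carrier}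
    (ht : t ∈ (tensorObj i M).deg d) : contr i M (coeffOne i j) t ∈ part i (d - 1) M :=
  contr_mem (fun d hd a ha => (coeff_of_mem ha i j).2 hd) ht

theorem tin_mem_deg {i : Fin n} {M : GrMod k n} {d e : ℤ} {a : Alg k n} {x : M}
    (ha : a ∈ algDeg k n e) (hx : x ∈ M.deg d) : tin i M a x ∈ (tensorObj i M).deg (e + d) := by
  change toP i a ⊗ₜ[k] toCorner i M x ∈ tensorDeg (P k i).deg (cornerDeg i M) (e + d)
  refine Submodule.subset_span ⟨e, d, rfl, toP i a, ?_, toCorner i M x, ?_, rfl⟩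
  · have := algDeg_mul ha (idem_mem i)
    rwa [add_zero] at this
  · exact idem_smul_mem i M hx

theorem tin_zero_mem {i : Fin n} (j : Fin n) {M : GrMod k n} {d : ℤ} {x : M}
    (hx : x ∈ M.deg d) : tin i M (pathZero k j i) x ∈ part j d (tensorObj i M) := by
  refine ⟨?_, by rw [smul_tin, idem_mul_pathZero, if_pos rfl]⟩
  have := tin_mem_deg (i := i) (pathZero_mem j i) hx
  rwa [zero_add] at this

theorem tin_one_mem {i : Fin n} (j : Fin n) {M : GrMod k n} {d : ℤ} {x : M}
    (hx : x ∈ M.deg (d - 1)) : tin i M (pathOne k j i) x ∈ part j d (tensorObj i M) := by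
  refine ⟨?_, by rw [smul_tin, idem_mul_pathOne, if_pos rfl]⟩
  have := tin_mem_deg (i := i) (pathOne_mem j i) hx
  rwa [add_sub_cancel] at this

theorem contr_zero_tin {i j : Fin n} {M : GrMod k n} {d : ℤ} {x : M} (hx : x ∈ part i d M) :
    contr i M (coeffZero i j) (tin i M (pathZero k j i) x) = x := by
  rw [contr_tin, pathZero_mul_idem, if_pos rfl, coeffZero_pathZero, if_pos ⟨rfl, rfl⟩, one_smul,
    hx.2]

theorem contr_one_tin {i j : Fin n} {M : GrMod k n} {d : ℤ} {x : M} (hx : x ∈ part i d M) :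
    contr i M (coeffOne i j) (tin i M (pathOne k j i) x) = x := by
  rw [contr_tin, pathOne_mul_idem, if_pos rfl, coeffOne_pathOne, if_pos ⟨rfl, rfl⟩, one_smul,
    hx.2]

theorem contr_zero_tin_one (i j : Fin n) (M : GrMod k n) (x : M) :
    contr i M (coeffZero i j) (tin i M (pathOne k j i) x) = 0 := by
  rw [contr_tin, pathOne_mul_idem, if_pos rfl, coeffZero_pathOne, zero_smul]

theorem contr_one_tin_zero (i j : Fin n) (M : GrMod k n) (x : M) :
    contr i M (coeffOne i j) (tin i M (pathZero k j i) x) = 0 := by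
  rw [contr_tin, pathZero_mul_idem, if_pos rfl, coeffOne_pathZero, zero_smul]

theorem counitLin_tin (i : Fin n) (M : GrMod k n) (a : Alg k n) (x : M) :
    counitLin i M (tin i M a x) = (a * idem k n i) • x := by
  change (a * idem k n i) • idem k n i • x = _
  rw [smul_smul, mul_assoc, idem_mul_self]

theorem counit_eq {i j : Fin n} {M : GrMod k n} {d : ℤ} {t : (tensorObj i M).carrier}
    (ht : t ∈ part j d (tensorObj i M)) : Hom.lin ((counit i).app M) t =
      pathZero k j i • contr i M (coeffZero i j) t + pathOne k j i • contr i M (coeffOne i j) t := by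
  conv_lhs => rw [← ht.2, idem_smul_eq]
  change counitLin i M _ = _
  rw [map_add, counitLin_tin, counitLin_tin, pathZero_mul_idem, if_pos rfl, pathOne_mul_idem,
    if_pos rfl]

/-- For `l ≠ i` the two letters are the paths of degree 0 and 1 from `l` to `i`, each paired with
its dual, and the loop and `e_i` play the same role for `l = i`. In this form the sum runs over dual
bases. -/
theorem unitBase_eq (i : Fin n) (M : GrMod k n) (m : M) : unitBase i M m =
    ∑ l, (tin i M (pathZero k l i) (pathOne k i l • m) +
      tin i M (pathOne k l i) (pathZero k i l • m)) := by
  rw [unitBase_apply, Fintype.sum_eq_add_sum_subtype_ne _ i, Fintype.sum_prod_type,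
    Finset.sum_comm]
  congr 1
  · rw [pathZero_self, pathOne_self, add_comm]
    rfl
  · refine Finset.sum_congr rfl fun l _ => ?_
    have hl : l.1 ≠ i := l.2
    have hs : ∀ f : Letter → (tensorObj i M).carrier, ∑ c, f c = f .x + f .y := fun f => by
      change ∑ c ∈ ({Letter.x, Letter.y} : Finset Letter), f c = _
      exact Finset.sum_pair (by decide)
    refine (hs _).trans ?_
    rcases lt_or_gt_of_ne hl with h | h
    · rw [add_comm]
      simp only [pathZero, pathOne, letterZero, letterOne, dif_neg hl, dif_neg hl.symm, if_pos h,
        if_neg h.not_gt]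
      rfl
    · simp only [pathZero, pathOne, letterZero, letterOne, dif_neg hl, dif_neg hl.symm, if_pos h,
        if_neg h.not_gt]
      rfl

theorem contr_zero_unit {i j : Fin n} {M : GrMod k n} {d : ℤ} {m : M} (hm : m ∈ part j d M) :
    contr i M (coeffZero i j) (unitBase i M m) = pathOne k i j • m := by
  rw [unitBase_eq, map_sum, Finset.sum_eq_single j]
  · rw [map_add, contr_zero_tin (pathOne_smul_mem i hm), contr_zero_tin_one, add_zero]
  · intro l _ hl
    rw [← hm.2, smul_smul, smul_smul, pathOne_mul_idem, pathZero_mul_idem, if_neg (Ne.symm hl),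
      if_neg (Ne.symm hl), zero_smul, map_zero, map_zero, add_zero, map_zero]
  · simp

theorem contr_one_unit {i j : Fin n} {M : GrMod k n} {d : ℤ} {m : M} (hm : m ∈ part j d M) :
    contr i M (coeffOne i j) (unitBase i M m) = pathZero k i j • m := by
  rw [unitBase_eq, map_sum, Finset.sum_eq_single j]
  · rw [map_add, contr_one_tin (pathZero_smul_mem i hm), contr_one_tin_zero, zero_add]
  · intro l _ hl
    rw [← hm.2, smul_smul, smul_smul, pathOne_mul_idem, pathZero_mul_idem, if_neg (Ne.symm hl),
      if_neg (Ne.symm hl), zero_smul, map_zero, map_zero, add_zero, map_zero]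
  · simp

end GrMod

namespace Cpx

open GrMod CochainComplex

variable {k : Type u} [Field k] {n : ℕ}

/-! ### Homology of mapping cones -/

section Cone

variable {Y Z : Cpx k n} (φ : Y ⟶ Z)

/-- The components of an element of a mapping cone. -/
def coneFst (m : ℤ) : (mappingCone φ).X m ⟶ Y.X (m + 1) := (mappingCone.fst φ).1.v m (m + 1) rfl

/-- The components of an element of a mapping cone. -/
def coneSnd (m : ℤ) : (mappingCone φ).X m ⟶ Z.X m := (mappingCone.snd φ).v m m (add_zero m)

/-- The inclusions of the components in a mapping cone. -/
def coneInl (m : ℤ) : Y.X (m + 1) ⟶ (mappingCone φ).X m :=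
  (mappingCone.inl φ).v (m + 1) m (by omega)

/-- The inclusions of the components in a mapping cone. -/
def coneInr (m : ℤ) : Z.X m ⟶ (mappingCone φ).X m := (mappingCone.inr φ).f m

theorem cone_eq (m : ℤ) (c : (mappingCone φ).X m) :
    Hom.lin (coneInl φ m) (Hom.lin (coneFst φ m) c) +
      Hom.lin (coneInr φ m) (Hom.lin (coneSnd φ m) c) = c :=
  LinearMap.congr_fun (congrArg Hom.lin (mappingCone.id_X φ m (m + 1) rfl)) c

theorem coneFst_inl (m : ℤ) (y : Y.X (m + 1)) :
    Hom.lin (coneFst φ m) (Hom.lin (coneInl φ m) y) = y :=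
  LinearMap.congr_fun (congrArg Hom.lin (mappingCone.inl_v_fst_v φ (m + 1) m rfl)) y

theorem coneSnd_inl (m : ℤ) (y : Y.X (m + 1)) :
    Hom.lin (coneSnd φ m) (Hom.lin (coneInl φ m) y) = 0 :=
  LinearMap.congr_fun (congrArg Hom.lin (mappingCone.inl_v_snd_v φ (m + 1) m (by omega))) y

theorem coneFst_inr (m : ℤ) (z : Z.X m) :
    Hom.lin (coneFst φ m) (Hom.lin (coneInr φ m) z) = 0 :=
  LinearMap.congr_fun (congrArg Hom.lin (mappingCone.inr_f_fst_v φ m (m + 1) rfl)) z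

theorem coneSnd_inr (m : ℤ) (z : Z.X m) :
    Hom.lin (coneSnd φ m) (Hom.lin (coneInr φ m) z) = z :=
  LinearMap.congr_fun (congrArg Hom.lin (mappingCone.inr_f_snd_v φ m)) z

theorem coneFst_dl (m : ℤ) (c : (mappingCone φ).X m) :
    Hom.lin (coneFst φ (m + 1)) (dl _ m c) = -dl Y (m + 1) (Hom.lin (coneFst φ m) c) :=
  LinearMap.congr_fun (congrArg Hom.lin
    (mappingCone.d_fst_v φ m (m + 1) (m + 1 + 1) rfl rfl)) c

theorem coneSnd_dl (m : ℤ) (c : (mappingCone φ).X m) :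
    Hom.lin (coneSnd φ (m + 1)) (dl _ m c) = Hom.lin (φ.f (m + 1)) (Hom.lin (coneFst φ m) c) +
      dl Z m (Hom.lin (coneSnd φ m) c) :=
  LinearMap.congr_fun (congrArg Hom.lin (mappingCone.d_snd_v φ m (m + 1) rfl)) c

theorem cone_ext {m : ℤ} {c c' : (mappingCone φ).X m}
    (h : Hom.lin (coneFst φ m) c = Hom.lin (coneFst φ m) c')
    (h' : Hom.lin (coneSnd φ m) c = Hom.lin (coneSnd φ m) c') : c = c' := by
  rw [← cone_eq φ m c, h, h', cone_eq]

variable {φ}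

/-- The differential of the cone is `(y, z) ↦ (-d y, φ y + d z)`. -/
theorem cone_ac_iff {j : Fin n} {d : ℤ} : Ac (mappingCone φ) j d ↔
    ∀ m, ∀ y ∈ part j d (Y.X (m + 1 + 1)), ∀ z ∈ part j d (Z.X (m + 1)),
      dl Y (m + 1 + 1) y = 0 → Hom.lin (φ.f (m + 1 + 1)) y + dl Z (m + 1) z = 0 →
      ∃ y' ∈ part j d (Y.X (m + 1)), ∃ z' ∈ part j d (Z.X m),
        dl Y (m + 1) y' = -y ∧ Hom.lin (φ.f (m + 1)) y' + dl Z m z' = z := by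
  constructor
  · intro h m y hy z hz hy' hyz
    obtain ⟨c, hc, hc'⟩ := h m (Hom.lin (coneInl φ _) y + Hom.lin (coneInr φ _) z)
      (Submodule.add_mem _ (lin_mem_part _ hy) (lin_mem_part _ hz)) (cone_ext φ (by
        rw [coneFst_dl, map_add, coneFst_inl, coneFst_inr, add_zero, hy', neg_zero, map_zero]) (by
        rw [coneSnd_dl, map_add, coneFst_inl, coneFst_inr, add_zero, map_add, coneSnd_inl,
          coneSnd_inr, zero_add, hyz, map_zero]))
    refine ⟨_, lin_mem_part (coneFst φ m) hc, _, lin_mem_part (coneSnd φ m) hc, ?_, ?_⟩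
    · rw [← neg_eq_iff_eq_neg, ← coneFst_dl, hc', map_add, coneFst_inl, coneFst_inr, add_zero]
    · rw [← coneSnd_dl, hc', map_add, coneSnd_inl, coneSnd_inr, zero_add]
  · intro h m c hc hc'
    obtain ⟨y, hy, z, hz, hy', hyz⟩ := h m _ (lin_mem_part (coneFst φ (m + 1)) hc) _
      (lin_mem_part (coneSnd φ (m + 1)) hc)
      (by rw [← neg_eq_zero, ← coneFst_dl, hc', map_zero]) (by rw [← coneSnd_dl, hc', map_zero])
    refine ⟨Hom.lin (coneInl φ _) y + Hom.lin (coneInr φ _) z,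
      Submodule.add_mem _ (lin_mem_part _ hy) (lin_mem_part _ hz), cone_ext φ ?_ ?_⟩
    · rw [coneFst_dl, map_add, coneFst_inl, coneFst_inr, add_zero, hy', neg_neg]
    · rw [coneSnd_dl, map_add, coneFst_inl, coneFst_inr, add_zero, map_add, coneSnd_inl,
        coneSnd_inr, zero_add, hyz]

theorem cone_ac_iff_left {j : Fin n} {d : ℤ} (h : Ac Z j d) :
    Ac (mappingCone φ) j d ↔ Ac Y j d := by
  rw [cone_ac_iff]
  constructor
  · intro hc m y hy hy'
    obtain ⟨m, rfl⟩ : ∃ m', m = m' + 1 := ⟨m - 1, by omega⟩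
    obtain ⟨z, hz, hz'⟩ := h (m + 1) (-Hom.lin (φ.f _) y) (Submodule.neg_mem _ (lin_mem_part _ hy))
      (by rw [map_neg, ← comp_dl, hy', map_zero, neg_zero])
    obtain ⟨y', hy'', -, -, hyy, -⟩ := hc m y hy z hz hy' (by rw [hz', add_neg_cancel])
    exact ⟨-y', Submodule.neg_mem _ hy'', by rw [map_neg, hyy, neg_neg]⟩
  · intro hY m y hy z hz hy' hyz
    obtain ⟨y', hy'', hyy⟩ := hY _ (-y) (Submodule.neg_mem _ hy) (by rw [map_neg, hy', neg_zero])
    obtain ⟨z', hz', hzz⟩ := h m (z - Hom.lin (φ.f _) y') (Submodule.sub_mem _ hz (lin_mem_part _ hy''))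
      (by rw [map_sub, ← comp_dl, hyy, map_neg, sub_neg_eq_add]; exact (add_comm _ _).trans hyz)
    exact ⟨y', hy'', z', hz', hyy, by rw [hzz, add_sub_cancel]⟩

theorem cone_ac_iff_right {j : Fin n} {d : ℤ} (h : Ac Y j d) :
    Ac (mappingCone φ) j d ↔ Ac Z j d := by
  refine ⟨fun hc m z hz hz' => ?_, fun hZ => (cone_ac_iff_left hZ).mpr h⟩
  rw [cone_ac_iff] at hc
  obtain ⟨m, rfl⟩ : ∃ m', m = m' + 1 := ⟨m - 1, by omega⟩
  obtain ⟨y, hy, w, hw, hy', hyw⟩ := hc (m + 1) 0 (Submodule.zero_mem _) z hz (map_zero _)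
    (by rw [map_zero, hz', add_zero])
  obtain ⟨x, hx, hx'⟩ := h _ y hy (by rw [hy', neg_zero])
  refine ⟨Hom.lin (φ.f _) x + w, Submodule.add_mem _ (lin_mem_part _ hx) hw, ?_⟩
  rw [map_add, ← comp_dl, hx', hyw]

end Cone

/-! ### Homology of `Σ_i` and its inverse -/

section Sigma

variable {Y : Cpx k n} {i j : Fin n} {d : ℤ}

/-- The complex `A e_i ⊗ e_i Y`. -/
abbrev TC (i : Fin n) (Y : Cpx k n) : Cpx k n :=
  ((tensor i).mapHomologicalComplex (ComplexShape.up ℤ)).obj Y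

/-- The complex `A e_i ⊗ e_i Y⟨1⟩`. -/
abbrev TC1 (i : Fin n) (Y : Cpx k n) : Cpx k n :=
  ((tensor i ⋙ shift 1).mapHomologicalComplex (ComplexShape.up ℤ)).obj Y

/-- Coordinates on a complex `T` whose part at each vertex is the sum of two copies of `e_i Y`, with
internal degrees shifted by `e` and `e - 1`. -/
structure Coord (i : Fin n) (Y T : Cpx k n) (e : ℤ) where
  /-- The first coordinate at `j`. -/
  c0 (j : Fin n) (m : ℤ) : (T.X m).carrier →ₗ[k] (Y.X m).carrier
  /-- The second coordinate at `j`. -/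
  c1 (j : Fin n) (m : ℤ) : (T.X m).carrier →ₗ[k] (Y.X m).carrier
  /-- The first inclusion at `j`. -/
  t0 (j : Fin n) (m : ℤ) : (Y.X m).carrier →ₗ[k] (T.X m).carrier
  /-- The second inclusion at `j`. -/
  t1 (j : Fin n) (m : ℤ) : (Y.X m).carrier →ₗ[k] (T.X m).carrier
  c0_mem : ∀ {j d m} {t : T.X m}, t ∈ part j d (T.X m) → c0 j m t ∈ part i (d + e) (Y.X m)
  c1_mem : ∀ {j d m} {t : T.X m}, t ∈ part j d (T.X m) → c1 j m t ∈ part i (d + e - 1) (Y.X m)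
  t0_mem : ∀ {j d m} {x : Y.X m}, x ∈ part i (d + e) (Y.X m) → t0 j m x ∈ part j d (T.X m)
  t1_mem : ∀ {j d m} {x : Y.X m}, x ∈ part i (d + e - 1) (Y.X m) → t1 j m x ∈ part j d (T.X m)
  c0_dl : ∀ {j m} (t : T.X m), c0 j (m + 1) (dl T m t) = dl Y m (c0 j m t)
  c1_dl : ∀ {j m} (t : T.X m), c1 j (m + 1) (dl T m t) = dl Y m (c1 j m t)
  dl_t0 : ∀ {j m} (x : Y.X m), dl T m (t0 j m x) = t0 j (m + 1) (dl Y m x)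
  dl_t1 : ∀ {j m} (x : Y.X m), dl T m (t1 j m x) = t1 j (m + 1) (dl Y m x)
  c0_t0 : ∀ {j d m} {x : Y.X m}, x ∈ part i d (Y.X m) → c0 j m (t0 j m x) = x
  c1_t1 : ∀ {j d m} {x : Y.X m}, x ∈ part i d (Y.X m) → c1 j m (t1 j m x) = x
  c0_t1 : ∀ {j m} (x : Y.X m), c0 j m (t1 j m x) = 0
  c1_t0 : ∀ {j m} (x : Y.X m), c1 j m (t0 j m x) = 0
  eq : ∀ {j d m} {t : T.X m}, t ∈ part j d (T.X m) →
    t0 j m (c0 j m t) + t1 j m (c1 j m t) = t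

/-- The coordinates on `A e_i ⊗ e_i Y`. -/
def coordTC (i : Fin n) (Y : Cpx k n) : Coord i Y (TC i Y) 0 where
  c0 j m := contr i (Y.X m) (coeffZero i j)
  c1 j m := contr i (Y.X m) (coeffOne i j)
  t0 j m := tin i (Y.X m) (pathZero k j i)
  t1 j m := tin i (Y.X m) (pathOne k j i)
  c0_mem {j d m t} ht := by rw [add_zero]; exact contr_zero_mem ht.1
  c1_mem {j d m t} ht := by rw [add_zero]; exact contr_one_mem ht.1
  t0_mem {j d m x} hx := by rw [add_zero] at hx; exact tin_zero_mem j hx.1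
  t1_mem {j d m x} hx := by rw [add_zero] at hx; exact tin_one_mem j hx.1
  c0_dl t := contr_tensorMap _ _ _
  c1_dl t := contr_tensorMap _ _ _
  dl_t0 x := tensorMap_tin _ _ _
  dl_t1 x := tensorMap_tin _ _ _
  c0_t0 hx := contr_zero_tin hx
  c1_t1 hx := contr_one_tin hx
  c0_t1 x := contr_zero_tin_one _ _ _ _
  c1_t0 x := contr_one_tin_zero _ _ _ _
  eq ht := (idem_smul_eq _ _ _ _).symm.trans ht.2

/-- The coordinates on `A e_i ⊗ e_i Y⟨1⟩`. -/
def coordTC1 (i : Fin n) (Y : Cpx k n) : Coord i Y (TC1 i Y) 1 where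
  c0 j m := contr i (Y.X m) (coeffZero i j)
  c1 j m := contr i (Y.X m) (coeffOne i j)
  t0 j m := tin i (Y.X m) (pathZero k j i)
  t1 j m := tin i (Y.X m) (pathOne k j i)
  c0_mem {j d m t} ht := contr_zero_mem ht.1
  c1_mem {j d m t} ht := contr_one_mem ht.1
  t0_mem {j d m x} hx := tin_zero_mem (d := d + 1) j hx.1
  t1_mem {j d m x} hx := tin_one_mem (d := d + 1) j hx.1
  c0_dl t := contr_tensorMap _ _ _
  c1_dl t := contr_tensorMap _ _ _
  dl_t0 x := tensorMap_tin _ _ _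
  dl_t1 x := tensorMap_tin _ _ _
  c0_t0 hx := contr_zero_tin hx
  c1_t1 hx := contr_one_tin hx
  c0_t1 x := contr_zero_tin_one _ _ _ _
  c1_t0 x := contr_one_tin_zero _ _ _ _
  eq ht := (idem_smul_eq _ _ _ _).symm.trans ht.2

/-- The coordinates commute with the differentials, so homology at `j` is the sum of the homologies
of the two copies of `e_i Y`. -/
theorem Coord.ac_iff {T : Cpx k n} {e : ℤ} (c : Coord i Y T e) :
    Ac T j d ↔ Ac Y i (d + e) ∧ Ac Y i (d + e - 1) := by
  refine ⟨fun h => ⟨fun m y hy hy' => ?_, fun m y hy hy' => ?_⟩, fun h m t ht ht' => ?_⟩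
  · obtain ⟨t, ht, ht'⟩ := h m (c.t0 j _ y) (c.t0_mem hy) (by rw [c.dl_t0, hy', map_zero])
    exact ⟨_, c.c0_mem ht, by rw [← c.c0_dl, ht', c.c0_t0 hy]⟩
  · obtain ⟨t, ht, ht'⟩ := h m (c.t1 j _ y) (c.t1_mem hy) (by rw [c.dl_t1, hy', map_zero])
    exact ⟨_, c.c1_mem ht, by rw [← c.c1_dl, ht', c.c1_t1 hy]⟩
  · obtain ⟨x, hx, hx'⟩ := h.1 m _ (c.c0_mem ht) (by rw [← c.c0_dl, ht', map_zero])
    obtain ⟨y, hy, hy'⟩ := h.2 m _ (c.c1_mem ht) (by rw [← c.c1_dl, ht', map_zero])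
    refine ⟨c.t0 j _ x + c.t1 j _ y, Submodule.add_mem _ (c.t0_mem hx) (c.t1_mem hy), ?_⟩
    rw [map_add, c.dl_t0, c.dl_t1, hx', hy', c.eq ht]

theorem ac_tensor_iff : Ac (TC i Y) j d ↔ Ac Y i d ∧ Ac Y i (d - 1) := by
  have := (coordTC i Y).ac_iff (j := j) (d := d)
  rwa [add_zero] at this

theorem ac_tensor_shift_iff : Ac (TC1 i Y) j d ↔ Ac Y i (d + 1) ∧ Ac Y i d := by
  have := (coordTC1 i Y).ac_iff (j := j) (d := d)
  rwa [add_sub_cancel_right] at this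

theorem c0_unit {m : ℤ} {y : Y.X m} (hy : y ∈ part j d (Y.X m)) :
    (coordTC1 i Y).c0 j m (Hom.lin ((unitMap i Y).f m) y) = pathOne k i j • y :=
  contr_zero_unit hy

theorem c1_unit {m : ℤ} {y : Y.X m} (hy : y ∈ part j d (Y.X m)) :
    (coordTC1 i Y).c1 j m (Hom.lin ((unitMap i Y).f m) y) = pathZero k i j • y :=
  contr_one_unit hy

theorem counit_apply {m : ℤ} {t : (TC i Y).X m} (ht : t ∈ part j d ((TC i Y).X m)) :
    Hom.lin ((counitMap i Y).f m) t =
      pathZero k j i • (coordTC i Y).c0 j m t + pathOne k j i • (coordTC i Y).c1 j m t :=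
  counit_eq ht

/-- At the vertex `i` the second coordinate of the unit is the identity of `e_i Y` in degree `d`. It
cancels the source against the second copy, and only the copy in degree `d + 1` remains. -/
theorem ac_unitCone (h : Ac Y i (d + 1)) : Ac (mappingCone (unitMap i Y)) i d := by
  rw [cone_ac_iff]
  intro m y hy z hz hy' hyz
  generalize hc : coordTC1 i Y = c
  have u0 : ∀ {m : ℤ} {y : Y.X m}, y ∈ part i d (Y.X m) →
    c.c0 i m (Hom.lin ((unitMap i Y).f m) y) = pathOne k i i • y := by subst hc; exact c0_unit
  have u1 : ∀ {m : ℤ} {y : Y.X m}, y ∈ part i d (Y.X m) →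
      c.c1 i m (Hom.lin ((unitMap i Y).f m) y) = y := by
    subst hc
    intro m y hy
    rw [c1_unit hy, pathZero_self, hy.2]
  have hz0 := c.c0_mem hz
  have hz1 := c.c1_mem hz
  rw [add_sub_cancel_right] at hz1
  have e0 := congrArg (c.c0 i _) hyz
  have e1 := congrArg (c.c1 i _) hyz
  rw [map_add, u0 hy, c.c0_dl, map_zero] at e0
  rw [map_add, u1 hy, c.c1_dl, map_zero] at e1
  obtain ⟨x, hx, hx'⟩ := h m (c.c0 i _ z - pathOne k i i • c.c1 i _ z)
    (Submodule.sub_mem _ hz0 (pathOne_smul_mem i hz1)) (by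
      rw [map_sub, dl_smul, ← neg_eq_of_add_eq_zero_right e1, smul_neg, sub_neg_eq_add]
      exact (add_comm _ _).trans e0)
  refine ⟨_, hz1, c.t0 i _ x, c.t0_mem hx, (neg_eq_of_add_eq_zero_right e1).symm, ?_⟩
  have hmem : Hom.lin ((unitMap i Y).f (m + 1)) (c.c1 i _ z) + dl _ m (c.t0 i _ x) ∈
      part i d ((TC1 i Y).X (m + 1)) :=
    Submodule.add_mem _ (lin_mem_part _ hz1) (dl_mem (c.t0_mem hx))
  rw [← c.eq hmem]
  refine Eq.trans ?_ (c.eq hz)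
  congr 1
  · rw [map_add, u0 hz1, c.dl_t0, c.c0_t0 (dl_mem hx), hx', add_sub_cancel]
  · rw [map_add, u1 hz1, c.dl_t0, c.c1_t0, add_zero]

/-- A class `w` outside the image, placed in the second coordinate at `l`, is a cycle of the cone.
If it bounded, the second coordinate of the unit, which is the action of the path from `i` to `l`,
would hit the class of `w`. -/
theorem not_ac_unitCone_of_nonSurj {l : Fin n} (h : NonSurj Y i l d) :
    ¬ Ac (mappingCone (unitMap i Y)) l d := by
  rw [cone_ac_iff]
  intro hc
  obtain ⟨m, w, hw, hw', hns⟩ := h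
  have hmem : (coordTC1 i Y).t1 l _ w ∈ part l d ((TC1 i Y).X (m + 1)) :=
    (coordTC1 i Y).t1_mem (by rwa [add_sub_cancel_right])
  obtain ⟨y, hy, z, hz, hy', hyz⟩ := hc m 0 (Submodule.zero_mem _) _ hmem (map_zero _) (by
    rw [map_zero, zero_add, (coordTC1 i Y).dl_t1, hw', map_zero])
  have hz' := (coordTC1 i Y).c1_mem hz
  rw [add_sub_cancel_right] at hz'
  refine hns y hy (by rw [hy', neg_zero]) _ hz' ?_
  rw [← (coordTC1 i Y).c1_dl, ← c1_unit hy, ← map_add, hyz, (coordTC1 i Y).c1_t1 hw]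

/-- At `i` the counit is `c₀ + z c₁`. It maps the first copy of `e_i Y` identically onto the target,
and only the second copy, in degree `d - 1`, remains. -/
theorem ac_counitCone (h : Ac Y i (d - 1)) : Ac (mappingCone (counitMap i Y)) i d := by
  rw [cone_ac_iff]
  intro m y hy z hz hy' hyz
  generalize hc : coordTC i Y = c
  have u : ∀ {m : ℤ} {t : (TC i Y).X m}, t ∈ part i d ((TC i Y).X m) →
      Hom.lin ((counitMap i Y).f m) t = c.c0 i m t + pathOne k i i • c.c1 i m t := by
    subst hc
    intro m t ht
    rw [counit_apply ht, pathZero_self, ((coordTC i Y).c0_mem ht).2]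
  have h0 := c.c0_mem hy
  have h1 := c.c1_mem hy
  rw [add_zero] at h0 h1
  obtain ⟨x1, hx1, hx1'⟩ := h _ (-c.c1 i _ y) (Submodule.neg_mem _ h1)
    (by rw [map_neg, ← c.c1_dl, hy', map_zero, neg_zero])
  rw [u hy] at hyz
  have hb : pathOne k i i • x1 ∈ part i d (Y.X (m + 1)) := by
    have := pathOne_smul_mem i hx1
    rwa [sub_add_cancel] at this
  have hx0 : z - pathOne k i i • x1 ∈ part i d (Y.X (m + 1)) := Submodule.sub_mem _ hz hb
  have hmem : c.t0 i _ (z - pathOne k i i • x1) + c.t1 i _ x1 ∈ part i d ((TC i Y).X (m + 1)) :=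
    Submodule.add_mem _ (c.t0_mem (by rwa [add_zero])) (c.t1_mem (by rwa [add_zero]))
  refine ⟨_, hmem, 0, Submodule.zero_mem _, ?_, ?_⟩
  · rw [map_add, c.dl_t0, c.dl_t1]
    refine Eq.trans ?_ (congrArg _ (c.eq hy))
    rw [neg_add]
    congr 1
    · rw [← map_neg, map_sub, dl_smul, hx1', smul_neg, sub_neg_eq_add]
      congr 1
      rw [eq_neg_iff_add_eq_zero, ← hyz]
      abel
    · rw [hx1', map_neg]
  · rw [map_zero, add_zero, u hmem, map_add, map_add, c.c0_t0 hx0, c.c0_t1, c.c1_t0,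
      c.c1_t1 hx1, add_zero, zero_add, sub_add_cancel]

/-- A class `w` in the kernel, placed in the first coordinate at `l`, together with minus the chain
`x` bounding its image, is a cycle of the cone. A bounding chain would bound `w` itself. -/
theorem not_ac_counitCone_of_nonInj {l : Fin n} (h : NonInj Y i l d) :
    ¬ Ac (mappingCone (counitMap i Y)) l d := by
  rw [cone_ac_iff]
  intro hc
  obtain ⟨m, w, hw, hw', hb, x, hx, hx'⟩ := h
  obtain ⟨m, rfl⟩ : ∃ m', m = m' + 1 := ⟨m - 1, by omega⟩
  have hmem : (coordTC i Y).t0 l _ w ∈ part l d ((TC i Y).X (m + 1 + 1)) :=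
    (coordTC i Y).t0_mem (by rwa [add_zero])
  obtain ⟨y, hy, z, hz, hy', hyz⟩ := hc m _ hmem (-x) (Submodule.neg_mem _ hx)
    (by rw [(coordTC i Y).dl_t0, hw', map_zero]) (by
      rw [counit_apply hmem, map_neg, hx', (coordTC i Y).c0_t0 hw, (coordTC i Y).c1_t0, smul_zero,
        add_zero, add_neg_cancel])
  have hy0 := (coordTC i Y).c0_mem hy
  rw [add_zero] at hy0
  refine hb ⟨-(coordTC i Y).c0 l _ y, Submodule.neg_mem _ hy0, ?_⟩
  rw [map_neg, ← (coordTC i Y).c0_dl, hy', map_neg, neg_neg, (coordTC i Y).c0_t0 hw]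

end Sigma

end Cpx

end Zigzag

end

noncomputable section

open CategoryTheory CategoryTheory.Limits TensorProduct

namespace Zigzag

universe u

namespace GrMod

variable {k : Type u} [Field k] {n : ℕ}

/-! ### Finiteness and projectivity of `A e_i ⊗ e_i M` -/

instance (i : Fin n) : Module.Finite (Alg k n) (P k i).carrier :=
  Module.Finite.of_surjective (toP (k := k) i) fun v => ⟨incl i v, Subtype.ext (pval_mul_idem i 0 v)⟩

instance (i : Fin n) : Module.Projective (Alg k n) (P k i).carrier :=
  Module.Projective.of_split (incl i) (toP i) (LinearMap.ext fun v =>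
    Subtype.ext (pval_mul_idem i 0 v))

theorem finite_base (M : GrMod k n) [Module.Finite (Alg k n) M] : Module.Finite k M :=
  Module.Finite.trans (Alg k n) M.carrier

instance (i : Fin n) (M : GrMod k n) [Module.Finite (Alg k n) M] :
    Module.Finite (Alg k n) (tensorObj i M).carrier := by
  have := finite_base M
  have : Module.Finite k (P k i).carrier := finite_base (P k i)
  have : Module.Finite k (tensorObj i M).carrier :=
    inferInstanceAs (Module.Finite k ((P k i).carrier ⊗[k] corner i M))
  exact Module.Finite.of_restrictScalars_finite k (Alg k n) _

instance (i : Fin n) (M : GrMod k n) : Module.Projective (Alg k n) (tensorObj i M).carrier :=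
  inferInstanceAs (Module.Projective (Alg k n) ((P k i).carrier ⊗[k] corner i M))

end GrMod

namespace Cpx

open GrMod CochainComplex

variable {k : Type u} [Field k] {n : ℕ} {Y Z : Cpx k n}

theorem inD_TC (i : Fin n) (hY : InD Y) : InD (TC i Y) := by
  obtain ⟨⟨a, b, hab⟩, h⟩ := hY
  refine ⟨⟨a, b, fun m hm => (tensor i).map_isZero (hab m hm)⟩, fun m => ?_⟩
  have := (h m).1
  exact ⟨inferInstanceAs (Module.Finite (Alg k n) (tensorObj i (Y.X m)).carrier),
    inferInstanceAs (Module.Projective (Alg k n) (tensorObj i (Y.X m)).carrier)⟩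

theorem inD_TC1 (i : Fin n) (hY : InD Y) : InD (TC1 i Y) := by
  obtain ⟨⟨a, b, hab⟩, h⟩ := hY
  refine ⟨⟨a, b, fun m hm => (tensor i ⋙ shift 1).map_isZero (hab m hm)⟩, fun m => ?_⟩
  have := (h m).1
  exact ⟨inferInstanceAs (Module.Finite (Alg k n) (tensorObj i (Y.X m)).carrier),
    inferInstanceAs (Module.Projective (Alg k n) (tensorObj i (Y.X m)).carrier)⟩

theorem inD_cone (φ : Y ⟶ Z) (hY : InD Y) (hZ : InD Z) : InD (mappingCone φ) := by
  obtain ⟨⟨a, b, hab⟩, h⟩ := hY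
  obtain ⟨⟨a', b', hab'⟩, h'⟩ := hZ
  refine ⟨⟨min (a - 1) a', max b b', fun m hm => (mappingCone.isZero_X_iff φ m).mpr
    ⟨hab _ (by omega), hab' _ (by omega)⟩⟩, fun m => ?_⟩
  have := (h (m + 1)).1
  have := (h (m + 1)).2
  have := (h' m).1
  have := (h' m).2
  have hs : (LinearMap.coprod (Hom.lin (coneInl φ m)) (Hom.lin (coneInr φ m))) ∘ₗ
      (LinearMap.prod (Hom.lin (coneFst φ m)) (Hom.lin (coneSnd φ m))) = LinearMap.id :=
    LinearMap.ext fun c => cone_eq φ m c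
  exact ⟨Module.Finite.of_surjective _ (LinearMap.surjective_of_comp_eq_id _ _ hs),
    Module.Projective.of_split _ _ hs⟩

theorem inD_shift (hY : InD Y) (a : ℤ) : InD (Y⟦a⟧) := by
  obtain ⟨⟨b, c, hbc⟩, h⟩ := hY
  exact ⟨⟨b - a, c - a, fun m hm => hbc (m + a) (by omega)⟩, fun m => h (m + a)⟩

theorem inD_sigma (i : Fin n) (hY : InD Y) : InD (sigma i Y) :=
  inD_shift (inD_cone _ hY (inD_TC1 i hY)) (-1)

theorem inD_sigmaInv (i : Fin n) (hY : InD Y) : InD (sigmaInv i Y) :=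
  inD_cone _ (inD_TC i hY) hY

/-! ### Homological shifts -/

/-- The shift of a complex in the homotopy category. -/
def toHoShift (Y : Cpx k n) (a : ℤ) : (toHo k n).obj (Y⟦a⟧) ≅ ((toHo k n).obj Y)⟦a⟧ :=
  ((toHo k n).commShiftIso a).app Y

/-- Homological shifts of `P_j⟨l⟩`. -/
def spShiftIso (j : Fin n) (l m a : ℤ) : (SP k j l (m + a))⟦a⟧ ≅ SP k j l m :=
  ((CochainComplex.singleFunctors (GrMod k n)).shiftIso a m (m + a) (by omega)).app (PS k j l)

/-- The statement is transported through Hom from the `P_j⟨l⟩`, where the shift functor is full; no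
signs of shifted differentials appear. -/
theorem Ac.shift {j : Fin n} {d : ℤ} (h : Ac Y j d) (a : ℤ) : Ac (Y⟦a⟧) j d := by
  rw [ac_iff_hom] at h ⊢
  intro m f
  obtain ⟨g, hg⟩ := (CategoryTheory.shiftFunctor (HomotopyCategory (GrMod k n) (ComplexShape.up ℤ)) a).map_surjective
    ((toHoShift _ a).inv ≫ ((toHo k n).mapIso (spShiftIso j (-d) m a)).hom ≫ f ≫
      (toHoShift Y a).hom)
  rw [h _ g, Functor.map_zero] at hg
  have := hg.symm
  rwa [Preadditive.IsIso.comp_left_eq_zero, Preadditive.IsIso.comp_left_eq_zero,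
    Preadditive.IsIso.comp_right_eq_zero] at this

theorem ac_shift_iff {j : Fin n} {d : ℤ} (a : ℤ) : Ac (Y⟦a⟧) j d ↔ Ac Y j d :=
  ⟨fun h => (ac_iff_of_iso ((toHo k n).mapIso ((shiftEquiv (Cpx k n) a).unitIso.app Y))).mpr
    (h.shift (-a)), fun h => h.shift a⟩

theorem isZero_shift_iff {C : Type*} [Category C] [HasZeroMorphisms C] [HasShift C ℤ]
    [∀ a : ℤ, (CategoryTheory.shiftFunctor C a).PreservesZeroMorphisms] {X : C} (a : ℤ) :
    IsZero (X⟦a⟧) ↔ IsZero X :=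
  ⟨fun h => ((CategoryTheory.shiftFunctor C (-a)).map_isZero h).of_iso ((shiftEquiv C a).unitIso.app X),
    fun h => (CategoryTheory.shiftFunctor C a).map_isZero h⟩

/-! ### The complexes `P_j⟨l⟩` -/

theorem NonSurj.of_retract {i l : Fin n} {d : ℤ} (h : NonSurj Z i l d) (f : Z ⟶ Y) (r : Y ⟶ Z)
    (hfr : f ≫ r = 𝟙 Z) : NonSurj Y i l d := by
  have hx : ∀ m (z : Z.X m), Hom.lin (r.f m) (Hom.lin (f.f m) z) = z := fun m z =>
    LinearMap.congr_fun (congrArg Hom.lin (HomologicalComplex.congr_hom hfr m)) z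
  obtain ⟨m, w, hw, hw', hns⟩ := h
  refine ⟨m, Hom.lin (f.f _) w, lin_mem_part _ hw, by rw [← comp_dl, hw', map_zero],
    fun y hy hy' x hx' he => hns _ (lin_mem_part (r.f _) hy) (by rw [← comp_dl, hy', map_zero]) _
      (lin_mem_part (r.f _) hx') ?_⟩
  rw [← comp_dl, ← map_smul, ← map_add, ← he, hx]

theorem NonInj.of_retract {i l : Fin n} {d : ℤ} (h : NonInj Z i l d) (f : Z ⟶ Y) (r : Y ⟶ Z)
    (hfr : f ≫ r = 𝟙 Z) : NonInj Y i l d := by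
  have hx : ∀ m (z : Z.X m), Hom.lin (r.f m) (Hom.lin (f.f m) z) = z := fun m z =>
    LinearMap.congr_fun (congrArg Hom.lin (HomologicalComplex.congr_hom hfr m)) z
  obtain ⟨m, y, hy, hy', hb, x, hx', he⟩ := h
  refine ⟨m, Hom.lin (f.f _) y, lin_mem_part _ hy, by rw [← comp_dl, hy', map_zero], ?_,
    Hom.lin (f.f _) x, lin_mem_part _ hx', by rw [← comp_dl, he, map_smul]⟩
  rintro ⟨v, hv, hv'⟩
  exact hb ⟨_, lin_mem_part (r.f _) hv, by rw [← comp_dl, hv', hx]⟩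

section SP

variable (j : Fin n) (l m : ℤ)

/-- The degree of `P_j⟨l⟩` in which it is concentrated. -/
def spIso : (SP k j l m).X m ≅ PS k j l :=
  HomologicalComplex.singleObjXSelf (ComplexShape.up ℤ) m (PS k j l)

/-- The element of `P_j⟨l⟩` given by an element of the algebra. -/
def spElt (a : Alg k n) : (SP k j l m).X m := a • Hom.lin (spIso j l m).inv (topElt k j l)

variable {j l m}

theorem spElt_eq_zero_iff {a : Alg k n} : spElt j l m a = 0 ↔ a * idem k n j = 0 := by
  have h : Hom.lin (spIso j l m).hom (spElt j l m a) = a • topElt k j l := by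
    rw [spElt, map_smul]
    exact congrArg _ (LinearMap.congr_fun (congrArg Hom.lin (spIso j l m).inv_hom_id) _)
  have h' : Hom.lin (spIso j l m).inv (a • topElt k j l) = spElt j l m a := map_smul _ _ _
  have h2 : pval j l (a • topElt k j l) = a * idem k n j := by
    rw [map_smul, pval_topElt, smul_eq_mul]
  rw [← h2]
  constructor
  · intro h0
    rw [← h, h0, map_zero, map_zero]
  · intro h0
    rw [← h', pval_injective j l (h0.trans (map_zero _).symm), map_zero]

theorem spElt_zero_mem (p : Fin n) :
    spElt j l m (pathZero k p j) ∈ part p (-l) ((SP k j l m).X m) :=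
  pathZero_smul_mem p (lin_mem_part _ (topElt_mem j l))

theorem spElt_one_mem (p : Fin n) :
    spElt j l m (pathOne k p j) ∈ part p (1 - l) ((SP k j l m).X m) := by
  have := pathOne_smul_mem p (lin_mem_part (spIso j l m).inv (topElt_mem (k := k) j l))
  rwa [show -l + 1 = 1 - l by omega] at this

theorem exists_spElt (y : (SP k j l m).X m) : ∃ a, a * idem k n j = a ∧ y = spElt j l m a := by
  refine ⟨pval j l (Hom.lin (spIso j l m).hom y), pval_mul_idem _ _ _, ?_⟩
  rw [spElt, ← map_smul, pval_smul_topElt]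
  exact (LinearMap.congr_fun (congrArg Hom.lin (spIso j l m).hom_inv_id) y).symm

theorem smul_spElt (a b : Alg k n) : b • spElt j l m a = spElt j l m (b * a) := smul_smul _ _ _

theorem dl_SP {t : ℤ} (y : (SP k j l m).X t) : dl (SP k j l m) t y = 0 := by
  rw [dl, HomologicalComplex.single_obj_d]
  rfl

theorem pathZero_ne_zero (i j : Fin n) : pathZero k i j ≠ 0 := fun h => by
  have := coeffZero_pathZero (k := k) j i i j
  rw [h, map_zero, if_pos ⟨rfl, rfl⟩] at this
  exact zero_ne_one this

theorem pathOne_ne_zero (i j : Fin n) : pathOne k i j ≠ 0 := fun h => by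
  have := coeffOne_pathOne (k := k) j i i j
  rw [h, map_zero, if_pos ⟨rfl, rfl⟩] at this
  exact zero_ne_one this

theorem spElt_zero_ne_zero (p : Fin n) : spElt j l m (pathZero k p j) ≠ 0 := by
  rw [Ne, spElt_eq_zero_iff, pathZero_mul_idem, if_pos rfl]
  exact pathZero_ne_zero p j

theorem spElt_one_ne_zero (p : Fin n) : spElt j l m (pathOne k p j) ≠ 0 := by
  rw [Ne, spElt_eq_zero_iff, pathOne_mul_idem, if_pos rfl]
  exact pathOne_ne_zero p j

theorem not_ac_SP_bot (p : Fin n) : ¬ Ac (SP k j l m) p (-l) := fun h => by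
  obtain ⟨m, rfl⟩ : ∃ m', m = m' + 1 := ⟨m - 1, by omega⟩
  obtain ⟨x, -, hx⟩ := h m _ (spElt_zero_mem p) (dl_SP _)
  exact spElt_zero_ne_zero p (hx.symm.trans (dl_SP x))

theorem not_ac_SP_top (p : Fin n) : ¬ Ac (SP k j l m) p (1 - l) := fun h => by
  obtain ⟨m, rfl⟩ : ∃ m', m = m' + 1 := ⟨m - 1, by omega⟩
  obtain ⟨x, -, hx⟩ := h m _ (spElt_one_mem p) (dl_SP _)
  exact spElt_one_ne_zero p (hx.symm.trans (dl_SP x))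

theorem ac_SP {d : ℤ} (p : Fin n) (h : d ≠ -l) (h' : d ≠ 1 - l) : Ac (SP k j l m) p d := by
  intro t y hy _
  refine ⟨0, Submodule.zero_mem _, ?_⟩
  rw [map_zero]
  by_cases ht : t + 1 = m
  · subst ht
    have h1 := part_PS_eq_zero (lin_mem_part (spIso j l (t + 1)).hom hy) (by omega) (by omega)
    refine Eq.trans ?_ (LinearMap.congr_fun (congrArg Hom.lin (spIso j l (t + 1)).hom_inv_id) y)
    change 0 = Hom.lin (spIso j l (t + 1)).inv (Hom.lin (spIso j l (t + 1)).hom y)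
    rw [h1, map_zero]
  · exact (eq_zero_of_isZero (HomologicalComplex.isZero_single_obj_X _ _ _ _ ht) y).symm

/-- The top degree at `p` is spanned by the path of degree 1 from `p` to `j`. The path of degree 0
from `i` to `p` kills it, since the composite would have to return to `i ≠ j`. -/
theorem nonSurj_SP {i p : Fin n} (hi : i ≠ j) (hp : p ≠ i) :
    NonSurj (SP k j l m) i p (1 - l) := by
  obtain ⟨m, rfl⟩ : ∃ m', m = m' + 1 := ⟨m - 1, by omega⟩
  refine ⟨m, _, spElt_one_mem i, dl_SP _, fun y hy _ x _ he => spElt_one_ne_zero i (he.trans ?_)⟩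
  rw [dl_SP, add_zero]
  have h1 := pval_eq_one (lin_mem_part (spIso j l (m + 1)).hom hy) (by omega)
  obtain ⟨a, ha, rfl⟩ := exists_spElt y
  rw [smul_spElt, spElt_eq_zero_iff, mul_assoc, ha]
  have h2 : pval j l (Hom.lin (spIso j l (m + 1)).hom (spElt j l (m + 1) a)) = a := by
    rw [spElt, map_smul]
    refine (congrArg (fun t => pval j l (a • t)) (LinearMap.congr_fun (congrArg Hom.lin
      (spIso j l (m + 1)).inv_hom_id) (topElt k j l))).trans ?_
    change pval j l (a • topElt k j l) = a
    rw [map_smul, pval_topElt, smul_eq_mul, ha]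
  rw [h2] at h1
  rw [h1, mul_smul_comm, pathZero_mul_pathOne hp.symm hi, smul_zero]

/-- The bottom degree at `i` is spanned by the path of degree 0 from `i` to `j`, and two non-trivial
paths of degree 0 compose to zero. -/
theorem nonInj_SP {i p : Fin n} (hi : i ≠ j) (hp : p ≠ i) : NonInj (SP k j l m) i p (-l) := by
  obtain ⟨m, rfl⟩ : ∃ m', m = m' + 1 := ⟨m - 1, by omega⟩
  refine ⟨m, _, spElt_zero_mem i, dl_SP _, ?_, 0, Submodule.zero_mem _, ?_⟩
  · rintro ⟨x, -, hx⟩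
    exact spElt_zero_ne_zero i (hx.symm.trans (dl_SP x))
  · rw [smul_spElt, pathZero_mul_pathZero hp hi, map_zero]
    exact (zero_smul _ _).symm

end SP

/-- Maps between the complexes `P_j⟨l⟩` that are null-homotopic vanish. -/
theorem SP_hom_eq {j j' : Fin n} {l l' m m' : ℤ} {f g : SP k j l m ⟶ SP k j' l' m'}
    (h : (toHo k n).map f = (toHo k n).map g) : f = g := by
  rw [← sub_eq_zero, ← Functor.map_sub, toHo_map_eq_zero_iff] at h
  obtain ⟨r, hr⟩ := h
  rw [← sub_eq_zero]
  refine HomologicalComplex.hom_ext _ _ fun t => ?_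
  obtain ⟨t, rfl⟩ : ∃ t', t = t' + 1 := ⟨t - 1, by omega⟩
  have := hr t
  rw [HomologicalComplex.single_obj_d, HomologicalComplex.single_obj_d, comp_zero,
    zero_comp, add_zero] at this
  exact this

end Cpx

end Zigzag

end

noncomputable section

open CategoryTheory CategoryTheory.Limits TensorProduct

namespace Zigzag

universe u

/-! ### Splittings of complexes of vector spaces -/

section Splitting

variable {k : Type u} [Field k]

theorem exists_generalized_inverse {V W : Type u} [AddCommGroup V] [Module k V] [AddCommGroup W]
    [Module k W] (f : V →ₗ[k] W) : ∃ g : W →ₗ[k] V, ∀ x, f (g (f x)) = f x := by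
  obtain ⟨r, hr⟩ := f.rangeRestrict.exists_rightInverse_of_surjective f.range_rangeRestrict
  obtain ⟨g, hg⟩ := r.exists_extend
  refine ⟨g, fun x => ?_⟩
  have h1 : g (f x) = r (f.rangeRestrict x) := LinearMap.congr_fun hg (f.rangeRestrict x)
  rw [h1]
  exact congrArg Subtype.val (LinearMap.congr_fun hr (f.rangeRestrict x))

/-- From generalized inverses `g`, the maps `g δ g` satisfy the first two identities; subtracting `f
f δ` also gives `h h = 0`. Then `1 - δ h - h δ` is an idempotent whose image represents the
homology. -/
theorem exists_splitting {V : ℤ → Type u} [∀ m, AddCommGroup (V m)] [∀ m, Module k (V m)]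
    (δ : ∀ m, V m →ₗ[k] V (m + 1)) (hδ : ∀ m x, δ (m + 1) (δ m x) = 0) :
    ∃ h : ∀ m, V (m + 1) →ₗ[k] V m, (∀ m x, δ m (h m (δ m x)) = δ m x) ∧
      (∀ m x, h m (δ m (h m x)) = h m x) ∧ ∀ m x, h m (h (m + 1) x) = 0 := by
  choose g hg using fun m => exists_generalized_inverse (δ m)
  let f : ∀ m, V (m + 1) →ₗ[k] V m := fun m => g m ∘ₗ δ m ∘ₗ g m
  have h1 : ∀ m x, δ m (f m (δ m x)) = δ m x := fun m x => by
    change δ m (g m (δ m (g m (δ m x)))) = _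
    rw [hg, hg]
  have h2 : ∀ m x, f m (δ m (f m x)) = f m x := fun m x => by
    change g m (δ m (g m (δ m (g m (δ m (g m x)))))) = g m (δ m (g m x))
    rw [hg, hg]
  let h : ∀ m, V (m + 1) →ₗ[k] V m := fun m => f m - f m ∘ₗ f (m + 1) ∘ₗ δ (m + 1)
  have hx : ∀ m x, h m x = f m x - f m (f (m + 1) (δ (m + 1) x)) := fun m x => rfl
  have h3 : ∀ m x, h m (δ m x) = f m (δ m x) := fun m x => by
    rw [hx, hδ, map_zero, map_zero, sub_zero]
  have h4 : ∀ m x, f m (δ m (h m x)) = h m x := fun m x => by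
    rw [hx, map_sub, map_sub, h2, h2]
  refine ⟨h, fun m x => by rw [h3, h1], fun m x => by rw [h3, h4], fun m x => ?_⟩
  rw [hx m, h4, sub_self]

end Splitting

namespace GrMod

variable {k : Type u} [Field k] {n : ℕ}

theorem tin_eq_smul {i : Fin n} {M : GrMod k n} {a : Alg k n} (ha : a * idem k n i = a) (x : M) :
    tin i M a x = a • tin i M (idem k n i) x := by
  rw [smul_tin, ha]

/-- `A e_i ⊗ e_i M` is generated by the elements `e_i ⊗ x` with `x` homogeneous in `e_i M`. -/
theorem tensor_part_lin_ext {i : Fin n} {M : GrMod k n} {N : Type u} [AddCommGroup N]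
    [Module (Alg k n) N] {f g : (tensorObj i M).carrier →ₗ[Alg k n] N}
    (h : ∀ d, ∀ x ∈ part i d M, f (tin i M (idem k n i) x) = g (tin i M (idem k n i) x)) :
    f = g := by
  have h1 : ∀ x : M, idem k n i • x = x →
      f (tin i M (idem k n i) x) = g (tin i M (idem k n i) x) := by
    intro x hx
    rw [← hx]
    refine grading_induction (mem_iSup M.isInternal)
      (p := fun x => f (tin i M (idem k n i) (idem k n i • x)) =
        g (tin i M (idem k n i) (idem k n i • x))) (by simp only [smul_zero, map_zero])
      (fun a b ha hb => by simp only [smul_add, map_add, ha, hb]) (fun d x hx => ?_) x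
    exact h d _ (idem_smul_mem_part i hx)
  refine LinearMap.ext fun t => tensor_induction (p := fun t => f t = g t)
    (by simp only [map_zero]) (fun s t hs ht => by rw [map_add, map_add, hs, ht])
    (fun a x ha hx => ?_) t
  rw [tin_eq_smul ha, map_smul, map_smul, h1 x hx]

theorem tensor_part_hom_ext {i : Fin n} {M N : GrMod k n} {f g : tensorObj i M ⟶ N}
    (h : ∀ d, ∀ x ∈ part i d M,
      Hom.lin f (tin i M (idem k n i) x) = Hom.lin g (tin i M (idem k n i) x)) : f = g :=
  hom_ext (LinearMap.congr_fun (tensor_part_lin_ext h))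

/-- The map `A e_i ⊗ e_i M → A e_i ⊗ e_i N` given by a linear map on the second factor. -/
def tlin (i : Fin n) {M N : GrMod k n} (f : M.carrier →ₗ[k] N.carrier) :
    (tensorObj i M).carrier →ₗ[Alg k n] (tensorObj i N).carrier :=
  TensorProduct.AlgebraTensorModule.map LinearMap.id (toCorner i N ∘ₗ f ∘ₗ (corner i M).subtype)

theorem tlin_mem {i : Fin n} {M N : GrMod k n} {f : M.carrier →ₗ[k] N.carrier} {e : ℤ}
    (hf : ∀ d, ∀ x ∈ M.deg d, f x ∈ N.deg (d + e)) {d : ℤ} {t : (tensorObj i M).carrier}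
    (ht : t ∈ (tensorObj i M).deg d) : tlin i f t ∈ (tensorObj i N).deg (d + e) := by
  refine (Submodule.span_le (p := (tensorDeg (P k i).deg (cornerDeg i N) (d + e)).comap
    (TensorProduct.map LinearMap.id (toCorner i N ∘ₗ f ∘ₗ (corner i M).subtype)))).mpr ?_ ht
  rintro _ ⟨b, c, rfl, v, hv, w, hw, rfl⟩
  exact Submodule.subset_span ⟨b, c + e, (add_assoc b c e).symm, v, hv, toCorner i N (f w.1),
    idem_smul_mem i N (hf c _ hw), rfl⟩

theorem tlin_tin {i : Fin n} {M N : GrMod k n} (f : M.carrier →ₗ[k] N.carrier) (a : Alg k n) {x : M}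
    (hx : idem k n i • x = x) : tlin i f (tin i M a x) = tin i N a (f x) := by
  change toP i a ⊗ₜ[k] toCorner i N (f (idem k n i • x)) = toP i a ⊗ₜ[k] toCorner i N (f x)
  rw [hx]

/-- The graded map `A e_i ⊗ e_i M ⟶ A e_i ⊗ e_i N` given by a linear map on the second factor. -/
def tmap (i : Fin n) {M N : GrMod k n} (f : M.carrier →ₗ[k] N.carrier)
    (hf : ∀ d, ∀ x ∈ M.deg d, f x ∈ N.deg d) : tensorObj i M ⟶ tensorObj i N :=
  ofLin (M := tensorObj i M) (N := tensorObj i N) (tlin i f) fun d t ht => by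
    have := tlin_mem (e := 0) (f := f) (fun d x hx => by rw [add_zero]; exact hf d x hx) ht
    rwa [add_zero] at this

theorem tmap_tin {i : Fin n} {M N : GrMod k n} (f : M.carrier →ₗ[k] N.carrier)
    (hf : ∀ d, ∀ x ∈ M.deg d, f x ∈ N.deg d) (a : Alg k n) {x : M} (hx : idem k n i • x = x) :
    Hom.lin (tmap i f hf) (tin i M a x) = tin i N a (f x) :=
  tlin_tin f a hx

/-- The map `A e_i ⊗ e_i M → P_i⟨l⟩` given by a functional on the second factor. -/
def tfun (i : Fin n) {M : GrMod k n} (l : ℤ) (θ : M.carrier →ₗ[k] k)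
    (hθ : ∀ d, d ≠ -l → ∀ x ∈ M.deg d, θ x = 0) : tensorObj i M ⟶ PS k i l :=
  ofLin (M := tensorObj i M) (N := PS k i l)
    ((TensorProduct.AlgebraTensorModule.rid k (Alg k n) (P k i).carrier).toLinearMap ∘ₗ
      TensorProduct.AlgebraTensorModule.map LinearMap.id (θ ∘ₗ (corner i M).subtype)) (by
    intro d t ht
    refine (Submodule.span_le (p := ((P k i).deg (d + l)).comap
      (((TensorProduct.AlgebraTensorModule.rid k (Alg k n) (P k i).carrier).toLinearMap ∘ₗ
      TensorProduct.AlgebraTensorModule.map LinearMap.id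
        (θ ∘ₗ (corner i M).subtype)).restrictScalars k))).mpr ?_ ht
    rintro _ ⟨b, c, rfl, v, hv, w, hw, rfl⟩
    change θ w.1 • v ∈ (P k i).deg (b + c + l)
    by_cases hc : c = -l
    · subst hc
      rw [neg_add_cancel_right]
      exact Submodule.smul_mem _ _ hv
    · rw [show θ w.1 = 0 from hθ c hc _ hw, zero_smul]
      exact Submodule.zero_mem _)

theorem tfun_tin {i : Fin n} {M : GrMod k n} {l : ℤ} (θ : M.carrier →ₗ[k] k)
    (hθ : ∀ d, d ≠ -l → ∀ x ∈ M.deg d, θ x = 0) {x : M} (hx : idem k n i • x = x) :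
    Hom.lin (tfun i l θ hθ) (tin i M (idem k n i) x) = θ x • topElt k i l := by
  have h : toP i (idem k n i) = topElt k i l :=
    Subtype.ext (by change idem k n i * idem k n i = 1 * idem k n i; rw [idem_mul_self, one_mul])
  change θ (idem k n i • x) • toP i (idem k n i) = _
  rw [hx, h]
  rfl

theorem finite_degrees (M : GrMod k n) [Module.Finite (Alg k n) M] :
    Set.Finite {d | M.deg d ≠ ⊥} := by
  have := finite_base M
  exact WellFoundedGT.finite_ne_bot_of_iSupIndep M.isInternal.submodule_iSupIndep

end GrMod

namespace Cpx

open GrMod CochainComplex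

variable {k : Type u} [Field k] {n : ℕ}

/-! ### Direct sums of shifts of `P_i` -/

/-- An object of the homotopy category that is a finite direct sum of shifts of `P_i`. -/
def SumK (i : Fin n) (X : HomotopyCategory (GrMod k n) (ComplexShape.up ℤ)) : Prop :=
  ∃ (J : Type) (_ : Fintype J) (l m : J → ℤ)
    (ι : ∀ a, (toHo k n).obj (SP k i (l a) (m a)) ⟶ X)
    (π : ∀ a, X ⟶ (toHo k n).obj (SP k i (l a) (m a))),
    (∀ a, ι a ≫ π a = 𝟙 _) ∧ (∀ a b, a ≠ b → ι a ≫ π b = 0) ∧ ∑ a, π a ≫ ι a = 𝟙 X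

/-- Allowing zero objects among the summands is what is needed after applying a slice functor, which
kills all levels but one. -/
theorem sumK_of_family {i : Fin n} {X : HomotopyCategory (GrMod k n) (ComplexShape.up ℤ)}
    {J : Type} [Fintype J] {Z : J → HomotopyCategory (GrMod k n) (ComplexShape.up ℤ)}
    (hZ : ∀ a, IsZero (Z a) ∨ ∃ l m, Nonempty (Z a ≅ (toHo k n).obj (SP k i l m)))
    (ι : ∀ a, Z a ⟶ X) (π : ∀ a, X ⟶ Z a) (h1 : ∀ a, ι a ≫ π a = 𝟙 _)
    (h2 : ∀ a b, a ≠ b → ι a ≫ π b = 0) (h3 : ∑ a, π a ≫ ι a = 𝟙 X) : SumK i X := by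
  classical
  choose l m e using fun a : {a // ¬ IsZero (Z a)} => (hZ a.1).resolve_left a.2
  refine ⟨{a // ¬ IsZero (Z a)}, inferInstance, l, m, fun a => (e a).some.inv ≫ ι a.1,
    fun a => π a.1 ≫ (e a).some.hom, fun a => ?_, fun a b hab => ?_, ?_⟩
  · rw [Category.assoc, reassoc_of% (h1 a.1), Iso.inv_hom_id]
  · rw [Category.assoc, reassoc_of% (h2 a.1 b.1 fun h => hab (Subtype.ext h)), zero_comp, comp_zero]
  · rw [← h3, ← Fintype.sum_subtype_add_sum_subtype (fun a => ¬ IsZero (Z a)),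
      Fintype.sum_eq_zero (fun a : {a // ¬ ¬ IsZero (Z a)} => π a.1 ≫ ι a.1) (fun a => by
        rw [(not_not.mp a.2).eq_of_tgt (π a.1) 0, zero_comp]), add_zero]
    exact Finset.sum_congr rfl fun a _ => by
      rw [Category.assoc, (e a).some.hom_inv_id_assoc]

theorem SumK.map {i : Fin n} {X : HomotopyCategory (GrMod k n) (ComplexShape.up ℤ)}
    (h : SumK i X) (F : HomotopyCategory (GrMod k n) (ComplexShape.up ℤ) ⥤
      HomotopyCategory (GrMod k n) (ComplexShape.up ℤ)) [F.Additive]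
    (hF : ∀ l m, IsZero (F.obj ((toHo k n).obj (SP k i l m))) ∨
      ∃ l' m', Nonempty (F.obj ((toHo k n).obj (SP k i l m)) ≅ (toHo k n).obj (SP k i l' m'))) :
    SumK i (F.obj X) := by
  obtain ⟨J, _, l, m, ι, π, h1, h2, h3⟩ := h
  refine sumK_of_family (fun a => hF (l a) (m a)) (fun a => F.map (ι a)) (fun a => F.map (π a))
    (fun a => by rw [← F.map_comp, h1, F.map_id]) (fun a b hab => by
      rw [← F.map_comp, h2 a b hab, F.map_zero]) ?_
  rw [← F.map_id, ← h3, F.map_sum]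
  simp only [F.map_comp]

theorem SumK.of_iso {i : Fin n} {X X' : HomotopyCategory (GrMod k n) (ComplexShape.up ℤ)}
    (h : SumK i X) (e : X ≅ X') : SumK i X' := by
  obtain ⟨J, _, l, m, ι, π, h1, h2, h3⟩ := h
  refine ⟨J, inferInstance, l, m, fun a => ι a ≫ e.hom, fun a => e.inv ≫ π a, fun a => ?_,
    fun a b hab => ?_, ?_⟩
  · simp [h1]
  · simp [h2 a b hab]
  · simp only [Category.assoc]
    simp only [← Category.assoc (π _), ← Preadditive.comp_sum, ← Preadditive.sum_comp, h3]
    simp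

/-- The isomorphism between `P_j⟨l⟩[-m]` and `P_j⟨l⟩` placed in degree `m`. -/
def pShiftNegIso (j : Fin n) (l m : ℤ) : PShift k j l (-m) ≅ SP k j l m :=
  ((CochainComplex.singleFunctors (GrMod k n)).shiftIso (-m) m 0 (by omega)).app (PS k j l)

theorem isSumOfShifts_iff {i : Fin n} {Y : Cpx k n} :
    IsSumOfShifts i Y ↔ SumK i ((toHo k n).obj Y) := by
  constructor
  · rintro ⟨r, l, s, ⟨e⟩⟩
    refine sumK_of_family
      (fun a => Or.inr ⟨l a, -s a, ⟨(toHo k n).mapIso (pShiftIso i (l a) (s a))⟩⟩)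
      (fun a => biproduct.ι (fun a => (toHo k n).obj (PShift k i (l a) (s a))) a ≫ e.inv)
      (fun a => e.hom ≫ biproduct.π (fun a => (toHo k n).obj (PShift k i (l a) (s a))) a)
      (fun a => ?_) (fun a b hab => ?_) ?_
    · rw [Category.assoc, e.inv_hom_id_assoc, biproduct.ι_π_self]
    · rw [Category.assoc, e.inv_hom_id_assoc, biproduct.ι_π_ne _ hab]
    · simp only [Category.assoc]
      simp only [← Category.assoc (biproduct.π _ _), ← Preadditive.comp_sum,
        ← Preadditive.sum_comp, biproduct.total]
      simp
  · rintro ⟨J, _, l, m, ι, π, h1, h2, h3⟩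
    let e := (Fintype.equivFin J).symm
    let q : ∀ a, (toHo k n).obj (PShift k i (l a) (-m a)) ≅ (toHo k n).obj (SP k i (l a) (m a)) :=
      fun a => (toHo k n).mapIso (pShiftNegIso i (l a) (m a))
    let b : Bicone fun a => (toHo k n).obj (PShift k i (l (e a)) (-m (e a))) :=
      { pt := (toHo k n).obj Y
        π := fun a => π (e a) ≫ (q (e a)).inv
        ι := fun a => (q (e a)).hom ≫ ι (e a)
        ι_π := fun a c => by
          split_ifs with h
          · subst h
            rw [Category.assoc, reassoc_of% (h1 (e a)), Iso.hom_inv_id]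
            rfl
          · rw [Category.assoc, reassoc_of% (h2 (e a) (e c) fun h' => h (e.injective h')),
              zero_comp, comp_zero] }
    have hb : b.IsBilimit := isBilimitOfTotal b (by
      change ∑ a, (π (e a) ≫ (q (e a)).inv) ≫ (q (e a)).hom ≫ ι (e a) = 𝟙 _
      simp only [Category.assoc, Iso.inv_hom_id_assoc]
      exact (e.sum_comp fun a => π a ≫ ι a).trans h3)
    exact ⟨Fintype.card J, fun a => l (e a), fun a => -m (e a),
      ⟨biproduct.uniqueUpToIso _ hb⟩⟩

/-! ### `A e_i ⊗ e_i Y` is a direct sum of shifts of `P_i` -/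

theorem single_comp {W : Cpx k n} {i j : Fin n} {l l' m : ℤ} (f : PS k i l ⟶ W.X m)
    (g : W.X m ⟶ PS k j l') (hf : ∀ t, (ComplexShape.up ℤ).Rel m t → f ≫ W.d m t = 0)
    (hg : ∀ t, (ComplexShape.up ℤ).Rel t m → W.d t m ≫ g = 0) :
    HomologicalComplex.mkHomFromSingle f hf ≫ HomologicalComplex.mkHomToSingle g hg =
      (HomologicalComplex.single (GrMod k n) (ComplexShape.up ℤ) m).map (f ≫ g) := by
  refine HomologicalComplex.from_single_hom_ext ?_
  rw [HomologicalComplex.comp_f, HomologicalComplex.mkHomFromSingle_f,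
    HomologicalComplex.mkHomToSingle_f, HomologicalComplex.single_map_f_self]
  simp

theorem SP_hom_eq_zero {i j : Fin n} {l l' m m' : ℤ} (h : m ≠ m') (f : SP k i l m ⟶ SP k j l' m') :
    f = 0 :=
  HomologicalComplex.from_single_hom_ext
    ((HomologicalComplex.isZero_single_obj_X _ _ _ _ h).eq_of_tgt _ _)

/-- In each internal degree `e_i Y` is a bounded complex of finite-dimensional vector spaces. It
splits into its homology, with basis `v` and dual functionals `θ`, and a part contracted by `h`. -/
theorem exists_split_data (i : Fin n) {Y : Cpx k n} (hY : InD Y) :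
    ∃ (D : Finset (ℤ × ℤ)) (r : ℤ → ℤ → ℕ) (v : ∀ m l, Fin (r m l) → (Y.X (m + 1)).carrier)
      (θ : ∀ m l, Fin (r m l) → (Y.X (m + 1)).carrier →ₗ[k] k)
      (h : ∀ m, (Y.X (m + 1)).carrier →ₗ[k] (Y.X m).carrier),
      (∀ m l, (m, l) ∉ D → ∀ x ∈ part i (-l) (Y.X (m + 1)), x = 0) ∧
      (∀ m l x, v m l x ∈ part i (-l) (Y.X (m + 1))) ∧ (∀ m l x, dl Y (m + 1) (v m l x) = 0) ∧
      (∀ m l x d, d ≠ -l → ∀ y ∈ (Y.X (m + 1)).deg d, θ m l x y = 0) ∧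
      (∀ m l x y, θ m l x (v m l y) = if y = x then 1 else 0) ∧
      (∀ m l x, ∀ y ∈ part i (-l) (Y.X m), θ m l x (dl Y m y) = 0) ∧
      (∀ m d, ∀ y ∈ (Y.X (m + 1)).deg d, h m y ∈ (Y.X m).deg d) ∧
      ∀ m l, ∀ y ∈ part i (-l) (Y.X (m + 1)),
        y = ∑ x, θ m l x y • v m l x + (dl Y m (h m y) + h (m + 1) (dl Y (m + 1) y)) := by
  classical
  -- finiteness of the set of bidegrees
  obtain ⟨D, hD⟩ : ∃ D : Finset (ℤ × ℤ), ∀ m l, (m, l) ∉ D → ∀ x ∈ part i (-l) (Y.X (m + 1)),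
      x = 0 := by
    have hfin : ∀ m, ∃ S : Finset ℤ, ∀ d, d ∉ S → ∀ x ∈ (Y.X m).deg d, x = 0 := fun m => by
      have := (hY.2 m).1
      refine ⟨(finite_degrees (Y.X m)).toFinset, fun d hd x hx => ?_⟩
      rw [Set.Finite.mem_toFinset, Set.mem_ofPred_eq, not_not] at hd
      rw [hd] at hx
      exact (Submodule.mem_bot k).mp hx
    choose S hS using hfin
    obtain ⟨a, b, hab⟩ := hY.1
    refine ⟨(Finset.Icc (a - 1) b).biUnion fun m => (S (m + 1)).image fun d => (m, -d),
      fun m l hml x hx => ?_⟩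
    by_cases hm : m ∈ Finset.Icc (a - 1) b
    · refine hS (m + 1) (-l) (fun hl => hml ?_) x hx.1
      exact Finset.mem_biUnion.mpr ⟨m, hm, Finset.mem_image.mpr ⟨-l, hl, by rw [neg_neg]⟩⟩
    · rw [Finset.mem_Icc] at hm
      exact eq_zero_of_isZero (hab _ (by omega)) x
  -- the splitting of the complexes of vector spaces
  choose h hδ hh hhh using fun l => exists_splitting (V := fun m => part i (-l) (Y.X m))
    (fun m => partD Y i (-l) m) (fun m x => Subtype.ext (dl_dl Y m x.1))
  -- The idempotent onto representatives of the homology; it kills boundaries and takes values in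
  -- cycles.
  let e : ∀ m l, part i (-l) (Y.X (m + 1)) →ₗ[k] part i (-l) (Y.X (m + 1)) := fun m l =>
    LinearMap.id - partD Y i (-l) m ∘ₗ h l m - h l (m + 1) ∘ₗ partD Y i (-l) (m + 1)
  have he : ∀ m l x, e m l x = x - partD Y i (-l) m (h l m x) -
    h l (m + 1) (partD Y i (-l) (m + 1) x) := fun m l x => rfl
  have hdd : ∀ m l x, partD Y i (-l) (m + 1) (partD Y i (-l) m x) = 0 := fun m l x =>
    Subtype.ext (dl_dl Y m x.1)
  have hed : ∀ m l x, e m l (partD Y i (-l) m x) = 0 := fun m l x => by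
    rw [he, hδ, hdd, map_zero, sub_self, sub_zero]
  have hde : ∀ m l x, partD Y i (-l) (m + 1) (e m l x) = 0 := fun m l x => by
    rw [he, map_sub, map_sub, hdd, sub_zero, hδ, sub_self]
  have hee : ∀ m l x, e m l (e m l x) = e m l x := fun m l x => by
    have : h l m (e m l x) = 0 := by rw [he, map_sub, map_sub, hh, hhh, sub_self, sub_zero]
    rw [he _ _ (e m l x), this, hde, map_zero, map_zero, sub_zero, sub_zero]
  have hfd : ∀ m l, Module.Finite k (LinearMap.range (e m l)) := fun m l => by
    have := (hY.2 (m + 1)).1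
    have := finite_base (Y.X (m + 1))
    infer_instance
  let b : ∀ m l, Module.Basis (Fin (Module.finrank k (LinearMap.range (e m l)))) k
    (LinearMap.range (e m l)) := fun m l => Module.finBasis k _
  let v : ∀ m l, Fin (Module.finrank k (LinearMap.range (e m l))) → (Y.X (m + 1)).carrier :=
    fun m l x => (b m l x).1.1
  have hv : ∀ m l x, v m l x ∈ part i (-l) (Y.X (m + 1)) := fun m l x => (b m l x).1.2
  have hev : ∀ m l x, e m l (b m l x).1 = (b m l x).1 := fun m l x => by
    obtain ⟨y, hy⟩ := (b m l x).2
    rw [← hy, hee]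
  have hdv : ∀ m l x, dl Y (m + 1) (v m l x) = 0 := fun m l x => by
    have := hde m l (b m l x).1
    rw [hev] at this
    exact congrArg Subtype.val this
  let θ : ∀ m l, Fin (Module.finrank k (LinearMap.range (e m l))) →
      (Y.X (m + 1)).carrier →ₗ[k] k := fun m l x =>
    (b m l).coord x ∘ₗ (e m l).rangeRestrict ∘ₗ toPart i (-l) (Y.X (m + 1))
  have hθ : ∀ m l x y (hy : y ∈ part i (-l) (Y.X (m + 1))),
      θ m l x y = (b m l).repr ((e m l).rangeRestrict ⟨y, hy⟩) x := fun m l x y hy => by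
    change (b m l).repr ((e m l).rangeRestrict (toPart i (-l) (Y.X (m + 1)) y)) x = _
    rw [toPart_of_mem hy]
  have hθ0 : ∀ m l x d, d ≠ -l → ∀ y ∈ (Y.X (m + 1)).deg d, θ m l x y = 0 := by
    intro m l x d hd y hy
    change (b m l).coord x ((e m l).rangeRestrict (toPart i (-l) (Y.X (m + 1)) y)) = 0
    rw [toPart_of_ne hy (Ne.symm hd), map_zero, map_zero]
  have hθv : ∀ m l x y, θ m l x (v m l y) = if y = x then 1 else 0 := fun m l x y => by
    rw [hθ m l x _ (hv m l y)]
    have : (e m l).rangeRestrict ⟨v m l y, hv m l y⟩ = b m l y := Subtype.ext (hev m l y)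
    rw [this, Module.Basis.repr_self, Finsupp.single_apply]
  have hθd : ∀ m l x, ∀ y ∈ part i (-l) (Y.X m), θ m l x (dl Y m y) = 0 := fun m l x y hy => by
    rw [hθ m l x _ (dl_mem hy)]
    have : (e m l).rangeRestrict ⟨dl Y m y, dl_mem hy⟩ = 0 := Subtype.ext (hed m l ⟨y, hy⟩)
    rw [this, map_zero]
    rfl
  have hsum : ∀ m l y (hy : y ∈ part i (-l) (Y.X (m + 1))),
      ∑ x, θ m l x y • v m l x = (e m l ⟨y, hy⟩).1 := fun m l y hy => by
    have h1 := congrArg (fun t => t.1.1) ((b m l).sum_repr ((e m l).rangeRestrict ⟨y, hy⟩))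
    refine Eq.trans ?_ h1
    simp only [hθ m l _ y hy]
    rw [Submodule.coe_sum, Submodule.coe_sum]
    rfl
  -- The homotopies of the separate internal degrees assembled into one linear map. The finite set
  -- of levels occurring in `D` suffices, since the remaining parts are zero.
  let u : ∀ m, (Y.X (m + 1)).carrier →ₗ[k] (Y.X m).carrier := fun m =>
    ∑ l ∈ D.image Prod.snd, (part i (-l) (Y.X m)).subtype ∘ₗ h l m ∘ₗ toPart i (-l) (Y.X (m + 1))
  have hu' : ∀ m y, u m y = ∑ l ∈ D.image Prod.snd,
      (h l m (toPart i (-l) (Y.X (m + 1)) y)).1 := fun m y => LinearMap.sum_apply _ _ _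
  have hu : ∀ m l y (hy : y ∈ part i (-l) (Y.X (m + 1))), u m y = (h l m ⟨y, hy⟩).1 := by
    intro m l y hy
    rw [hu']
    by_cases hl : (m, l) ∈ D
    · rw [Finset.sum_eq_single l, toPart_of_mem hy]
      · intro l' _ hl'
        rw [toPart_of_ne hy.1 fun h' => hl' (neg_injective h'), map_zero]
        rfl
      · exact fun h' => absurd (Finset.mem_image.mpr ⟨_, hl, rfl⟩) h'
    · obtain rfl := hD m l hl y hy
      have h0 : (⟨0, hy⟩ : part i (-l) (Y.X (m + 1))) = 0 := rfl
      rw [h0, map_zero]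
      exact Finset.sum_eq_zero fun l' _ => by rw [map_zero, map_zero]; rfl
  refine ⟨D, _, v, θ, u, hD, hv, hdv, hθ0, hθv, hθd, fun m d y hy => ?_,
    fun m l y hy => ?_⟩
  · rw [hu']
    refine Submodule.sum_mem _ fun l _ => ?_
    by_cases hl : -l = d
    · subst hl
      exact (h l m _).2.1
    · rw [toPart_of_ne hy hl, map_zero]
      exact Submodule.zero_mem _
  · rw [hsum m l y hy, he, hu m l y hy, hu (m + 1) l _ (dl_mem hy)]
    change y = y - dl Y m (h l m ⟨y, hy⟩).1 - (h l (m + 1) ⟨dl Y (m + 1) y, _⟩).1 + _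
    abel

theorem single_comp_f {W : Cpx k n} {i : Fin n} {l m : ℤ} (f : PS k i l ⟶ W.X m)
    (g : W.X m ⟶ PS k i l) (hf : ∀ t, (ComplexShape.up ℤ).Rel m t → f ≫ W.d m t = 0)
    (hg : ∀ t, (ComplexShape.up ℤ).Rel t m → W.d t m ≫ g = 0) :
    (HomologicalComplex.mkHomToSingle g hg ≫ HomologicalComplex.mkHomFromSingle f hf).f m =
      g ≫ f := by
  rw [HomologicalComplex.comp_f, HomologicalComplex.mkHomFromSingle_f,
    HomologicalComplex.mkHomToSingle_f]
  simp

theorem comp_f_SP_eq_zero {W W' : Cpx k n} {i : Fin n} {l m m' : ℤ} (h : m' ≠ m)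
    (f : W ⟶ SP k i l m) (g : SP k i l m ⟶ W') : (f ≫ g).f m' = 0 := by
  rw [HomologicalComplex.comp_f,
    (HomologicalComplex.isZero_single_obj_X (ComplexShape.up ℤ) m (PS k i l) m' h).eq_of_tgt
      (f.f m') 0, zero_comp]

theorem lin_sum_f {W W' : Cpx k n} {J : Type} (s : Finset J) (f : J → (W ⟶ W')) (m : ℤ)
    (x : W.X m) : Hom.lin ((∑ a ∈ s, f a).f m) x = ∑ a ∈ s, Hom.lin ((f a).f m) x :=
  map_sum (AddMonoidHom.mk' (fun f : W ⟶ W' => Hom.lin (f.f m) x) fun _ _ => rfl) f s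

/-- The differential of `A e_i ⊗ e_i Y` acts on the second factor only, so the splitting of `e_i Y`
can be tensored with `A e_i`: each basis vector of homology gives a copy of `P_i`, and `h` gives the
homotopy that removes the rest. -/
theorem sumK_TC (i : Fin n) {Y : Cpx k n} (hY : InD Y) : SumK i ((toHo k n).obj (TC i Y)) := by
  classical
  obtain ⟨D, r, v, θ, h, hD, hv, hdv, hθ0, hθv, hθd, hhd, hsum⟩ := exists_split_data i hY
  have hmem : ∀ m l x, tin i _ (idem k n i) (v m l x) ∈ part i (-l) (tensorObj i (Y.X (m + 1))) :=
    fun m l x => by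
      have := tin_zero_mem (i := i) i (hv m l x).1
      rwa [pathZero_self] at this
  have hι : ∀ m l x t, (ComplexShape.up ℤ).Rel (m + 1) t →
      fromP _ (hmem m l x) ≫ (TC i Y).d (m + 1) t = 0 := by
    rintro m l x _ rfl
    refine PS_hom_ext ?_
    refine (congrArg (Hom.lin (tensorMap i (Y.d (m + 1) (m + 1 + 1))))
      (fromP_topElt _ (hmem m l x))).trans ((tensorMap_tin _ _ _).trans ?_)
    rw [show Hom.lin (Y.d (m + 1) (m + 1 + 1)) (v m l x) = 0 from hdv m l x, map_zero]
    rfl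
  have hπ : ∀ m l x t, (ComplexShape.up ℤ).Rel t (m + 1) →
      (TC i Y).d t (m + 1) ≫ tfun i l (θ m l x) (hθ0 m l x) = 0 := by
    intro m l x t ht
    obtain rfl : t = m := by
      have : t + 1 = m + 1 := ht
      omega
    refine tensor_part_hom_ext (M := Y.X t) fun d y hy => ?_
    change Hom.lin (tfun i l _ (hθ0 t l x)) (Hom.lin (tensorMap i (Y.d t (t + 1))) (tin i _ _ y)) = 0
    rw [tensorMap_tin]
    refine (tfun_tin _ _ (dl_mem (Y := Y) hy).2).trans ?_
    by_cases hd : d = -l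
    · subst hd
      rw [hθd t l x y hy]
      exact zero_smul _ _
    · rw [hθ0 t l x d hd _ (dl_mem (Y := Y) hy).1]
      exact zero_smul _ _
  let ι : ∀ m l, Fin (r m l) → (SP k i l (m + 1) ⟶ TC i Y) := fun m l x =>
    HomologicalComplex.mkHomFromSingle (K := TC i Y) (fromP _ (hmem m l x)) (hι m l x)
  let π : ∀ m l, Fin (r m l) → (TC i Y ⟶ SP k i l (m + 1)) := fun m l x =>
    HomologicalComplex.mkHomToSingle (K := TC i Y) (tfun i l (θ m l x) (hθ0 m l x)) (hπ m l x)
  have hιπ : ∀ m l l' x x', Hom.lin (fromP _ (hmem m l x) ≫ tfun i l' (θ m l' x') (hθ0 m l' x'))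
      (topElt k i l) = θ m l' x' (v m l x) • topElt k i l' := fun m l l' x x' =>
    (congrArg (Hom.lin (tfun i l' _ (hθ0 m l' x'))) (fromP_topElt _ (hmem m l x))).trans
      (tfun_tin _ _ (hv m l x).2)
  have hπι : ∀ m l x d, ∀ y ∈ part i d (Y.X (m + 1)),
      Hom.lin (tfun i l (θ m l x) (hθ0 m l x) ≫ fromP _ (hmem m l x)) (tin i _ (idem k n i) y) =
        tin i _ (idem k n i) (θ m l x y • v m l x) := fun m l x d y hy => by
    rw [lin_comp, LinearMap.comp_apply, tfun_tin _ _ hy.2, LinearMap.map_smul_of_tower,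
      fromP_topElt, map_smul]
  refine ⟨Σ p : D, Fin (r p.1.1 p.1.2), inferInstance, fun a => a.1.1.2, fun a => a.1.1.1 + 1,
    fun a => (toHo k n).map (ι _ _ a.2), fun a => (toHo k n).map (π _ _ a.2), ?_, ?_, ?_⟩
  · rintro ⟨⟨⟨m, l⟩, _⟩, x⟩
    rw [← Functor.map_comp, ← (toHo k n).map_id]
    congr 1
    refine (single_comp _ _ (hι m l x) (hπ m l x)).trans ?_
    rw [← CategoryTheory.Functor.map_id]
    congr 1
    refine PS_hom_ext ((hιπ m l l x x).trans ?_)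
    rw [hθv, if_pos rfl, one_smul]
    rfl
  · rintro ⟨⟨⟨m, l⟩, _⟩, x⟩ ⟨⟨⟨m', l'⟩, _⟩, x'⟩ hne
    rw [← Functor.map_comp]
    refine Eq.trans (congrArg _ ?_) ((toHo k n).map_zero _ _)
    by_cases hm : m = m'
    · subst hm
      refine (single_comp _ _ (hι m l x) (hπ m l' x')).trans ?_
      refine Eq.trans (congrArg _ ?_) (Functor.map_zero _ _ _)
      refine PS_hom_ext ((hιπ m l l' x x').trans ?_)
      by_cases hl : l = l'
      · subst hl
        rw [hθv, if_neg fun hx => hne (by subst hx; rfl)]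
        exact zero_smul _ _
      · rw [hθ0 m l' x' (-l) (fun h' => hl (neg_injective h')) _ (hv m l x).1]
        exact zero_smul _ _
    · exact SP_hom_eq_zero (by simpa using hm) _
  · rw [← sub_eq_zero, ← neg_eq_zero, neg_sub]
    have h0 : (toHo k n).map (𝟙 (TC i Y) - ∑ a : Σ p : D, Fin (r p.1.1 p.1.2),
        π _ _ a.2 ≫ ι _ _ a.2) = 0 := by
      -- The homotopy is `h` on the second factor; the identity to check is the one for `e_i Y`.
      refine (toHo_map_eq_zero_iff _).mpr ⟨fun m => tmap i (h m) (hhd m), fun m => ?_⟩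
      refine tensor_part_hom_ext (M := Y.X (m + 1)) fun d y hy => ?_
      obtain ⟨l, rfl⟩ : ∃ l, d = -l := ⟨-d, (neg_neg d).symm⟩
      have hr : Hom.lin (tmap i (h m) (hhd m) ≫ tensorMap i (Y.d m (m + 1)) +
          tensorMap i (Y.d (m + 1) (m + 1 + 1)) ≫ tmap i (h (m + 1)) (hhd (m + 1)))
          (tin i _ (idem k n i) y) = tin i (Y.X (m + 1)) (idem k n i)
            (dl Y m (h m y) + h (m + 1) (dl Y (m + 1) y)) := by
        rw [map_add, lin_add, LinearMap.add_apply]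
        refine congrArg₂ (· + ·) ?_ ?_
        · refine (congrArg (Hom.lin (tensorMap i (Y.d m (m + 1))))
            (tmap_tin (h m) (hhd m) (idem k n i) hy.2)).trans (tensorMap_tin _ _ _)
        · refine (congrArg (Hom.lin (tmap i (h (m + 1)) (hhd (m + 1))))
            (tensorMap_tin (Y.d (m + 1) (m + 1 + 1)) _ _)).trans
            (tmap_tin _ _ _ (dl_mem (Y := Y) hy).2)
      have hl : Hom.lin ((∑ a : Σ p : D, Fin (r p.1.1 p.1.2), π _ _ a.2 ≫ ι _ _ a.2).f (m + 1))
          (tin i (Y.X (m + 1)) (idem k n i) y) =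
            tin i (Y.X (m + 1)) (idem k n i) (∑ x, θ m l x y • v m l x) := by
        by_cases hml : (m, l) ∈ D
        · refine (lin_sum_f _ _ _ _).trans ?_
          rw [Fintype.sum_sigma, Finset.sum_eq_single ⟨(m, l), hml⟩, map_sum]
          · refine Finset.sum_congr rfl fun x _ => ?_
            exact (congrArg (fun t => Hom.lin t (tin i (Y.X (m + 1)) (idem k n i) y))
              (single_comp_f _ _ (hι m l x) (hπ m l x))).trans (hπι m l x _ y hy)
          · rintro ⟨⟨m', l'⟩, _⟩ _ hne
            refine Finset.sum_eq_zero fun x _ => ?_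
            by_cases hm : m = m'
            · subst hm
              refine (congrArg (fun t => Hom.lin t (tin i (Y.X (m + 1)) (idem k n i) y))
                (single_comp_f _ _ (hι m l' x) (hπ m l' x))).trans ((hπι m l' x _ y hy).trans ?_)
              have hll : l ≠ l' := fun h' => hne (by subst h'; rfl)
              rw [hθ0 m l' x (-l) (fun h' => hll (neg_injective h')) y hy.1, zero_smul, map_zero]
              rfl
            · exact congrArg (fun t => Hom.lin t (tin i (Y.X (m + 1)) (idem k n i) y))
                (comp_f_SP_eq_zero (by simpa using hm) (π m' l' x) (ι m' l' x))
          · exact fun h' => absurd (Finset.mem_univ _) h'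
        · obtain rfl := hD m l hml y hy
          simp only [map_zero, zero_smul, Finset.sum_const_zero]
          exact map_zero _
      refine Eq.trans ?_ hr.symm
      have h2 := congrArg (tin i (Y.X (m + 1)) (idem k n i)) (hsum m l y hy)
      rw [map_add, ← hl] at h2
      exact sub_eq_of_eq_add' h2
    rw [Functor.map_sub, Functor.map_sum, CategoryTheory.Functor.map_id] at h0
    simpa only [Functor.map_comp] using h0

end Cpx

end Zigzag

end

noncomputable section

open CategoryTheory CategoryTheory.Limits TensorProduct

namespace Zigzag

universe u

namespace GrMod

variable {k : Type u} [Field k] {n : ℕ}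

/-- The map `M⟨l⟩⟨s⟩ ⟶ M⟨l + s⟩`. -/
def shiftAddHom (M : GrMod k n) (l s : ℤ) : shiftObj s (shiftObj l M) ⟶ shiftObj (l + s) M :=
  ofLin (M := shiftObj s (shiftObj l M)) (N := shiftObj (l + s) M) (LinearMap.id (M := M.carrier))
    fun d x hx => by
      change x ∈ M.deg (d + (l + s))
      rw [add_comm l, ← add_assoc]
      exact hx

/-- The map `M⟨l + s⟩ ⟶ M⟨l⟩⟨s⟩`. -/
def shiftAddInv (M : GrMod k n) (l s : ℤ) : shiftObj (l + s) M ⟶ shiftObj s (shiftObj l M) :=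
  ofLin (M := shiftObj (l + s) M) (N := shiftObj s (shiftObj l M)) (LinearMap.id (M := M.carrier))
    fun d x hx => by
      change x ∈ M.deg (d + s + l)
      rw [add_assoc, add_comm s]
      exact hx

/-- The isomorphism `P_i⟨l⟩⟨s⟩ ≅ P_i⟨l + s⟩`. -/
def shiftPSIso (i : Fin n) (l s : ℤ) : (shift s).obj (PS k i l) ≅ PS k i (l + s) where
  hom := shiftAddHom (P k i) l s
  inv := shiftAddInv (P k i) l s
  hom_inv_id := hom_ext fun _ => rfl
  inv_hom_id := hom_ext fun _ => rfl

end GrMod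

namespace Cpx

open GrMod Pretriangulated

variable {k : Type u} [Field k] {n : ℕ}

/-! ### Slices of sums of shifts and of cones -/

/-- A functor on graded modules, applied termwise to a module placed in one degree. -/
def mapSingleIso (F : GrMod k n ⥤ GrMod k n) [F.Additive] (M : GrMod k n) (m : ℤ) :
    (F.mapHomotopyCategory (ComplexShape.up ℤ)).obj ((toHo k n).obj
      ((HomologicalComplex.single (GrMod k n) (ComplexShape.up ℤ) m).obj M)) ≅
    (toHo k n).obj ((HomologicalComplex.single (GrMod k n) (ComplexShape.up ℤ) m).obj (F.obj M)) :=
  (toHo k n).mapIso ((HomologicalComplex.singleMapHomologicalComplex F (ComplexShape.up ℤ) m).app M)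

theorem SumK.slice {i : Fin n} {X : HomotopyCategory (GrMod k n) (ComplexShape.up ℤ)}
    (h : SumK i X) (s : ℤ) :
    SumK i (((GrMod.slice s).mapHomotopyCategory (ComplexShape.up ℤ)).obj X) := by
  refine h.map _ fun l m => ?_
  by_cases hl : s = l
  · subst hl
    exact Or.inr ⟨s, m, ⟨mapSingleIso _ _ _ ≪≫ (toHo k n).mapIso
      ((HomologicalComplex.single (GrMod k n) (ComplexShape.up ℤ) m).mapIso (slicePSIso i s))⟩⟩
  · refine Or.inl (IsZero.of_iso ?_ (mapSingleIso _ _ _))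
    exact Functor.map_isZero _ (Functor.map_isZero _ (isZero_slice_PS hl))

theorem SumK.shiftInternal {i : Fin n} {X : HomotopyCategory (GrMod k n) (ComplexShape.up ℤ)}
    (h : SumK i X) (s : ℤ) :
    SumK i (((GrMod.shift s).mapHomotopyCategory (ComplexShape.up ℤ)).obj X) :=
  h.map _ fun l m => Or.inr ⟨l + s, m, ⟨mapSingleIso _ _ _ ≪≫ (toHo k n).mapIso
    ((HomologicalComplex.single (GrMod k n) (ComplexShape.up ℤ) m).mapIso (shiftPSIso i l s))⟩⟩

theorem SumK.shift {i : Fin n} {X : HomotopyCategory (GrMod k n) (ComplexShape.up ℤ)}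
    (h : SumK i X) (a : ℤ) : SumK i (X⟦a⟧) :=
  h.map (CategoryTheory.shiftFunctor _ a) fun l m => Or.inr ⟨l, m - a, ⟨
    (toHoShift _ a).symm ≪≫ (toHo k n).mapIso (by
      have e := spShiftIso (k := k) i l (m - a) a
      rwa [sub_add_cancel] at e)⟩⟩

theorem sumK_TC1 (i : Fin n) {Y : Cpx k n} (hY : InD Y) : SumK i ((toHo k n).obj (TC1 i Y)) :=
  (sumK_TC i hY).shiftInternal 1

/-- The isomorphism between a slice of a shift and the shift of the slice. -/
def sliceShiftIso (s a : ℤ) (Y : Cpx k n) :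
    (toHo k n).obj (baricSlice s (Y⟦a⟧)) ≅ ((toHo k n).obj (baricSlice s Y))⟦a⟧ :=
  ((GrMod.slice s).mapHomotopyCategory (ComplexShape.up ℤ)).mapIso (toHoShift Y a) ≪≫
    (((GrMod.slice s).mapHomotopyCategory (ComplexShape.up ℤ)).commShiftIso a).app ((toHo k n).obj Y)

theorem slice_cone_distinguished (s : ℤ) {Y Z : Cpx k n} (f : Y ⟶ Z) :
    ((GrMod.slice s).mapHomotopyCategory (ComplexShape.up ℤ)).mapTriangle.obj
      (CochainComplex.mappingCone.triangleh f) ∈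
        distTriang (HomotopyCategory (GrMod k n) (ComplexShape.up ℤ)) :=
  Functor.map_distinguished _ _ (HomotopyCategory.mappingCone_triangleh_distinguished f)

/-- The slice functor is exact on triangles, so where the slice of `Y` vanishes the slice of the
cone is that of `A e_i ⊗ e_i Y⟨1⟩`, a sum of shifts of `P_i`. -/
theorem isSumOfShifts_sigma {i : Fin n} {Y : Cpx k n} (hY : InD Y) {s : ℤ}
    (hs : IsZero ((toHo k n).obj (baricSlice s Y))) : IsSumOfShifts i (baricSlice s (sigma i Y)) := by
  have h := (sumK_TC1 i hY).slice s
  have : IsIso (((GrMod.slice s).mapHomotopyCategory (ComplexShape.up ℤ)).mapTriangle.obj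
      (CochainComplex.mappingCone.triangleh (unitMap i Y))).mor₂ :=
    (Triangle.isZero₁_iff_isIso₂ _ (slice_cone_distinguished s (unitMap i Y))).mp hs
  have e := asIso (((GrMod.slice s).mapHomotopyCategory (ComplexShape.up ℤ)).mapTriangle.obj
    (CochainComplex.mappingCone.triangleh (unitMap i Y))).mor₂
  exact isSumOfShifts_iff.mpr (((h.of_iso e).shift (-1)).of_iso (sliceShiftIso s (-1) _).symm)

theorem isSumOfShifts_sigmaInv {i : Fin n} {Y : Cpx k n} (hY : InD Y) {s : ℤ}
    (hs : IsZero ((toHo k n).obj (baricSlice s Y))) :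
    IsSumOfShifts i (baricSlice s (sigmaInv i Y)) := by
  have h := (((sumK_TC i hY).slice s).shift 1)
  have : IsIso (((GrMod.slice s).mapHomotopyCategory (ComplexShape.up ℤ)).mapTriangle.obj
      (CochainComplex.mappingCone.triangleh (counitMap i Y))).mor₃ :=
    (Triangle.isZero₂_iff_isIso₃ _ (slice_cone_distinguished s (counitMap i Y))).mp hs
  exact isSumOfShifts_iff.mpr (h.of_iso (asIso (((GrMod.slice s).mapHomotopyCategory
    (ComplexShape.up ℤ)).mapTriangle.obj
      (CochainComplex.mappingCone.triangleh (counitMap i Y))).mor₃).symm)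

/-! ### Consequences of being a sum of shifts -/

theorem ac_slice {Y : Cpx k n} (hY : InD Y) {s d : ℤ} (h : d ≠ -s) (h' : d ≠ 1 - s) (j : Fin n) :
    Ac (baricSlice s Y) j d := fun m y hy _ =>
  ⟨0, Submodule.zero_mem _, by rw [(hY.isLevel s (m + 1)).eq_zero h h' y hy, map_zero]⟩

/-- A non-zero sum has a summand, and its level must be `s`. The retraction holds on the nose, since
null-homotopic maps between modules placed in one degree are zero; this lets `NonInj` and `NonSurj`
be transported. -/
theorem exists_retract {Y : Cpx k n} (hY : InD Y) {s : ℤ}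
    (h0 : ¬ IsZero ((toHo k n).obj (baricSlice s Y))) {j : Fin n}
    (h : IsSumOfShifts j (baricSlice s Y)) :
    ∃ (m : ℤ) (f : SP k j s m ⟶ baricSlice s Y) (r : baricSlice s Y ⟶ SP k j s m), f ≫ r = 𝟙 _ := by
  obtain ⟨J, _, l, m, ι, π, h1, h2, h3⟩ := isSumOfShifts_iff.mp h
  obtain ⟨a⟩ : Nonempty J := by
    by_contra hJ
    rw [not_nonempty_iff] at hJ
    rw [Finset.univ_eq_empty, Finset.sum_empty] at h3
    exact h0 ((IsZero.iff_id_eq_zero _).mpr h3.symm)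
  -- A summand `P_j⟨l⟩` has homology in both degrees `-l` and `1 - l`, and for `l ≠ s` one of them
  -- lies outside the degrees `-s` and `1 - s` of the slice.
  have hl : l a = s := by
    by_contra hne
    by_cases hd : 1 - l a = -s
    · exact not_ac_SP_bot (k := k) (j := j) (l := l a) (m := m a) j
        ((ac_slice hY (d := -l a) (by omega) (by omega) j).of_retract (ι a) (π a) (h1 a))
    · exact not_ac_SP_top (k := k) (j := j) (l := l a) (m := m a) j
        ((ac_slice hY (d := 1 - l a) hd (by omega) j).of_retract (ι a) (π a) (h1 a))
  obtain ⟨f, hf⟩ := (toHo k n).map_surjective (ι a)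
  obtain ⟨r, hr⟩ := (toHo k n).map_surjective (π a)
  have hfr : f ≫ r = 𝟙 _ := SP_hom_eq (by
    rw [Functor.map_comp, hf, hr, h1, CategoryTheory.Functor.map_id])
  subst hl
  exact ⟨m a, f, r, hfr⟩

/-- `P_j` has a path of degree 0 at every vertex `p`. This is what separates `X_j^+` from all the
`X_p^-`. -/
theorem not_ac_phiPlus_of_sum {Y : Cpx k n} (hY : InD Y) (h0 : ¬ IsZero ((toHo k n).obj Y))
    {j : Fin n} (h : IsSumOfShifts j (baricSlice (phiPlus Y) Y)) (p : Fin n) :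
    ¬ Ac Y p (-phiPlus Y) := fun hac => by
  obtain ⟨m, f, r, hfr⟩ := exists_retract hY (isGreatest_phiPlus hY h0).1 h
  exact not_ac_SP_bot p (((ac_phiPlus_iff hY h0 p).mp hac).of_retract ((toHo k n).map f)
    ((toHo k n).map r) (by rw [← Functor.map_comp, hfr, CategoryTheory.Functor.map_id]))

theorem not_ac_phiMinus_of_sum {Y : Cpx k n} (hY : InD Y) (h0 : ¬ IsZero ((toHo k n).obj Y))
    {j : Fin n} (h : IsSumOfShifts j (baricSlice (phiMinus Y) Y)) (p : Fin n) :
    ¬ Ac Y p (1 - phiMinus Y) := fun hac => by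
  obtain ⟨m, f, r, hfr⟩ := exists_retract hY (isLeast_phiMinus hY h0).1 h
  exact not_ac_SP_top p (((ac_phiMinus_iff hY h0 p).mp hac).of_retract ((toHo k n).map f)
    ((toHo k n).map r) (by rw [← Functor.map_comp, hfr, CategoryTheory.Functor.map_id]))

theorem nonInj_phiPlus_of_sum {Y : Cpx k n} (hY : InD Y) (h0 : ¬ IsZero ((toHo k n).obj Y))
    {j : Fin n} (h : IsSumOfShifts j (baricSlice (phiPlus Y) Y)) {i p : Fin n} (hij : i ≠ j)
    (hp : p ≠ i) : NonInj Y i p (-phiPlus Y) := by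
  obtain ⟨m, f, r, hfr⟩ := exists_retract hY (isGreatest_phiPlus hY h0).1 h
  exact nonInj_phiPlus hY h0 ((nonInj_SP hij hp).of_retract f r hfr)

theorem nonSurj_phiMinus_of_sum {Y : Cpx k n} (hY : InD Y) (h0 : ¬ IsZero ((toHo k n).obj Y))
    {j : Fin n} (h : IsSumOfShifts j (baricSlice (phiMinus Y) Y)) {i p : Fin n} (hij : i ≠ j)
    (hp : p ≠ i) : NonSurj Y i p (1 - phiMinus Y) := by
  obtain ⟨m, f, r, hfr⟩ := exists_retract hY (isLeast_phiMinus hY h0).1 h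
  exact nonSurj_phiMinus hY h0 ((nonSurj_SP hij hp).of_retract f r hfr)

end Cpx

end Zigzag

end

noncomputable section

open CategoryTheory CategoryTheory.Limits TensorProduct

namespace Zigzag

universe u

/-! ### The natural maps that relate the two functors -/

namespace GrMod

variable {k : Type u} [Field k] {n : ℕ}

theorem tlin_naturality {i : Fin n} {M N M' N' : GrMod k n} (φ : M ⟶ M') (ψ : N ⟶ N')
    (f : M.carrier →ₗ[k] N.carrier) (f' : M'.carrier →ₗ[k] N'.carrier)
    (h : ∀ x, f' (Hom.lin φ x) = Hom.lin ψ (f x)) (t : (tensorObj i M).carrier) :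
    tlin i f' (Hom.lin (tensorMap i φ) t) = Hom.lin (tensorMap i ψ) (tlin i f t) := by
  refine LinearMap.congr_fun (f := tlin i f' ∘ₗ Hom.lin (tensorMap i φ))
    (g := Hom.lin (tensorMap i ψ) ∘ₗ tlin i f) (tensor_part_lin_ext fun d x hx => ?_) t
  rw [LinearMap.comp_apply, LinearMap.comp_apply, tensorMap_tin, tlin_tin f _ hx.2, tensorMap_tin,
    tlin_tin f' _ (by rw [← map_smul, hx.2]), h]

theorem idem_smul_tin_idem (i : Fin n) (M : GrMod k n) (x : M) :
    idem k n i • tin i M (idem k n i) x = tin i M (idem k n i) x := by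
  rw [smul_tin, idem_mul_self]

theorem tin_idem_mem {i : Fin n} {M : GrMod k n} {d : ℤ} {x : M} (hx : x ∈ M.deg d) :
    tin i M (idem k n i) x ∈ (tensorObj i M).deg d := by
  have := tin_mem_deg (i := i) (idem_mem i) hx
  rwa [zero_add] at this

theorem contr_idem {i : Fin n} {M : GrMod k n} {x : M} (hx : idem k n i • x = x) :
    contr i M (coeffZero i i) (tin i M (idem k n i) x) = x ∧
      contr i M (coeffOne i i) (tin i M (idem k n i) x) = 0 := by
  have h0 := coeffZero_pathZero (k := k) i i i i
  have h1 := coeffOne_pathZero (k := k) i i i i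
  rw [pathZero_self] at h0 h1
  rw [contr_tin, contr_tin, idem_mul_self, h0, h1, if_pos ⟨rfl, rfl⟩, one_smul, zero_smul, hx]
  exact ⟨rfl, rfl⟩

theorem contr_loop {i : Fin n} {M : GrMod k n} {x : M} (hx : idem k n i • x = x) :
    contr i M (coeffOne i i) (tin i M (pathOne k i i) x) = x := by
  rw [contr_tin, pathOne_mul_idem, if_pos rfl, coeffOne_pathOne, if_pos ⟨rfl, rfl⟩, one_smul, hx]

theorem corner_eq {i : Fin n} {M : GrMod k n} {t : (tensorObj i M).carrier}
    (ht : idem k n i • t = t) : tin i M (idem k n i) (contr i M (coeffZero i i) t) +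
      tin i M (pathOne k i i) (contr i M (coeffOne i i) t) = t := by
  have := idem_smul_eq i i M t
  rw [pathZero_self, ht] at this
  exact this.symm

/-! ### The unit becomes a split monomorphism after tensoring -/

variable (k) in
/-- The map `A e_i ⊗ e_i M → A e_i ⊗ e_i A e_i ⊗ e_i M`, `p ⊗ w ↦ p ⊗ e_i ⊗ w`, twisted. -/
def insertOuter (i : Fin n) : tensor (k := k) i ⋙ shift 1 ⟶ (tensor i ⋙ shift 1) ⋙ tensor i where
  app M := ofLin (M := shiftObj 1 (tensorObj i M)) (N := tensorObj i (shiftObj 1 (tensorObj i M)))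
    (tlin i (N := shiftObj 1 (tensorObj i M)) (tin i M (idem k n i))) fun d t ht => by
      have := tlin_mem (N := shiftObj 1 (tensorObj i M)) (f := tin i M (idem k n i)) (e := -1)
        (fun d x hx => by
          change _ ∈ (tensorObj i M).deg (d + -1 + 1)
          rw [neg_add_cancel_right]
          exact tin_idem_mem hx) ht
      rwa [add_neg_cancel_right] at this
  naturality M N φ := hom_ext fun t =>
    tlin_naturality (N := shiftObj 1 (tensorObj i M)) (N' := shiftObj 1 (tensorObj i N)) φ
      ((shift 1).map (tensorMap i φ)) (tin i M (idem k n i)) (tin i N (idem k n i))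
      (fun x => (tensorMap_tin φ _ x).symm) t

variable (k) in
/-- The map `A e_i ⊗ e_i A e_i ⊗ e_i M → A e_i ⊗ e_i M` that takes the coefficient of the loop in
the middle factor. -/
def traceOuter (i : Fin n) : (tensor (k := k) i ⋙ shift 1) ⋙ tensor i ⟶ tensor i where
  app M := ofLin (M := tensorObj i (shiftObj 1 (tensorObj i M))) (N := tensorObj i M)
    (tlin i (M := shiftObj 1 (tensorObj i M)) (contr i M (coeffOne i i))) fun d t ht => by
      have := tlin_mem (M := shiftObj 1 (tensorObj i M)) (f := contr i M (coeffOne i i)) (e := 0)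
        (fun d x hx => by
          have := (contr_one_mem (j := i) hx).1
          rwa [add_sub_cancel_right, ← add_zero d] at this) ht
      rwa [add_zero] at this
  naturality M N φ := hom_ext fun t =>
    tlin_naturality (M := shiftObj 1 (tensorObj i M)) (M' := shiftObj 1 (tensorObj i N))
      ((shift 1).map (tensorMap i φ)) φ (contr i M (coeffOne i i)) (contr i N (coeffOne i i))
      (fun x => contr_tensorMap φ _ x) t

/-- The map `p ⊗ w ↦ c₀(p) w - c₁(p) z w`, where `c₀` and `c₁` are the coefficients of `e_i` and of
the loop. -/
def complLin (i : Fin n) (M : GrMod k n) : (tensorObj i M).carrier →ₗ[k] M.carrier :=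
  contr i M (coeffZero i i) -
    Algebra.lsmul k k M.carrier (pathOne k i i) ∘ₗ contr i M (coeffOne i i)

theorem complLin_apply (i : Fin n) (M : GrMod k n) (t : (tensorObj i M).carrier) :
    complLin i M t = contr i M (coeffZero i i) t - pathOne k i i • contr i M (coeffOne i i) t := rfl

theorem complLin_tensorMap (i : Fin n) {M N : GrMod k n} (φ : M ⟶ N) (t : (tensorObj i M).carrier) :
    complLin i N (Hom.lin (tensorMap i φ) t) = Hom.lin φ (complLin i M t) := by
  rw [complLin_apply, complLin_apply, contr_tensorMap, contr_tensorMap, map_sub, map_smul]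

theorem complLin_mem {i : Fin n} {M : GrMod k n} {d : ℤ} {t : (tensorObj i M).carrier}
    (ht : t ∈ (tensorObj i M).deg d) : complLin i M t ∈ M.deg d := by
  rw [complLin_apply]
  refine Submodule.sub_mem _ (contr_zero_mem ht).1 ?_
  have := M.smul_mem (pathOne_mem (k := k) i i) (contr_one_mem (j := i) ht).1
  rwa [add_sub_cancel] at this

variable (k) in
/-- The map `p ⊗ q ⊗ w ↦ c₀(q) p ⊗ w - c₁(q) p ⊗ z w`. -/
def complOuter (i : Fin n) : (tensor (k := k) i ⋙ shift 1) ⋙ tensor i ⟶ tensor i ⋙ shift 1 where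
  app M := ofLin (M := tensorObj i (shiftObj 1 (tensorObj i M))) (N := shiftObj 1 (tensorObj i M))
    (tlin i (M := shiftObj 1 (tensorObj i M)) (complLin i M)) fun d t ht =>
      tlin_mem (M := shiftObj 1 (tensorObj i M)) (f := complLin i M) (e := 1)
        (fun d x hx => complLin_mem hx) ht
  naturality M N φ := hom_ext fun t =>
    tlin_naturality (M := shiftObj 1 (tensorObj i M)) (M' := shiftObj 1 (tensorObj i N))
      ((shift 1).map (tensorMap i φ)) φ (complLin i M) (complLin i N)
      (fun x => complLin_tensorMap i φ x) t

theorem insertOuter_counit (i : Fin n) (M : GrMod k n) :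
    (insertOuter k i).app M ≫ (counit i).app (shiftObj 1 (tensorObj i M)) = 𝟙 _ := by
  refine hom_ext (LinearMap.congr_fun (tensor_part_lin_ext (M := M) fun d x hx => ?_))
  refine (congrArg (counitLin i (shiftObj 1 (tensorObj i M)))
    (tlin_tin (N := shiftObj 1 (tensorObj i M)) (tin i M (idem k n i)) _ hx.2)).trans ?_
  refine (counitLin_tin i (shiftObj 1 (tensorObj i M)) _ _).trans ?_
  rw [idem_mul_self]
  exact idem_smul_tin_idem i M x

theorem insertOuter_compl (i : Fin n) (M : GrMod k n) :
    (insertOuter k i).app M ≫ (complOuter k i).app M = 𝟙 _ := by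
  refine hom_ext (LinearMap.congr_fun (tensor_part_lin_ext (M := M) fun d x hx => ?_))
  refine (congrArg (tlin i (M := shiftObj 1 (tensorObj i M)) (complLin i M))
    (tlin_tin (N := shiftObj 1 (tensorObj i M)) (tin i M (idem k n i)) _ hx.2)).trans ?_
  refine (tlin_tin (M := shiftObj 1 (tensorObj i M)) _ _ (idem_smul_tin_idem i M x)).trans ?_
  have h : complLin i M (tin i M (idem k n i) x) = x := by
    rw [complLin_apply, (contr_idem hx.2).1, (contr_idem hx.2).2, smul_zero, sub_zero]
  exact congrArg (tin i M (idem k n i)) h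

variable (k) in
/-- The functor `A e_i ⊗ e_i -` applied to the unit. -/
def unitOuter (i : Fin n) : tensor (k := k) i ⟶ (tensor i ⋙ shift 1) ⋙ tensor i where
  app M := tensorMap i ((unit i).app M)
  naturality M N φ := by
    have h := congrArg (tensor i).map ((unit i).naturality φ)
    rwa [Functor.map_comp, Functor.map_comp] at h

theorem unit_traceOuter (i : Fin n) (M : GrMod k n) :
    (unitOuter k i).app M ≫ (traceOuter k i).app M = 𝟙 _ := by
  refine hom_ext (LinearMap.congr_fun (tensor_part_lin_ext (M := M) fun d x hx => ?_))
  refine (congrArg (tlin i (M := shiftObj 1 (tensorObj i M)) (contr i M (coeffOne i i)))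
    (tensorMap_tin ((unit i).app M) _ _)).trans ?_
  refine (tlin_tin (M := shiftObj 1 (tensorObj i M)) _ _ ?_).trans ?_
  · exact (map_smul (Hom.lin ((unit i).app M)) (idem k n i) x).symm.trans (by rw [hx.2])
  · exact congrArg (tin i M (idem k n i)) ((contr_one_unit hx).trans (by rw [pathZero_self, hx.2]))

/-- In the coordinates at `i` the unit is `x ↦ (z x, x)`, and `complLin` is `c₀ - z c₁`. -/
theorem unit_complOuter (i : Fin n) (M : GrMod k n) :
    (unitOuter k i).app M ≫ (complOuter k i).app M = 0 := by
  refine hom_ext (LinearMap.congr_fun (tensor_part_lin_ext (M := M) fun d x hx => ?_))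
  refine (congrArg (tlin i (M := shiftObj 1 (tensorObj i M)) (complLin i M))
    (tensorMap_tin ((unit i).app M) _ _)).trans ?_
  refine (tlin_tin (M := shiftObj 1 (tensorObj i M)) _ _ ?_).trans ?_
  · exact (map_smul (Hom.lin ((unit i).app M)) (idem k n i) x).symm.trans (by rw [hx.2])
  · have h : complLin i M (unitBase i M x) = 0 := by
      rw [complLin_apply, contr_zero_unit hx, contr_one_unit hx, pathZero_self, hx.2, sub_self]
    exact (congrArg (tin i M (idem k n i)) h).trans (map_zero _)

theorem idem_smul_complLin (i : Fin n) (M : GrMod k n) (t : (tensorObj i M).carrier) :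
    idem k n i • complLin i M t = complLin i M t := by
  rw [complLin_apply, smul_sub, idem_smul_contr, smul_smul, idem_mul_pathOne, if_pos rfl]

/-- `e_i A e_i ⊗ e_i M` is the direct sum of the graph `(z x, x)` of the unit and of `e_i ⊗ e_i M`:
subtracting the unit of the loop coordinate leaves a multiple of `e_i`. -/
theorem unit_trace_add {i : Fin n} {M : GrMod k n} {d : ℤ} {t : (tensorObj i M).carrier}
    (ht : t ∈ part i d (tensorObj i M)) : unitBase i M (contr i M (coeffOne i i) t) +
      tin i M (idem k n i) (complLin i M t) = t := by
  have hp := contr_one_mem (j := i) ht.1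
  have hu : idem k n i • unitBase i M (contr i M (coeffOne i i) t) =
      unitBase i M (contr i M (coeffOne i i) t) := by rw [← unitBase_smul, hp.2]
  have hu' := corner_eq hu
  rw [contr_zero_unit hp, contr_one_unit hp, pathZero_self, hp.2] at hu'
  rw [← hu', complLin_apply, map_sub]
  refine Eq.trans ?_ (corner_eq ht.2)
  abel

theorem traceOuter_add (i : Fin n) (M : GrMod k n) :
    (traceOuter k i).app M ≫ (unitOuter k i).app M +
      (complOuter k i).app M ≫ (insertOuter k i).app M = 𝟙 _ := by
  refine hom_ext (LinearMap.congr_fun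
    (tensor_part_lin_ext (M := shiftObj 1 (tensorObj i M)) fun d t ht => ?_))
  have h1 : Hom.lin ((traceOuter k i).app M ≫ (unitOuter k i).app M)
      (tin i (shiftObj 1 (tensorObj i M)) (idem k n i) t) =
        tin i (shiftObj 1 (tensorObj i M)) (idem k n i)
          (unitBase i M (contr i M (coeffOne i i) t)) :=
    (congrArg (Hom.lin (tensorMap i ((unit i).app M)))
      (tlin_tin (M := shiftObj 1 (tensorObj i M)) _ _ ht.2)).trans (tensorMap_tin _ _ _)
  have h2 : Hom.lin ((complOuter k i).app M ≫ (insertOuter k i).app M)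
      (tin i (shiftObj 1 (tensorObj i M)) (idem k n i) t) =
        tin i (shiftObj 1 (tensorObj i M)) (idem k n i) (tin i M (idem k n i) (complLin i M t)) :=
    (congrArg (tlin i (N := shiftObj 1 (tensorObj i M)) (tin i M (idem k n i)))
      (tlin_tin (M := shiftObj 1 (tensorObj i M)) _ _ ht.2)).trans
        (tlin_tin _ _ (idem_smul_complLin i M t))
  exact (congrArg₂ (· + ·) h1 h2).trans (((map_add _ _ _).symm).trans
    (congrArg (tin i (shiftObj 1 (tensorObj i M)) (idem k n i)) (unit_trace_add (M := M) ht)))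

/-! ### The counit becomes a split epimorphism after tensoring -/

variable (k) in
/-- The map `A e_i ⊗ e_i M → A e_i ⊗ e_i A e_i ⊗ e_i M`, `p ⊗ w ↦ p ⊗ e_i ⊗ w`. -/
def insertInner (i : Fin n) : tensor (k := k) i ⋙ shift 1 ⟶ tensor i ⋙ tensor i ⋙ shift 1 where
  app M := ofLin (M := shiftObj 1 (tensorObj i M)) (N := shiftObj 1 (tensorObj i (tensorObj i M)))
    (tlin i (N := tensorObj i M) (tin i M (idem k n i))) fun d t ht => by
      have := tlin_mem (N := tensorObj i M) (f := tin i M (idem k n i)) (e := 0)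
        (fun d x hx => by rw [add_zero]; exact tin_idem_mem hx) ht
      rwa [add_zero] at this
  naturality M N φ := hom_ext fun t => tlin_naturality φ (tensorMap i φ) (tin i M (idem k n i))
    (tin i N (idem k n i)) (fun x => (tensorMap_tin φ _ x).symm) t

variable (k) in
/-- The map `A e_i ⊗ e_i A e_i ⊗ e_i M → A e_i ⊗ e_i M` that takes the coefficient of the loop in
the middle factor. -/
def traceInner (i : Fin n) : tensor (k := k) i ⋙ tensor i ⋙ shift 1 ⟶ tensor i where
  app M := ofLin (M := shiftObj 1 (tensorObj i (tensorObj i M))) (N := tensorObj i M)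
    (tlin i (M := tensorObj i M) (contr i M (coeffOne i i))) fun d t ht => by
      have := tlin_mem (M := tensorObj i M) (f := contr i M (coeffOne i i)) (e := -1)
        (fun d x hx => (contr_one_mem (j := i) hx).1) ht
      rwa [add_neg_cancel_right] at this
  naturality M N φ := hom_ext fun t => tlin_naturality (tensorMap i φ) φ
    (contr i M (coeffOne i i)) (contr i N (coeffOne i i)) (fun x => contr_tensorMap φ _ x) t

/-- The map `w ↦ z ⊗ w - e_i ⊗ z w`. -/
def kerLin (i : Fin n) (M : GrMod k n) : M.carrier →ₗ[k] (tensorObj i M).carrier :=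
  tin i M (pathOne k i i) -
    tin i M (idem k n i) ∘ₗ Algebra.lsmul k k M.carrier (pathOne k i i)

theorem kerLin_apply (i : Fin n) (M : GrMod k n) (x : M) : kerLin i M x =
    tin i M (pathOne k i i) x - tin i M (idem k n i) (pathOne k i i • x) := rfl

variable (k) in
/-- The map `p ⊗ w ↦ p ⊗ z ⊗ w - p ⊗ e_i ⊗ z w`. -/
def kerInner (i : Fin n) : tensor (k := k) i ⟶ tensor i ⋙ tensor i ⋙ shift 1 where
  app M := ofLin (M := tensorObj i M) (N := shiftObj 1 (tensorObj i (tensorObj i M)))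
    (tlin i (N := tensorObj i M) (kerLin i M)) fun d t ht =>
      tlin_mem (N := tensorObj i M) (f := kerLin i M) (e := 1) (fun d x hx => by
        rw [kerLin_apply, add_comm d]
        exact Submodule.sub_mem _ (tin_mem_deg (pathOne_mem i i) hx)
          (tin_idem_mem (M.smul_mem (pathOne_mem i i) hx))) ht
  naturality M N φ := hom_ext fun t => tlin_naturality φ (tensorMap i φ) (kerLin i M) (kerLin i N)
    (fun x => by
      rw [kerLin_apply, kerLin_apply, map_sub, tensorMap_tin, tensorMap_tin,
        map_smul (Hom.lin φ)]) t

variable (k) in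
/-- The functor `A e_i ⊗ e_i -⟨1⟩` applied to the counit. -/
def counitInner (i : Fin n) : tensor (k := k) i ⋙ tensor i ⋙ shift 1 ⟶ tensor i ⋙ shift 1 where
  app M := (shift 1).map (tensorMap i ((counit i).app M))
  naturality M N φ := by
    have h := congrArg (tensor i ⋙ shift 1).map ((counit i).naturality φ)
    rwa [Functor.map_comp, Functor.map_comp] at h

theorem counitLin_corner {i : Fin n} {M : GrMod k n} {t : (tensorObj i M).carrier}
    (ht : idem k n i • t = t) : counitLin i M t =
      contr i M (coeffZero i i) t + pathOne k i i • contr i M (coeffOne i i) t := by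
  conv_lhs => rw [← corner_eq ht]
  rw [map_add, counitLin_tin, counitLin_tin, idem_mul_self, idem_smul_contr, pathOne_mul_idem,
    if_pos rfl]

theorem idem_smul_kerLin (i : Fin n) (M : GrMod k n) (x : M) :
    idem k n i • kerLin i M x = kerLin i M x := by
  rw [kerLin_apply, smul_sub, smul_tin, smul_tin, idem_mul_pathOne, if_pos rfl, idem_mul_self]

/-- Both terms of `z ⊗ w - e_i ⊗ z w` act as `z w`. -/
theorem kerInner_counit (i : Fin n) (M : GrMod k n) :
    (kerInner k i).app M ≫ (counitInner k i).app M = 0 := by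
  refine hom_ext (LinearMap.congr_fun (tensor_part_lin_ext (M := M) fun d x hx => ?_))
  refine (congrArg (Hom.lin (tensorMap i ((counit i).app M)))
    (tlin_tin (N := tensorObj i M) (kerLin i M) _ hx.2)).trans ((tensorMap_tin _ _ _).trans ?_)
  have h : counitLin i M (kerLin i M x) = 0 := by
    rw [kerLin_apply, map_sub, counitLin_tin, counitLin_tin, pathOne_mul_idem, if_pos rfl,
      idem_mul_self, smul_smul, idem_mul_pathOne, if_pos rfl, sub_self]
  exact (congrArg (tin i M (idem k n i)) h).trans (map_zero _)

theorem kerInner_trace (i : Fin n) (M : GrMod k n) :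
    (kerInner k i).app M ≫ (traceInner k i).app M = 𝟙 _ := by
  refine hom_ext (LinearMap.congr_fun (tensor_part_lin_ext (M := M) fun d x hx => ?_))
  refine (congrArg (tlin i (M := tensorObj i M) (contr i M (coeffOne i i)))
    (tlin_tin (N := tensorObj i M) (kerLin i M) _ hx.2)).trans
      ((tlin_tin _ _ (idem_smul_kerLin i M x)).trans ?_)
  have h : contr i M (coeffOne i i) (kerLin i M x) = x := by
    rw [kerLin_apply, map_sub, contr_loop hx.2, (contr_idem (x := pathOne k i i • x) (by
      rw [smul_smul, idem_mul_pathOne, if_pos rfl])).2, sub_zero]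
  exact congrArg (tin i M (idem k n i)) h

theorem insertInner_counit (i : Fin n) (M : GrMod k n) :
    (insertInner k i).app M ≫ (counitInner k i).app M = 𝟙 _ := by
  refine hom_ext (LinearMap.congr_fun (tensor_part_lin_ext (M := M) fun d x hx => ?_))
  refine (congrArg (Hom.lin (tensorMap i ((counit i).app M)))
    (tlin_tin (N := tensorObj i M) (tin i M (idem k n i)) _ hx.2)).trans
      ((tensorMap_tin _ _ _).trans ?_)
  have h : counitLin i M (tin i M (idem k n i) x) = x := by
    rw [counitLin_tin, idem_mul_self, hx.2]
  exact congrArg (tin i M (idem k n i)) h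

theorem traceInner_add (i : Fin n) (M : GrMod k n) :
    (traceInner k i).app M ≫ (kerInner k i).app M +
      (counitInner k i).app M ≫ (insertInner k i).app M = 𝟙 _ := by
  refine hom_ext (LinearMap.congr_fun
    (tensor_part_lin_ext (M := tensorObj i M) fun d t ht => ?_))
  have hc : idem k n i • counitLin i M t = counitLin i M t := by rw [← map_smul, ht.2]
  have h1 : Hom.lin ((traceInner k i).app M ≫ (kerInner k i).app M)
      (tin i (tensorObj i M) (idem k n i) t) =
        tin i (tensorObj i M) (idem k n i) (kerLin i M (contr i M (coeffOne i i) t)) :=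
    (congrArg (tlin i (N := tensorObj i M) (kerLin i M)) (tlin_tin _ _ ht.2)).trans
      (tlin_tin _ _ (idem_smul_contr i M _ t))
  have h2 : Hom.lin ((counitInner k i).app M ≫ (insertInner k i).app M)
      (tin i (tensorObj i M) (idem k n i) t) =
        tin i (tensorObj i M) (idem k n i) (tin i M (idem k n i) (counitLin i M t)) :=
    (congrArg (tlin i (N := tensorObj i M) (tin i M (idem k n i)))
      (tensorMap_tin ((counit i).app M) _ _)).trans (tlin_tin _ _ hc)
  have h3 : kerLin i M (contr i M (coeffOne i i) t) + tin i M (idem k n i) (counitLin i M t) = t := by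
    rw [counitLin_corner ht.2, kerLin_apply, map_add]
    refine Eq.trans ?_ (corner_eq (M := M) ht.2)
    abel
  exact (congrArg₂ (· + ·) h1 h2).trans (((map_add _ _ _).symm).trans
    (congrArg (tin i (tensorObj i M) (idem k n i)) h3))

/-- On `e_i ⊗ x` only the term of the vertex `i` survives, which gives `e_i ⊗ z ⊗ x + z ⊗ e_i ⊗ x`.
The loop coefficient of the middle factor keeps the first summand only. -/
theorem unit_traceInner (i : Fin n) (M : GrMod k n) :
    (unit i).app (tensorObj i M) ≫ (traceInner k i).app M = 𝟙 _ := by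
  refine hom_ext (LinearMap.congr_fun (tensor_part_lin_ext (M := M) fun d x hx => ?_))
  have h0 : ∀ l, l ≠ i → pathOne k i l • tin i M (idem k n i) x = 0 ∧
      pathZero k i l • tin i M (idem k n i) x = 0 := fun l hl => by
    rw [smul_tin, smul_tin, pathOne_mul_idem, pathZero_mul_idem, if_neg hl.symm, if_neg hl.symm]
    exact ⟨by rw [← zero_smul k (0 : Alg k n), tin_smul, zero_smul, map_zero],
      by rw [← zero_smul k (0 : Alg k n), tin_smul, zero_smul, map_zero]⟩
  have h1 : unitBase i (tensorObj i M) (tin i M (idem k n i) x) =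
      tin i (tensorObj i M) (idem k n i) (tin i M (pathOne k i i) x) +
        tin i (tensorObj i M) (pathOne k i i) (tin i M (idem k n i) x) := by
    rw [unitBase_eq, Finset.sum_eq_single i]
    · rw [smul_tin, smul_tin, pathOne_mul_idem, if_pos rfl, pathZero_self, idem_mul_self]
    · intro l _ hl
      rw [(h0 l hl).1, (h0 l hl).2, map_zero, map_zero, add_zero]
    · exact fun h => absurd (Finset.mem_univ i) h
  have h2 : tlin i (M := tensorObj i M) (contr i M (coeffOne i i))
      (unitBase i (tensorObj i M) (tin i M (idem k n i) x)) = tin i M (idem k n i) x := by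
    rw [h1, map_add, tlin_tin _ _ (by rw [smul_tin, idem_mul_pathOne, if_pos rfl]),
      tlin_tin _ _ (idem_smul_tin_idem i M x), contr_loop hx.2, (contr_idem hx.2).2, map_zero,
      add_zero]
  exact h2

end GrMod

end Zigzag

end

noncomputable section

open CategoryTheory CategoryTheory.Limits TensorProduct

namespace Zigzag

universe u

section Category

variable {C : Type*} [Category* C]

theorem eq_of_comp_id {X Y : C} {a b : X ⟶ Y} {e : Y ⟶ Y} {e' : X ⟶ X} (he : e = 𝟙 Y)
    (he' : e' = 𝟙 X) (h : a ≫ e = e' ≫ b) : a = b := by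
  rwa [he, he', Category.comp_id, Category.id_comp] at h

theorem comp_eq_of_squares {X X' Y Y' Y'' Z : C} {c : X ⟶ X'} {u' : X' ⟶ Y'} {u : X ⟶ Y}
    {f : Y ⟶ Y'} {κ : Y' ⟶ Z} {κ₀ : Y ⟶ Y''} {c' : Y'' ⟶ Z} {v : X ⟶ Y''} {w : X' ⟶ Z}
    (h1 : c ≫ u' = u ≫ f) (h2 : f ≫ κ = κ₀ ≫ c') (h3 : u ≫ κ₀ = v) (h4 : v ≫ c' = c ≫ w) :
    c ≫ u' ≫ κ = c ≫ w := by
  rw [reassoc_of% h1, h2, reassoc_of% h3, h4]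

theorem comp_eq_of_retract {X Y Z W V : C} {δ : X ⟶ Y} {u' : Y ⟶ Z} {u : X ⟶ W} {f : W ⟶ Z}
    {κ : Z ⟶ V} {v : Y ⟶ V} {r : V ⟶ Y} (h1 : δ ≫ u' = u ≫ f) (h2 : u' ≫ κ = v)
    (h3 : v ≫ r = 𝟙 Y) : u ≫ (f ≫ κ) ≫ r = δ := by
  rw [Category.assoc, ← reassoc_of% h1, reassoc_of% h2, h3, Category.comp_id]

end Category

/-! ### Triangles whose first map splits -/

section Triangulated

open Pretriangulated

variable {C : Type*} [Category* C] [HasZeroObject C] [HasShift C ℤ] [Preadditive C]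
  [∀ a : ℤ, (CategoryTheory.shiftFunctor C a).Additive] [Pretriangulated C]

/-- The third vertex of a triangle on a split monomorphism is the complement: `q` factors through
it, and the factor is inverse to `s ≫ T.mor₂`. -/
theorem isIso_of_splitMono {T : Triangle C} (hT : T ∈ distTriang C) {S : C} (r : T.obj₂ ⟶ T.obj₁)
    (s : S ⟶ T.obj₂) (q : T.obj₂ ⟶ S) (h1 : T.mor₁ ≫ r = 𝟙 _) (h2 : T.mor₁ ≫ q = 0)
    (h3 : s ≫ q = 𝟙 S) (h4 : r ≫ T.mor₁ + q ≫ s = 𝟙 _) : IsIso (s ≫ T.mor₂) := by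
  obtain ⟨c, hc⟩ := Triangle.yoneda_exact₂ T hT q h2
  have h12 : T.mor₁ ≫ T.mor₂ = 0 := comp_distTriang_mor_zero₁₂ _ hT
  have : Mono T.mor₁ := mono_of_mono_fac h1
  have : Epi T.mor₂ := (Triangle.epi₂ _ hT ((Triangle.mor₃_eq_zero_iff_mono₁ _ hT).mpr ‹_›))
  refine ⟨c, by rw [Category.assoc, ← hc, h3], ?_⟩
  rw [← cancel_epi T.mor₂, ← reassoc_of% hc, Category.comp_id, ← Category.assoc,
    ← sub_eq_iff_eq_add'.mpr h4.symm, Preadditive.sub_comp, Category.assoc, h12, comp_zero,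
    Category.id_comp, sub_zero]

/-- Dually, the third vertex of a triangle on a split epimorphism is the kernel shifted by one. -/
theorem isIso_of_splitEpi {T : Triangle C} (hT : T ∈ distTriang C) {K : C} (r : T.obj₁ ⟶ K)
    (i : K ⟶ T.obj₁) (s : T.obj₂ ⟶ T.obj₁) (h1 : i ≫ T.mor₁ = 0) (h2 : i ≫ r = 𝟙 K)
    (h3 : s ≫ T.mor₁ = 𝟙 _) (h4 : r ≫ i + T.mor₁ ≫ s = 𝟙 _) : IsIso (T.mor₃ ≫ r⟦(1 : ℤ)⟧') := by
  obtain ⟨d, hd⟩ := Triangle.coyoneda_exact₁ T hT (i⟦(1 : ℤ)⟧') (by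
    rw [← Functor.map_comp, h1, Functor.map_zero])
  have h31 : T.mor₃ ≫ T.mor₁⟦(1 : ℤ)⟧' = 0 := comp_distTriang_mor_zero₃₁ _ hT
  have : Epi T.mor₁ := epi_of_epi_fac h3
  have : Mono T.mor₃ := Triangle.mono₃ _ hT ((Triangle.mor₂_eq_zero_iff_epi₁ _ hT).mpr ‹_›)
  refine ⟨d, ?_, by rw [← Category.assoc, ← hd, ← Functor.map_comp, h2, CategoryTheory.Functor.map_id]⟩
  rw [← cancel_mono T.mor₃, Category.assoc, ← hd, Category.id_comp, Category.assoc,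
    ← Functor.map_comp, ← sub_eq_iff_eq_add.mpr h4.symm, Functor.map_sub, Functor.map_comp,
    Preadditive.comp_sub, reassoc_of% h31, zero_comp, sub_zero, CategoryTheory.Functor.map_id,
    Category.comp_id]

end Triangulated

namespace Cpx

open GrMod Pretriangulated

variable {k : Type u} [Field k] {n : ℕ}

/-! ### `Σ_i` and `Σ_i^{-1}` are inverse to each other up to a shift -/

/-- The map of complexes given by a natural transformation. -/
abbrev natMap {F G : GrMod k n ⥤ GrMod k n} [F.Additive] [G.Additive] (α : F ⟶ G) (Y : Cpx k n) :
    (F.mapHomologicalComplex (ComplexShape.up ℤ)).obj Y ⟶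
      (G.mapHomologicalComplex (ComplexShape.up ℤ)).obj Y :=
  (NatTrans.mapHomologicalComplex α (ComplexShape.up ℤ)).app Y

theorem toHo_comp_eq {X Y Z : Cpx k n} {f : X ⟶ Y} {g : Y ⟶ Z} {h : X ⟶ Z}
    (w : ∀ m, f.f m ≫ g.f m = h.f m) : (toHo k n).map f ≫ (toHo k n).map g = (toHo k n).map h := by
  rw [← Functor.map_comp]
  exact congrArg _ (HomologicalComplex.hom_ext _ _ w)

/-- The functor `A e_i ⊗ e_i -` on the homotopy category. -/
abbrev TK (k : Type u) [Field k] {n : ℕ} (i : Fin n) :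
    HomotopyCategory (GrMod k n) (ComplexShape.up ℤ) ⥤
    HomotopyCategory (GrMod k n) (ComplexShape.up ℤ) :=
  (tensor i).mapHomotopyCategory (ComplexShape.up ℤ)

/-- The functor `A e_i ⊗ e_i -⟨1⟩` on the homotopy category. -/
abbrev TK1 (k : Type u) [Field k] {n : ℕ} (i : Fin n) :
    HomotopyCategory (GrMod k n) (ComplexShape.up ℤ) ⥤
    HomotopyCategory (GrMod k n) (ComplexShape.up ℤ) :=
  (tensor i ⋙ GrMod.shift 1).mapHomotopyCategory (ComplexShape.up ℤ)

/-- The map `p ⊗ w ↦ p ⊗ e_i ⊗ w` into `A e_i ⊗ e_i -` of the cone of the unit. -/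
def insertMap (i : Fin n) (Y : Cpx k n) :
    TC1 i Y ⟶ TC i (CochainComplex.mappingCone (unitMap i Y)) :=
  CategoryStruct.comp (Y := TC i (TC1 i Y)) (natMap (insertOuter k i) Y)
    (((tensor i).mapHomologicalComplex _).map (CochainComplex.mappingCone.inr (unitMap i Y)))

/-- Tensoring the triangle of the unit with `A e_i` gives a triangle whose first map is split by the
trace, with complement `A e_i ⊗ e_i Y⟨1⟩`. -/
theorem isIso_insertMap (i : Fin n) (Y : Cpx k n) : IsIso ((toHo k n).map (insertMap i Y)) := by
  have hT := (TK k i).map_distinguished _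
    (HomotopyCategory.mappingCone_triangleh_distinguished (unitMap i Y))
  change IsIso ((toHo k n).map (natMap (insertOuter k i) Y) ≫
    (TK k i).map ((toHo k n).map (CochainComplex.mappingCone.inr (unitMap i Y))))
  refine isIso_of_splitMono hT ((toHo k n).map (natMap (traceOuter k i) Y))
    ((toHo k n).map (natMap (insertOuter k i) Y)) ((toHo k n).map (natMap (complOuter k i) Y))
    ?_ ?_ ?_ ?_
  · exact (toHo_comp_eq (f := natMap (unitOuter k i) Y) (h := 𝟙 _) fun m =>
      unit_traceOuter i (Y.X m)).trans (CategoryTheory.Functor.map_id _ _)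
  · exact (toHo_comp_eq (f := natMap (unitOuter k i) Y) (h := 0) fun m =>
      unit_complOuter i (Y.X m)).trans (Functor.map_zero _ _ _)
  · exact (toHo_comp_eq (h := 𝟙 _) fun m => insertOuter_compl i (Y.X m)).trans
      (CategoryTheory.Functor.map_id _ _)
  · have h : natMap (traceOuter k i) Y ≫ natMap (unitOuter k i) Y +
        natMap (complOuter k i) Y ≫ natMap (insertOuter k i) Y = 𝟙 _ :=
      HomologicalComplex.hom_ext _ _ fun m => traceOuter_add i (Y.X m)
    have h' := congrArg (toHo k n).map h
    rw [Functor.map_add, Functor.map_comp, Functor.map_comp, CategoryTheory.Functor.map_id] at h'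
    exact h'

/-- `Σ_i^{-1}` of the cone of the unit of `Y` is `Y[1]`. -/
def sigmaInvConeIso (i : Fin n) (Y : Cpx k n) :
    (toHo k n).obj (sigmaInv i (CochainComplex.mappingCone (unitMap i Y))) ≅
      ((toHo k n).obj Y)⟦(1 : ℤ)⟧ := by
  have := isIso_insertMap i Y
  let e : (toHo k n).obj (TC1 i Y) ≅ (toHo k n).obj (TC i (CochainComplex.mappingCone (unitMap i Y))) :=
    asIso ((toHo k n).map (insertMap i Y))
  -- Under `insertMap` the counit of the cone becomes the inclusion of `A e_i ⊗ e_i Y⟨1⟩` in the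
  -- cone. Its own cone is read off from the rotated triangle of the unit, and is `Y[1]`.
  refine (Triangle.π₃.mapIso (isoTriangleOfIso₁₂
    (CochainComplex.mappingCone.triangleh (unitMap i Y)).rotate
    (CochainComplex.mappingCone.triangleh (counitMap i (CochainComplex.mappingCone (unitMap i Y))))
    (rot_of_distTriang _ (HomotopyCategory.mappingCone_triangleh_distinguished _))
    (HomotopyCategory.mappingCone_triangleh_distinguished _)
    e (Iso.refl _) ?_)).symm
  refine (Category.comp_id _).trans ?_
  refine (toHo_comp_eq (f := insertMap i Y) (h := CochainComplex.mappingCone.inr (unitMap i Y))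
    fun m => ?_).symm
  have h1 := (counit i).naturality ((CochainComplex.mappingCone.inr (unitMap i Y)).f m)
  refine (Category.assoc _ _ _).trans ?_
  refine (congrArg ((insertOuter k i).app (Y.X m) ≫ ·) h1).trans ?_
  refine (Category.assoc _ _ _).symm.trans ?_
  exact (congrArg (· ≫ (CochainComplex.mappingCone.inr (unitMap i Y)).f m)
    (insertOuter_counit i (Y.X m))).trans (Category.id_comp _)

/-- The unit on the homotopy category. -/
def unitK (k : Type u) [Field k] {n : ℕ} (i : Fin n) : 𝟭 _ ⟶ TK1 k i where
  app X := (toHo k n).map (unitMap i X.as)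
  naturality X Y f := by
    obtain ⟨f, rfl⟩ := (toHo k n).map_surjective (X := X.as) (Y := Y.as) f
    have h : f ≫ unitMap i Y.as =
        unitMap i X.as ≫ ((tensor i ⋙ GrMod.shift 1).mapHomologicalComplex _).map f :=
      HomologicalComplex.hom_ext _ _ fun m => (unit i).naturality (f.f m)
    have h' := congrArg (toHo k n).map h
    rw [Functor.map_comp, Functor.map_comp] at h'
    exact h'

/-- Needed to move the unit past the connecting map of the counit triangle, whose target is a shift.
-/
theorem unitK_shift (i : Fin n) (W : Cpx k n) :
    (unitK k i).app (((toHo k n).obj W)⟦(1 : ℤ)⟧) ≫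
      ((TK1 k i).commShiftIso (1 : ℤ)).hom.app ((toHo k n).obj W) =
        ((unitK k i).app ((toHo k n).obj W))⟦(1 : ℤ)⟧' := by
  rw [← cancel_epi (((toHo k n).commShiftIso (1 : ℤ)).hom.app W)]
  have h1 := (unitK k i).naturality (((toHo k n).commShiftIso (1 : ℤ)).hom.app W)
  have h2 := NatTrans.shift_app_comm
    ((tensor i ⋙ GrMod.shift (k := k) 1).mapHomotopyCategoryFactors (ComplexShape.up ℤ)).hom
    -- The comparison isomorphism used in `h2` is an identity, but only definitionally, so it is
    -- removed by `eq_of_comp_id` and not by rewriting.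
    (1 : ℤ) W
  have h3 := ((toHo k n).commShiftIso (1 : ℤ)).hom.naturality (unitMap i W)
  rw [Functor.commShiftIso_comp_hom_app, Functor.commShiftIso_comp_hom_app] at h2
  have h2' : (TK1 k i).map (((toHo k n).commShiftIso (1 : ℤ)).hom.app W) ≫
      ((TK1 k i).commShiftIso (1 : ℤ)).hom.app ((toHo k n).obj W) =
        (toHo k n).map ((((tensor i ⋙ GrMod.shift 1).mapHomologicalComplex
          (ComplexShape.up ℤ)).commShiftIso (1 : ℤ)).hom.app W) ≫
            ((toHo k n).commShiftIso (1 : ℤ)).hom.app (TC1 i W) :=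
    eq_of_comp_id (e := (CategoryTheory.shiftFunctor _ (1 : ℤ)).map (((tensor i ⋙
      GrMod.shift (k := k) 1).mapHomotopyCategoryFactors (ComplexShape.up ℤ)).hom.app W))
      (e' := ((tensor i ⋙ GrMod.shift (k := k) 1).mapHomotopyCategoryFactors
        (ComplexShape.up ℤ)).hom.app (W⟦(1 : ℤ)⟧)) (CategoryTheory.Functor.map_id _ _) rfl h2
  have h4 : (toHo k n).map (unitMap i (W⟦(1 : ℤ)⟧)) ≫
      (toHo k n).map ((((tensor i ⋙ GrMod.shift 1).mapHomologicalComplex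
          (ComplexShape.up ℤ)).commShiftIso (1 : ℤ)).hom.app W) =
        (toHo k n).map ((unitMap i W)⟦(1 : ℤ)⟧') :=
    toHo_comp_eq fun m => Category.comp_id _
  exact comp_eq_of_squares h1 h2' h4 h3

/-- Tensoring the triangle of the counit gives a split epimorphism with kernel `A e_i ⊗ e_i Y`, so
its third vertex is this kernel shifted by one. -/
theorem isIso_trace (i : Fin n) (Y : Cpx k n) :
    IsIso (((TK1 k i).mapTriangle.obj (CochainComplex.mappingCone.triangleh (counitMap i Y))).mor₃ ≫
      ((toHo k n).map (natMap (traceInner k i) Y))⟦(1 : ℤ)⟧') := by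
  have hT := (TK1 k i).map_distinguished _
    (HomotopyCategory.mappingCone_triangleh_distinguished (counitMap i Y))
  refine isIso_of_splitEpi hT ((toHo k n).map (natMap (traceInner k i) Y))
    ((toHo k n).map (natMap (kerInner k i) Y)) ((toHo k n).map (natMap (insertInner k i) Y))
    ?_ ?_ ?_ ?_
  · exact (toHo_comp_eq (g := natMap (counitInner k i) Y) (h := 0) fun m =>
      kerInner_counit i (Y.X m)).trans (Functor.map_zero _ _ _)
  · exact (toHo_comp_eq (h := 𝟙 _) fun m => kerInner_trace i (Y.X m)).trans
      (CategoryTheory.Functor.map_id _ _)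
  · exact (toHo_comp_eq (g := natMap (counitInner k i) Y) (h := 𝟙 _) fun m =>
      insertInner_counit i (Y.X m)).trans (CategoryTheory.Functor.map_id _ _)
  · have h : natMap (traceInner k i) Y ≫ natMap (kerInner k i) Y +
        natMap (counitInner k i) Y ≫ natMap (insertInner k i) Y = 𝟙 _ :=
      HomologicalComplex.hom_ext _ _ fun m => traceInner_add i (Y.X m)
    have h' := congrArg (toHo k n).map h
    rw [Functor.map_add, Functor.map_comp, Functor.map_comp, CategoryTheory.Functor.map_id] at h'
    exact h'

/-- The cone of the unit of `Σ_i^{-1}(Y)` is `Y[1]`. -/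
def coneSigmaInvIso (i : Fin n) (Y : Cpx k n) :
    (toHo k n).obj (CochainComplex.mappingCone (unitMap i (sigmaInv i Y))) ≅
      ((toHo k n).obj Y)⟦(1 : ℤ)⟧ := by
  let e : (toHo k n).obj (TC1 i (sigmaInv i Y)) ≅ ((toHo k n).obj (TC i Y))⟦(1 : ℤ)⟧ :=
    @asIso _ _ _ _ _ (isIso_trace i Y)
  -- Under `isIso_trace` the unit of `Σ_i^{-1}(Y)` becomes the connecting map of the counit
  -- triangle, and rotating that triangle twice shows that its cone is `Y[1]`.
  refine Triangle.π₃.mapIso (isoTriangleOfIso₁₂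
    (CochainComplex.mappingCone.triangleh (unitMap i (sigmaInv i Y)))
    (CochainComplex.mappingCone.triangleh (counitMap i Y)).rotate.rotate
    (HomotopyCategory.mappingCone_triangleh_distinguished _)
    (rot_of_distTriang _ (rot_of_distTriang _
      (HomotopyCategory.mappingCone_triangleh_distinguished _)))
    (Iso.refl _) e ?_)
  refine Eq.trans ?_ (Category.id_comp _).symm
  let δ : (toHo k n).obj (sigmaInv i Y) ⟶ ((toHo k n).obj (TC i Y))⟦(1 : ℤ)⟧ :=
    (CochainComplex.mappingCone.triangleh (counitMap i Y)).mor₃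
  have h1 : δ ≫ (unitK k i).app _ = (unitK k i).app _ ≫ (TK1 k i).map δ := (unitK k i).naturality δ
  have h2 := unitK_shift i (TC i Y)
  have h3 : (unitK k i).app ((toHo k n).obj (TC i Y)) ≫
      (toHo k n).map (natMap (traceInner k i) Y) = 𝟙 _ :=
    (toHo_comp_eq (f := unitMap i (TC i Y)) (h := 𝟙 _) fun m =>
      unit_traceInner i (Y.X m)).trans (CategoryTheory.Functor.map_id _ _)
  have h4 : ((unitK k i).app ((toHo k n).obj (TC i Y)))⟦(1 : ℤ)⟧' ≫
      ((toHo k n).map (natMap (traceInner k i) Y))⟦(1 : ℤ)⟧' = 𝟙 _ :=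
    (Functor.map_comp _ _ _).symm.trans
      ((congrArg (CategoryTheory.shiftFunctor _ (1 : ℤ)).map h3).trans
        (CategoryTheory.Functor.map_id _ _))
  exact comp_eq_of_retract h1 h2 h4

end Cpx

end Zigzag

end

noncomputable section

open CategoryTheory CategoryTheory.Limits TensorProduct

namespace Zigzag

universe u

namespace Cpx

open GrMod Pretriangulated

variable {k : Type u} [Field k] {n : ℕ}

/-! ### Cones of natural transformations -/

section Cone

variable {F G : Cpx k n ⥤ Cpx k n} (α : F ⟶ G)

/-- The cone of a natural transformation, as a functor on complexes. -/
def coneFunctor : Cpx k n ⥤ Cpx k n where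
  obj Y := CochainComplex.mappingCone (α.app Y)
  map f := CochainComplex.mappingCone.map _ _ (F.map f) (G.map f) (α.naturality f).symm
  map_id Y := by
    simp only [CategoryTheory.Functor.map_id]
    exact CochainComplex.mappingCone.map_id _
  map_comp f g := by
    simp only [Functor.map_comp]
    exact CochainComplex.mappingCone.map_comp _ _ _ _ _ _ _ _ _

theorem mappingCone_map_add {K₁ L₁ K₂ L₂ : Cpx k n} (φ₁ : K₁ ⟶ L₁) (φ₂ : K₂ ⟶ L₂)
    {a a' : K₁ ⟶ K₂} {b b' : L₁ ⟶ L₂} (h : φ₁ ≫ b = a ≫ φ₂) (h' : φ₁ ≫ b' = a' ≫ φ₂) :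
    CochainComplex.mappingCone.map φ₁ φ₂ (a + a') (b + b')
      (by rw [Preadditive.comp_add, Preadditive.add_comp, h, h']) =
    CochainComplex.mappingCone.map φ₁ φ₂ a b h + CochainComplex.mappingCone.map φ₁ φ₂ a' b' h' := by
  ext m
  simp [CochainComplex.mappingCone.ext_from_iff _ (m + 1) m rfl, CochainComplex.mappingCone.map]

instance [F.Additive] [G.Additive] : (coneFunctor α).Additive where
  map_add {X Y f g} := by
    refine Eq.trans ?_ (mappingCone_map_add (α.app X) (α.app Y) (α.naturality f).symm
      (α.naturality g).symm)
    simp only [coneFunctor, Functor.map_add]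

/-- Two of three in a map of triangles. Cones are functorial for complexes but not in the homotopy
category, so the functors stay on complexes and preserve isomorphisms in the sense of `PreservesK`.
-/
theorem isIso_coneFunctor {Y Z : Cpx k n} (f : Y ⟶ Z) (hF : IsIso ((toHo k n).map (F.map f)))
    (hG : IsIso ((toHo k n).map (G.map f))) : IsIso ((toHo k n).map ((coneFunctor α).map f)) :=
  isIso₃_of_isIso₁₂ ((toHo k n).mapTriangle.map (CochainComplex.mappingCone.triangleMap
    (α.app Y) (α.app Z) (F.map f) (G.map f) (α.naturality f).symm))
    (HomotopyCategory.mappingCone_triangleh_distinguished _)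
    (HomotopyCategory.mappingCone_triangleh_distinguished _) hF hG

end Cone

/-! ### Functors that are inverse to each other up to a shift -/

/-- Functors that preserve isomorphisms in the homotopy category. -/
def PreservesK (S : Cpx k n ⥤ Cpx k n) : Prop :=
  ∀ ⦃Y Z : Cpx k n⦄ (f : Y ⟶ Z), IsIso ((toHo k n).map f) → IsIso ((toHo k n).map (S.map f))

theorem PreservesK.isZero {S : Cpx k n ⥤ Cpx k n} (hS : PreservesK S) [S.Additive] {Y : Cpx k n}
    (h : IsZero ((toHo k n).obj Y)) : IsZero ((toHo k n).obj (S.obj Y)) := by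
  have h1 : IsIso ((toHo k n).map (0 : Y ⟶ Y)) := ⟨0, h.eq_of_src _ _, h.eq_of_src _ _⟩
  have h2 := hS _ h1
  rw [S.map_zero, Functor.map_zero] at h2
  exact (IsZero.iff_id_eq_zero _).mpr (by
    rw [← IsIso.hom_inv_id (0 : (toHo k n).obj (S.obj Y) ⟶ (toHo k n).obj (S.obj Y)), zero_comp])

/-- A decomposition of `S Y` is carried by `R` and a shift by `-1` to one of `Y`, so one summand
dies, and `S` brings this back. The isomorphisms need not be natural. -/
theorem isIndec_of_inverse {S R : Cpx k n ⥤ Cpx k n} [S.Additive] [R.Additive]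
    (hS : PreservesK S) (hR : PreservesK R) (hSD : ∀ Y, InD Y → InD (S.obj Y))
    (hRD : ∀ Y, InD Y → InD (R.obj Y))
    (hRS : ∀ Y, Nonempty ((toHo k n).obj (R.obj (S.obj Y)) ≅ ((toHo k n).obj Y)⟦(1 : ℤ)⟧))
    (hSR : ∀ Y, Nonempty ((toHo k n).obj (S.obj (R.obj Y)) ≅ ((toHo k n).obj Y)⟦(1 : ℤ)⟧))
    {Y : Cpx k n} (hY : IsIndec Y) : IsIndec (S.obj Y) := by
  have hz : ∀ Z : Cpx k n, IsZero ((toHo k n).obj ((R.obj Z)⟦(-1 : ℤ)⟧)) →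
      IsZero ((toHo k n).obj Z) := fun Z h => by
    have h1 : IsZero ((toHo k n).obj (R.obj Z)) :=
      (isZero_shift_iff (-1 : ℤ)).mp (h.of_iso (toHoShift _ _).symm)
    exact (isZero_shift_iff (1 : ℤ)).mp ((hS.isZero h1).of_iso (hSR Z).some.symm)
  refine ⟨hSD Y hY.1, fun h => hY.2.1 ((isZero_shift_iff (1 : ℤ)).mp
    ((hR.isZero h).of_iso (hRS Y).some.symm)), fun Y₁ Y₂ h₁ h₂ ⟨e⟩ => ?_⟩
  have := preservesBinaryBiproducts_of_preservesBiproducts (toHo k n)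
  have := preservesBinaryBiproducts_of_preservesBiproducts R
  have := preservesBinaryBiproducts_of_preservesBiproducts (CategoryTheory.shiftFunctor
    (HomotopyCategory (GrMod k n) (ComplexShape.up ℤ)) (-1 : ℤ))
  have e' : (toHo k n).obj (S.obj Y) ≅ (toHo k n).obj (Y₁ ⊞ Y₂) :=
    e ≪≫ ((toHo k n).mapBiprod Y₁ Y₂).symm
  -- `R` acts on complexes only, so the isomorphism is first represented by a map of complexes.
  obtain ⟨f, hf⟩ := (toHo k n).map_surjective e'.hom
  have hf' : IsIso ((toHo k n).map f) := by rw [hf]; infer_instance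
  have := hR f hf'
  have e₁ : ((toHo k n).obj Y)⟦(1 : ℤ)⟧ ≅ (toHo k n).obj (R.obj Y₁) ⊞ (toHo k n).obj (R.obj Y₂) :=
    (hRS Y).some.symm ≪≫ asIso ((toHo k n).map (R.map f)) ≪≫
      (toHo k n).mapIso (R.mapBiprod Y₁ Y₂) ≪≫ (toHo k n).mapBiprod _ _
  have e₂ : (toHo k n).obj Y ≅ (toHo k n).obj ((R.obj Y₁)⟦(-1 : ℤ)⟧) ⊞
      (toHo k n).obj ((R.obj Y₂)⟦(-1 : ℤ)⟧) :=
    ((CategoryTheory.shiftFunctorCompIsoId _ (1 : ℤ) (-1) (by simp)).app _).symm ≪≫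
      (CategoryTheory.shiftFunctor _ (-1 : ℤ)).mapIso e₁ ≪≫
      (CategoryTheory.shiftFunctor _ (-1 : ℤ)).mapBiprod _ _ ≪≫
      biprod.mapIso (toHoShift _ _).symm (toHoShift _ _).symm
  exact (hY.2.2 _ _ (inD_shift (hRD _ h₁) _) (inD_shift (hRD _ h₂) _) ⟨e₂⟩).imp (hz _) (hz _)

theorem preservesK_shift (a : ℤ) : PreservesK (k := k) (n := n) (CategoryTheory.shiftFunctor _ a) :=
  fun Y Z f hf => by
    have h := ((toHo k n).commShiftIso a).hom.naturality f
    have : IsIso (((toHo k n).map f)⟦a⟧') := inferInstance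
    have h2 : IsIso ((toHo k n).map (f⟦a⟧') ≫ ((toHo k n).commShiftIso a).hom.app Z) := by
      rw [show (toHo k n).map (f⟦a⟧') ≫ ((toHo k n).commShiftIso a).hom.app Z =
        ((toHo k n).commShiftIso a).hom.app Y ≫ ((toHo k n).map f)⟦a⟧' from h]
      infer_instance
    exact IsIso.of_isIso_comp_right _ (((toHo k n).commShiftIso a).hom.app Z)

/-- The shifts by `a` and `1 - a` compose to the shift by 1, the form that `isIndec_of_inverse` asks
for. -/
theorem isIndec_shift {Y : Cpx k n} (hY : IsIndec Y) (a : ℤ) : IsIndec (Y⟦a⟧) := by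
  have key : ∀ (b c : ℤ) (h : b + c = 1) (Y : Cpx k n),
      Nonempty ((toHo k n).obj ((Y⟦b⟧)⟦c⟧) ≅ ((toHo k n).obj Y)⟦(1 : ℤ)⟧) := fun b c h Y =>
    ⟨(toHo k n).mapIso ((CategoryTheory.shiftFunctorAdd' (Cpx k n) b c 1 h).app Y).symm ≪≫
      toHoShift Y 1⟩
  exact isIndec_of_inverse (S := CategoryTheory.shiftFunctor _ a)
    (R := CategoryTheory.shiftFunctor _ (1 - a)) (preservesK_shift a) (preservesK_shift (1 - a))
    (fun _ h => inD_shift h a) (fun _ h => inD_shift h (1 - a)) (key _ _ (by omega))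
    (key _ _ (by omega)) hY

/-! ### The functors `Σ_i` and `Σ_i^{-1}` preserve indecomposable objects -/

/-- The unit as a natural transformation between functors on complexes. -/
def unitNat (k : Type u) [Field k] {n : ℕ} (i : Fin n) : 𝟭 (Cpx k n) ⟶
    (tensor i ⋙ GrMod.shift 1).mapHomologicalComplex (ComplexShape.up ℤ) where
  app Y := unitMap i Y
  naturality Y Z f := HomologicalComplex.hom_ext _ _ fun m => (unit i).naturality (f.f m)

/-- The counit as a natural transformation between functors on complexes. -/
def counitNat (k : Type u) [Field k] {n : ℕ} (i : Fin n) :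
    (tensor i).mapHomologicalComplex (ComplexShape.up ℤ) ⟶ 𝟭 (Cpx k n) where
  app Y := counitMap i Y
  naturality Y Z f := HomologicalComplex.hom_ext _ _ fun m => (counit i).naturality (f.f m)

theorem preservesK_map (F : GrMod k n ⥤ GrMod k n) [F.Additive] :
    PreservesK (F.mapHomologicalComplex (ComplexShape.up ℤ)) := fun _ _ f _ =>
  inferInstanceAs (IsIso ((F.mapHomotopyCategory (ComplexShape.up ℤ)).map ((toHo k n).map f)))

theorem preservesK_cone_unit (i : Fin n) : PreservesK (coneFunctor (unitNat k i)) := fun _ _ f hf =>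
  isIso_coneFunctor _ f hf (preservesK_map _ f hf)

theorem preservesK_cone_counit (i : Fin n) : PreservesK (coneFunctor (counitNat k i)) :=
  fun _ _ f hf => isIso_coneFunctor _ f (preservesK_map _ f hf) hf

theorem isIndec_sigma {Y : Cpx k n} (hY : IsIndec Y) (i : Fin n) : IsIndec (sigma i Y) :=
  isIndec_shift (isIndec_of_inverse (S := coneFunctor (unitNat k i)) (R := coneFunctor (counitNat k i))
    (preservesK_cone_unit i) (preservesK_cone_counit i)
    (fun _ h => inD_cone _ h (inD_TC1 i h)) (fun _ h => inD_sigmaInv i h)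
    (fun Y => ⟨sigmaInvConeIso i Y⟩) (fun Y => ⟨coneSigmaInvIso i Y⟩) hY) (-1)

theorem isIndec_sigmaInv {Y : Cpx k n} (hY : IsIndec Y) (i : Fin n) : IsIndec (sigmaInv i Y) :=
  isIndec_of_inverse (S := coneFunctor (counitNat k i)) (R := coneFunctor (unitNat k i))
    (preservesK_cone_counit i) (preservesK_cone_unit i)
    (fun _ h => inD_sigmaInv i h) (fun _ h => inD_cone _ h (inD_TC1 i h))
    (fun Y => ⟨coneSigmaInvIso i Y⟩) (fun Y => ⟨sigmaInvConeIso i Y⟩) hY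

end Cpx

end Zigzag

end

noncomputable section

open CategoryTheory CategoryTheory.Limits TensorProduct

namespace Zigzag

universe u

namespace Cpx

open GrMod

variable {k : Type u} [Field k] {n : ℕ}

/-! ### The complex `P_j` -/

/-- The part of degree 0 of `e_j A e_j` is spanned by `e_j`, so graded endomorphisms are scalars. -/
theorem PS_endo_eq {j : Fin n} {l : ℤ} {g : PS k j l ⟶ PS k j l} (hg : g ≫ g = g) :
    g = 0 ∨ g = 𝟙 _ := by
  obtain ⟨c, hc⟩ : ∃ c : k, Hom.lin g (topElt k j l) = c • topElt k j l :=
    ⟨_, pval_injective j l ((pval_eq_zero (lin_mem_part g (topElt_mem j l)) (by omega)).trans (by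
      rw [LinearMap.map_smul_of_tower, pval_topElt, pathZero_self]))⟩
  have h1 : (c * c) • topElt k j l = c • topElt k j l := by
    have h := LinearMap.congr_fun (congrArg Hom.lin hg) (topElt k j l)
    rw [lin_comp, LinearMap.comp_apply, hc, LinearMap.map_smul_of_tower, hc, smul_smul] at h
    exact h
  by_cases h0 : c = 0
  · refine Or.inl (PS_hom_ext (hc.trans ?_))
    rw [h0, zero_smul]
    rfl
  · refine Or.inr (PS_hom_ext (hc.trans ?_))
    have h2 := congrArg (c⁻¹ • ·) h1
    simp only [smul_smul] at h2
    rw [inv_mul_cancel_left₀ h0, inv_mul_cancel₀ h0, one_smul] at h2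
    exact h2

theorem SP_endo_eq {j : Fin n} {l m : ℤ} {f : SP k j l m ⟶ SP k j l m} (hf : f ≫ f = f) :
    f = 0 ∨ f = 𝟙 _ := by
  obtain ⟨g, rfl⟩ := (HomologicalComplex.single (GrMod k n) (ComplexShape.up ℤ) m).map_surjective f
  have hg : g ≫ g = g :=
    (HomologicalComplex.single (GrMod k n) (ComplexShape.up ℤ) m).map_injective (by
      rw [Functor.map_comp, hf])
  rcases PS_endo_eq hg with rfl | rfl
  · exact Or.inl (Functor.map_zero _ _ _)
  · exact Or.inr (CategoryTheory.Functor.map_id _ _)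

theorem inD_single (M : GrMod k n) [Module.Finite (Alg k n) M] [Module.Projective (Alg k n) M]
    (m : ℤ) : InD ((HomologicalComplex.single (GrMod k n) (ComplexShape.up ℤ) m).obj M) := by
  refine ⟨⟨m, m, fun t ht => HomologicalComplex.isZero_single_obj_X _ _ _ _ (by omega)⟩,
    fun t => ?_⟩
  obtain ⟨f, r, h⟩ : ∃ (f : ((HomologicalComplex.single (GrMod k n) (ComplexShape.up ℤ) m).obj
      M).X t ⟶ M) (r : M ⟶ ((HomologicalComplex.single (GrMod k n) (ComplexShape.up ℤ) m).obj
        M).X t), f ≫ r = 𝟙 _ := by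
    by_cases ht : t = m
    · subst ht
      exact ⟨_, _, (HomologicalComplex.singleObjXSelf (ComplexShape.up ℤ) t M).hom_inv_id⟩
    · exact ⟨0, 0, (HomologicalComplex.isZero_single_obj_X _ _ _ _ ht).eq_of_src _ _⟩
  have hs : Hom.lin r ∘ₗ Hom.lin f = LinearMap.id := congrArg Hom.lin h
  exact ⟨Module.Finite.of_surjective _ (LinearMap.surjective_of_comp_eq_id _ _ hs),
    Module.Projective.of_split _ _ hs⟩

theorem isIndec_of_end {Y : Cpx k n} (hY : InD Y) (h0 : ¬ IsZero ((toHo k n).obj Y))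
    (h : ∀ p : (toHo k n).obj Y ⟶ (toHo k n).obj Y, p ≫ p = p → p = 0 ∨ p = 𝟙 _) : IsIndec Y := by
  refine ⟨hY, h0, fun Y₁ Y₂ _ _ ⟨e⟩ => ?_⟩
  have hp : (e.hom ≫ biprod.fst ≫ biprod.inl ≫ e.inv) ≫ (e.hom ≫ biprod.fst ≫ biprod.inl ≫ e.inv) =
      e.hom ≫ biprod.fst ≫ biprod.inl ≫ e.inv := by simp
  rcases h _ hp with h | h
  · left
    rw [IsZero.iff_id_eq_zero]
    have := congrArg (fun f => biprod.inl ≫ e.inv ≫ f ≫ e.hom ≫ biprod.fst) h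
    simpa using this
  · right
    rw [IsZero.iff_id_eq_zero]
    have := congrArg (fun f => biprod.inr ≫ e.inv ≫ f ≫ e.hom ≫ biprod.snd) h
    simpa using this.symm

/-- The isomorphism between the two descriptions of the complex `P_j`. -/
def pCpxIso (j : Fin n) : PCpx k j ≅ SP k j 0 0 :=
  (HomologicalComplex.single (GrMod k n) (ComplexShape.up ℤ) 0).mapIso
    { hom := ofLin (M := P k j) (N := PS k j 0) (LinearMap.id (M := (P k j).carrier))
        fun d x hx => by
          change x ∈ (P k j).deg (d + 0)
          rwa [add_zero]
      inv := ofLin (M := PS k j 0) (N := P k j) (LinearMap.id (M := (P k j).carrier))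
        fun d x hx => by
          change x ∈ (P k j).deg (d + 0) at hx
          rwa [add_zero] at hx
      hom_inv_id := hom_ext fun _ => rfl
      inv_hom_id := hom_ext fun _ => rfl }

theorem ac_PCpx_iff {j p : Fin n} {d : ℤ} : Ac (PCpx k j) p d ↔ Ac (SP k j 0 0) p d :=
  ac_iff_of_iso ((toHo k n).mapIso (pCpxIso j))

theorem inD_PCpx (j : Fin n) : InD (PCpx k j) := inD_single (P k j) 0

theorem isIndec_PCpx (j : Fin n) : IsIndec (PCpx k j) := by
  refine isIndec_of_end (inD_PCpx j) (fun h => not_ac_SP_bot (k := k) (j := j) (l := 0) (m := 0) j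
    (ac_PCpx_iff.mp (ac_of_isZero h j _))) fun p hp => ?_
  let e : (toHo k n).obj (PCpx k j) ≅ (toHo k n).obj (SP k j 0 0) := (toHo k n).mapIso (pCpxIso j)
  obtain ⟨f, hf⟩ := (toHo k n).map_surjective (e.inv ≫ p ≫ e.hom)
  have hpe : p = e.hom ≫ (toHo k n).map f ≫ e.inv := by rw [hf]; simp
  have hff : f ≫ f = f := SP_hom_eq (by
    rw [Functor.map_comp, hf]
    simp only [Category.assoc, Iso.hom_inv_id_assoc]
    rw [reassoc_of% hp])
  rcases SP_endo_eq hff with rfl | rfl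
  · left
    rw [hpe, Functor.map_zero, zero_comp, comp_zero]
  · right
    rw [hpe, CategoryTheory.Functor.map_id, Category.id_comp, Iso.hom_inv_id]

theorem phiPlus_PCpx (j : Fin n) : phiPlus (PCpx k j) = 0 :=
  phiPlus_eq (inD_PCpx j) (fun l hl p => ac_PCpx_iff.mpr (ac_SP p (by omega) (by omega)))
    ⟨j, fun h => not_ac_SP_bot j (ac_PCpx_iff.mp h)⟩

theorem phiMinus_PCpx (j : Fin n) : phiMinus (PCpx k j) = 0 :=
  phiMinus_eq (inD_PCpx j) (fun l hl p => ac_PCpx_iff.mpr (ac_SP p (by omega) (by omega)))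
    ⟨j, fun h => not_ac_SP_top j (ac_PCpx_iff.mp h)⟩

/-! ### The action of `Σ_i` and `Σ_i^{-1}` on the levels of the slices -/

variable {Y : Cpx k n} {i : Fin n}

theorem ac_sigma_iff {j : Fin n} {d : ℤ} :
    Ac (sigma i Y) j d ↔ Ac (CochainComplex.mappingCone (unitMap i Y)) j d :=
  ac_shift_iff (-1)

/-- The common core of the assertions on `Σ_i`: `hi` makes `φ_+` rise by one, and `h` gives homology
in degree `1 - φ_-` at all vertices but `i`. -/
theorem sigma_mem_XPlus (hY : IsIndec Y) (hi : ¬ Ac Y i (-phiPlus Y))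
    (h : ∀ l, l ≠ i → NonSurj Y i l (1 - phiMinus Y) ∨
      (Ac Y i (1 - phiMinus Y) ∧ ¬ Ac Y l (1 - phiMinus Y)))
    (hne : ∃ l, l ≠ i) : sigma i Y ∈ XPlus i := by
  obtain ⟨hD, h0, -⟩ := id hY
  have hplus : phiPlus (sigma i Y) = phiPlus Y + 1 := by
    refine phiPlus_eq (inD_sigma i hD) (fun l hl j => ?_) ⟨i, fun hac => hi ?_⟩
    · rw [ac_sigma_iff, cone_ac_iff_right (ac_of_phiPlus_lt hD h0 (by omega) j), ac_tensor_shift_iff]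
      have := ac_of_phiPlus_lt hD h0 (l := l - 1) (by omega) i
      rw [show -(l - 1) = -l + 1 by ring] at this
      exact ⟨this, ac_of_phiPlus_lt hD h0 (by omega) i⟩
    · rw [ac_sigma_iff, cone_ac_iff_right (ac_of_phiPlus_lt hD h0 (by omega) i), ac_tensor_shift_iff,
        show -(phiPlus Y + 1) + 1 = -phiPlus Y by ring] at hac
      exact hac.1
  have hnext : Ac Y i (1 - phiMinus Y + 1) := by
    have := ac_of_lt_phiMinus hD h0 (l := phiMinus Y - 1) (by omega) i
    rwa [show 1 - (phiMinus Y - 1) = 1 - phiMinus Y + 1 by ring] at this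
  -- At `i` the cone is acyclic by cancellation. At `l ≠ i` either the path from `i` to `l` misses a
  -- class, or the target is acyclic and the cone keeps the homology of `e_l Y`.
  have hcond : ∀ j, Ac (sigma i Y) j (1 - phiMinus Y) ↔ j = i := fun j => by
    rw [ac_sigma_iff]
    refine ⟨fun hac => ?_, ?_⟩
    · by_contra hj
      rcases h j hj with hns | ⟨h1, h2⟩
      · exact not_ac_unitCone_of_nonSurj hns hac
      · exact h2 ((cone_ac_iff_left (ac_tensor_shift_iff.mpr ⟨hnext, h1⟩)).mp hac)
    · rintro rfl
      exact ac_unitCone hnext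
  have hminus : phiMinus (sigma i Y) = phiMinus Y := by
    -- Without a vertex other than `i` nothing would hold the bottom level in place.
    obtain ⟨l, hl⟩ := hne
    refine phiMinus_eq (inD_sigma i hD) (fun l hl j => ?_) ⟨l, fun hac => hl ((hcond l).mp hac)⟩
    rw [ac_sigma_iff, cone_ac_iff_right (ac_of_lt_phiMinus hD h0 hl j), ac_tensor_shift_iff]
    have := ac_of_lt_phiMinus hD h0 (l := l - 1) (by omega) i
    rw [show 1 - (l - 1) = 1 - l + 1 by ring] at this
    exact ⟨this, ac_of_lt_phiMinus hD h0 hl i⟩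
  refine ⟨isIndec_sigma hY i, ?_, fun j => ?_⟩
  · rw [hplus]
    exact isSumOfShifts_sigma hD (isZero_slice_of_phiPlus_lt hD h0 (by omega))
  · rw [hom_pShift_iff, hminus, hcond]

/-- Dual to `sigma_mem_XPlus`: the bottom level drops by one, the top level stays, and injectivity
of paths replaces surjectivity. -/
theorem sigmaInv_mem_XMinus (hY : IsIndec Y) (hi : ¬ Ac Y i (1 - phiMinus Y))
    (h : ∀ l, l ≠ i → NonInj Y i l (-phiPlus Y) ∨ (Ac Y i (-phiPlus Y) ∧ ¬ Ac Y l (-phiPlus Y)))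
    (hne : ∃ l, l ≠ i) : sigmaInv i Y ∈ XMinus i := by
  obtain ⟨hD, h0, -⟩ := id hY
  have hminus : phiMinus (sigmaInv i Y) = phiMinus Y - 1 := by
    refine phiMinus_eq (inD_sigmaInv i hD) (fun l hl j => ?_) ⟨i, fun hac => hi ?_⟩
    · refine (cone_ac_iff_left (ac_of_lt_phiMinus hD h0 (by omega) j)).mpr (ac_tensor_iff.mpr ?_)
      have := ac_of_lt_phiMinus hD h0 (l := l + 1) (by omega) i
      rw [show 1 - (l + 1) = 1 - l - 1 by ring] at this
      exact ⟨ac_of_lt_phiMinus hD h0 (by omega) i, this⟩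
    · have := (ac_tensor_iff.mp
        ((cone_ac_iff_left (ac_of_lt_phiMinus hD h0 (by omega) i)).mp hac)).2
      rwa [show 1 - (phiMinus Y - 1) - 1 = 1 - phiMinus Y by ring] at this
  have hnext : Ac Y i (-phiPlus Y - 1) := by
    have := ac_of_phiPlus_lt hD h0 (l := phiPlus Y + 1) (by omega) i
    rwa [show -(phiPlus Y + 1) = -phiPlus Y - 1 by ring] at this
  have hcond : ∀ j, Ac (sigmaInv i Y) j (-phiPlus Y) ↔ j = i := fun j => by
    refine ⟨fun hac => ?_, ?_⟩
    · by_contra hj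
      rcases h j hj with hni | ⟨h1, h2⟩
      · exact not_ac_counitCone_of_nonInj hni hac
      · exact h2 ((cone_ac_iff_right (ac_tensor_iff.mpr ⟨h1, hnext⟩)).mp hac)
    · rintro rfl
      exact ac_counitCone hnext
  have hplus : phiPlus (sigmaInv i Y) = phiPlus Y := by
    obtain ⟨l, hl⟩ := hne
    refine phiPlus_eq (inD_sigmaInv i hD) (fun l hl j => ?_) ⟨l, fun hac => hl ((hcond l).mp hac)⟩
    refine (cone_ac_iff_left (ac_of_phiPlus_lt hD h0 hl j)).mpr (ac_tensor_iff.mpr ?_)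
    have := ac_of_phiPlus_lt hD h0 (l := l + 1) (by omega) i
    rw [show -(l + 1) = -l - 1 by ring] at this
    exact ⟨ac_of_phiPlus_lt hD h0 hl i, this⟩
  refine ⟨isIndec_sigmaInv hY i, ?_, fun j => ?_⟩
  · rw [hminus]
    exact isSumOfShifts_sigmaInv hD (isZero_slice_of_lt_phiMinus hD h0 (by omega))
  · rw [pShift_hom_iff, hplus, hcond]

theorem nonSurj_of_XPlus {j : Fin n} (hD : InD Y) (h0 : ¬ IsZero ((toHo k n).obj Y))
    (h : ∀ p, Ac Y p (1 - phiMinus Y) ↔ p = j) (hij : i ≠ j) {l : Fin n} (hl : l ≠ i) :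
    NonSurj Y i l (1 - phiMinus Y) :=
  nonSurj_phiMinus hD h0 (nonSurj_of_ac (hD.isLevel _) (isBdd_slice hD.isBdd _) hij hl
    ((ac_phiMinus_iff hD h0 j).mp ((h j).mpr rfl))
    fun hac => hij ((h i).mp ((ac_phiMinus_iff hD h0 i).mpr hac)))

theorem nonInj_of_XMinus {j : Fin n} (hD : InD Y) (h0 : ¬ IsZero ((toHo k n).obj Y))
    (h : ∀ p, Ac Y p (-phiPlus Y) ↔ p = j) (hij : i ≠ j) {l : Fin n} (hl : l ≠ i) :
    NonInj Y i l (-phiPlus Y) :=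
  nonInj_phiPlus hD h0 (nonInj_of_ac (hD.isLevel _) (isBdd_slice hD.isBdd _) hij hl
    ((ac_phiPlus_iff hD h0 j).mp ((h j).mpr rfl))
    fun hac => hij ((h i).mp ((ac_phiPlus_iff hD h0 i).mpr hac)))

/-! ### The assertions on the sets `X_i^±` -/

theorem XPlus_spec {j : Fin n} (h : Y ∈ XPlus j) :
    IsIndec Y ∧ IsSumOfShifts j (baricSlice (phiPlus Y) Y) ∧
      ∀ p, Ac Y p (1 - phiMinus Y) ↔ p = j :=
  ⟨h.1, h.2.1, fun p => hom_pShift_iff.symm.trans (h.2.2 p)⟩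

theorem XMinus_spec {j : Fin n} (h : Y ∈ XMinus j) :
    IsIndec Y ∧ IsSumOfShifts j (baricSlice (phiMinus Y) Y) ∧ ∀ p, Ac Y p (-phiPlus Y) ↔ p = j :=
  ⟨h.1, h.2.1, fun p => pShift_hom_iff.symm.trans (h.2.2 p)⟩

theorem sigma_PCpx_mem {j : Fin n} (hij : j ≠ i) : sigma i (PCpx k j) ∈ XPlus i := by
  refine sigma_mem_XPlus (isIndec_PCpx j) (fun h => ?_) (fun l hl => Or.inl ?_) ⟨j, hij⟩
  · rw [phiPlus_PCpx] at h
    exact not_ac_SP_bot i (ac_PCpx_iff.mp h)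
  · rw [phiMinus_PCpx]
    exact (nonSurj_SP hij.symm hl).of_retract (pCpxIso j).inv (pCpxIso j).hom
      (pCpxIso j).inv_hom_id

theorem sigmaInv_PCpx_mem {j : Fin n} (hij : j ≠ i) : sigmaInv i (PCpx k j) ∈ XMinus i := by
  refine sigmaInv_mem_XMinus (isIndec_PCpx j) (fun h => ?_) (fun l hl => Or.inl ?_) ⟨j, hij⟩
  · rw [phiMinus_PCpx] at h
    exact not_ac_SP_top i (ac_PCpx_iff.mp h)
  · rw [phiPlus_PCpx]
    exact (nonInj_SP hij.symm hl).of_retract (pCpxIso j).inv (pCpxIso j).hom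
      (pCpxIso j).inv_hom_id

theorem sigma_mem_of_XMinus {j : Fin n} (hij : i ≠ j) (hY : Y ∈ XMinus j) :
    sigma i Y ∈ XPlus i := by
  obtain ⟨hI, hs, h⟩ := XMinus_spec hY
  exact sigma_mem_XPlus hI (fun hac => hij ((h i).mp hac))
    (fun l hl => Or.inl (nonSurj_phiMinus_of_sum hI.1 hI.2.1 hs hij hl)) ⟨j, hij.symm⟩

theorem sigmaInv_mem_of_XPlus {j : Fin n} (hij : i ≠ j) (hY : Y ∈ XPlus j) :
    sigmaInv i Y ∈ XMinus i := by
  obtain ⟨hI, hs, h⟩ := XPlus_spec hY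
  exact sigmaInv_mem_XMinus hI (fun hac => hij ((h i).mp hac))
    (fun l hl => Or.inl (nonInj_phiPlus_of_sum hI.1 hI.2.1 hs hij hl)) ⟨j, hij.symm⟩

/-- Here the bottom slice of `Y` need not be a sum of copies of one `P_j`. For `i ≠ j` surjectivity
fails by `nonSurj_of_ac`; for `i = j` the target of the path is acyclic while the other vertices are
not. -/
theorem sigma_mem_of_XPlus {j : Fin n} (hY : Y ∈ XPlus j) : sigma i Y ∈ XPlus i := by
  obtain ⟨hI, hs, h⟩ := XPlus_spec hY
  refine sigma_mem_XPlus hI (not_ac_phiPlus_of_sum hI.1 hI.2.1 hs i) (fun l hl => ?_) ?_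
  · by_cases hij : i = j
    · subst hij
      exact Or.inr ⟨(h i).mpr rfl, fun hac => hl ((h l).mp hac)⟩
    · exact Or.inl (nonSurj_of_XPlus hI.1 hI.2.1 h hij hl)
  · by_cases hij : i = j
    · subst hij
      -- The bottom level has homology at some vertex but not at `i`, so a second vertex exists.
      obtain ⟨l, hl⟩ := exists_not_ac_phiMinus hI.1 hI.2.1
      exact ⟨l, fun hli => hl ((h l).mpr hli)⟩
    · exact ⟨j, Ne.symm hij⟩

theorem sigmaInv_mem_of_XMinus {j : Fin n} (hY : Y ∈ XMinus j) : sigmaInv i Y ∈ XMinus i := by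
  obtain ⟨hI, hs, h⟩ := XMinus_spec hY
  refine sigmaInv_mem_XMinus hI (not_ac_phiMinus_of_sum hI.1 hI.2.1 hs i) (fun l hl => ?_) ?_
  · by_cases hij : i = j
    · subst hij
      exact Or.inr ⟨(h i).mpr rfl, fun hac => hl ((h l).mp hac)⟩
    · exact Or.inl (nonInj_of_XMinus hI.1 hI.2.1 h hij hl)
  · by_cases hij : i = j
    · subst hij
      obtain ⟨l, hl⟩ := exists_not_ac_phiPlus hI.1 hI.2.1
      exact ⟨l, fun hli => hl ((h l).mpr hli)⟩
    · exact ⟨j, Ne.symm hij⟩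

theorem XMinus_disjoint_XPlus (i j : Fin n) : Disjoint (XMinus (k := k) i) (XPlus j) :=
  Set.disjoint_left.mpr fun _ hm hp =>
    not_ac_phiPlus_of_sum hp.1.1 hp.1.2.1 hp.2.1 i (((XMinus_spec hm).2.2 i).mpr rfl)

theorem XPlus_disjoint {i j : Fin n} (hij : i ≠ j) : Disjoint (XPlus (k := k) i) (XPlus j) :=
  Set.disjoint_left.mpr fun _ hi hj => hij ((hj.2.2 i).mp ((hi.2.2 i).mpr rfl))

theorem XMinus_disjoint {i j : Fin n} (hij : i ≠ j) : Disjoint (XMinus (k := k) i) (XMinus j) :=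
  Set.disjoint_left.mpr fun _ hi hj => hij ((hj.2.2 i).mp ((hi.2.2 i).mpr rfl))

end Cpx

end Zigzag

end

theorem mainTheorem2 {k : Type*} [Field k] [CharZero k] (n : ℕ) :
    (∀ i j : Fin n, j ≠ i →
      Zigzag.sigma i (Zigzag.PCpx k j) ∈ Zigzag.XPlus i ∧
      Zigzag.sigmaInv i (Zigzag.PCpx k j) ∈ Zigzag.XMinus i) ∧
    Pairwise (fun s t : Fin n ⊕ Fin n =>
      Disjoint (Sum.elim (Zigzag.XMinus (k := k)) (Zigzag.XPlus (k := k)) s)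
        (Sum.elim (Zigzag.XMinus (k := k)) (Zigzag.XPlus (k := k)) t)) ∧
    (∀ i j : Fin n, i ≠ j → ∀ Y : Zigzag.Cpx k n,
      Y ∈ Zigzag.XMinus j → Zigzag.sigma i Y ∈ Zigzag.XPlus i) ∧
    (∀ i j : Fin n, i ≠ j → ∀ Y : Zigzag.Cpx k n,
      Y ∈ Zigzag.XPlus j → Zigzag.sigmaInv i Y ∈ Zigzag.XMinus i) ∧
    (∀ i j : Fin n, ∀ Y : Zigzag.Cpx k n,
      Y ∈ Zigzag.XPlus j → Zigzag.sigma i Y ∈ Zigzag.XPlus i) ∧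
    (∀ i j : Fin n, ∀ Y : Zigzag.Cpx k n,
      Y ∈ Zigzag.XMinus j → Zigzag.sigmaInv i Y ∈ Zigzag.XMinus i) := by
  refine ⟨fun i j hij => ⟨Zigzag.Cpx.sigma_PCpx_mem hij, Zigzag.Cpx.sigmaInv_PCpx_mem hij⟩, ?_,
    fun i j hij Y hY => Zigzag.Cpx.sigma_mem_of_XMinus hij hY,
    fun i j hij Y hY => Zigzag.Cpx.sigmaInv_mem_of_XPlus hij hY,
    fun i j Y hY => Zigzag.Cpx.sigma_mem_of_XPlus hY,
    fun i j Y hY => Zigzag.Cpx.sigmaInv_mem_of_XMinus hY⟩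
  rintro (i | i) (j | j) hij
  · exact Zigzag.Cpx.XMinus_disjoint fun h => hij (congrArg Sum.inl h)
  · exact Zigzag.Cpx.XMinus_disjoint_XPlus i j
  · exact (Zigzag.Cpx.XMinus_disjoint_XPlus j i).symm
  · exact Zigzag.Cpx.XPlus_disjoint fun h => hij (congrArg Sum.inr h)
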